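/- Let $\mathbb k$ be a field of characteristic $0$. **Graphs.** A graph is a finite set of half-edges with a partition into vertices and a partition into internal edges (two half-edges) and external legs (one half-edge). Let $\mathcal{FG}$ be the set of isomorphism classes (external legs may be permuted) of one-particle irreducible graphs of pure gravity: connected graphs that stay connected when any internal edge is cut, with all vertices of valence $\ge 3$, at least one loop and at least two external legs. Let $|\Gamma|$ be the number of loops of $\Gamma$. Let $H=\mathbb k[\mathcal{FG}]$ be the polynomial algebra, with algebra maps $\varepsilon\colon H\to\mathbb k$, $\varepsilon(\Gamma)=0$, and $$\Delta(\Gamma)=\sum_{\gamma\subseteq\Gamma}\gamma\otimes\Gamma/\gamma ,$$ where $\gamma$ runs over all disjoint unions of one-particle irreducible subgraphs, $\gamma=\emptyset$ and $\gamma=\Gamma$ included (in gravity all of them are superficially divergent). In $\Gamma/\gamma$ each component of $\gamma$ with at least $3$ legs is shrunk to a vertex, each component with $2$ legs is replaced by an edge, and $\Gamma/\Gamma=1$. **Sums of graphs.** For $n\ge2$ put $\sigma_2=-1$, $\sigma_n=1$ for $n\ge 3$, and $$X^n=1+\sigma_n\sum_{\Gamma}\alpha^{|\Gamma|}\,w(\Gamma)\,\Gamma\in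 H[[\alpha]],\qquad w(\Gamma)=\frac{n!}{|\mathrm{Aut}\,\Gamma|},$$ the sum over all $\Gamma\in\mathcal{FG}$ with $n$ external graviton lines, where automorphisms may permute the external lines (equivalently, the sum over graphs with labelled external lines, weighted by the inverse of the number of automorphisms fixing these lines, with the labels then forgotten). Let $Q^2=(X^3)^2/(X^2)^3$. Let $I\subseteq H$ be the ideal generated by the coefficients of $$\frac{X^{n+1}}{X^n}-\frac{X^n}{X^{n-1}},\qquad n\ge 3,$$ let $\pi\colon H\to H/I$ be the projection, and let $A\subseteq H/I$ be the subalgebra generated by the coefficients of all $\pi(X^n)$, $n\ge2$. Let $V_n\subseteq H/I$ be the span of the coefficients of $\pi(X^nQ^2)$. **Insertion.** For $\gamma\in\mathcal{FG}$ and a product $X$ of graphs, a gluing of $X$ into $\gamma$ places the factors of $X$ into $\gamma$, a factor with $m\ge3$ legs at an $m$-valent vertex (at most one per vertex) and a factor with $2$ legs in an internal edge (several, in any order, are allowed in the same edge), together with bijections from the legs of the factors to the half-edges of their places. Let $B_+^\gamma\colon H\to H$ be the linear map that sends $X$ to the average, over all gluings of $X$ into $\gamma$, of $\Gamma/\mathrm{maxf}(\Gamma)$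 (and to $0$ if there is no gluing), where $\Gamma$ is the graph obtained by the gluing and $\mathrm{maxf}(\Gamma)$ is the number of maximal elements among the disjoint unions of one-particle irreducible subgraphs of $\Gamma$ different from $\Gamma$ (the empty one included). Put $$X_\gamma=\prod_{v\text{ vertex of }\gamma}X^{\mathrm{val}(v)}\prod_{e\text{ internal edge of }\gamma}\frac1{X^2}\in H[[\alpha]].$$ **Proposition.** $H$ with $\Delta,\varepsilon$ is a Hopf algebra, $I$ is a Hopf ideal (so that $H/I$ is a Hopf algebra), and $A$ is a sub-Hopf algebra of $H/I$. Moreover, for every $n\ge 2$: 1. $\pi(X_\gamma)=\pi(X^nQ^2)$ for every one-loop graph $\gamma\in\mathcal{FG}$ with $n$ external lines. 2. There is a unique linear map $B_+^{1,n}\colon V_n\to A$ with $$B_+^{1,n}\bigl(\pi([\alpha^k]X^nQ^2)\bigr)=\pi\Bigl(\sum_{\gamma}w(\gamma)\,B_+^\gamma([\alpha^k]X_\gamma)\Bigr),\qquad k\ge0,$$ the sum over all primitive one-loop graphs $\gamma$ with $n$ external lines, and the combinatorial Dyson–Schwinger equations $$X^n=1+\sigma_n\,\alpha\,B_+^{1,n}(X^nQ^2)$$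 hold in $(H/I)[[\alpha]]$. 3. $B_+^{1,n}$ is Hochschild closed: $\Delta(V_n)\subseteq A\otimes V_n$, and on $V_n$ $$bB_+^{1,n}=(\mathrm{id}\otimes B_+^{1,n})\Delta-\Delta B_+^{1,n}+B_+^{1,n}\otimes 1=0 .$$ -/

import Mathlib

open scoped TensorProduct
open Classical

/-! ## Graphs built from half-edges -/

/-- A graph with set of half-edges `α`: a partition of the half-edges into vertices and a partition
of the half-edges into edges. An edge with two half-edges is internal; an edge with one half-edge
is an external leg. -/
structure FGraph (α : Type) where
  vert : Setoid α
  edge : Setoid α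

namespace FGraph

variable {α β : Type}

/-- The half-edge belongs to an internal edge. -/
def IsInternal (Γ : FGraph α) (x : α) : Prop := ∃ y, y ≠ x ∧ Γ.edge.r x y

/-- The half-edge is an external leg. -/
def IsLeg (Γ : FGraph α) (x : α) : Prop := ¬ Γ.IsInternal x

/-- The edge partition in which only the edges lying in `S` are kept; all other half-edges
are singletons. -/
def edgeOn (Γ : FGraph α) (S : Set α) : Setoid α where
  r x y := x = y ∨ (x ∈ S ∧ y ∈ S ∧ Γ.edge.r x y)
  iseqv :=
    { refl := fun _ => Or.inl rfl
      symm := by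
        rintro x y (h | ⟨hx, hy, h⟩)
        · exact Or.inl h.symm
        · exact Or.inr ⟨hy, hx, Γ.edge.symm' h⟩
      trans := by
        rintro x y z (rfl | ⟨hx, hy, h⟩) (rfl | ⟨hy', hz, h'⟩)
        · exact Or.inl rfl
        · exact Or.inr ⟨hy', hz, h'⟩
        · exact Or.inr ⟨hx, hy, h⟩
        · exact Or.inr ⟨hx, hz, Γ.edge.trans' h h'⟩ }

/-- Two half-edges are equivalent if their vertices are joined by a path of edges from `S`. -/
def conn (Γ : FGraph α) (S : Set α) : Setoid α := Γ.vert ⊔ Γ.edgeOn S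

noncomputable def numLegs (Γ : FGraph α) : ℕ := Nat.card {x // Γ.IsLeg x}

noncomputable def numEdges (Γ : FGraph α) : ℕ := Nat.card {x // Γ.IsInternal x} / 2

noncomputable def numVertices (Γ : FGraph α) : ℕ := Nat.card (Quotient Γ.vert)

/-- The number of half-edges at a vertex. -/
noncomputable def valence (Γ : FGraph α) (v : Quotient Γ.vert) : ℕ :=
  Nat.card {x // Quotient.mk Γ.vert x = v}

/-- The loop number `E - V + 1` (used for connected graphs only). -/
noncomputable def loops (Γ : FGraph α) : ℕ := Γ.numEdges + 1 - Γ.numVertices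

/-- One-particle irreducible graphs of pure gravity: connected graphs that remain connected when any
internal edge is cut, with at least one loop, at least two external graviton lines, and
graviton vertices of every valence `≥ 3`. -/
structure IsFeynman (Γ : FGraph α) : Prop where
  edge_le_two : ∀ x y z, Γ.edge.r x y → Γ.edge.r x z → x = y ∨ x = z ∨ y = z
  three_le_valence : ∀ v, 3 ≤ Γ.valence v
  connected : ∀ x y, (Γ.conn Set.univ).r x y
  irreducible : ∀ x y, x ≠ y → Γ.edge.r x y → (Γ.conn {x, y}ᶜ).r x y
  has_internal : ∃ x, Γ.IsInternal x
  two_le_legs : 2 ≤ Γ.numLegs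

/-- Isomorphisms of graphs (external legs may be permuted). -/
def Iso (Γ : FGraph α) (Γ' : FGraph β) : Type :=
  {e : α ≃ β // ∀ x y, (Γ.vert.r x y ↔ Γ'.vert.r (e x) (e y)) ∧
    (Γ.edge.r x y ↔ Γ'.edge.r (e x) (e y))}

/-- Transport to a standard set of half-edges. -/
noncomputable def toFin [Finite α] (Γ : FGraph α) : FGraph (Fin (Nat.card α)) where
  vert := Γ.vert.comap (Finite.equivFin α).symm
  edge := Γ.edge.comap (Finite.equivFin α).symm

/-! ### Subgraphs and contraction -/

/-- `S` is the set of internal half-edges of a (possibly empty) disjoint union of one-particle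
irreducible subgraphs of `Γ`. Such a subgraph contains all half-edges at its vertices; those outside
`S` are its external legs. In gravity every such subgraph is superficially divergent. -/
def IsSub (Γ : FGraph α) (S : Set α) : Prop :=
  (∀ x ∈ S, Γ.IsInternal x ∧ ∀ y, Γ.edge.r x y → y ∈ S) ∧
  ∀ x ∈ S, ∀ y ∈ S, x ≠ y → Γ.edge.r x y → (Γ.conn (S \ {x, y})).r x y

/-- A connected component of the subgraph with internal half-edges `S`; a vertex that does
not meet `S` counts as a component without internal edges. -/
def component (Γ : FGraph α) (S : Set α) (c : Quotient (Γ.conn S)) :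
    FGraph {x // Quotient.mk (Γ.conn S) x = c} where
  vert := Γ.vert.comap Subtype.val
  edge := (Γ.edgeOn S).comap Subtype.val

/-- The half-edge `x` lies in a component of `S` with exactly two external legs. -/
def InPropagator (Γ : FGraph α) (S : Set α) (x : α) : Prop :=
  Nat.card {y // (Γ.conn S).r x y ∧ y ∉ S} = 2

/-- The two external legs of each component with exactly two legs are identified. -/
def propagatorRel (Γ : FGraph α) (S : Set α) : Setoid α where
  r x y := x = y ∨ (x ∉ S ∧ y ∉ S ∧ (Γ.conn S).r x y ∧ Γ.InPropagator S x ∧ Γ.InPropagator S y)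
  iseqv :=
    { refl := fun _ => Or.inl rfl
      symm := by
        rintro x y (h | ⟨hx, hy, h, px, py⟩)
        · exact Or.inl h.symm
        · exact Or.inr ⟨hy, hx, (Γ.conn S).symm' h, py, px⟩
      trans := by
        rintro x y z (rfl | ⟨hx, hy, h, px, py⟩) (rfl | ⟨hy', hz, h', py', pz⟩)
        · exact Or.inl rfl
        · exact Or.inr ⟨hy', hz, h', py', pz⟩
        · exact Or.inr ⟨hx, hy, h, px, py⟩
        · exact Or.inr ⟨hx, hz, (Γ.conn S).trans' h h', px, pz⟩ }

/-- The cograph `Γ / S`: every component of the subgraph with at least three external legs is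
shrunk to a vertex; a component with two external legs is removed and its two adjacent edges are
merged into one edge. -/
def contract (Γ : FGraph α) (S : Set α) : FGraph {x // x ∉ S ∧ ¬ Γ.InPropagator S x} where
  vert := (Γ.conn S).comap Subtype.val
  edge := (Γ.edge ⊔ Γ.propagatorRel S).comap Subtype.val

/-- The number of maximal forests of `Γ`: subgraphs that are maximal among those different from
`Γ` itself (equivalently, the cograph is primitive). -/
noncomputable def maxf (Γ : FGraph α) : ℕ :=
  Nat.card {S : Set α // Γ.IsSub S ∧ S ≠ {x | Γ.IsInternal x} ∧
    ∀ T, Γ.IsSub T → S ⊆ T → T = S ∨ T = {x | Γ.IsInternal x}}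

end FGraph

/-! ## The algebra of Feynman graphs -/

/-- One-particle irreducible graphs on standard half-edge sets. -/
abbrev PreFeynmanGraph : Type := {p : Σ h : ℕ, FGraph (Fin h) // p.2.IsFeynman}

instance PreFeynmanGraph.setoid : Setoid PreFeynmanGraph where
  r p q := Nonempty (FGraph.Iso p.1.2 q.1.2)
  iseqv :=
    { refl := fun _ => ⟨⟨Equiv.refl _, fun _ _ => ⟨Iff.rfl, Iff.rfl⟩⟩⟩
      symm := by
        rintro p q ⟨e, he⟩
        refine ⟨⟨e.symm, fun x y => ?_⟩⟩
        have h := he (e.symm x) (e.symm y)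
        simp only [Equiv.apply_symm_apply] at h
        exact ⟨h.1.symm, h.2.symm⟩
      trans := by
        rintro p q r ⟨e, he⟩ ⟨f, hf⟩
        exact ⟨⟨e.trans f, fun x y => ⟨(he x y).1.trans (hf (e x) (e y)).1,
          (he x y).2.trans (hf (e x) (e y)).2⟩⟩⟩ }

/-- Isomorphism classes of one-particle irreducible graphs of pure gravity. -/
def FeynmanGraph : Type := Quotient PreFeynmanGraph.setoid

namespace FeynmanGraph

/-- The number of half-edges of a representative. -/
noncomputable def size (γ : FeynmanGraph) : ℕ := (Quotient.out γ).1.1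

/-- A representative of an isomorphism class. -/
noncomputable def rep (γ : FeynmanGraph) : FGraph (Fin γ.size) := (Quotient.out γ).1.2

noncomputable def numLegs (γ : FeynmanGraph) : ℕ := γ.rep.numLegs

noncomputable def loops (γ : FeynmanGraph) : ℕ := γ.rep.loops

/-- The number of automorphisms, external legs being allowed to be permuted. -/
noncomputable def numAut (γ : FeynmanGraph) : ℕ := Nat.card (FGraph.Iso γ.rep γ.rep)

end FeynmanGraph

noncomputable section

variable (𝕜 : Type*) [Field 𝕜]

/-- The commutative algebra of gravity graphs: polynomials in the one-particle irreducible graphs;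
products are disjoint unions. -/
abbrev GraphAlg : Type _ := MvPolynomial FeynmanGraph 𝕜

/-- The element of the algebra given by a graph. A connected graph without loops is identified
with `1`; the value `0` is a default for graphs outside the theory. -/
def FGraph.toAlg {α : Type} [Finite α] (Γ : FGraph α) : GraphAlg 𝕜 :=
  if h : Γ.toFin.IsFeynman then
    MvPolynomial.X (Quotient.mk PreFeynmanGraph.setoid ⟨⟨_, Γ.toFin⟩, h⟩)
  else if ∀ x, Γ.IsLeg x then 1 else 0

/-- The coproduct of a graph: the sum over all subgraphs `γ_S` that are disjoint unions of
one-particle irreducible graphs (including the empty one and `Γ` itself) of `γ_S ⊗ Γ / γ_S`. -/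
def FGraph.coprod {α : Type} [Finite α] (Γ : FGraph α) : GraphAlg 𝕜 ⊗[𝕜] GraphAlg 𝕜 :=
  ∑ᶠ S : {S : Set α // Γ.IsSub S},
    (∏ᶠ c : Quotient (Γ.conn S.1), (Γ.component S.1 c).toAlg 𝕜) ⊗ₜ[𝕜] (Γ.contract S.1).toAlg 𝕜

/-- The coproduct on the algebra of graphs. -/
def graphComul : GraphAlg 𝕜 →ₐ[𝕜] GraphAlg 𝕜 ⊗[𝕜] GraphAlg 𝕜 :=
  MvPolynomial.aeval fun γ : FeynmanGraph => γ.rep.coprod 𝕜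

/-- The counit vanishes on all graphs. -/
def graphCounit : GraphAlg 𝕜 →ₐ[𝕜] 𝕜 :=
  MvPolynomial.aeval fun _ : FeynmanGraph => (0 : 𝕜)

/-- The graph is a primitive element of the Hopf algebra. -/
def FeynmanGraph.IsPrimitive (γ : FeynmanGraph) : Prop :=
  graphComul 𝕜 (MvPolynomial.X γ) =
    MvPolynomial.X γ ⊗ₜ[𝕜] (1 : GraphAlg 𝕜) + (1 : GraphAlg 𝕜) ⊗ₜ[𝕜] MvPolynomial.X γ

/-- The weight of an unlabelled graph in the sum of all graphs with its number `n` of external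
lines, `n! / |Aut γ|`. It is the sum, over the different labellings of the external lines, of
the inverse of the number of automorphisms that fix the external lines. -/
def FeynmanGraph.weight (γ : FeynmanGraph) : 𝕜 := (γ.numLegs.factorial : 𝕜) / (γ.numAut : 𝕜)

/-- The sign in `X^2 = 1 - ...` (propagator) and `X^n = 1 + ...` for `n ≥ 3` (vertices). -/
def greenSign (n : ℕ) : 𝕜 := if n = 2 then -1 else 1

/-- `X^n`, the sum of all graphs with `n` external graviton lines, as a formal power series whose
variable counts loops. -/
def green (n : ℕ) : PowerSeries (GraphAlg 𝕜) :=
  1 + PowerSeries.mk fun L => greenSign 𝕜 n •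
    ∑ᶠ γ : {γ : FeynmanGraph // γ.numLegs = n ∧ γ.loops = L},
      γ.1.weight 𝕜 • (MvPolynomial.X γ.1 : GraphAlg 𝕜)

/-- `1 / X^n` (the constant coefficient of `X^n` is `1`). -/
def greenInv (n : ℕ) : PowerSeries (GraphAlg 𝕜) := PowerSeries.invOfUnit (green 𝕜 n) 1

/-- The square of the invariant charge `Q = X^3 / (X^2)^{3/2}`. -/
def chargeSq : PowerSeries (GraphAlg 𝕜) := green 𝕜 3 ^ 2 * greenInv 𝕜 2 ^ 3

/-- The ideal of the relations `X^{n+1} / X^n = X^n / X^{n-1}`, `n ≥ 3`, at all loop orders. -/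
def relIdeal : Ideal (GraphAlg 𝕜) :=
  Ideal.span {r | ∃ n k, 3 ≤ n ∧ r = PowerSeries.coeff k
    (green 𝕜 (n + 1) * greenInv 𝕜 n - green 𝕜 n * greenInv 𝕜 (n - 1))}

/-- The algebra of graphs modulo the relations. -/
abbrev QuotAlg : Type _ := GraphAlg 𝕜 ⧸ relIdeal 𝕜

/-- The projection to the quotient. -/
abbrev proj : GraphAlg 𝕜 →ₐ[𝕜] QuotAlg 𝕜 := Ideal.Quotient.mkₐ 𝕜 (relIdeal 𝕜)

/-- The subalgebra of the quotient generated by the coefficients of all `X^n`, `n ≥ 2`. -/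
def greenSubalg : Subalgebra 𝕜 (QuotAlg 𝕜) :=
  Algebra.adjoin 𝕜 {a | ∃ n k, 2 ≤ n ∧ a = proj 𝕜 (PowerSeries.coeff k (green 𝕜 n))}

/-! ## Insertion of graphs and the maps `B_+` -/

namespace FGraph

variable {α β : Type}

/-- The bijections of the external legs of `Y` with an insertion place of `Γ`, that is, with the
half-edges of a vertex, or, if `Y` has two legs, with the two half-edges of an internal edge. Places
that belong to the set `S` of half-edges inserted earlier are excluded. -/
def Gluing (Γ : FGraph α) (S : Set α) (Y : FGraph β) : Type :=
  {φ : {l : β // Y.IsLeg l} → α // Function.Injective φ ∧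
    if Y.numLegs = 2 then ∃ x, x ∉ S ∧ Γ.IsInternal x ∧ Set.range φ = {z | Γ.edge.r x z}
    else ∃ x, Set.range φ = {z | Γ.vert.r x z} ∧ Disjoint (Set.range φ) S}

/-- The half-edges after insertion: if a vertex is replaced, its half-edges disappear. -/
def GlueCarrier (Γ : FGraph α) (S : Set α) (Y : FGraph β) (φ : Gluing Γ S Y) : Type :=
  {z : α ⊕ β // ∀ x, z = Sum.inl x → Y.numLegs = 2 ∨ x ∉ Set.range φ.1}

instance [Finite α] [Finite β] (Γ : FGraph α) (S : Set α) (Y : FGraph β) (φ : Gluing Γ S Y) :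
    Finite (GlueCarrier Γ S Y φ) :=
  Subtype.finite

/-- Insertion of `Y` into `Γ` along `φ`. If `Y` is put in place of a vertex, its leg `l` takes
the place of the half-edge `φ l`; if `Y` is put into an internal edge, this edge is cut
and its two half-edges are joined to the corresponding legs of `Y`. -/
def glue (Γ : FGraph α) (S : Set α) (Y : FGraph β) (φ : Gluing Γ S Y) :
    FGraph (GlueCarrier Γ S Y φ) where
  vert := (Relation.EqvGen.setoid (Sum.LiftRel Γ.vert.r Y.vert.r)).comap Subtype.val
  edge := (Relation.EqvGen.setoid fun a b =>
      Sum.LiftRel (Γ.edgeOn (if Y.numLegs = 2 then (Set.range φ.1)ᶜ else Set.univ)).r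
        Y.edge.r a b ∨
      ∃ l, a = Sum.inl (φ.1 l) ∧ b = Sum.inr l.1).comap Subtype.val

/-- The internal half-edges of the inserted graphs after the insertion of `Y`. -/
def glueSet (Γ : FGraph α) (S : Set α) (Y : FGraph β) (φ : Gluing Γ S Y) :
    Set (GlueCarrier Γ S Y φ) :=
  {z | (∃ x ∈ S, z.1 = Sum.inl x) ∨ ∃ y, Y.IsInternal y ∧ z.1 = Sum.inr y}

/-- The sum of `f` over the graphs that result from all the gluings of the graphs of a list into `Γ`.
The graphs are inserted one after the other, always into places of the original graph; several
graphs with two legs may be put, in any order, into the same edge. -/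
def glueSum {M : Type*} [AddCommMonoid M] (f : ∀ (α : Type) [Finite α], FGraph α → M) :
    List FeynmanGraph → ∀ (α : Type) [Finite α], FGraph α → Set α → M
  | [], α, _, Γ, _ => f α Γ
  | Y :: L, _, _, Γ, S => ∑ᶠ φ : Gluing Γ S Y.rep,
      glueSum f L (GlueCarrier Γ S Y.rep φ) (glue Γ S Y.rep φ) (glueSet Γ S Y.rep φ)

end FGraph

/-- `B_+^γ`. On a product `X` of graphs it is the average, over all the ways to glue the external
legs of the factors of `X` to insertion places of `γ`, of `Γ / maxf(Γ)`, where `Γ` is the resulting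
graph. So `Γ` has the coefficient `(1 / maxf(Γ)) bij(γ, X, Γ) / (|X|_∨ (γ|X))`: the total number of
gluings is the number `(γ|X)` of placements times the number of leg bijections for a placement,
which is `|X|_∨` when bijections that differ by an automorphism of `X` are identified. -/
def insertion (γ : FeynmanGraph) : GraphAlg 𝕜 →ₗ[𝕜] GraphAlg 𝕜 :=
  (MvPolynomial.basisMonomials FeynmanGraph 𝕜).constr 𝕜 fun m =>
    (FGraph.glueSum (fun _ _ _ => (1 : 𝕜)) (Finsupp.toMultiset m).toList _ γ.rep ∅)⁻¹ •
      FGraph.glueSum (fun _ _ Γ => ((Γ.maxf : 𝕜)⁻¹) • Γ.toAlg 𝕜)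
        (Finsupp.toMultiset m).toList _ γ.rep ∅

/-- What is inserted into `γ`: a factor `X^m` for every `m`-valent vertex and a factor `1 / X^2` for
every internal edge. -/
def insertionArg (γ : FeynmanGraph) : PowerSeries (GraphAlg 𝕜) :=
  (∏ᶠ v : Quotient γ.rep.vert, green 𝕜 (γ.rep.valence v)) * greenInv 𝕜 2 ^ γ.rep.numEdges

/-- The space spanned by the coefficients of `X^n Q^2`, modulo the relations. -/
def dseSpace (n : ℕ) : Submodule 𝕜 (QuotAlg 𝕜) :=
  Submodule.span 𝕜 (Set.range fun k => proj 𝕜 (PowerSeries.coeff k (green 𝕜 n * chargeSq 𝕜)))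

/-- The coefficient of order `k` of `X^n Q^2`, modulo the relations. -/
def dseArg (n k : ℕ) : dseSpace 𝕜 n :=
  ⟨proj 𝕜 (PowerSeries.coeff k (green 𝕜 n * chargeSq 𝕜)), Submodule.subset_span ⟨k, rfl⟩⟩

/-- The sum of `B_+^γ`, with symmetry weights, over all primitive one-loop graphs `γ` with `n`
external lines, applied to the coefficient of order `k` of the arguments of the `B_+^γ`. -/
def oneLoopInsertion (n k : ℕ) : GraphAlg 𝕜 :=
  ∑ᶠ γ : {γ : FeynmanGraph // γ.numLegs = n ∧ γ.loops = 1 ∧ γ.IsPrimitive 𝕜},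
    γ.1.weight 𝕜 • insertion 𝕜 γ.1 (PowerSeries.coeff k (insertionArg 𝕜 γ.1))

/-! ## Hopf algebras and Hochschild closedness -/

/-- The Hopf algebra axioms for algebra maps `Δ`, `ε` and a linear map `S` on a commutative
algebra. -/
structure IsHopfAlgebra {𝕜 A : Type*} [Field 𝕜] [CommRing A] [Algebra 𝕜 A]
    (Δ : A →ₐ[𝕜] A ⊗[𝕜] A) (ε : A →ₐ[𝕜] 𝕜) (S : A →ₗ[𝕜] A) : Prop where
  coassoc : ∀ a, TensorProduct.assoc 𝕜 A A A
      (TensorProduct.map Δ.toLinearMap LinearMap.id (Δ a)) =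
    TensorProduct.map LinearMap.id Δ.toLinearMap (Δ a)
  counit_left : ∀ a,
    TensorProduct.lid 𝕜 A (TensorProduct.map ε.toLinearMap LinearMap.id (Δ a)) = a
  counit_right : ∀ a,
    TensorProduct.rid 𝕜 A (TensorProduct.map LinearMap.id ε.toLinearMap (Δ a)) = a
  antipode_left : ∀ a,
    LinearMap.mul' 𝕜 A (TensorProduct.map S LinearMap.id (Δ a)) = algebraMap 𝕜 A (ε a)
  antipode_right : ∀ a,
    LinearMap.mul' 𝕜 A (TensorProduct.map LinearMap.id S (Δ a)) = algebraMap 𝕜 A (ε a)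

/-- A subalgebra is a sub-Hopf algebra. -/
structure IsSubHopf {𝕜 A : Type*} [Field 𝕜] [CommRing A] [Algebra 𝕜 A]
    (Δ : A →ₐ[𝕜] A ⊗[𝕜] A) (S : A →ₗ[𝕜] A) (C : Subalgebra 𝕜 A) : Prop where
  comul_mem : ∀ a ∈ C, Δ a ∈
    LinearMap.range (TensorProduct.map C.val.toLinearMap C.val.toLinearMap)
  antipode_mem : ∀ a ∈ C, S a ∈ C

/-- A linear map `B : V → C` from a subspace `V` of `A` to a sub-Hopf algebra `C` is Hochschild
closed: `V` is a left subcomodule, with `ρ v ∈ C ⊗ V` the coproduct of `v`, and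
`(id ⊗ B) Δ - Δ B + B ⊗ 1 = 0` on `V`. -/
def IsHochschildClosed {𝕜 A : Type*} [Field 𝕜] [CommRing A] [Algebra 𝕜 A]
    (Δ : A →ₐ[𝕜] A ⊗[𝕜] A) (C : Subalgebra 𝕜 A) (V : Submodule 𝕜 A) (B : V →ₗ[𝕜] C) : Prop :=
  ∃ ρ : V →ₗ[𝕜] C ⊗[𝕜] V,
    (∀ v, TensorProduct.map C.val.toLinearMap V.subtype (ρ v) = Δ v) ∧
    ∀ v, TensorProduct.map C.val.toLinearMap (C.val.toLinearMap ∘ₗ B) (ρ v)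
      - Δ (B v) + (B v : A) ⊗ₜ[𝕜] (1 : A) = 0

end

/-!
The proof rests on two bijections for graphs and on a generating function argument; everything after
them is algebra of power series.

**Subgraphs of cographs.** Subgraphs are encoded by their sets `S` of internal half-edges. The
subgraphs of `Γ / S` correspond to the subgraphs `T ⊇ S` of `Γ`, the subgraphs of the components of
`S` to the subgraphs of `Γ` inside `S`, and `(Γ / S) / (T / S) ≅ Γ / T`. This is coassociativity
(`FGraph.IsFeynman.coassoc`). Every graph has a loop and loop numbers add up over subgraph and
cograph, so the coproduct is conilpotent. The antipode is therefore a geometric series of convolution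
powers, which passes to quotients and preserves subalgebras closed under the coproduct
(`IsConilpotent.isHopfAlgebra`, `IsConilpotent.antipode_map`, `IsConilpotent.isSubHopf`).

**Insertion.** Gluing a graph `Y` into a graph and marking the new internal half-edges is inverse to
contracting a marked component isomorphic to `Y`; counted with isomorphisms, this is
`FGraph.sum_card_glue_iso`. Iteration (`FGraph.markedGlueSum_card`) shows that a graph `Γ` arises by
insertion of the factors of a monomial `m` into `γ` as often as it has subgraphs `S` of type `m` with
`Γ / S ≅ γ`, up to the orders of automorphism groups. On the other hand `∂ / ∂Y`, applied to a
product of factors `X^m` for the vertices and `1 / X^2` for the edges, replaces one factor by the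
results of all gluings of `Y` (`FGraph.IsFeynman.seriesDeriv_freeSeries`): the sign of `X^2` and the
weights `n! / |Aut|` are made for this. Hence the coefficients of `X_γ` count insertions, and
`[α^k] X_γ` is the sum over all `Γ` and `S` with `Γ / S ≅ γ` of the subgraphs `S`, weighted by
automorphisms (`FeynmanGraph.coeff_insertionArg_eq_sum`).

Two formulas in `H` follow. If `X^n` is expanded by the cographs of its coproduct, the coefficient
of a cograph `γ` is its weight times `X_γ` (`graphComul_coeff_green`). Moreover, the maximal proper
subgraphs of `Γ` are those whose cograph has one loop, one-loop graphs are primitive, and so the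
division by the number of maximal subgraphs in `B_+^γ` makes every graph appear exactly once in the
sum over one-loop graphs. The Dyson-Schwinger equation `X^n = 1 ± α ∑ w(γ) B_+^γ(X_γ)` thus holds
already in `H` (`coeff_green_succ`).

**Modulo the relations** the series `X^n` form a geometric progression. Counting vertices, edges and
valences gives `X_γ = X^n Q^{2l}` for all `γ` with `n` legs and `l` loops (`map_insertionArg`), so that
`Δ X^n = ∑ X^n Q^{2l} ⊗ [α^l] X^n`. The right side is the product of `X^n ⊗ 1` with the result of the
substitution `α ↦ α (Q^2 ⊗ 1)` in `1 ⊗ X^n`, and is multiplicative in `X^n`. It therefore preserves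
the relations `X^{n+1} X^{n-1} = (X^n)^2` (`eq_zero_of_isTwisted`), the coproduct descends to the
quotient, and the same multiplicativity yields the coproduct of `X^n Q^2`.

The coefficients of `X^n Q^2` are linearly independent (`linearIndependent_dseArg`). Indeed there are
graphs with any numbers `n ≥ 2` of legs and `k ≥ 1` of loops, namely those with a single vertex, so
the coefficients of the `X^n` can be given any values by a character of `H`. The character with
`X^n ↦ (1 - t α)^{-(n-2)}` respects the relations and sends `[α^k] X^n Q^2` to a nonzero multiple of
`t^k`. Thus `B_+^{1,n}` can be defined on these coefficients by the Dyson-Schwinger equation, and it is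
Hochschild closed because the coproducts of `X^n` and `X^n Q^2` differ by the shift of `l` by one.
-/



/-! ### Equivalence relations -/

namespace Setoid

variable {α β : Type*}

/-- Induction along a path of steps from two equivalence relations. -/
theorem sup_induction {r s : Setoid α} {x : α} (P : α → Prop) (h0 : P x)
    (hr : ∀ y z, P y → r y z → P z) (hs : ∀ y z, P y → s y z → P z) {y : α}
    (h : (r ⊔ s) x y) : P y := by
  have key : ∀ t : Setoid α, (∀ y z, P y → t y z → P z) → t ≤ Setoid.ker P := by
    intro t ht y z hyz
    exact propext ⟨fun hy => ht _ _ hy hyz, fun hz => ht _ _ hz (t.symm' hyz)⟩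
  have : (r ⊔ s) ≤ Setoid.ker P := sup_le (key r hr) (key s hs)
  exact (this h : P x = P y) ▸ h0

/-- If `s` is trivial outside the range of `f`, restriction along `f` commutes with joining
with `s`. -/
theorem comap_sup_of_supported (f : β → α) (r s : Setoid α)
    (hs : ∀ x y, s x y → x = y ∨ (x ∈ Set.range f ∧ y ∈ Set.range f)) :
    (r ⊔ s).comap f = r.comap f ⊔ s.comap f := by
  apply le_antisymm
  · intro x y h
    obtain ⟨u, hu, hy⟩ := sup_induction
      (P := fun z => ∃ u, (r.comap f ⊔ s.comap f) x u ∧ r (f u) z)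
      ⟨x, Setoid.refl' _ _, Setoid.refl' _ _⟩
      (fun y z ⟨u, hu, hy⟩ hyz => ⟨u, hu, r.trans' hy hyz⟩)
      (by
        rintro y z ⟨u, hu, hy⟩ hyz
        rcases hs _ _ hyz with rfl | ⟨⟨a, rfl⟩, ⟨b, rfl⟩⟩
        · exact ⟨u, hu, hy⟩
        · refine ⟨b, Setoid.trans' _ (y := a) (Setoid.trans' _ hu ?_) ?_, Setoid.refl' _ _⟩
          · exact (le_sup_left : r.comap f ≤ r.comap f ⊔ s.comap f) hy
          · exact (le_sup_right : s.comap f ≤ r.comap f ⊔ s.comap f) hyz) h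
    exact Setoid.trans' _ hu ((le_sup_left : r.comap f ≤ r.comap f ⊔ s.comap f) hy)
  · exact sup_le (fun x y h => (le_sup_left : r ≤ r ⊔ s) h)
      (fun x y h => (le_sup_right : s ≤ r ⊔ s) h)

/-- If the range of `f` is a union of classes of both relations, restriction along `f` commutes with
their join. -/
theorem comap_sup_of_saturated (f : β → α) (r s : Setoid α)
    (hr : ∀ x y, r x y → x ∈ Set.range f → y ∈ Set.range f)
    (hs : ∀ x y, s x y → x ∈ Set.range f → y ∈ Set.range f) :
    (r ⊔ s).comap f = r.comap f ⊔ s.comap f ∧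
      ∀ x y, (r ⊔ s) x y → x ∈ Set.range f → y ∈ Set.range f := by
  have key : ∀ x z, (r ⊔ s) (f x) z → ∃ u, (r.comap f ⊔ s.comap f) x u ∧ r (f u) z := by
    intro x z h
    refine sup_induction (P := fun z => ∃ u, (r.comap f ⊔ s.comap f) x u ∧ r (f u) z)
      ⟨x, Setoid.refl' _ _, Setoid.refl' _ _⟩
      (fun y z ⟨u, hu, hy⟩ hyz => ⟨u, hu, r.trans' hy hyz⟩) ?_ h
    rintro y z ⟨u, hu, hy⟩ hyz
    obtain ⟨a, rfl⟩ := hr _ _ hy ⟨u, rfl⟩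
    obtain ⟨b, rfl⟩ := hs _ _ hyz ⟨a, rfl⟩
    refine ⟨b, Setoid.trans' _ (y := a) (Setoid.trans' _ hu ?_) ?_, Setoid.refl' _ _⟩
    · exact (le_sup_left : r.comap f ≤ r.comap f ⊔ s.comap f) hy
    · exact (le_sup_right : s.comap f ≤ r.comap f ⊔ s.comap f) hyz
  refine ⟨le_antisymm ?_ ?_, ?_⟩
  · intro x y h
    obtain ⟨u, hu, hy⟩ := key x (f y) h
    exact Setoid.trans' _ hu ((le_sup_left : r.comap f ≤ r.comap f ⊔ s.comap f) hy)
  · exact sup_le (fun x y h => (le_sup_left : r ≤ r ⊔ s) h)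
      (fun x y h => (le_sup_right : s ≤ r ⊔ s) h)
  · rintro _ y h ⟨x, rfl⟩
    obtain ⟨u, hu, hy⟩ := key x y h
    exact hr _ _ hy ⟨u, rfl⟩

theorem sup_left {r s : Setoid α} {x y : α} (h : r x y) : (r ⊔ s) x y :=
  (le_sup_left : r ≤ r ⊔ s) h

theorem sup_right {r s : Setoid α} {x y : α} (h : s x y) : (r ⊔ s) x y :=
  (le_sup_right : s ≤ r ⊔ s) h

/-- A union of classes of two relations is a union of classes of their join. -/
theorem mem_iff_of_sup {r s : Setoid α} {A : Set α} (hr : ∀ y z, y ∈ A → r y z → z ∈ A)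
    (hs : ∀ y z, y ∈ A → s y z → z ∈ A) {x y : α} (h : (r ⊔ s) x y) (hx : x ∈ A) : y ∈ A :=
  sup_induction (· ∈ A) hx hr hs h

end Setoid

/-! ### Isomorphisms and unions of connected components -/

namespace FGraph

variable {α β δ : Type}

@[ext] theorem ext' {Γ Γ' : FGraph α} (hv : Γ.vert = Γ'.vert) (he : Γ.edge = Γ'.edge) : Γ = Γ' := by
  cases Γ; cases Γ'; simp_all

/-- The graph structure pulled back along a map of half-edges. -/
def comap (f : β → α) (Γ : FGraph α) : FGraph β := ⟨Γ.vert.comap f, Γ.edge.comap f⟩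

/-- The graph in which the edges outside `S` are cut. -/
def cut (Γ : FGraph α) (S : Set α) : FGraph α := ⟨Γ.vert, Γ.edgeOn S⟩

/-- `f` identifies `β` with a union of connected components of `Γ`. -/
structure IsSummand (f : β → α) (Γ : FGraph α) : Prop where
  inj : Function.Injective f
  vert : ∀ x y, Γ.vert.r x y → x ∈ Set.range f → y ∈ Set.range f
  edge : ∀ x y, Γ.edge.r x y → x ∈ Set.range f → y ∈ Set.range f

theorem IsSummand.of_equiv (e : β ≃ α) (Γ : FGraph α) : IsSummand e Γ :=
  ⟨e.injective, fun _ y _ _ => e.surjective y, fun _ y _ _ => e.surjective y⟩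

theorem comap_comap (f : β → α) (g : δ → β) (Γ : FGraph α) :
    (Γ.comap f).comap g = Γ.comap (f ∘ g) := rfl

theorem edgeOn_comap (Γ : FGraph α) {f : β → α} (hf : Function.Injective f) (S : Set α) :
    (Γ.comap f).edgeOn (f ⁻¹' S) = (Γ.edgeOn S).comap f := by
  ext x y
  change (x = y ∨ _) ↔ (f x = f y ∨ _)
  rw [hf.eq_iff]; rfl

theorem edgeOn_rel (Γ : FGraph α) (S : Set α) (x y : α) :
    (Γ.edgeOn S).r x y ↔ x = y ∨ (x ∈ S ∧ y ∈ S ∧ Γ.edge.r x y) := Iff.rfl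

theorem edgeOn_le (Γ : FGraph α) (S : Set α) : Γ.edgeOn S ≤ Γ.edge := by
  rintro x y (rfl | ⟨_, _, h⟩)
  · exact Γ.edge.refl' _
  · exact h

theorem edgeOn_univ (Γ : FGraph α) : Γ.edgeOn Set.univ = Γ.edge :=
  le_antisymm (Γ.edgeOn_le _) fun _ _ h => Or.inr ⟨trivial, trivial, h⟩

theorem edgeOn_mono (Γ : FGraph α) {S T : Set α} (h : S ⊆ T) : Γ.edgeOn S ≤ Γ.edgeOn T := by
  rintro x y (rfl | ⟨hx, hy, hxy⟩)
  · exact Or.inl rfl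
  · exact Or.inr ⟨h hx, h hy, hxy⟩

theorem conn_mono (Γ : FGraph α) {S T : Set α} (h : S ⊆ T) : Γ.conn S ≤ Γ.conn T :=
  sup_le_sup_left (Γ.edgeOn_mono h) _

theorem conn_vert (Γ : FGraph α) {S : Set α} {x y : α} (h : Γ.vert.r x y) : (Γ.conn S).r x y :=
  Setoid.sup_left h

theorem conn_edge (Γ : FGraph α) {S : Set α} {x y : α} (hx : x ∈ S) (hy : y ∈ S)
    (h : Γ.edge.r x y) : (Γ.conn S).r x y :=
  Setoid.sup_right (Or.inr ⟨hx, hy, h⟩)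

/-- A set of half-edges that is a union of vertices and that is not left by the edges in `S` is a
union of classes of `Γ.conn S`. -/
theorem conn_mem (Γ : FGraph α) {S A : Set α} (hv : ∀ y z, y ∈ A → Γ.vert.r y z → z ∈ A)
    (he : ∀ y z, y ∈ A → y ∈ S → z ∈ S → Γ.edge.r y z → z ∈ A) {x y : α}
    (h : (Γ.conn S).r x y) (hx : x ∈ A) : y ∈ A := by
  refine Setoid.mem_iff_of_sup hv ?_ h hx
  rintro y z hy (rfl | ⟨h1, h2, h3⟩)
  · exact hy
  · exact he y z hy h1 h2 h3

theorem edge_comm (Γ : FGraph α) {x y : α} : Γ.edge.r x y ↔ Γ.edge.r y x :=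
  ⟨Γ.edge.symm', Γ.edge.symm'⟩

theorem conn_comap {Γ : FGraph α} {f : β → α} (hf : Function.Injective f) (S : Set α)
    (hv : ∀ x y, Γ.vert.r x y → x ∈ Set.range f → y ∈ Set.range f)
    (he : ∀ x y, x ∈ S → y ∈ S → Γ.edge.r x y → x ∈ Set.range f → y ∈ Set.range f) :
    (Γ.comap f).conn (f ⁻¹' S) = (Γ.conn S).comap f ∧
      ∀ x y, (Γ.conn S).r x y → x ∈ Set.range f → y ∈ Set.range f := by
  have := Setoid.comap_sup_of_saturated f Γ.vert (Γ.edgeOn S) hv (by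
    rintro x y (rfl | ⟨h1, h2, h3⟩) h
    · exact h
    · exact he _ _ h1 h2 h3 h)
  refine ⟨?_, this.2⟩
  rw [conn, edgeOn_comap Γ hf, conn, this.1]; rfl

namespace IsSummand

variable {Γ : FGraph α} {f : β → α}

theorem conn (h : IsSummand f Γ) (S : Set α) :
    (Γ.comap f).conn (f ⁻¹' S) = (Γ.conn S).comap f :=
  (conn_comap h.inj S h.vert fun x y _ _ => h.edge x y).1

theorem conn_mem (h : IsSummand f Γ) {S : Set α} {x y : α} (hxy : (Γ.conn S).r x y)
    (hx : x ∈ Set.range f) : y ∈ Set.range f :=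
  (conn_comap h.inj S h.vert fun x y _ _ => h.edge x y).2 x y hxy hx

theorem conn_rel (h : IsSummand f Γ) (S : Set α) (x y : β) :
    ((Γ.comap f).conn (f ⁻¹' S)).r x y ↔ (Γ.conn S).r (f x) (f y) := by
  rw [h.conn]; rfl

theorem isInternal (h : IsSummand f Γ) (x : β) :
    (Γ.comap f).IsInternal x ↔ Γ.IsInternal (f x) := by
  constructor
  · rintro ⟨y, hy, hxy⟩; exact ⟨f y, h.inj.ne hy, hxy⟩
  · rintro ⟨z, hz, hxz⟩
    obtain ⟨y, rfl⟩ := h.edge _ _ hxz ⟨x, rfl⟩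
    exact ⟨y, fun e => hz (by rw [e]), hxz⟩

theorem card_fiber (h : IsSummand f Γ) (P : α → Prop) (hP : ∀ x, P x → x ∈ Set.range f) :
    Nat.card {y : β // P (f y)} = Nat.card {x : α // P x} := by
  refine Nat.card_congr (Equiv.ofBijective (fun y => ⟨f y.1, y.2⟩) ⟨?_, ?_⟩)
  · intro a b hab
    exact Subtype.ext (h.inj (congrArg Subtype.val hab))
  · rintro ⟨x, hx⟩
    obtain ⟨y, rfl⟩ := hP x hx
    exact ⟨⟨y, hx⟩, rfl⟩

theorem inPropagator (h : IsSummand f Γ) (S : Set α) (x : β) :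
    (Γ.comap f).InPropagator (f ⁻¹' S) x ↔ Γ.InPropagator S (f x) := by
  unfold InPropagator
  rw [← h.card_fiber (fun z => (Γ.conn S).r (f x) z ∧ z ∉ S)
    fun z hz => h.conn_mem hz.1 ⟨x, rfl⟩]
  simp only [h.conn_rel]; rfl

theorem propagatorRel (h : IsSummand f Γ) (S : Set α) :
    (Γ.comap f).propagatorRel (f ⁻¹' S) = (Γ.propagatorRel S).comap f := by
  ext x y
  change (x = y ∨ _) ↔ (f x = f y ∨ _)
  rw [h.inj.eq_iff, h.conn_rel, h.inPropagator, h.inPropagator]; rfl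

theorem contractEdge (h : IsSummand f Γ) (S : Set α) :
    (Γ.comap f).edge ⊔ (Γ.comap f).propagatorRel (f ⁻¹' S) =
      (Γ.edge ⊔ Γ.propagatorRel S).comap f := by
  rw [h.propagatorRel, (Setoid.comap_sup_of_saturated f _ _ h.edge _).1]
  · rfl
  · rintro x y (rfl | ⟨_, _, h1, _⟩) hx
    · exact hx
    · exact h.conn_mem h1 hx

theorem isSub (h : IsSummand f Γ) (S : Set α) (hS : S ⊆ Set.range f) :
    (Γ.comap f).IsSub (f ⁻¹' S) ↔ Γ.IsSub S := by
  have hpre : ∀ x y : β, f ⁻¹' S \ {x, y} = f ⁻¹' (S \ {f x, f y}) := by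
    intro x y; ext z; simp [h.inj.eq_iff]
  constructor
  · rintro ⟨h1, h2⟩
    refine ⟨fun x hx => ?_, fun x hx y hy hne hxy => ?_⟩
    · obtain ⟨x, rfl⟩ := hS hx
      refine ⟨(h.isInternal x).1 (h1 x hx).1, fun y hy => ?_⟩
      obtain ⟨y, rfl⟩ := h.edge _ _ hy ⟨x, rfl⟩
      exact (h1 x hx).2 y hy
    · obtain ⟨x, rfl⟩ := hS hx
      obtain ⟨y, rfl⟩ := hS hy
      have := h2 x hx y hy (fun e => hne (by rw [e])) hxy
      rwa [hpre, h.conn_rel] at this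
  · rintro ⟨h1, h2⟩
    refine ⟨fun x hx => ⟨(h.isInternal x).2 (h1 _ hx).1, fun y hy => (h1 _ hx).2 _ hy⟩,
      fun x hx y hy hne hxy => ?_⟩
    rw [hpre, h.conn_rel]
    exact h2 _ hx _ hy (h.inj.ne hne) hxy

end IsSummand

/-! Invariance of the basic notions under isomorphisms. -/

theorem isInternal_comap (Γ : FGraph α) (e : β ≃ α) (x : β) :
    (Γ.comap e).IsInternal x ↔ Γ.IsInternal (e x) := (IsSummand.of_equiv e Γ).isInternal x

theorem numLegs_comap (Γ : FGraph α) (e : β ≃ α) : (Γ.comap e).numLegs = Γ.numLegs := by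
  unfold numLegs IsLeg
  simp only [isInternal_comap]
  exact (IsSummand.of_equiv e Γ).card_fiber (fun x => ¬ Γ.IsInternal x) fun x _ => e.surjective x

theorem card_internal_comap (Γ : FGraph α) (e : β ≃ α) :
    Nat.card {x // (Γ.comap e).IsInternal x} = Nat.card {x // Γ.IsInternal x} := by
  simp only [isInternal_comap]
  exact (IsSummand.of_equiv e Γ).card_fiber (fun x => Γ.IsInternal x) fun x _ => e.surjective x

theorem numEdges_comap (Γ : FGraph α) (e : β ≃ α) : (Γ.comap e).numEdges = Γ.numEdges := by
  unfold numEdges; rw [card_internal_comap]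

/-- Classes of a pulled back equivalence relation. -/
noncomputable def _root_.Setoid.quotientComapEquiv (r : Setoid α) (e : β ≃ α) :
    Quotient (r.comap e) ≃ Quotient r :=
  Quotient.congr e fun _ _ => Iff.rfl

theorem numVertices_comap (Γ : FGraph α) (e : β ≃ α) :
    (Γ.comap e).numVertices = Γ.numVertices :=
  Nat.card_congr (Γ.vert.quotientComapEquiv e)

theorem loops_comap (Γ : FGraph α) (e : β ≃ α) : (Γ.comap e).loops = Γ.loops := by
  unfold loops; rw [numEdges_comap, numVertices_comap]

theorem valence_mk (Γ : FGraph α) (x : α) :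
    Γ.valence (Quotient.mk _ x) = Nat.card {y // Γ.vert.r y x} := by
  unfold valence
  refine Nat.card_congr (Equiv.subtypeEquivRight fun y => ?_)
  exact Quotient.eq

theorem conn_comap_equiv (Γ : FGraph α) (e : β ≃ α) (S : Set α) (x y : β) :
    ((Γ.comap e).conn (e ⁻¹' S)).r x y ↔ (Γ.conn S).r (e x) (e y) :=
  (IsSummand.of_equiv e Γ).conn_rel S x y

theorem IsFeynman.comap {Γ : FGraph α} (h : Γ.IsFeynman) (e : β ≃ α) :
    (Γ.comap e).IsFeynman where
  edge_le_two x y z h1 h2 := by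
    simpa using h.edge_le_two (e x) (e y) (e z) h1 h2
  three_le_valence v := by
    induction v using Quotient.inductionOn with
    | h x =>
      rw [valence_mk]
      have := h.three_le_valence (Quotient.mk _ (e x))
      rw [valence_mk] at this
      rwa [← (IsSummand.of_equiv e Γ).card_fiber (fun z => Γ.vert.r z (e x))
        fun z _ => e.surjective z] at this
  connected x y := by
    exact (conn_comap_equiv Γ e Set.univ x y).2 (h.connected _ _)
  irreducible x y hne hxy := by
    have := (conn_comap_equiv Γ e {e x, e y}ᶜ x y).2 (h.irreducible _ _ (e.injective.ne hne) hxy)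
    convert this using 2
    ext z; simp
  has_internal := by
    obtain ⟨x, hx⟩ := h.has_internal
    exact ⟨e.symm x, (isInternal_comap _ _ _).2 (by simpa using hx)⟩
  two_le_legs := by rw [numLegs_comap]; exact h.two_le_legs

theorem isFeynman_comap_iff (Γ : FGraph α) (e : β ≃ α) :
    (Γ.comap e).IsFeynman ↔ Γ.IsFeynman := by
  refine ⟨fun h => ?_, fun h => h.comap e⟩
  have := h.comap e.symm
  rw [comap_comap] at this
  simpa [FGraph.comap, Function.comp_def] using this

theorem Iso.eq_comap {Γ : FGraph α} {Γ' : FGraph β} (e : Iso Γ Γ') : Γ = Γ'.comap e.1 :=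
  ext' (Setoid.ext fun x y => (e.2 x y).1) (Setoid.ext fun x y => (e.2 x y).2)

/-- The isomorphism given by an equality with a pulled back graph. -/
def Iso.ofEq {Γ : FGraph α} {Γ' : FGraph β} (e : α ≃ β) (h : Γ = Γ'.comap e) : Iso Γ Γ' :=
  ⟨e, fun x y => by subst h; exact ⟨Iff.rfl, Iff.rfl⟩⟩

def Iso.symm {Γ : FGraph α} {Γ' : FGraph β} (e : Iso Γ Γ') : Iso Γ' Γ :=
  ⟨e.1.symm, fun x y => by
    have h := e.2 (e.1.symm x) (e.1.symm y)
    simp only [Equiv.apply_symm_apply] at h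
    exact ⟨h.1.symm, h.2.symm⟩⟩

def Iso.trans {Γ : FGraph α} {Γ' : FGraph β} {Γ'' : FGraph δ} (e : Iso Γ Γ') (f : Iso Γ' Γ'') :
    Iso Γ Γ'' :=
  ⟨e.1.trans f.1, fun x y => ⟨(e.2 x y).1.trans (f.2 _ _).1, (e.2 x y).2.trans (f.2 _ _).2⟩⟩

def Iso.refl (Γ : FGraph α) : Iso Γ Γ := ⟨Equiv.refl _, fun _ _ => ⟨Iff.rfl, Iff.rfl⟩⟩

theorem Iso.isFeynman {Γ : FGraph α} {Γ' : FGraph β} (e : Iso Γ Γ') (h : Γ'.IsFeynman) :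
    Γ.IsFeynman := by
  rw [e.eq_comap]; exact h.comap _

/-- A graph as an isomorphism to its standard copy. -/
noncomputable def isoToFin [Finite α] (Γ : FGraph α) : Iso Γ Γ.toFin :=
  (Iso.ofEq (Γ := Γ.toFin) (Γ' := Γ) (Finite.equivFin α).symm rfl).symm

/-- The isomorphism class of a one-particle irreducible graph. -/
noncomputable def cls [Finite α] (Γ : FGraph α) (h : Γ.IsFeynman) : FeynmanGraph :=
  Quotient.mk PreFeynmanGraph.setoid ⟨⟨_, Γ.toFin⟩, h.comap _⟩

theorem _root_.FeynmanGraph.rep_isFeynman (γ : FeynmanGraph) : γ.rep.IsFeynman :=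
  (Quotient.out γ).2

theorem cls_iso [Finite α] (Γ : FGraph α) (h : Γ.IsFeynman) : Nonempty (Iso Γ (Γ.cls h).rep) := by
  have h1 : Nonempty (Iso (Quotient.out (Γ.cls h)).1.2 Γ.toFin) :=
    Quotient.exact (Quotient.out_eq (Γ.cls h))
  exact ⟨Γ.isoToFin.trans h1.some.symm⟩

theorem cls_eq_iff [Finite α] [Finite β] {Γ : FGraph α} {Γ' : FGraph β} (h : Γ.IsFeynman)
    (h' : Γ'.IsFeynman) : Γ.cls h = Γ'.cls h' ↔ Nonempty (Iso Γ Γ') := by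
  constructor
  · intro e
    obtain ⟨f⟩ : Nonempty (Iso Γ.toFin Γ'.toFin) := Quotient.exact e
    exact ⟨Γ.isoToFin.trans (f.trans Γ'.isoToFin.symm)⟩
  · rintro ⟨e⟩
    exact Quotient.sound ⟨Γ.isoToFin.symm.trans (e.trans Γ'.isoToFin)⟩

theorem cls_rep (γ : FeynmanGraph) : γ.rep.cls γ.rep_isFeynman = γ := by
  conv_rhs => rw [← Quotient.out_eq γ]
  exact Quotient.sound ⟨γ.rep.isoToFin.symm⟩

theorem cls_eq_iff_rep [Finite α] {Γ : FGraph α} (h : Γ.IsFeynman) (γ : FeynmanGraph) :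
    Γ.cls h = γ ↔ Nonempty (Iso γ.rep Γ) := by
  conv_lhs => rw [← cls_rep γ]
  rw [cls_eq_iff]
  exact ⟨fun ⟨e⟩ => ⟨e.symm⟩, fun ⟨e⟩ => ⟨e.symm⟩⟩

theorem numLegs_cls [Finite α] (Γ : FGraph α) (h : Γ.IsFeynman) :
    (Γ.cls h).numLegs = Γ.numLegs := by
  obtain ⟨e⟩ := Γ.cls_iso h
  conv_rhs => rw [e.eq_comap, numLegs_comap]
  rfl

theorem loops_cls [Finite α] (Γ : FGraph α) (h : Γ.IsFeynman) :
    (Γ.cls h).loops = Γ.loops := by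
  obtain ⟨e⟩ := Γ.cls_iso h
  conv_rhs => rw [e.eq_comap, loops_comap]
  rfl

section Alg

variable (𝕜 : Type*) [Field 𝕜]

theorem toAlg_of_isFeynman [Finite α] {Γ : FGraph α} (h : Γ.IsFeynman) :
    Γ.toAlg 𝕜 = MvPolynomial.X (Γ.cls h) := by
  have h' : Γ.toFin.IsFeynman := h.comap _
  rw [toAlg, dif_pos h']; rfl

theorem toAlg_of_legs [Finite α] {Γ : FGraph α} (h : ∀ x, Γ.IsLeg x) : Γ.toAlg 𝕜 = 1 := by
  rw [toAlg, dif_neg, if_pos h]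
  intro h'
  obtain ⟨x, hx⟩ := h'.has_internal
  exact h _ ((isInternal_comap Γ _ x).1 hx)

theorem toAlg_comap [Finite α] [Finite β] (Γ : FGraph α) (e : β ≃ α) :
    (Γ.comap e).toAlg 𝕜 = Γ.toAlg 𝕜 := by
  by_cases h : Γ.IsFeynman
  · rw [toAlg_of_isFeynman 𝕜 h, toAlg_of_isFeynman 𝕜 (h.comap e)]
    congr 1
    rw [cls_eq_iff]
    exact ⟨Iso.ofEq e rfl⟩
  · have h1 : ¬ Γ.toFin.IsFeynman := fun h' => h ((isFeynman_comap_iff Γ _).1 h')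
    have h2 : ¬ (Γ.comap e).toFin.IsFeynman := fun h' =>
      h ((isFeynman_comap_iff Γ _).1 ((isFeynman_comap_iff (Γ.comap e) _).1 h'))
    rw [toAlg, dif_neg h2, toAlg, dif_neg h1]
    congr 1
    refine propext ⟨fun H x => ?_, fun H x hx => H (e x) ((isInternal_comap _ _ _).1 hx)⟩
    intro hx
    exact H (e.symm x) ((isInternal_comap _ _ _).2 (by simpa using hx))

theorem toAlg_iso [Finite α] [Finite β] {Γ : FGraph α} {Γ' : FGraph β} (e : Iso Γ Γ') :
    Γ.toAlg 𝕜 = Γ'.toAlg 𝕜 := by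
  rw [e.eq_comap, toAlg_comap]

theorem toAlg_rep (γ : FeynmanGraph) : γ.rep.toAlg 𝕜 = MvPolynomial.X γ := by
  rw [toAlg_of_isFeynman 𝕜 γ.rep_isFeynman, cls_rep]

end Alg

end FGraph



/-! ### Components, contractions and the coproduct under isomorphisms -/

/-- Products over the classes of a relation, grouped by the values of a function that is constant on
the classes. -/
theorem finprod_quotient_fiber {α ι M : Type*} [Finite α] [Finite ι] [CommMonoid M] {r : Setoid α}
    (q : α → ι) (h : ∀ x y, r x y → q x = q y) (g : α → M) (hg : ∀ x y, r x y → g x = g y) :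
    ∏ᶠ c : Quotient r, g c.out = ∏ᶠ i : ι,
      ∏ᶠ c : Quotient (r.comap (Subtype.val : {x // q x = i} → α)), g c.out.1 := by
  have : Fintype (Quotient r) := Fintype.ofFinite _
  have : Fintype ι := Fintype.ofFinite _
  have (i : ι) : Fintype (Quotient (r.comap
      (Subtype.val : {x // q x = i} → α))) := Fintype.ofFinite _
  let e : (Σ i, Quotient (r.comap (Subtype.val : {x // q x = i} → α))) ≃ Quotient r :=
    .trans (.symm <| .sigmaCongrRight fun i => .subtypeQuotientEquivQuotientSubtype
      (s₁ := r) (s₂ := r.comap Subtype.val) (fun x => q x = i) (fun c : Quotient r => c.lift q h = i)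
      (fun _ => Iff.rfl) fun _ _ => Iff.rfl) (.sigmaFiberEquiv fun a : Quotient r => a.lift q h)
  simp only [finprod_eq_prod_of_fintype]
  rw [← Fintype.prod_sigma (fun p : (Σ i, Quotient (r.comap
    (Subtype.val : {x // q x = i} → α))) => g p.2.out.1)]
  refine (Fintype.prod_equiv e _ _ ?_).symm
  rintro ⟨d, c⟩
  apply hg
  obtain ⟨x, hx⟩ : ∃ x, x = c.out := ⟨_, rfl⟩
  have hc : c = Quotient.mk _ x := by rw [hx, Quotient.out_eq]
  have h1 : e ⟨d, c⟩ = Quotient.mk r x.1 := by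
    rw [hc]; rfl
  change r c.out.1 (e ⟨d, c⟩).out
  rw [h1, ← hx]
  exact r.symm' (Quotient.mk_out (s := r) x.1)

theorem finprod_quotient_equiv {α β : Type} {M : Type*} [CommMonoid M] (r : Setoid α)
    (e : β ≃ α) (g : α → M) (hg : ∀ x y, r x y → g x = g y) :
    ∏ᶠ c : Quotient (r.comap e), g (e c.out) = ∏ᶠ c : Quotient r, g c.out := by
  refine finprod_eq_of_bijective (r.quotientComapEquiv e) (Equiv.bijective _) fun c => ?_
  apply hg
  obtain ⟨x, rfl⟩ := Quotient.exists_rep c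
  exact r.trans' (Quotient.mk_out (s := r.comap e) x) (r.symm' (Quotient.mk_out (s := r) (e x)))

namespace FGraph

variable {α β δ : Type}

/-- The connected component of a half-edge. -/
def compAt (G : FGraph α) (x : α) : FGraph {y // (G.vert ⊔ G.edge).r y x} :=
  G.comap Subtype.val

theorem compAt_summand {G : FGraph α} {f : β → α} (h : IsSummand f G) (y : β) :
    Nonempty (Iso ((G.comap f).compAt y) (G.compAt (f y))) := by
  have h1 := Setoid.comap_sup_of_saturated f G.vert G.edge h.vert h.edge
  have h2 : ∀ z, ((G.comap f).vert ⊔ (G.comap f).edge).r z y ↔ (G.vert ⊔ G.edge).r (f z) (f y) := by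
    intro z
    change (G.vert.comap f ⊔ G.edge.comap f).r z y ↔ _
    rw [← h1.1]; rfl
  refine ⟨Iso.ofEq (Equiv.ofBijective (fun z => ⟨f z.1, (h2 _).1 z.2⟩) ⟨?_, ?_⟩) rfl⟩
  · intro a b hab
    exact Subtype.ext (h.inj (congrArg Subtype.val hab))
  · rintro ⟨x, hx⟩
    obtain ⟨z, rfl⟩ := h1.2 _ _ (Setoid.symm' _ hx) ⟨y, rfl⟩
    exact ⟨⟨z, (h2 _).2 hx⟩, rfl⟩

theorem compAt_rel {G : FGraph α} {x y : α} (h : (G.vert ⊔ G.edge).r x y) :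
    Nonempty (Iso (G.compAt x) (G.compAt y)) :=
  ⟨Iso.ofEq (Equiv.subtypeEquivRight fun _ =>
    ⟨fun h' => Setoid.trans' _ h' h, fun h' => Setoid.trans' _ h' (Setoid.symm' _ h)⟩) rfl⟩

theorem component_iso (Γ : FGraph α) (S : Set α) (x : α) :
    Nonempty (Iso (Γ.component S (Quotient.mk _ x)) ((Γ.cut S).compAt x)) :=
  ⟨Iso.ofEq (Equiv.subtypeEquivRight fun _ => Quotient.eq) rfl⟩

section Alg

variable (𝕜 : Type*) [Field 𝕜]

/-- The element of the algebra given by a possibly disconnected graph: the product of its connected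
components. -/
noncomputable def compsProd [Finite α] (G : FGraph α) : GraphAlg 𝕜 :=
  ∏ᶠ c : Quotient (G.vert ⊔ G.edge), (G.compAt c.out).toAlg 𝕜

theorem toAlg_compAt_rel [Finite α] (G : FGraph α) (x y : α) (h : (G.vert ⊔ G.edge).r x y) :
    (G.compAt x).toAlg 𝕜 = (G.compAt y).toAlg 𝕜 :=
  toAlg_iso 𝕜 (compAt_rel h).some

theorem finprod_component [Finite α] (Γ : FGraph α) (S : Set α) :
    ∏ᶠ c : Quotient (Γ.conn S), (Γ.component S c).toAlg 𝕜 = (Γ.cut S).compsProd 𝕜 := by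
  refine finprod_congr fun c => ?_
  conv_lhs => rw [← Quotient.out_eq c]
  exact toAlg_iso 𝕜 (Γ.component_iso S _).some

theorem compsProd_comap [Finite α] [Finite β] (G : FGraph α) (e : β ≃ α) :
    (G.comap e).compsProd 𝕜 = G.compsProd 𝕜 := by
  have h := IsSummand.of_equiv e G
  have h1 := (Setoid.comap_sup_of_saturated e G.vert G.edge h.vert h.edge).1
  rw [compsProd, compsProd, ← finprod_quotient_equiv _ e _ (toAlg_compAt_rel 𝕜 G)]
  change ∏ᶠ c : Quotient (G.vert.comap e ⊔ G.edge.comap e), _ = _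
  have : ∀ c, ((G.comap e).compAt c).toAlg 𝕜 = (G.compAt (e c)).toAlg 𝕜 := fun c =>
    toAlg_iso 𝕜 (compAt_summand h c).some
  simp only [this]
  rw [h1]
  rfl

/-- The restriction of a graph to a fibre of a function that is constant on components. -/
theorem isSummand_fiber {G : FGraph α} {ι : Type*} {q : α → ι}
    (h : ∀ x y, (G.vert ⊔ G.edge).r x y → q x = q y) (d : ι) :
    IsSummand (Subtype.val : {x // q x = d} → α) G where
  inj := Subtype.val_injective
  vert := by
    rintro x y hxy ⟨⟨x, hx⟩, rfl⟩
    exact ⟨⟨y, hx ▸ (h _ _ (Setoid.sup_left hxy)).symm⟩, rfl⟩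
  edge := by
    rintro x y hxy ⟨⟨x, hx⟩, rfl⟩
    exact ⟨⟨y, hx ▸ (h _ _ (Setoid.sup_right hxy)).symm⟩, rfl⟩

theorem compsProd_eq_finprod [Finite α] {G : FGraph α} {ι : Type*} [Finite ι] {q : α → ι}
    (h : ∀ x y, (G.vert ⊔ G.edge).r x y → q x = q y) :
    G.compsProd 𝕜 = ∏ᶠ d : ι,
      (G.comap (Subtype.val : {x // q x = d} → α)).compsProd 𝕜 := by
  rw [compsProd, finprod_quotient_fiber q h _ (toAlg_compAt_rel 𝕜 G)]
  refine finprod_congr fun d => ?_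
  have hd := isSummand_fiber h d
  have h1 := (Setoid.comap_sup_of_saturated _ G.vert G.edge hd.vert hd.edge).1
  rw [compsProd]
  have : ∀ c, ((G.comap Subtype.val).compAt c).toAlg 𝕜 = (G.compAt c.1).toAlg 𝕜 := fun c =>
    toAlg_iso 𝕜 (compAt_summand hd c).some
  simp only [this]
  change _ = ∏ᶠ c : Quotient (G.vert.comap _ ⊔ G.edge.comap _), _
  rw [h1]
  rfl

/-- A connected graph is its only component. -/
theorem compsProd_of_connected [Finite α] [Nonempty α] {G : FGraph α}
    (h : ∀ x y, (G.vert ⊔ G.edge).r x y) : G.compsProd 𝕜 = G.toAlg 𝕜 := by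
  have : Unique (Quotient (G.vert ⊔ G.edge)) :=
    { default := Quotient.mk _ (Classical.arbitrary α)
      uniq := fun c => by
        obtain ⟨x, rfl⟩ := Quotient.exists_rep c
        exact Quotient.sound (h _ _) }
  rw [compsProd, finprod_unique]
  exact toAlg_iso 𝕜 (Iso.ofEq (Equiv.subtypeUnivEquiv fun _ => h _ _) rfl)

theorem isLeg_of_edge_bot {G : FGraph α} (h : ∀ x y, G.edge.r x y → x = y) (x : α) : G.IsLeg x := by
  rintro ⟨y, hy, hxy⟩
  exact hy (h _ _ hxy).symm

theorem compsProd_of_legs [Finite α] {G : FGraph α} (h : ∀ x, G.IsLeg x) :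
    G.compsProd 𝕜 = 1 := by
  rw [compsProd]
  refine finprod_eq_one_of_forall_eq_one fun c => toAlg_of_legs 𝕜 fun x hx => h x.1 ?_
  obtain ⟨y, hy, hxy⟩ := hx
  exact ⟨y.1, fun e => hy (Subtype.ext e), hxy⟩

end Alg

namespace IsSummand

variable {Γ : FGraph α} {f : β → α}

/-- The half-edges of the contraction of a union of components. -/
def contractMap (h : IsSummand f Γ) (S : Set α) :
    {y // y ∉ f ⁻¹' S ∧ ¬ (Γ.comap f).InPropagator (f ⁻¹' S) y} →
      {x // x ∉ S ∧ ¬ Γ.InPropagator S x} :=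
  fun y => ⟨f y.1, y.2.1, fun hy => y.2.2 ((h.inPropagator S _).2 hy)⟩

theorem contract_comap (h : IsSummand f Γ) (S : Set α) :
    (Γ.comap f).contract (f ⁻¹' S) = (Γ.contract S).comap (h.contractMap S) := by
  refine ext' ?_ ?_
  · change ((Γ.comap f).conn (f ⁻¹' S)).comap _ = _
    rw [h.conn]; rfl
  · change ((Γ.comap f).edge ⊔ (Γ.comap f).propagatorRel (f ⁻¹' S)).comap _ = _
    rw [h.contractEdge]; rfl

theorem contractMap_injective (h : IsSummand f Γ) (S : Set α) :
    Function.Injective (h.contractMap S) := fun _ _ hab =>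
  Subtype.ext (h.inj (congrArg Subtype.val hab))

theorem mem_range_contractMap (h : IsSummand f Γ) (S : Set α)
    (x : {x // x ∉ S ∧ ¬ Γ.InPropagator S x}) :
    x ∈ Set.range (h.contractMap S) ↔ x.1 ∈ Set.range f := by
  constructor
  · rintro ⟨y, rfl⟩; exact ⟨y.1, rfl⟩
  · rintro ⟨y, hy⟩
    refine ⟨⟨y, ?_, ?_⟩, Subtype.ext hy⟩
    · change f y ∉ S; rw [hy]; exact x.2.1
    · rw [h.inPropagator, hy]; exact x.2.2

theorem contract_iso (h : IsSummand f Γ) (hf : Function.Surjective f) (S : Set α) :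
    Nonempty (Iso ((Γ.comap f).contract (f ⁻¹' S)) (Γ.contract S)) :=
  ⟨Iso.ofEq (Equiv.ofBijective (h.contractMap S) ⟨h.contractMap_injective S, fun x =>
    (h.mem_range_contractMap S x).2 (hf _)⟩) (h.contract_comap S)⟩

end IsSummand

theorem preimage_bijective {f : β → α} (hf : Function.Bijective f) :
    Function.Bijective (fun S : Set α => f ⁻¹' S) :=
  ⟨hf.2.preimage_injective, fun S => ⟨f '' S, hf.1.preimage_image S⟩⟩

theorem cut_comap (Γ : FGraph α) {f : β → α} (hf : Function.Injective f) (S : Set α) :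
    (Γ.comap f).cut (f ⁻¹' S) = (Γ.cut S).comap f :=
  ext' rfl (Γ.edgeOn_comap hf S)

/-- Subgraphs of isomorphic graphs. -/
noncomputable def subEquiv (Γ : FGraph α) (e : β ≃ α) :
    {S : Set α // Γ.IsSub S} ≃ {S : Set β // (Γ.comap e).IsSub S} :=
  Equiv.ofBijective
    (fun S => ⟨e ⁻¹' S.1, ((IsSummand.of_equiv e Γ).isSub S.1 fun x _ => e.surjective x).2 S.2⟩)
    ⟨fun _ _ h => Subtype.ext ((preimage_bijective e.bijective).1 (congrArg Subtype.val h)), by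
      rintro ⟨S, hS⟩
      obtain ⟨T, rfl⟩ := (preimage_bijective e.bijective).2 S
      exact ⟨⟨T, ((IsSummand.of_equiv e Γ).isSub T fun x _ => e.surjective x).1 hS⟩, rfl⟩⟩

section Alg

variable (𝕜 : Type*) [Field 𝕜]

theorem coprod_eq [Finite α] (Γ : FGraph α) : Γ.coprod 𝕜 = ∑ᶠ S : {S : Set α // Γ.IsSub S},
    (Γ.cut S.1).compsProd 𝕜 ⊗ₜ[𝕜] (Γ.contract S.1).toAlg 𝕜 := by
  unfold coprod
  simp only [finprod_component]

theorem coprod_comap [Finite α] [Finite β] (Γ : FGraph α) (e : β ≃ α) :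
    (Γ.comap e).coprod 𝕜 = Γ.coprod 𝕜 := by
  rw [coprod_eq, coprod_eq]
  refine (finsum_eq_of_bijective (Γ.subEquiv e) (Equiv.bijective _) fun S => ?_).symm
  change _ = ((Γ.comap e).cut (e ⁻¹' S.1)).compsProd 𝕜 ⊗ₜ[𝕜]
    ((Γ.comap e).contract (e ⁻¹' S.1)).toAlg 𝕜
  rw [cut_comap Γ e.injective, compsProd_comap,
    toAlg_iso 𝕜 ((IsSummand.of_equiv e Γ).contract_iso e.surjective S.1).some]

theorem coprod_iso [Finite α] [Finite β] {Γ : FGraph α} {Γ' : FGraph β} (e : Iso Γ Γ') :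
    Γ.coprod 𝕜 = Γ'.coprod 𝕜 := by
  rw [e.eq_comap, coprod_comap]

theorem graphComul_toAlg [Finite α] {Γ : FGraph α} (h : Γ.IsFeynman) :
    graphComul 𝕜 (Γ.toAlg 𝕜) = Γ.coprod 𝕜 := by
  rw [toAlg_of_isFeynman 𝕜 h, graphComul, MvPolynomial.aeval_X]
  exact (coprod_iso 𝕜 (Γ.cls_iso h).some).symm

end Alg

theorem maxf_comap (Γ : FGraph α) (e : β ≃ α) : (Γ.comap e).maxf = Γ.maxf := by
  have hI : {x | (Γ.comap e).IsInternal x} = e ⁻¹' {x | Γ.IsInternal x} := by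
    ext x; exact isInternal_comap Γ e x
  have hb := preimage_bijective e.bijective
  have hsub : ∀ S, (Γ.comap e).IsSub (e ⁻¹' S) ↔ Γ.IsSub S := fun S =>
    (IsSummand.of_equiv e Γ).isSub S fun x _ => e.surjective x
  unfold maxf
  rw [hI]
  refine (Nat.card_congr (Equiv.ofBijective
    (Subtype.map (fun S : Set α => e ⁻¹' S) ?_) ⟨Subtype.map_injective _ hb.1, ?_⟩)).symm
  · rintro S ⟨h1, h2, h3⟩
    refine ⟨(hsub S).2 h1, fun h => h2 (hb.1 h), fun T hT hST => ?_⟩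
    obtain ⟨T, rfl⟩ := hb.2 T
    exact (h3 T ((hsub T).1 hT) ((Set.preimage_subset_preimage_iff (by simp [e.surjective.range_eq])).1 hST)).imp
      (fun h => by rw [h]) fun h => by rw [h]
  · rintro ⟨S, h1, h2, h3⟩
    obtain ⟨S, rfl⟩ := hb.2 S
    refine ⟨⟨S, (hsub S).1 h1, fun h => h2 (by rw [h]), fun T hT hST => ?_⟩, rfl⟩
    exact (h3 _ ((hsub T).2 hT) (Set.preimage_mono hST)).imp (fun h => hb.1 h) fun h => hb.1 h

end FGraph



/-! ### Matchings -/

theorem eq_or_eq_of_card_two {α : Type*} {P : α → Prop} (h : Nat.card {y // P y} = 2) {x y z : α}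
    (hx : P x) (hy : P y) (hz : P z) : x = y ∨ x = z ∨ y = z := by
  obtain ⟨a, b, -, hab⟩ := Nat.card_eq_two_iff.1 h
  have key : ∀ w (hw : P w), w = a.1 ∨ w = b.1 := by
    intro w hw
    have : (⟨w, hw⟩ : {y // P y}) ∈ ({a, b} : Set _) := by rw [hab]; trivial
    rcases this with h | h
    · exact Or.inl (congrArg Subtype.val h)
    · exact Or.inr (congrArg Subtype.val h)
  rcases key x hx with h1 | h1 <;> rcases key y hy with h2 | h2 <;> rcases key z hz with h3 | h3 <;>
    simp [h1, h2, h3]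

theorem exists_ne_of_card_two {α : Type*} {P : α → Prop} (h : Nat.card {y // P y} = 2) (x : α) :
    ∃ y, P y ∧ y ≠ x := by
  obtain ⟨a, b, hne, -⟩ := Nat.card_eq_two_iff.1 h
  by_cases hx : a.1 = x
  · exact ⟨b.1, b.2, fun e => hne (Subtype.ext (hx.trans e.symm))⟩
  · exact ⟨a.1, a.2, hx⟩

/-- A relation with classes of at most two elements is given by an involution. -/
theorem Setoid.exists_involution {α : Type*} (E : Setoid α)
    (hE : ∀ x y z, E x y → E x z → x = y ∨ x = z ∨ y = z) :
    ∃ a : Equiv.Perm α, (∀ x, a (a x) = x) ∧ ∀ x y, E x y ↔ y = x ∨ y = a x := by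
  -- the partner of `x` if there is one, and `x` itself otherwise
  let a : α → α := fun x => if h : ∃ y, y ≠ x ∧ E x y then h.choose else x
  have ha : ∀ x, E x (a x) := by
    intro x
    by_cases h : ∃ y, y ≠ x ∧ E x y
    · simp only [a, dif_pos h]; exact h.choose_spec.2
    · simp only [a, dif_neg h]; exact E.refl' x
  have hne : ∀ x y, y ≠ x → E x y → a x ≠ x := by
    intro x y h1 h2
    have h : ∃ y, y ≠ x ∧ E x y := ⟨y, h1, h2⟩
    simp only [a, dif_pos h]; exact h.choose_spec.1
  have hE' : ∀ x y, E x y ↔ y = x ∨ y = a x := by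
    intro x y
    constructor
    · intro h
      by_cases hxy : y = x
      · exact Or.inl hxy
      · rcases hE x y (a x) h (ha x) with h' | h' | h'
        · exact Or.inl h'.symm
        · exact absurd h'.symm (hne x y hxy h)
        · exact Or.inr h'
    · rintro (rfl | rfl)
      · exact E.refl' _
      · exact ha x
  have haa : ∀ x, a (a x) = x := by
    intro x
    by_cases h : a x = x
    · rw [h, h]
    · have h1 : a (a x) ≠ a x := hne (a x) x (Ne.symm h) (E.symm' (ha x))
      rcases hE x (a x) (a (a x)) (ha x) (E.trans' (ha x) (ha _)) with h' | h' | h'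
      · exact absurd h'.symm h
      · exact h'.symm
      · exact absurd h'.symm h1
  exact ⟨⟨a, a, haa, haa⟩, haa, hE'⟩

/-- A path component in the union of two matchings has at most two ends: at most two
elements of a class of `E ⊔ P` are unmatched by `P`. The class of an unmatched `x` is the orbit of
`x` under the permutation `P ∘ E`, and `P` reverses this orbit. -/
theorem Setoid.ends_le_two {α : Type*} {E P : Setoid α}
    (hE : ∀ x y z, E x y → E x z → x = y ∨ x = z ∨ y = z)
    (hP : ∀ x y z, P x y → P x z → x = y ∨ x = z ∨ y = z) {x y z : α}
    (hx : ∀ w, P x w → w = x) (hy : ∀ w, P y w → w = y) (hz : ∀ w, P z w → w = z)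
    (hxy : (E ⊔ P) x y) (hxz : (E ⊔ P) x z) : x = y ∨ x = z ∨ y = z := by
  obtain ⟨a, haa, ha⟩ := Setoid.exists_involution E hE
  obtain ⟨p, hpp, hp⟩ := Setoid.exists_involution P hP
  -- a step along an edge of `E` followed by one along an edge of `P`
  let f : Equiv.Perm α := p * a
  have hpx : p x = x := hx _ ((hp _ _).2 (Or.inr rfl))
  -- `p` conjugates `f` to its inverse, and it fixes `x`, so it reverses the orbit of `x`
  have hpf : ∀ w, p (f w) = f⁻¹ (p w) := by
    intro w
    apply f.injective
    rw [show f (f⁻¹ (p w)) = p w from f.apply_symm_apply _]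
    simp only [f, Equiv.Perm.mul_apply, hpp, haa]
  have hpfi : ∀ w, p (f⁻¹ w) = f (p w) := by
    intro w
    obtain ⟨v, rfl⟩ := f.surjective w
    rw [hpf, show f⁻¹ (f v) = v from f.symm_apply_apply _,
      show f (f⁻¹ (p v)) = p v from f.apply_symm_apply _]
  have hpz : ∀ i : ℤ, p ((f ^ i) x) = (f ^ (-i)) x := by
    intro i
    induction i using Int.induction_on with
    | zero => simpa using hpx
    | succ n ih =>
      rw [zpow_add_one, ← (Commute.refl f).zpow_left n |>.eq.symm, Equiv.Perm.mul_apply, hpf, ih, neg_add,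
        add_comm, zpow_add, Equiv.Perm.mul_apply, zpow_neg_one]
    | pred n ih =>
      have h1 : (f ^ (-(n:ℤ) - 1)) x = f⁻¹ ((f ^ (-(n:ℤ))) x) := by
        rw [sub_eq_add_neg, add_comm, zpow_add, zpow_neg_one, Equiv.Perm.mul_apply]
      rw [h1, hpfi, ih, ← Equiv.Perm.mul_apply, ← zpow_one_add]
      congr 2; ring
  have haf : ∀ w, a w = p (f w) := by
    intro w; simp only [f, Equiv.Perm.mul_apply, hpp]
  have horb : ∀ w, (E ⊔ P) x w → ∃ i : ℤ, w = (f ^ i) x := by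
    intro w hw
    refine Setoid.sup_induction (P := fun w => ∃ i : ℤ, w = (f ^ i) x) ⟨0, by simp⟩ ?_ ?_ hw
    · rintro u v ⟨i, rfl⟩ huv
      rcases (ha _ _).1 huv with rfl | rfl
      · exact ⟨i, rfl⟩
      · refine ⟨-(1 + i), ?_⟩
        rw [haf, ← hpz, zpow_one_add]
        rfl
    · rintro u v ⟨i, rfl⟩ huv
      rcases (hp _ _).1 huv with rfl | rfl
      · exact ⟨i, rfl⟩
      · exact ⟨-i, hpz i⟩
  -- a second unmatched element `f^i x` is fixed by `p`, so that `f^i x = f^(-i) x`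
  have hper : ∀ i : ℤ, (∀ w, P ((f ^ i) x) w → w = (f ^ i) x) → (f ^ (2 * i)) x = x := by
    intro i hi
    have h1 : (f ^ (-i)) x = (f ^ i) x := by
      rw [← hpz]; exact hi _ ((hp _ _).2 (Or.inr rfl))
    rw [two_mul, zpow_add, Equiv.Perm.mul_apply, ← h1, ← Equiv.Perm.mul_apply, ← zpow_add]
    simp
  obtain ⟨i, rfl⟩ := horb y hxy
  obtain ⟨j, rfl⟩ := horb z hxz
  have hfix : ∀ i : ℤ, (f ^ i) x = x ↔ (MulAction.period f x : ℤ) ∣ i := fun i =>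
    MulAction.zpow_smul_eq_iff_period_dvd (g := f) (a := x)
  -- modulo the period `m` of `x`, the exponents `i`, `j` of unmatched elements satisfy `2i = 2j = 0`;
  -- if neither is `0`, both are `m / 2`
  have h2i := (hfix _).1 (hper i hy)
  have h2j := (hfix _).1 (hper j hz)
  by_cases hi : (MulAction.period f x : ℤ) ∣ i
  · exact Or.inl ((hfix i).2 hi).symm
  by_cases hj : (MulAction.period f x : ℤ) ∣ j
  · exact Or.inr (Or.inl ((hfix j).2 hj).symm)
  right; right
  have hij : (MulAction.period f x : ℤ) ∣ i - j := by
    generalize (MulAction.period f x : ℤ) = m at *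
    obtain ⟨u, hu⟩ := h2i
    obtain ⟨v, hv⟩ := h2j
    rcases Int.even_or_odd' u with ⟨u', rfl | rfl⟩
    · exact absurd ⟨u', by linarith⟩ hi
    rcases Int.even_or_odd' v with ⟨v', rfl | rfl⟩
    · exact absurd ⟨v', by linarith⟩ hj
    exact ⟨u' - v', by linarith⟩
  have := (hfix _).2 hij
  rw [sub_eq_neg_add, zpow_add, Equiv.Perm.mul_apply] at this
  have h3 := congrArg (f ^ j) this
  rwa [← Equiv.Perm.mul_apply, ← zpow_add, add_neg_cancel, zpow_zero, Equiv.Perm.one_apply] at h3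

namespace FGraph

variable {α β : Type} {Γ : FGraph α} {S T : Set α}

/-! ### Subgraphs -/

/-- The set contains with a half-edge also its edge. -/
def EdgeClosed (Γ : FGraph α) (S : Set α) : Prop := ∀ x ∈ S, ∀ y, Γ.edge.r x y → y ∈ S

/-- The set contains both or none of the legs of a component of `S` with two legs. -/
def PropClosed (Γ : FGraph α) (S T : Set α) : Prop :=
  ∀ x ∈ T, ∀ y, (Γ.propagatorRel S).r x y → y ∈ T

/-- The half-edges of internal edges. -/
def internals (Γ : FGraph α) : Set α := {x | Γ.IsInternal x}

/-- Half-edges lying in a chain of edges and of components of `S` with two legs. -/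
def chain (Γ : FGraph α) (S : Set α) : Setoid α := Γ.edge ⊔ Γ.propagatorRel S

theorem chain_edge {x y : α} (h : Γ.edge.r x y) : (Γ.chain S).r x y := Setoid.sup_left h

theorem IsSub.edgeClosed (h : Γ.IsSub S) : Γ.EdgeClosed S := fun x hx y hy => (h.1 x hx).2 y hy

theorem IsSub.subset (h : Γ.IsSub S) : S ⊆ Γ.internals := fun x hx => (h.1 x hx).1

theorem EdgeClosed.mem_iff (h : Γ.EdgeClosed S) {x y : α} (hxy : Γ.edge.r x y) : x ∈ S ↔ y ∈ S :=
  ⟨fun hx => h x hx y hxy, fun hy => h y hy x (Γ.edge.symm' hxy)⟩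

theorem propagatorRel_iff {x y : α} : (Γ.propagatorRel S).r x y ↔
    x = y ∨ (x ∉ S ∧ y ∉ S ∧ (Γ.conn S).r x y ∧ Γ.InPropagator S x ∧ Γ.InPropagator S y) := Iff.rfl

theorem propagatorRel_le_conn : Γ.propagatorRel S ≤ Γ.conn S := by
  rintro x y (rfl | ⟨_, _, h, _⟩)
  · exact Setoid.refl' _ _
  · exact h

theorem inPropagator_congr {x y : α} (h : (Γ.conn S).r x y) :
    Γ.InPropagator S x ↔ Γ.InPropagator S y := by
  unfold InPropagator
  have : ∀ z, ((Γ.conn S).r x z ∧ z ∉ S) ↔ ((Γ.conn S).r y z ∧ z ∉ S) := fun z =>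
    ⟨fun h' => ⟨Setoid.trans' _ (Setoid.symm' _ h) h'.1, h'.2⟩,
      fun h' => ⟨Setoid.trans' _ h h'.1, h'.2⟩⟩
  simp only [this]

theorem propagatorRel_le_two {x y z : α} (hy : (Γ.propagatorRel S).r x y)
    (hz : (Γ.propagatorRel S).r x z) : x = y ∨ x = z ∨ y = z := by
  rcases hy with h | ⟨hx, hy, hxy, px, py⟩
  · exact Or.inl h
  rcases hz with h | ⟨-, hz, hxz, -, pz⟩
  · exact Or.inr (Or.inl h)
  exact eq_or_eq_of_card_two px ⟨Setoid.refl' _ _, hx⟩ ⟨hxy, hy⟩ ⟨hxz, hz⟩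

/-- A class of `Γ.conn S` that is not left by the edges in `T` is a class of `Γ.conn T`. -/
theorem conn_of_isolated {x y : α}
    (h : ∀ z w, (Γ.conn S).r x z → z ∈ T → w ∈ T → Γ.edge.r z w → (Γ.conn S).r x w)
    (hxy : (Γ.conn T).r x y) : (Γ.conn S).r x y :=
  Γ.conn_mem (A := {z | (Γ.conn S).r x z}) (fun _ _ hy hyz => Setoid.trans' _ hy (Γ.conn_vert hyz))
    (fun z w hz hzT hwT hzw => h z w hz hzT hwT hzw) hxy
    (show (Γ.conn S).r x x from Setoid.refl' _ x)

theorem EdgeClosed.conn (hS : Γ.EdgeClosed S) {x z w : α} (hz : (Γ.conn S).r x z) (hzS : z ∈ S)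
    (h : Γ.edge.r z w) : (Γ.conn S).r x w :=
  Setoid.trans' _ hz (Γ.conn_edge hzS (hS _ hzS _ h) h)

/-- A component of `S` with two legs, one of which is not in `T`, is a component of `T`. -/
theorem conn_of_notMem (hS : Γ.EdgeClosed S) (hP : Γ.PropClosed S T) {x y : α}
    (hx : x ∉ S) (hxT : x ∉ T) (hp : Γ.InPropagator S x) (h : (Γ.conn T).r x y) :
    (Γ.conn S).r x y := by
  refine conn_of_isolated (fun z w hz hzT _ hzw => ?_) h
  by_cases hzS : z ∈ S
  · exact hS.conn hz hzS hzw
  · exact absurd (hP z hzT x (Or.inr ⟨hzS, hx, Setoid.symm' _ hz,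
      (inPropagator_congr hz).1 hp, hp⟩)) hxT

theorem inPropagator_of_notMem (hS : Γ.EdgeClosed S) (hST : S ⊆ T)
    (hP : Γ.PropClosed S T) {x : α} (hxT : x ∉ T) (hp : Γ.InPropagator S x) :
    Γ.InPropagator T x := by
  have hx : x ∉ S := fun h => hxT (hST h)
  have : ∀ z, ((Γ.conn T).r x z ∧ z ∉ T) ↔ ((Γ.conn S).r x z ∧ z ∉ S) := by
    intro z
    constructor
    · rintro ⟨h1, h2⟩
      exact ⟨conn_of_notMem hS hP hx hxT hp h1, fun h => h2 (hST h)⟩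
    · rintro ⟨h1, h2⟩
      refine ⟨Γ.conn_mono hST h1, fun h3 => hxT (hP z h3 x (Or.inr ⟨h2, hx, Setoid.symm' _ h1,
        (inPropagator_congr h1).1 hp, hp⟩))⟩
  unfold InPropagator at hp ⊢
  simpa only [this] using hp

theorem PropClosed.chain (hT : Γ.EdgeClosed T) (hP : Γ.PropClosed S T) {x y : α}
    (h : (Γ.chain S).r x y) : x ∈ T ↔ y ∈ T :=
  ⟨Setoid.mem_iff_of_sup (fun y z hy => hT y hy z) (fun y z hy => hP y hy z) h,
    Setoid.mem_iff_of_sup (fun y z hy => hT y hy z) (fun y z hy => hP y hy z) (Setoid.symm' _ h)⟩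

theorem propClosed_self : Γ.PropClosed S S := by
  rintro x hx y (rfl | ⟨h, _⟩)
  · exact hx
  · exact absurd hx h

theorem propClosed_univ : Γ.PropClosed S Set.univ := fun _ _ _ _ => trivial

theorem conn_of_chain (hST : S ⊆ T) (hT : Γ.EdgeClosed T) (hP : Γ.PropClosed S T) {x y : α}
    (hx : x ∈ T) (h : (Γ.chain S).r x y) : (Γ.conn T).r x y := by
  refine (Setoid.sup_induction (P := fun z => z ∈ T ∧ (Γ.conn T).r x z) ⟨hx, Setoid.refl' _ _⟩
    ?_ ?_ h).2
  · rintro y z ⟨h1, h2⟩ h3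
    have := hT y h1 z h3
    exact ⟨this, Setoid.trans' _ h2 (Γ.conn_edge h1 this h3)⟩
  · rintro y z ⟨h1, h2⟩ h3
    exact ⟨hP y h1 z h3, Setoid.trans' _ h2 (Γ.conn_mono hST (propagatorRel_le_conn h3))⟩

/-- Connectedness in the contracted graph is connectedness in the graph. -/
theorem contract_conn (hST : S ⊆ T) (hS : Γ.EdgeClosed S) (hT : Γ.EdgeClosed T)
    (hP : Γ.PropClosed S T) :
    (Γ.contract S).conn (Subtype.val ⁻¹' T) = (Γ.conn T).comap Subtype.val := by
  apply le_antisymm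
  · refine sup_le (fun x y h => Γ.conn_mono hST h) ?_
    rintro x y (rfl | ⟨hx, _, h⟩)
    · exact Setoid.refl' _ _
    · exact conn_of_chain hST hT hP hx h
  · intro x y hxy
    let G := Γ.contract S
    let T' : Set {x // x ∉ S ∧ ¬ Γ.InPropagator S x} := Subtype.val ⁻¹' T
    -- along a path in `Γ`, the last half-edge `u` of the contracted graph is remembered
    have key : ∃ u : {x // x ∉ S ∧ ¬ Γ.InPropagator S x}, (G.conn T').r x u ∧
        ((¬ Γ.InPropagator S y.1 ∧ (Γ.conn S).r u.1 y.1) ∨ (Γ.InPropagator S y.1 ∧ ∃ z, z ∉ S ∧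
          (Γ.conn S).r y.1 z ∧ z ∈ T ∧ (Γ.chain S).r u.1 z)) := by
      have hC : ∀ v w, (∃ u : {x // x ∉ S ∧ ¬ Γ.InPropagator S x}, (G.conn T').r x u ∧
          ((¬ Γ.InPropagator S v ∧ (Γ.conn S).r u.1 v) ∨ (Γ.InPropagator S v ∧ ∃ z, z ∉ S ∧
          (Γ.conn S).r v z ∧ z ∈ T ∧ (Γ.chain S).r u.1 z))) → (Γ.conn S).r v w →
          (∃ u : {x // x ∉ S ∧ ¬ Γ.InPropagator S x}, (G.conn T').r x u ∧
          ((¬ Γ.InPropagator S w ∧ (Γ.conn S).r u.1 w) ∨ (Γ.InPropagator S w ∧ ∃ z, z ∉ S ∧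
          (Γ.conn S).r w z ∧ z ∈ T ∧ (Γ.chain S).r u.1 z))) := by
        rintro v w ⟨u, hu, h⟩ hvw
        refine ⟨u, hu, ?_⟩
        rcases h with ⟨h1, h2⟩ | ⟨h1, z, h2, h3, h4, h5⟩
        · exact Or.inl ⟨fun h => h1 ((inPropagator_congr hvw).2 h), Setoid.trans' _ h2 hvw⟩
        · exact Or.inr ⟨(inPropagator_congr hvw).1 h1, z, h2,
            Setoid.trans' _ (Setoid.symm' _ hvw) h3, h4, h5⟩
      refine Setoid.sup_induction (r := Γ.vert) (s := Γ.edgeOn T) (x := x.1)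
        (P := fun v => ∃ u : {x // x ∉ S ∧ ¬ Γ.InPropagator S x}, (G.conn T').r x u ∧
          ((¬ Γ.InPropagator S v ∧ (Γ.conn S).r u.1 v) ∨ (Γ.InPropagator S v ∧ ∃ z, z ∉ S ∧
          (Γ.conn S).r v z ∧ z ∈ T ∧ (Γ.chain S).r u.1 z)))
        ⟨x, Setoid.refl' _ _, Or.inl ⟨x.2.2, Setoid.refl' _ _⟩⟩
        (fun v w hv hvw => hC v w hv (Γ.conn_vert hvw)) ?_ hxy
      rintro v w hv (rfl | ⟨hvT, hwT, hvw⟩)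
      · exact hv
      by_cases hvS : v ∈ S
      · exact hC v w hv (Γ.conn_edge hvS (hS v hvS w hvw) hvw)
      have hwS : w ∉ S := fun h => hvS (hS w h v (Γ.edge.symm' hvw))
      obtain ⟨u, hu, ⟨h1, h2⟩ | ⟨h1, z, h2, h3, h4, h5⟩⟩ := hv
      · have huv : (G.conn T').r x ⟨v, hvS, h1⟩ := Setoid.trans' _ hu (G.conn_vert h2)
        by_cases hw : Γ.InPropagator S w
        · exact ⟨_, huv, Or.inr ⟨hw, w, hwS, Setoid.refl' _ _, hwT, chain_edge hvw⟩⟩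
        · exact ⟨⟨w, hwS, hw⟩, Setoid.trans' _ huv (G.conn_edge hvT hwT (chain_edge hvw)),
            Or.inl ⟨hw, Setoid.refl' _ _⟩⟩
      · have hzv : (Γ.chain S).r z v := Setoid.sup_right
          (Or.inr ⟨h2, hvS, Setoid.symm' _ h3, (inPropagator_congr h3).1 h1, h1⟩)
        have huw : (Γ.chain S).r u.1 w :=
          Setoid.trans' _ (Setoid.trans' _ h5 hzv) (chain_edge hvw)
        by_cases hw : Γ.InPropagator S w
        · exact ⟨u, hu, Or.inr ⟨hw, w, hwS, Setoid.refl' _ _, hwT, huw⟩⟩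
        · exact ⟨⟨w, hwS, hw⟩, Setoid.trans' _ hu
            (G.conn_edge ((hP.chain hT huw).2 hwT) hwT huw), Or.inl ⟨hw, Setoid.refl' _ _⟩⟩
    obtain ⟨u, hu, ⟨_, h2⟩ | ⟨h1, _⟩⟩ := key
    · exact Setoid.trans' _ hu ((Γ.contract S).conn_vert h2)
    · exact absurd h1 y.2.2

theorem contract_conn_rel (hST : S ⊆ T) (hS : Γ.EdgeClosed S) (hT : Γ.EdgeClosed T)
    (hP : Γ.PropClosed S T) (x y : {x // x ∉ S ∧ ¬ Γ.InPropagator S x}) :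
    ((Γ.contract S).conn (Subtype.val ⁻¹' T)).r x y ↔ (Γ.conn T).r x.1 y.1 := by
  rw [contract_conn hST hS hT hP]; rfl

theorem contract_inPropagator (hST : S ⊆ T) (hS : Γ.EdgeClosed S) (hT : Γ.EdgeClosed T)
    (hP : Γ.PropClosed S T) (x : {x // x ∉ S ∧ ¬ Γ.InPropagator S x}) :
    (Γ.contract S).InPropagator (Subtype.val ⁻¹' T) x ↔ Γ.InPropagator T x.1 := by
  have : Nat.card {y : {x // x ∉ S ∧ ¬ Γ.InPropagator S x} //
      (Γ.conn T).r x.1 y.1 ∧ y ∉ (Subtype.val ⁻¹' T : Set {x // x ∉ S ∧ ¬ Γ.InPropagator S x})} =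
      Nat.card {y // (Γ.conn T).r x.1 y ∧ y ∉ T} := by
    refine Nat.card_congr (Equiv.ofBijective (fun y => ⟨y.1.1, y.2⟩) ⟨?_, ?_⟩)
    · intro a b hab
      have hab' := congrArg Subtype.val hab
      exact Subtype.ext (Subtype.ext hab')
    · rintro ⟨y, hxy, hyT⟩
      have hyS : y ∉ S := fun h => hyT (hST h)
      have hy : ¬ Γ.InPropagator S y := fun h => x.2.2 ((inPropagator_congr
        (conn_of_notMem hS hP hyS hyT h (Setoid.symm' _ hxy))).1 h)
      exact ⟨⟨⟨y, hyS, hy⟩, hxy, hyT⟩, rfl⟩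
  refine Eq.congr_left (Eq.trans ?_ this)
  simp only [contract_conn_rel hST hS hT hP]

/-- Contracting in two steps. -/
theorem contract_contract_iso (hST : S ⊆ T) (hS : Γ.EdgeClosed S) (hT : Γ.EdgeClosed T)
    (hP : Γ.PropClosed S T) :
    Nonempty (Iso ((Γ.contract S).contract (Subtype.val ⁻¹' T)) (Γ.contract T)) := by
  have hin := contract_inPropagator hST hS hT hP
  have hconn := contract_conn_rel hST hS hT hP
  let e : {x : {x // x ∉ S ∧ ¬ Γ.InPropagator S x} // x ∉ (Subtype.val ⁻¹' T : Set _) ∧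
      ¬ (Γ.contract S).InPropagator (Subtype.val ⁻¹' T) x} ≃ {x // x ∉ T ∧ ¬ Γ.InPropagator T x} :=
    Equiv.ofBijective (fun x => ⟨x.1.1, x.2.1, fun h => x.2.2 ((hin _).2 h)⟩) ⟨by
      intro a b hab
      have hab' := congrArg Subtype.val hab
      exact Subtype.ext (Subtype.ext hab'), by
      rintro ⟨x, hx1, hx2⟩
      exact ⟨⟨⟨x, fun h => hx1 (hST h), fun h => hx2 (inPropagator_of_notMem hS hST hP hx1 h)⟩, hx1,
        fun h => hx2 ((hin _).1 h)⟩, rfl⟩⟩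
  refine ⟨Iso.ofEq e (ext' ?_ ?_)⟩
  · exact Setoid.ext fun x y => hconn x.1 y.1
  -- the part of the propagator relation of `T` that survives in the contracted graph
  let s : Setoid α := { 
    r := fun x y => x = y ∨ ((x ∉ S ∧ ¬ Γ.InPropagator S x) ∧ (y ∉ S ∧ ¬ Γ.InPropagator S y) ∧
      (Γ.propagatorRel T).r x y)
    iseqv :=
    { refl := fun _ => Or.inl rfl
      symm := by
        rintro x y (h | ⟨hx, hy, h⟩)
        · exact Or.inl h.symm
        · exact Or.inr ⟨hy, hx, Setoid.symm' _ h⟩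
      trans := by
        rintro x y z (rfl | ⟨hx, hy, h⟩) (rfl | ⟨hy', hz, h'⟩)
        · exact Or.inl rfl
        · exact Or.inr ⟨hy', hz, h'⟩
        · exact Or.inr ⟨hx, hy, h⟩
        · exact Or.inr ⟨hx, hz, Setoid.trans' _ h h'⟩ } }
  have hs : (Γ.contract S).propagatorRel (Subtype.val ⁻¹' T) = s.comap Subtype.val := by
    refine Setoid.ext fun x y => ?_
    change (x = y ∨ _) ↔ (x.1 = y.1 ∨ _)
    rw [hin, hin, hconn, propagatorRel_iff]
    constructor
    · rintro (rfl | h)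
      · exact Or.inl rfl
      · exact Or.inr ⟨x.2, y.2, Or.inr h⟩
    · rintro (h | ⟨_, _, h | h⟩)
      · exact Or.inl (Subtype.ext h)
      · exact Or.inl (Subtype.ext h)
      · exact Or.inr h
  have h1 : (Γ.contract S).edge ⊔ (Γ.contract S).propagatorRel (Subtype.val ⁻¹' T) =
      (Γ.chain S ⊔ s).comap Subtype.val := by
    rw [hs, Setoid.comap_sup_of_supported Subtype.val (Γ.chain S) s]
    · rfl
    · rintro x y (h | ⟨hx, hy, -⟩)
      · exact Or.inl h
      · exact Or.inr ⟨⟨⟨x, hx⟩, rfl⟩, ⟨⟨y, hy⟩, rfl⟩⟩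
  refine Setoid.ext fun x y => ?_
  change ((Γ.contract S).edge ⊔ (Γ.contract S).propagatorRel (Subtype.val ⁻¹' T)).r x.1 y.1 ↔
    (Γ.chain T).r x.1.1 y.1.1
  rw [h1]
  constructor
  · intro h
    have h' : (Γ.chain S ⊔ s).r x.1.1 y.1.1 := h
    -- outside `T` every step is a step of the chain relation of `T`
    have hch : ∀ v w, v ∉ T → (Γ.chain S).r v w → w ∉ T ∧ (Γ.chain T).r v w := by
      intro v w hv hvw
      refine Setoid.sup_induction (P := fun w => w ∉ T ∧ (Γ.chain T).r v w)
        ⟨hv, Setoid.refl' _ _⟩ ?_ ?_ hvw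
      · rintro y z ⟨h1, h2⟩ h3
        exact ⟨fun h => h1 ((hT.mem_iff h3).2 h), Setoid.trans' _ h2 (chain_edge h3)⟩
      · rintro y z ⟨h1, h2⟩ (rfl | h3)
        · exact ⟨h1, h2⟩
        have hz : z ∉ T := fun h => h1 (hP z h y (Setoid.symm' _ (Or.inr h3)))
        refine ⟨hz, Setoid.trans' _ h2 (Setoid.sup_right (Or.inr ⟨h1, hz, ?_, ?_, ?_⟩))⟩
        · exact Γ.conn_mono hST h3.2.2.1
        · exact inPropagator_of_notMem hS hST hP h1 h3.2.2.2.1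
        · exact inPropagator_of_notMem hS hST hP hz h3.2.2.2.2
    refine (Setoid.sup_induction (P := fun w => w ∉ T ∧ (Γ.chain T).r x.1.1 w)
        ⟨x.2.1, Setoid.refl' _ _⟩ ?_ ?_ h').2
    · rintro y z ⟨h1, h2⟩ h3
      obtain ⟨h4, h5⟩ := hch _ _ h1 h3
      exact ⟨h4, Setoid.trans' _ h2 h5⟩
    · rintro y z ⟨h1, h2⟩ (rfl | ⟨-, -, h3⟩)
      · exact ⟨h1, h2⟩
      · refine ⟨?_, Setoid.trans' _ h2 (Setoid.sup_right h3)⟩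
        rcases h3 with rfl | h3
        · exact h1
        · exact h3.2.1
  · intro h
    change (Γ.chain S ⊔ s).r x.1.1 y.1.1
    have hle : Γ.chain T ≤ Γ.chain S ⊔ s := by
      refine sup_le (fun _ _ h => Setoid.sup_left (chain_edge h)) ?_
      rintro v w hvw
      by_cases hvw' : v = w
      · subst hvw'; exact Setoid.refl' _ _
      obtain ⟨hv, hw, hc, pv, pw⟩ := hvw.resolve_left hvw'
      have hvS : v ∉ S := fun h => hv (hST h)
      have hwS : w ∉ S := fun h => hw (hST h)
      by_cases qv : Γ.InPropagator S v
      · have := conn_of_notMem hS hP hvS hv qv hc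
        exact Setoid.sup_left (Setoid.sup_right
          (Or.inr ⟨hvS, hwS, this, qv, (inPropagator_congr this).1 qv⟩))
      by_cases qw : Γ.InPropagator S w
      · have := conn_of_notMem hS hP hwS hw qw (Setoid.symm' _ hc)
        exact Setoid.sup_left (Setoid.sup_right
          (Or.inr ⟨hvS, hwS, Setoid.symm' _ this, (inPropagator_congr this).1 qw, qw⟩))
      · exact Setoid.sup_right (Or.inr ⟨⟨hvS, qv⟩, ⟨hwS, qw⟩, hvw⟩)
    exact hle h

end FGraph



namespace FGraph

variable {α β : Type} {Γ : FGraph α} {S T : Set α}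

/-! ### Contraction of subgraphs of one-particle irreducible graphs -/

theorem IsFeynman.internals_edgeClosed : Γ.EdgeClosed Γ.internals := by
  rintro x ⟨y, hy, hxy⟩ z hxz
  by_cases h : z = x
  · rw [h]; exact ⟨y, hy, hxy⟩
  · exact ⟨x, fun e => h e.symm, Γ.edge.symm' hxz⟩

theorem isLeg_eq {x y : α} (hx : Γ.IsLeg x) (h : Γ.edge.r x y) : y = x := by
  by_contra hne; exact hx ⟨y, hne, h⟩

theorem conn_inter_internals (S : Set α) : Γ.conn (S ∩ Γ.internals) = Γ.conn S := by
  apply le_antisymm (Γ.conn_mono Set.inter_subset_left)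
  refine sup_le (fun _ _ h => Γ.conn_vert h) ?_
  rintro x y (rfl | ⟨hx, hy, h⟩)
  · exact Setoid.refl' _ _
  · by_cases hxy : x = y
    · subst hxy; exact Setoid.refl' _ _
    · exact Γ.conn_edge ⟨hx, ⟨y, Ne.symm hxy, h⟩⟩ ⟨hy, ⟨x, hxy, Γ.edge.symm' h⟩⟩ h

theorem isSub_empty : Γ.IsSub ∅ := ⟨fun _ h => absurd h (Set.notMem_empty _),
  fun _ h => absurd h (Set.notMem_empty _)⟩

theorem IsFeynman.isSub_internals (h : Γ.IsFeynman) : Γ.IsSub Γ.internals := by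
  refine ⟨fun x hx => ⟨hx, IsFeynman.internals_edgeClosed x hx⟩, fun x hx y hy hne hxy => ?_⟩
  have := h.irreducible x y hne hxy
  rw [← conn_inter_internals] at this
  rwa [Set.sdiff_eq, Set.inter_comm]

theorem IsFeynman.exists_leg (h : Γ.IsFeynman) : ∃ x, Γ.IsLeg x := by
  by_contra hc
  have h2 := h.two_le_legs
  have : IsEmpty {x // Γ.IsLeg x} := ⟨fun x => hc ⟨x.1, x.2⟩⟩
  rw [numLegs, Nat.card_of_isEmpty] at h2
  omega

theorem two_of_inPropagator {x y z : α} (hp : Γ.InPropagator S x) (hx : x ∉ S)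
    (hy : (Γ.conn S).r x y) (hyS : y ∉ S) (hxy : x ≠ y) (hz : (Γ.conn S).r x z) (hzS : z ∉ S) :
    z = x ∨ z = y := by
  rcases eq_or_eq_of_card_two hp ⟨Setoid.refl' _ x, hx⟩ ⟨hy, hyS⟩ ⟨hz, hzS⟩ with h | h | h
  · exact absurd h hxy
  · exact Or.inl h.symm
  · exact Or.inr h.symm

/-- A subgraph contains both or none of the legs of a component with two legs: otherwise the
only leg that it contains would be a bridge. -/
theorem IsSub.propClosed (hT : Γ.IsSub T) (hS : Γ.EdgeClosed S) : Γ.PropClosed S T := by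
  intro x hx y hxy
  by_cases hne : x = y
  · exact hne ▸ hx
  obtain ⟨hxS, hyS, hc, px, -⟩ := hxy.resolve_left hne
  by_contra hy
  obtain ⟨x', hx', hxx'⟩ := (hT.1 x hx).1
  have hx'S : x' ∉ S := fun h => hxS ((hS.mem_iff hxx').2 h)
  have h1 : (Γ.conn S).r x x' := by
    refine conn_of_isolated (fun z w hz hzT _ hzw => ?_)
      (hT.2 x hx x' ((hT.1 x hx).2 _ hxx') (Ne.symm hx') hxx')
    by_cases hzS : z ∈ S
    · exact hS.conn hz hzS hzw
    · rcases two_of_inPropagator px hxS hc hyS hne hz hzS with rfl | rfl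
      · exact absurd (Or.inl rfl) hzT.2
      · exact absurd hzT.1 hy
  rcases two_of_inPropagator px hxS hc hyS hne h1 hx'S with rfl | rfl
  · exact hx' rfl
  · exact hy ((hT.1 x hx).2 _ hxx')

/-- An external leg of the graph is a leg of a component with two legs only if this component is
the whole graph. -/
theorem IsFeynman.eq_internals_of_leg (h : Γ.IsFeynman) (hS : Γ.IsSub S) {x : α} (hx : Γ.IsLeg x)
    (hp : Γ.InPropagator S x) : S = Γ.internals := by
  have hSe := hS.edgeClosed
  have hxS : x ∉ S := fun h => hx (hS.1 x h).1
  obtain ⟨y, ⟨hc, hyS⟩, hne⟩ := exists_ne_of_card_two hp x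
  -- `x` and `y` are the two legs of the component
  have h2 : ∀ z, (Γ.conn S).r x z → z ∉ S → z = x ∨ z = y := fun z =>
    two_of_inPropagator hp hxS hc hyS hne.symm
  -- if `y` lay on an internal edge, this edge would be a bridge: it is the only way out of the
  -- component, as `x` is an external leg of the whole graph
  by_cases hy : Γ.IsInternal y
  · exfalso
    obtain ⟨y', hy', hyy'⟩ := hy
    have hy'S : y' ∉ S := fun h => hyS ((hSe.mem_iff hyy').2 h)
    have h1 : (Γ.conn S).r x y' := by
      refine Setoid.trans' _ hc (conn_of_isolated (fun z w hz hzT _ hzw => ?_)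
        (h.irreducible y y' hy'.symm hyy'))
      by_cases hzS : z ∈ S
      · exact hSe.conn hz hzS hzw
      rcases h2 z (Setoid.trans' _ hc hz) hzS with rfl | rfl
      · rw [isLeg_eq hx hzw]; exact hz
      · exact absurd (Or.inl rfl) hzT
    rcases h2 _ h1 hy'S with rfl | rfl
    · exact hx ⟨y, Ne.symm hy', Γ.edge.symm' hyy'⟩
    · exact hy' rfl
  -- otherwise nothing leads out of the component, which therefore is the whole graph
  · have hall : ∀ z, (Γ.conn S).r x z := by
      intro z
      refine conn_of_isolated (fun z w hz _ _ hzw => ?_) (h.connected x z)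
      by_cases hzS : z ∈ S
      · exact hSe.conn hz hzS hzw
      rcases h2 z hz hzS with rfl | rfl
      · rw [isLeg_eq hx hzw]
      · rw [isLeg_eq hy hzw]; exact hz
    refine Set.Subset.antisymm hS.subset fun z hz => ?_
    by_contra hzS
    rcases h2 z (hall z) hzS with rfl | rfl
    · exact hx hz
    · exact hy hz

/-- Every component of a subgraph has at least two legs. -/
theorem IsFeynman.two_le_card_legs [Finite α] (h : Γ.IsFeynman) (hS : Γ.IsSub S) (x : α) :
    2 ≤ Nat.card {y // (Γ.conn S).r x y ∧ y ∉ S} := by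
  have hSe := hS.edgeClosed
  by_contra hlt
  have hsub : ∀ y z, (Γ.conn S).r x y → y ∉ S → (Γ.conn S).r x z → z ∉ S → y = z := by
    intro y z h1 h2 h3 h4
    have : Subsingleton {y // (Γ.conn S).r x y ∧ y ∉ S} :=
      (Finite.card_le_one_iff_subsingleton).1 (by omega)
    exact congrArg Subtype.val (Subsingleton.elim (⟨y, h1, h2⟩ : {y // (Γ.conn S).r x y ∧ y ∉ S})
      ⟨z, h3, h4⟩)
  have hlegs : ∃ y z, Γ.IsLeg y ∧ Γ.IsLeg z ∧ y ≠ z := by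
    have := h.two_le_legs
    rw [numLegs] at this
    obtain ⟨y, z, hne⟩ := (Finite.one_lt_card_iff_nontrivial.1 this).exists_pair_ne
    exact ⟨y.1, z.1, y.2, z.2, fun e => hne (Subtype.ext e)⟩
  have hlS : ∀ y, Γ.IsLeg y → y ∉ S := fun y hy h => hy (hS.1 y h).1
  -- if the component has a single leg and this leg is internal in the graph, its edge is a bridge
  by_cases hz : ∃ z, (Γ.conn S).r x z ∧ z ∉ S ∧ Γ.IsInternal z
  · obtain ⟨z, hxz, hzS, z', hz', hzz'⟩ := hz
    have hz'S : z' ∉ S := fun h => hzS ((hSe.mem_iff hzz').2 h)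
    have h1 : (Γ.conn S).r z z' := by
      refine conn_of_isolated (fun v w hv hvT _ hvw => ?_) (h.irreducible z z' hz'.symm hzz')
      by_cases hvS : v ∈ S
      · exact hSe.conn hv hvS hvw
      · exact absurd (Or.inl (hsub v z (Setoid.trans' _ hxz hv) hvS hxz hzS)) hvT
    exact hz' (hsub _ _ (Setoid.trans' _ hxz h1) hz'S hxz hzS)
  -- otherwise the component is the whole graph, which has two external legs
  · have hall : ∀ z, (Γ.conn S).r x z := by
      intro z
      refine conn_of_isolated (fun v w hv _ _ hvw => ?_) (h.connected x z)
      by_cases hvS : v ∈ S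
      · exact hSe.conn hv hvS hvw
      · have : Γ.IsLeg v := fun h => hz ⟨v, hv, hvS, h⟩
        rw [isLeg_eq this hvw]; exact hv
    obtain ⟨y, z, hy, hz, hne⟩ := hlegs
    exact hne (hsub y z (hall y) (hlS y hy) (hall z) (hlS z hz))

theorem chain_ends (h : Γ.IsFeynman) {x y z : α} (hx : ¬ Γ.InPropagator S x)
    (hy : ¬ Γ.InPropagator S y) (hz : ¬ Γ.InPropagator S z) (hxy : (Γ.chain S).r x y)
    (hxz : (Γ.chain S).r x z) : x = y ∨ x = z ∨ y = z := by
  have key : ∀ x, ¬ Γ.InPropagator S x → ∀ w, (Γ.propagatorRel S).r x w → w = x := by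
    rintro x hx w (rfl | ⟨_, _, _, hp, _⟩)
    · rfl
    · exact absurd hp hx
  exact Setoid.ends_le_two h.edge_le_two (fun _ _ _ => propagatorRel_le_two) (key x hx) (key y hy)
    (key z hz) hxy hxz

theorem chain_notMem (hS : Γ.EdgeClosed S) {x y : α} (hx : x ∉ S) (h : (Γ.chain S).r x y) :
    y ∉ S := fun hy => hx ((propClosed_self.chain hS h).2 hy)

/-- Passing through a component with two legs along a chain. -/
theorem chain_pass {x z w : α} (hxS : (Γ.chain S).r x w) (hw : w ∉ S) (hz : z ∉ S)
    (hp : Γ.InPropagator S z) (h : (Γ.conn S).r z w) : (Γ.chain S).r x z :=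
  Setoid.trans' _ hxS (Setoid.sup_right (Or.inr ⟨hw, hz, Setoid.symm' _ h,
    (inPropagator_congr h).1 hp, hp⟩))

/-- A half-edge of the contracted graph is internal if it is internal in the graph: the chain
that starts with an internal edge cannot end inside a component, since its first edge would
be a bridge. -/
theorem IsFeynman.contract_isInternal (h : Γ.IsFeynman) (hS : Γ.IsSub S)
    (u : {x // x ∉ S ∧ ¬ Γ.InPropagator S x}) :
    (Γ.contract S).IsInternal u ↔ Γ.IsInternal u.1 := by
  have hSe := hS.edgeClosed
  constructor
  · rintro ⟨v, hv, huv⟩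
    by_contra hu
    refine hv (Subtype.ext ?_)
    refine Setoid.sup_induction (P := fun w => w = u.1) rfl ?_ ?_ huv
    · rintro y z rfl hyz; exact isLeg_eq hu hyz
    · rintro y z rfl (h | ⟨_, _, _, hp, _⟩)
      · exact h.symm
      · exact absurd hp u.2.2
  · intro hu
    by_contra hc
    -- if `u` is not internal after the contraction, all other elements of its chain lie in components
    -- with two legs
    have hend : ∀ v, v ∉ S → (Γ.chain S).r u.1 v → v ≠ u.1 → Γ.InPropagator S v := by
      intro v hv huv hne
      by_contra hp
      exact hc ⟨⟨v, hv, hp⟩, fun e => hne (congrArg Subtype.val e), huv⟩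
    obtain ⟨u1, hu1, huu1⟩ := hu
    have hu1S : u1 ∉ S := fun h => u.2.1 ((hSe.mem_iff huu1).2 h)
    -- the union of the components that the chain passes through is left only by the first edge of the
    -- chain, but by irreducibility it cannot be separated from `u` by cutting that edge
    have hmem := Γ.conn_mem (S := {u1, u.1}ᶜ) (A := {v | Γ.InPropagator S v ∧ ∃ w, w ∉ S ∧
        (Γ.conn S).r v w ∧ (Γ.chain S).r u.1 w})
      (by
        rintro v w ⟨hp, z, h1, h2, h3⟩ hvw
        have hvw' : (Γ.conn S).r v w := Γ.conn_vert hvw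
        exact ⟨(inPropagator_congr hvw').1 hp, z, h1, Setoid.trans' _ (Setoid.symm' _ hvw') h2, h3⟩)
      (by
        rintro v w ⟨hp, z, h1, h2, h3⟩ hv hw hvw
        by_cases hvS : v ∈ S
        · have hvw' : (Γ.conn S).r v w := Γ.conn_edge hvS (hSe _ hvS _ hvw) hvw
          exact ⟨(inPropagator_congr hvw').1 hp, z, h1,
            Setoid.trans' _ (Setoid.symm' _ hvw') h2, h3⟩
        · have huw : (Γ.chain S).r u.1 w :=
            Setoid.trans' _ (chain_pass h3 h1 hvS hp h2) (chain_edge hvw)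
          have hwS := chain_notMem hSe u.2.1 huw
          exact ⟨hend w hwS huw fun e => hw (Or.inr e), w, hwS, Setoid.refl' _ _, huw⟩)
      (h.irreducible u1 u.1 hu1 (Γ.edge.symm' huu1))
      ⟨hend u1 hu1S (chain_edge huu1) hu1, u1, hu1S, Setoid.refl' _ _, chain_edge huu1⟩
    exact u.2.2 hmem.1

/-- Every chain ends in the contracted graph. -/
theorem IsFeynman.exists_chain_end (h : Γ.IsFeynman) (hS : Γ.IsSub S) (hne : S ≠ Γ.internals)
    {z : α} (hz : z ∉ S) : ∃ u : {x // x ∉ S ∧ ¬ Γ.InPropagator S x}, (Γ.chain S).r z u.1 := by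
  have hSe := hS.edgeClosed
  by_contra hc
  have hend : ∀ v, v ∉ S → (Γ.chain S).r z v → Γ.InPropagator S v := by
    intro v hv hzv
    by_contra hp
    exact hc ⟨⟨v, hv, hp⟩, hzv⟩
  obtain ⟨x, hx⟩ := h.exists_leg
  -- the components that an endless chain passes through form a union of components of the graph, so
  -- they contain an external leg
  have hmem := Γ.conn_mem (S := Set.univ) (A := {v | Γ.InPropagator S v ∧ ∃ w, w ∉ S ∧
      (Γ.conn S).r v w ∧ (Γ.chain S).r z w})
    (by
      rintro v w ⟨hp, z, h1, h2, h3⟩ hvw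
      have hvw' : (Γ.conn S).r v w := Γ.conn_vert hvw
      exact ⟨(inPropagator_congr hvw').1 hp, z, h1, Setoid.trans' _ (Setoid.symm' _ hvw') h2, h3⟩)
    (by
      rintro v w ⟨hp, z', h1, h2, h3⟩ _ _ hvw
      by_cases hvS : v ∈ S
      · have hvw' : (Γ.conn S).r v w := Γ.conn_edge hvS (hSe _ hvS _ hvw) hvw
        exact ⟨(inPropagator_congr hvw').1 hp, z', h1,
          Setoid.trans' _ (Setoid.symm' _ hvw') h2, h3⟩
      · have huw : (Γ.chain S).r z w :=
          Setoid.trans' _ (chain_pass h3 h1 hvS hp h2) (chain_edge hvw)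
        have hwS := chain_notMem hSe hz huw
        exact ⟨hend w hwS huw, w, hwS, Setoid.refl' _ _, huw⟩)
    (h.connected z x)
    ⟨hend z hz (Setoid.refl' _ _), z, hz, Setoid.refl' _ _, Setoid.refl' _ _⟩
  exact hne (h.eq_internals_of_leg hS hx hmem.1)

/-- The set of half-edges of a chain is removed from `T`. -/
theorem preimage_diff_chain (h : Γ.IsFeynman) {x y : {x // x ∉ S ∧ ¬ Γ.InPropagator S x}}
    (hxy : (Γ.chain S).r x.1 y.1) (hne : x ≠ y) :
    (Subtype.val ⁻¹' (T \ {z | (Γ.chain S).r x.1 z}) : Set {x // x ∉ S ∧ ¬ Γ.InPropagator S x}) =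
      (Subtype.val ⁻¹' T) \ {x, y} := by
  ext z
  constructor
  · rintro ⟨h1, h2⟩
    refine ⟨h1, ?_⟩
    rintro (rfl | rfl)
    · exact h2 (show (Γ.chain S).r z.1 z.1 from Setoid.refl' _ _)
    · exact h2 hxy
  · rintro ⟨h1, h2⟩
    refine ⟨h1, fun h3 => h2 ?_⟩
    rcases chain_ends h x.2.2 y.2.2 z.2.2 hxy h3 with h4 | h4 | h4
    · exact absurd (Subtype.ext h4) hne
    · exact Or.inl (Subtype.ext h4.symm)
    · exact Or.inr (Subtype.ext h4.symm)

theorem diff_chain_closed (hST : S ⊆ T) (hS : Γ.EdgeClosed S) (hT : Γ.EdgeClosed T)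
    (hP : Γ.PropClosed S T) {x : α} (hx : x ∉ S) :
    S ⊆ T \ {z | (Γ.chain S).r x z} ∧ Γ.EdgeClosed (T \ {z | (Γ.chain S).r x z}) ∧
      Γ.PropClosed S (T \ {z | (Γ.chain S).r x z}) := by
  refine ⟨fun z hz => ⟨hST hz, fun h => chain_notMem hS hx h hz⟩, ?_, ?_⟩
  · rintro z ⟨h1, h2⟩ w hzw
    exact ⟨hT z h1 w hzw, fun h => h2 (Setoid.trans' _ h (chain_edge (Γ.edge.symm' hzw)))⟩
  · rintro z ⟨h1, h2⟩ w hzw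
    exact ⟨hP z h1 w hzw, fun h => h2 (Setoid.trans' _ h (Setoid.sup_right (Setoid.symm' _ hzw)))⟩

theorem contract_conn_chain (h : Γ.IsFeynman) (hST : S ⊆ T) (hS : Γ.EdgeClosed S)
    (hT : Γ.EdgeClosed T) (hP : Γ.PropClosed S T) {x y : {x // x ∉ S ∧ ¬ Γ.InPropagator S x}}
    (hxy : (Γ.chain S).r x.1 y.1) (hne : x ≠ y) :
    ((Γ.contract S).conn ((Subtype.val ⁻¹' T) \ {x, y})).r x y ↔
      (Γ.conn (T \ {z | (Γ.chain S).r x.1 z})).r x.1 y.1 := by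
  obtain ⟨h1, h2, h3⟩ := diff_chain_closed hST hS hT hP x.2.1
  rw [← preimage_diff_chain h hxy hne, contract_conn_rel h1 hS h2 h3]

/-- The image of a subgraph in the contracted graph is a subgraph. -/
theorem IsFeynman.isSub_contract (h : Γ.IsFeynman) (hS : Γ.IsSub S) (hT : Γ.IsSub T)
    (hST : S ⊆ T) : (Γ.contract S).IsSub (Subtype.val ⁻¹' T) := by
  have hSe := hS.edgeClosed
  have hTe := hT.edgeClosed
  have hP := hT.propClosed hSe
  refine ⟨fun x hx => ⟨(h.contract_isInternal hS x).2 (hT.1 _ hx).1, fun y hy => ?_⟩,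
    fun x hx y hy hne hxy => ?_⟩
  · exact (hP.chain hTe hy).1 hx
  rw [contract_conn_chain h hST hSe hTe hP hxy hne]
  -- the first edge of the chain from `x` to `y` is `{x, x1}`; a path from `x1` to `x` in `T` without this
  -- edge can only get away from the chain through its other end `y`
  obtain ⟨x1, hx1, hxx1⟩ := (hT.1 _ hx).1
  have hx1S : x1 ∉ S := fun h => x.2.1 ((hSe.mem_iff hxx1).2 h)
  set Ch := {z | (Γ.chain S).r x.1 z} with hCh
  have hend : ∀ w, (Γ.chain S).r x.1 w → w ≠ x.1 →
      (Γ.InPropagator S w ∧ ∃ v, v ∉ S ∧ (Γ.conn S).r w v ∧ (Γ.chain S).r x.1 v) ∨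
        (Γ.conn (T \ Ch)).r y.1 w := by
    intro w hw hwx
    have hwS := chain_notMem hSe x.2.1 hw
    by_cases hp : Γ.InPropagator S w
    · exact Or.inl ⟨hp, w, hwS, Setoid.refl' _ _, hw⟩
    · rcases chain_ends h x.2.2 y.2.2 hp hxy hw with h1 | h1 | h1
      · exact absurd (Subtype.ext h1) hne
      · exact absurd h1.symm hwx
      · right; rw [h1]
  have hvert : ∀ v w, (Γ.conn S).r v w → ((Γ.InPropagator S v ∧ ∃ z, z ∉ S ∧ (Γ.conn S).r v z ∧
      (Γ.chain S).r x.1 z)) → ((Γ.InPropagator S w ∧ ∃ z, z ∉ S ∧ (Γ.conn S).r w z ∧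
      (Γ.chain S).r x.1 z)) := by
    rintro v w hvw ⟨hp, z, h1, h2, h3⟩
    exact ⟨(inPropagator_congr hvw).1 hp, z, h1, Setoid.trans' _ (Setoid.symm' _ hvw) h2, h3⟩
  have hmem := Γ.conn_mem (S := T \ {x1, x.1}) (A := {w | (Γ.InPropagator S w ∧ ∃ v, v ∉ S ∧
      (Γ.conn S).r w v ∧ (Γ.chain S).r x.1 v) ∨ (Γ.conn (T \ Ch)).r y.1 w})
    (by
      rintro v w (hv | hv) hvw
      · exact Or.inl (hvert v w (Γ.conn_vert hvw) hv)
      · exact Or.inr (Setoid.trans' _ hv (Γ.conn_vert hvw)))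
    (by
      rintro v w hA hv hw hvw
      have hwx : w ≠ x.1 := fun e => hw.2 (Or.inr e)
      by_cases hch : (Γ.chain S).r x.1 v
      · exact hend w (Setoid.trans' _ hch (chain_edge hvw)) hwx
      rcases hA with hA | hA
      · by_cases hvS : v ∈ S
        · exact Or.inl (hvert v w (Γ.conn_edge hvS (hSe _ hvS _ hvw) hvw) hA)
        · obtain ⟨hp, z, h1, h2, h3⟩ := hA
          exact absurd (chain_pass h3 h1 hvS hp h2) hch
      · refine Or.inr (Setoid.trans' _ hA (Γ.conn_edge ⟨hv.1, hch⟩ ⟨hw.1, fun h => hch ?_⟩ hvw))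
        exact Setoid.trans' _ h (chain_edge (Γ.edge.symm' hvw)))
    (hT.2 x1 ((hT.1 _ hx).2 _ hxx1) x.1 hx hx1 (Γ.edge.symm' hxx1))
    (hend x1 (chain_edge hxx1) hx1)
  rcases hmem with hmem | hmem
  · exact absurd hmem.1 x.2.2
  · exact Setoid.symm' _ hmem

/-- A set of half-edges whose image in the contracted graph is a subgraph is a subgraph. -/
theorem IsFeynman.isSub_of_contract (h : Γ.IsFeynman) (hS : Γ.IsSub S) (hne : S ≠ Γ.internals)
    (hST : S ⊆ T) (hTi : T ⊆ Γ.internals) (hTe : Γ.EdgeClosed T) (hP : Γ.PropClosed S T)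
    (hT' : (Γ.contract S).IsSub (Subtype.val ⁻¹' T)) : Γ.IsSub T := by
  have hSe := hS.edgeClosed
  refine ⟨fun x hx => ⟨hTi hx, hTe x hx⟩, fun z hz z' hz' hzz' hed => ?_⟩
  by_cases hzS : z ∈ S
  · exact Γ.conn_mono (Set.sdiff_subset_sdiff_left hST) (hS.2 z hzS z' (hSe _ hzS _ hed) hzz' hed)
  obtain ⟨x, hzx⟩ := h.exists_chain_end hS hne hzS
  have hxT : x.1 ∈ T := (hP.chain hTe hzx).1 hz
  obtain ⟨y, hyx, hxy⟩ := (h.contract_isInternal hS x).2 (hTi hxT)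
  have hxy' : (Γ.chain S).r x.1 y.1 := hxy
  have hyT : y.1 ∈ T := (hP.chain hTe hxy').1 hxT
  have hconn := (contract_conn_chain h hST hSe hTe hP hxy' hyx.symm).1
    (hT'.2 x hxT y hyT hyx.symm hxy)
  by_contra hQ
  -- if the edge is a bridge, both ends of its chain lie on the side of `z`; the components of
  -- the chain on the side of `z'` then cannot be left
  have key : ∀ z z', z ∈ T → z ∉ S → Γ.edge.r z z' → z ≠ z' → (Γ.chain S).r z x.1 →
      ¬ (Γ.conn (T \ {z, z'})).r z z' → (Γ.conn (T \ {z, z'})).r z' x.1 := by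
    intro z z' hz hzS hed hzz' hzx hQ
    by_contra hx
    have hSQ : S ⊆ T \ {z, z'} := by
      intro v hv
      refine ⟨hST hv, ?_⟩
      rintro (rfl | rfl)
      · exact hzS hv
      · exact hzS ((hSe.mem_iff hed).2 hv)
    have hchQ : ∀ v, (Γ.chain S).r z x.1 → v ∈ T \ {v | (Γ.chain S).r x.1 v} → v ∈ T \ {z, z'} := by
      rintro v _ ⟨h1, h2⟩
      refine ⟨h1, ?_⟩
      rintro (rfl | rfl)
      · exact h2 (Setoid.symm' _ hzx)
      · exact h2 (Setoid.trans' _ (Setoid.symm' _ hzx) (chain_edge hed))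
    have hxyQ : (Γ.conn (T \ {z, z'})).r x.1 y.1 := Γ.conn_mono (fun v => hchQ v hzx) hconn
    have hy : ¬ (Γ.conn (T \ {z, z'})).r z' y.1 := fun h =>
      hx (Setoid.trans' _ h (Setoid.symm' _ hxyQ))
    have hend : ∀ w, (Γ.chain S).r x.1 w → (Γ.conn (T \ {z, z'})).r z' w →
        Γ.InPropagator S w := by
      intro w hw hzw
      by_contra hp
      rcases chain_ends h x.2.2 y.2.2 hp hxy' hw with h1 | h1 | h1
      · exact hyx (Subtype.ext h1.symm)
      · exact hx (h1 ▸ hzw)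
      · exact hy (h1 ▸ hzw)
    have hz'ch : (Γ.chain S).r x.1 z' := Setoid.trans' _ (Setoid.symm' _ hzx) (chain_edge hed)
    have hmem := Γ.conn_mem (S := {z', z}ᶜ) (A := {v | Γ.InPropagator S v ∧
        (Γ.conn (T \ {z, z'})).r z' v ∧ ∃ w, w ∉ S ∧ (Γ.conn S).r v w ∧ (Γ.chain S).r x.1 w})
      (by
        rintro v w ⟨hp, hq, u, h1, h2, h3⟩ hvw
        have hvw' : (Γ.conn S).r v w := Γ.conn_vert hvw
        exact ⟨(inPropagator_congr hvw').1 hp, Setoid.trans' _ hq (Γ.conn_vert hvw), u, h1,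
          Setoid.trans' _ (Setoid.symm' _ hvw') h2, h3⟩)
      (by
        rintro v w ⟨hp, hq, u, h1, h2, h3⟩ hv hw hvw
        by_cases hvS : v ∈ S
        · have hvw' : (Γ.conn S).r v w := Γ.conn_edge hvS (hSe _ hvS _ hvw) hvw
          exact ⟨(inPropagator_congr hvw').1 hp, Setoid.trans' _ hq (Γ.conn_mono hSQ hvw'), u, h1,
            Setoid.trans' _ (Setoid.symm' _ hvw') h2, h3⟩
        · have hxv := chain_pass h3 h1 hvS hp h2
          have hxw := Setoid.trans' _ hxv (chain_edge hvw)
          have hvT : v ∈ T := (hP.chain hTe hxv).1 hxT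
          have hwT : w ∈ T := (hP.chain hTe hxw).1 hxT
          have hzw : (Γ.conn (T \ {z, z'})).r z' w := by
            refine Setoid.trans' _ hq (Γ.conn_edge ⟨hvT, ?_⟩ ⟨hwT, ?_⟩ hvw)
            · rintro (e | e)
              · exact hv (Or.inr e)
              · exact hv (Or.inl e)
            · rintro (e | e)
              · exact hw (Or.inr e)
              · exact hw (Or.inl e)
          exact ⟨hend w hxw hzw, hzw, w, chain_notMem hSe x.2.1 hxw, Setoid.refl' _ _, hxw⟩)
      (h.irreducible z' z hzz'.symm (Γ.edge.symm' hed))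
      ⟨hend z' hz'ch (Setoid.refl' _ _), Setoid.refl' _ _, z',
        chain_notMem hSe x.2.1 hz'ch, Setoid.refl' _ _, hz'ch⟩
    exact hQ (Setoid.symm' _ hmem.2.1)
  have h1 := key z z' hz hzS hed hzz' hzx hQ
  have h2 := key z' z (hTe _ hz _ hed) (fun h => hzS ((hSe.mem_iff hed).2 h)) (Γ.edge.symm' hed)
    hzz'.symm (Setoid.trans' _ (chain_edge (Γ.edge.symm' hed)) hzx)
    (fun h => hQ (by rw [Set.pair_comm]; exact Setoid.symm' _ h))
  rw [Set.pair_comm] at h2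
  exact hQ (Setoid.trans' _ h2 (Setoid.symm' _ h1))

theorem IsFeynman.numLegs_contract (h : Γ.IsFeynman) (hS : Γ.IsSub S) (hne : S ≠ Γ.internals) :
    (Γ.contract S).numLegs = Γ.numLegs := by
  unfold numLegs
  refine Nat.card_congr (Equiv.ofBijective
    (fun x => ⟨x.1.1, fun hx => x.2 ((h.contract_isInternal hS _).2 hx)⟩) ⟨?_, ?_⟩)
  · intro a b hab
    have hab' := congrArg Subtype.val hab
    exact Subtype.ext (Subtype.ext hab')
  · rintro ⟨x, hx⟩
    exact ⟨⟨⟨x, fun hxS => hx (hS.1 x hxS).1, fun hp => hne (h.eq_internals_of_leg hS hx hp)⟩,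
      fun hx' => hx ((h.contract_isInternal hS _).1 hx')⟩, rfl⟩

/-- The contraction of a proper subgraph is one-particle irreducible. -/
theorem IsFeynman.contract [Finite α] (h : Γ.IsFeynman) (hS : Γ.IsSub S) (hne : S ≠ Γ.internals) :
    (Γ.contract S).IsFeynman where
  edge_le_two x y z hxy hxz := by
    rcases chain_ends h x.2.2 y.2.2 z.2.2 hxy hxz with h1 | h1 | h1
    · exact Or.inl (Subtype.ext h1)
    · exact Or.inr (Or.inl (Subtype.ext h1))
    · exact Or.inr (Or.inr (Subtype.ext h1))
  three_le_valence v := by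
    obtain ⟨x, rfl⟩ := Quotient.exists_rep v
    rw [valence_mk]
    have h1 := h.two_le_card_legs hS x.1
    have h2 : Nat.card {y // (Γ.conn S).r x.1 y ∧ y ∉ S} ≠ 2 := x.2.2
    -- a component that becomes a vertex has at least two legs, and not exactly two
    have h3 : Nat.card {y // (Γ.contract S).vert.r y x} =
        Nat.card {y // (Γ.conn S).r x.1 y ∧ y ∉ S} := by
      refine Nat.card_congr (Equiv.ofBijective
        (fun y => ⟨y.1.1, Setoid.symm' _ y.2, y.1.2.1⟩) ⟨?_, ?_⟩)
      · intro a b hab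
        have hab' := congrArg Subtype.val hab
        exact Subtype.ext (Subtype.ext hab')
      · rintro ⟨y, hy, hyS⟩
        exact ⟨⟨⟨y, hyS, fun hp => x.2.2 ((inPropagator_congr hy).2 hp)⟩, Setoid.symm' _ hy⟩, rfl⟩
    omega
  connected x y :=
    (contract_conn_rel (Set.subset_univ S) hS.edgeClosed (fun _ _ _ _ => trivial)
      propClosed_univ x y).2 (h.connected _ _)
  irreducible x y hxy hed := by
    have hint : ∀ z w, z ≠ w → (Γ.contract S).edge.r z w → Γ.IsInternal z.1 := fun z w hzw hed =>
      (h.contract_isInternal hS z).1 ⟨w, hzw.symm, hed⟩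
    -- the set of all internal half-edges is a subgraph of the contracted graph
    have := (h.isSub_contract hS h.isSub_internals hS.subset).2 x (hint x y hxy hed) y
      (hint y x hxy.symm (Setoid.symm' _ hed)) hxy hed
    exact (Γ.contract S).conn_mono (fun z hz => hz.2) this
  has_internal := by
    obtain ⟨z, hz, hzS⟩ : ∃ z, Γ.IsInternal z ∧ z ∉ S := by
      by_contra hc
      push Not at hc
      exact hne (Set.Subset.antisymm hS.subset hc)
    obtain ⟨u, hu⟩ := h.exists_chain_end hS hne hzS
    refine ⟨u, (h.contract_isInternal hS u).2 ?_⟩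
    by_contra hleg
    refine hleg (?_ : Γ.IsInternal u.1)
    have : z = u.1 := by
      refine Setoid.sup_induction (P := fun w => w = u.1) rfl ?_ ?_ (Setoid.symm' _ hu)
      · rintro y z rfl hyz; exact isLeg_eq hleg hyz
      · rintro y z rfl (h | ⟨_, _, _, hp, _⟩)
        · exact h.symm
        · exact absurd hp u.2.2
    exact this ▸ hz
  two_le_legs := by rw [h.numLegs_contract hS hne]; exact h.two_le_legs

theorem contract_internals_isLeg (x) : (Γ.contract Γ.internals).IsLeg x := by
  rintro ⟨y, hy, hxy⟩
  refine hy (Subtype.ext ?_)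
  refine Setoid.sup_induction (P := fun w => w = x.1) rfl ?_ ?_ hxy
  · rintro y z rfl hyz; exact isLeg_eq x.2.1 hyz
  · rintro y z rfl (h | ⟨_, _, _, hp, _⟩)
    · exact h.symm
    · exact absurd hp x.2.2

/-- Subgraphs of the contracted graph correspond to the subgraphs that contain the contracted
subgraph. -/
theorem IsFeynman.bijective_preimage (h : Γ.IsFeynman) (hS : Γ.IsSub S) :
    Function.Bijective (fun T : {T // Γ.IsSub T ∧ S ⊆ T} =>
      (⟨Subtype.val ⁻¹' T.1, h.isSub_contract hS T.2.1 T.2.2⟩ :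
        {T' // (Γ.contract S).IsSub T'})) := by
  have hSe := hS.edgeClosed
  -- the contraction of the whole graph has no internal edges, and only the empty subgraph
  by_cases hne : S = Γ.internals
  · have h1 : ∀ T : {T // Γ.IsSub T ∧ S ⊆ T}, T.1 = S := fun T =>
      Set.Subset.antisymm (hne ▸ T.2.1.subset) T.2.2
    refine ⟨fun T T' _ => Subtype.ext ((h1 T).trans (h1 T').symm), ?_⟩
    rintro ⟨T', hT'⟩
    refine ⟨⟨S, hS, le_rfl⟩, Subtype.ext ?_⟩
    subst hne
    have : T' = ∅ := Set.eq_empty_of_forall_notMem fun x hx =>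
      contract_internals_isLeg x (hT'.1 x hx).1
    change Subtype.val ⁻¹' Γ.internals = T'
    rw [this]
    exact Set.eq_empty_of_forall_notMem fun x hx => x.2.1 hx
  constructor
  · rintro ⟨T1, hT1, hS1⟩ ⟨T2, hT2, hS2⟩ heq
    have heq' : ∀ u : {x // x ∉ S ∧ ¬ Γ.InPropagator S x}, u.1 ∈ T1 ↔ u.1 ∈ T2 := fun u => by
      have := congrArg Subtype.val heq
      exact Set.ext_iff.1 this u
    refine Subtype.ext (Set.ext fun z => ?_)
    by_cases hzS : z ∈ S
    · exact ⟨fun _ => hS2 hzS, fun _ => hS1 hzS⟩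
    -- a half-edge outside `S` belongs to `T` if and only if the end of its chain does
    obtain ⟨u, hu⟩ := h.exists_chain_end hS hne hzS
    change z ∈ T1 ↔ z ∈ T2
    rw [(hT1.propClosed hSe).chain hT1.edgeClosed hu, (hT2.propClosed hSe).chain hT2.edgeClosed hu,
      heq']
  · rintro ⟨T', hT'⟩
    -- the preimage consists of `S` and of the chains that form the edges of `T'`
    let T : Set α := S ∪ {z | ∃ x ∈ T', (Γ.chain S).r x.1 z}
    have hpre : (Subtype.val ⁻¹' T : Set {x // x ∉ S ∧ ¬ Γ.InPropagator S x}) = T' := by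
      ext x
      constructor
      · rintro (hx | ⟨y, hy, hyx⟩)
        · exact absurd hx x.2.1
        · exact (hT'.1 y hy).2 x hyx
      · intro hx
        exact Or.inr ⟨x, hx, Setoid.refl' _ _⟩
    have hT : Γ.IsSub T := by
      refine h.isSub_of_contract hS hne Set.subset_union_left ?_ ?_ ?_ (hpre.symm ▸ hT')
      · rintro z (hz | ⟨x, hx, hxz⟩)
        · exact hS.subset hz
        · by_contra hleg
          have hint := (h.contract_isInternal hS x).1 (hT'.1 x hx).1
          have hzx : x.1 = z := by
            refine Setoid.sup_induction (P := fun w => w = z) rfl ?_ ?_ (Setoid.symm' _ hxz)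
            · rintro y z rfl hyz; exact isLeg_eq hleg hyz
            · rintro y z rfl (h' | ⟨_, _, _, hp, _⟩)
              · exact h'.symm
              · exact absurd (h.eq_internals_of_leg hS hleg hp) hne
          exact hleg (hzx ▸ hint)
      · rintro z (hz | ⟨x, hx, hxz⟩) w hzw
        · exact Or.inl (hSe z hz w hzw)
        · exact Or.inr ⟨x, hx, Setoid.trans' _ hxz (chain_edge hzw)⟩
      · rintro z (hz | ⟨x, hx, hxz⟩) w hzw
        · exact Or.inl (propClosed_self z hz w hzw)
        · exact Or.inr ⟨x, hx, Setoid.trans' _ hxz (Setoid.sup_right hzw)⟩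
    exact ⟨⟨T, hT, Set.subset_union_left⟩, Subtype.ext hpre⟩

end FGraph



/-! ### Coassociativity -/

theorem finsum_subtype_eq_sum {α M : Type*} [Fintype α] [AddCommMonoid M] (p : α → Prop)
    [DecidablePred p] (f : α → M) : ∑ᶠ x : {x // p x}, f x.1 = ∑ x ∈ Finset.univ.filter p, f x := by
  rw [finsum_eq_sum_of_fintype]
  exact (Finset.sum_subtype _ (by simp) f).symm

theorem prod_tmul_prod {𝕜 A B ι : Type*} [Field 𝕜] [CommRing A] [CommRing B] [Algebra 𝕜 A]
    [Algebra 𝕜 B] (s : Finset ι) (a : ι → A) (b : ι → B) :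
    ∏ i ∈ s, (a i ⊗ₜ[𝕜] b i) = (∏ i ∈ s, a i) ⊗ₜ[𝕜] (∏ i ∈ s, b i) := by
  induction s using Finset.induction_on with
  | empty => rfl
  | insert i s hi ih => simp only [Finset.prod_insert hi, ih, Algebra.TensorProduct.tmul_mul_tmul]

namespace FGraph

variable {α β δ : Type} {Γ : FGraph α} {S T : Set α}

/-- Restrictions along injective maps with the same range are isomorphic. -/
theorem comap_iso_of_range (G : FGraph α) {f : β → α} {g : δ → α} (hf : Function.Injective f)
    (hg : Function.Injective g) (h : Set.range f = Set.range g) :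
    Nonempty (Iso (G.comap f) (G.comap g)) := by
  let e : β ≃ δ := (Equiv.ofInjective f hf).trans
    ((Equiv.setCongr h).trans (Equiv.ofInjective g hg).symm)
  have he : ∀ x, g (e x) = f x := by
    intro x
    have : Equiv.ofInjective g hg (e x) = Equiv.setCongr h (Equiv.ofInjective f hf x) := by
      simp [e]
    exact congrArg Subtype.val this
  refine ⟨Iso.ofEq e ?_⟩
  have : f = g ∘ e := funext fun x => (he x).symm
  rw [this]; rfl

theorem cut_edgeOn (hST : S ⊆ T) : (Γ.cut T).edgeOn S = Γ.edgeOn S := by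
  refine Setoid.ext fun x y => ⟨?_, ?_⟩
  · rintro (rfl | ⟨hx, hy, h⟩)
    · exact Or.inl rfl
    · exact Or.inr ⟨hx, hy, Γ.edgeOn_le T h⟩
  · rintro (rfl | ⟨hx, hy, h⟩)
    · exact Or.inl rfl
    · exact Or.inr ⟨hx, hy, Or.inr ⟨hST hx, hST hy, h⟩⟩

theorem cut_conn (hST : S ⊆ T) : (Γ.cut T).conn S = Γ.conn S := by
  rw [conn, conn, cut_edgeOn hST]; rfl

theorem cut_cut (hST : S ⊆ T) : (Γ.cut T).cut S = Γ.cut S := ext' rfl (cut_edgeOn hST)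

theorem cut_inPropagator (hST : S ⊆ T) (x : α) :
    (Γ.cut T).InPropagator S x ↔ Γ.InPropagator S x := by
  unfold InPropagator; rw [cut_conn hST]

theorem cut_isInternal (h : Γ.IsSub T) (x : α) : (Γ.cut T).IsInternal x ↔ x ∈ T := by
  constructor
  · rintro ⟨y, hy, h | ⟨hx, _⟩⟩
    · exact absurd h.symm hy
    · exact hx
  · intro hx
    obtain ⟨y, hy, hxy⟩ := (h.1 x hx).1
    exact ⟨y, hy, Or.inr ⟨hx, h.edgeClosed x hx y hxy, hxy⟩⟩

theorem cut_isSub (hT : Γ.IsSub T) (S : Set α) :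
    (Γ.cut T).IsSub S ↔ Γ.IsSub S ∧ S ⊆ T := by
  constructor
  · rintro ⟨h1, h2⟩
    have hST : S ⊆ T := fun x hx => (cut_isInternal hT x).1 (h1 x hx).1
    refine ⟨⟨fun x hx => ⟨hT.subset (hST hx), fun y hy => (h1 x hx).2 y
      (Or.inr ⟨hST hx, hT.edgeClosed x (hST hx) y hy, hy⟩)⟩, fun x hx y hy hne hxy => ?_⟩, hST⟩
    have := h2 x hx y hy hne (Or.inr ⟨hST hx, hST hy, hxy⟩)
    rwa [cut_conn (Set.sdiff_subset.trans hST)] at this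
  · rintro ⟨⟨h1, h2⟩, hST⟩
    refine ⟨fun x hx => ⟨(cut_isInternal hT x).2 (hST hx), fun y hy =>
      (h1 x hx).2 y (Γ.edgeOn_le T hy)⟩, fun x hx y hy hne hxy => ?_⟩
    rw [cut_conn (Set.sdiff_subset.trans hST)]
    exact h2 x hx y hy hne (Γ.edgeOn_le T hxy)

/-- A subgraph of a disconnected graph is a family of subgraphs of its parts. -/
theorem isSub_iff_forall_fiber {G : FGraph α} {ι : Type*} {q : α → ι}
    (h : ∀ x y, (G.vert ⊔ G.edge).r x y → q x = q y) (S : Set α) :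
    G.IsSub S ↔ ∀ d : ι, (G.comap (Subtype.val : {x // q x = d} → α)).IsSub (Subtype.val ⁻¹' S) := by
  have hs := isSummand_fiber h
  have hpre : ∀ (d : ι) (x y : {x // q x = d}), (Subtype.val ⁻¹' S \ {x, y} : Set {x // q x = d}) =
      Subtype.val ⁻¹' (S \ {x.1, y.1}) := by
    intro d x y; ext z; simp [Subtype.ext_iff]
  constructor
  · rintro ⟨h1, h2⟩ d
    refine ⟨fun x hx => ⟨((hs d).isInternal x).2 (h1 _ hx).1, fun y hy => (h1 _ hx).2 _ hy⟩,
      fun x hx y hy hne hxy => ?_⟩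
    rw [hpre, (hs d).conn_rel]
    exact h2 _ hx _ hy ((hs d).inj.ne hne) hxy
  · intro H
    refine ⟨fun x hx => ⟨((hs (q x)).isInternal ⟨x, rfl⟩).1 ((H (q x)).1 ⟨x, rfl⟩ hx).1,
      fun y hy => ?_⟩, fun x hx y hy hne hxy => ?_⟩
    · exact ((H (q x)).1 ⟨x, rfl⟩ hx).2 ⟨y, (h _ _ (Setoid.sup_right hy)).symm⟩ hy
    · have hq := (h _ _ (Setoid.sup_right hxy)).symm
      have := (H (q x)).2 ⟨x, rfl⟩ hx ⟨y, hq⟩ hy (fun e => hne (congrArg Subtype.val e)) hxy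
      rwa [hpre, (hs (q x)).conn_rel] at this

/-- The components of a subgraph are one-particle irreducible, or vertices. -/
theorem IsFeynman.component [Finite α] (h : Γ.IsFeynman) (hT : Γ.IsSub T)
    (d : Quotient (Γ.conn T)) :
    (Γ.component T d).IsFeynman ∨ ∀ x, (Γ.component T d).IsLeg x := by
  by_cases hleg : ∀ x, (Γ.component T d).IsLeg x
  · exact Or.inr hleg
  left
  have hs : IsSummand (Subtype.val : {x // Quotient.mk (Γ.conn T) x = d} → α) (Γ.cut T) :=
    isSummand_fiber (G := Γ.cut T) (q := Quotient.mk (Γ.conn T))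
      (fun x y hxy => Quotient.sound hxy) d
  have hint : ∀ x, (Γ.component T d).IsInternal x ↔ x.1 ∈ T := fun x =>
    (hs.isInternal x).trans (cut_isInternal hT x.1)
  refine
    { edge_le_two := fun x y z hxy hxz => ?_
      three_le_valence := fun v => ?_
      connected := fun x y => ?_
      irreducible := fun x y hne hxy => ?_
      has_internal := ?_
      two_le_legs := ?_ }
  · rcases h.edge_le_two x.1 y.1 z.1 (Γ.edgeOn_le T hxy) (Γ.edgeOn_le T hxz) with e | e | e
    · exact Or.inl (Subtype.ext e)
    · exact Or.inr (Or.inl (Subtype.ext e))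
    · exact Or.inr (Or.inr (Subtype.ext e))
  · obtain ⟨x, rfl⟩ := Quotient.exists_rep v
    have := h.three_le_valence (Quotient.mk _ x.1)
    rw [valence_mk] at this ⊢
    rwa [← hs.card_fiber (fun y => Γ.vert.r y x.1)
      fun y hy => hs.vert _ _ (Γ.vert.symm' hy) ⟨x, rfl⟩] at this
  · have := (hs.conn_rel Set.univ x y).2 (by
      have h1 : (Γ.cut T).conn Set.univ = Γ.conn T := by
        rw [conn, edgeOn_univ]; rfl
      rw [h1]; exact Quotient.exact (x.2.trans y.2.symm))
    exact this
  · rcases hxy with e | ⟨hx, hy, hxy⟩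
    · exact absurd (Subtype.ext e) hne
    have hne' : x.1 ≠ y.1 := fun e => hne (Subtype.ext e)
    have h1 := hT.2 x.1 hx y.1 hy hne' hxy
    rw [← cut_conn Set.sdiff_subset] at h1
    have h2 := (hs.conn_rel {x.1, y.1}ᶜ x y).2 ((Γ.cut T).conn_mono (fun z hz => hz.2) h1)
    have h3 : (Subtype.val ⁻¹' {x.1, y.1}ᶜ : Set {x // Quotient.mk (Γ.conn T) x = d}) =
        {x, y}ᶜ := by
      ext z; simp [Subtype.ext_iff]
    rwa [h3] at h2
  · push Not at hleg
    obtain ⟨x, hx⟩ := hleg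
    exact ⟨x, not_not.1 hx⟩
  · obtain ⟨x, rfl⟩ := Quotient.exists_rep d
    have h1 := h.two_le_card_legs hT x
    -- the legs of a component are its half-edges outside `T`
    have h2 : (Γ.component T (Quotient.mk _ x)).numLegs =
        Nat.card {y // (Γ.conn T).r x y ∧ y ∉ T} := by
      refine Nat.card_congr (Equiv.ofBijective (fun y => ⟨y.1.1,
        Setoid.symm' _ (Quotient.exact y.1.2), fun hy => y.2 ((hint _).2 hy)⟩) ⟨?_, ?_⟩)
      · intro a b hab
        have hab' := congrArg Subtype.val hab
        exact Subtype.ext (Subtype.ext hab')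
      · rintro ⟨y, hy, hyT⟩
        exact ⟨⟨⟨y, Quotient.sound (Setoid.symm' _ hy)⟩, fun h' => hyT ((hint _).1 h')⟩, rfl⟩
    omega

/-- Cutting the edges outside `T` commutes with contracting a subgraph of `T`. -/
theorem cut_contract_iso (hST : S ⊆ T) (hT : Γ.EdgeClosed T) (hP : Γ.PropClosed S T) :
    ∃ e : Iso ((Γ.cut T).contract S) ((Γ.contract S).cut (Subtype.val ⁻¹' T)),
      ∀ x, (e.1 x).1 = x.1 := by
  have hpr : (Γ.cut T).propagatorRel S = Γ.propagatorRel S := by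
    refine Setoid.ext fun x y => ?_
    rw [propagatorRel_iff, propagatorRel_iff, cut_conn hST, cut_inPropagator hST,
      cut_inPropagator hST]
  refine ⟨Iso.ofEq (Equiv.subtypeEquivRight fun x => by rw [cut_inPropagator hST]) (ext' ?_ ?_),
    fun x => rfl⟩
  · refine Setoid.ext fun x y => ?_
    change ((Γ.cut T).conn S).r x.1 y.1 ↔ (Γ.conn S).r x.1 y.1
    rw [cut_conn hST]
  · refine Setoid.ext fun x y => ?_
    -- a chain from `x` starts with an edge, and it stays in `T` if this edge belongs to `T`
    have hx : ∀ w, (Γ.propagatorRel S).r x.1 w → w = x.1 := by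
      rintro w (e | ⟨_, _, _, hp, _⟩)
      · exact e.symm
      · exact absurd hp fun hp => x.2.2 ((cut_inPropagator hST _).2 hp)
    change ((Γ.cut T).edge ⊔ (Γ.cut T).propagatorRel S).r x.1 y.1 ↔ (_ = _ ∨ (x.1 ∈ T ∧ y.1 ∈ T ∧
      (Γ.chain S).r x.1 y.1))
    rw [hpr]
    constructor
    · intro hxy
      have : y.1 = x.1 ∨ (x.1 ∈ T ∧ y.1 ∈ T ∧ (Γ.chain S).r x.1 y.1) := by
        refine Setoid.sup_induction (P := fun w => w = x.1 ∨ (x.1 ∈ T ∧ w ∈ T ∧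
          (Γ.chain S).r x.1 w)) (Or.inl rfl) ?_ ?_ hxy
        · rintro v w hv (rfl | ⟨hvT, hwT, hvw⟩)
          · exact hv
          · rcases hv with rfl | ⟨h1, h2, h3⟩
            · exact Or.inr ⟨hvT, hwT, chain_edge hvw⟩
            · exact Or.inr ⟨h1, hwT, Setoid.trans' _ h3 (chain_edge hvw)⟩
        · rintro v w (rfl | ⟨h1, h2, h3⟩) hvw
          · exact Or.inl (hx w hvw)
          · exact Or.inr ⟨h1, hP v h2 w hvw, Setoid.trans' _ h3 (Setoid.sup_right hvw)⟩
      rcases this with e | h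
      · exact Or.inl (Subtype.ext (Subtype.ext_iff.1 (Subtype.ext e.symm)))
      · exact Or.inr h
    · rintro (e | ⟨h1, h2, h3⟩)
      · have e' : x = y := (Equiv.injective _) e
        rw [e']
      · refine (Setoid.sup_induction (P := fun w => w ∈ T ∧
          ((Γ.cut T).edge ⊔ Γ.propagatorRel S).r x.1 w) ⟨h1, Setoid.refl' _ _⟩ ?_ ?_ h3).2
        · rintro v w ⟨hv, hxv⟩ hvw
          have hw := hT v hv w hvw
          exact ⟨hw, Setoid.trans' _ hxv (Setoid.sup_left (Or.inr ⟨hv, hw, hvw⟩))⟩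
        · rintro v w ⟨hv, hxv⟩ hvw
          exact ⟨hP v hv w hvw, Setoid.trans' _ hxv (Setoid.sup_right hvw)⟩

section Alg

variable (𝕜 : Type*) [Field 𝕜]

/-- For a graph all of whose parts with respect to `q` are connected or empty. -/
theorem compsProd_eq_finprod_toAlg [Finite α] {G : FGraph α} {ι : Type*} [Finite ι] {q : α → ι}
    (h : ∀ x y, (G.vert ⊔ G.edge).r x y ↔ q x = q y) :
    G.compsProd 𝕜 = ∏ᶠ d : ι, (G.comap (Subtype.val : {x // q x = d} → α)).toAlg 𝕜 := by
  rw [compsProd_eq_finprod 𝕜 (q := q) fun x y => (h x y).1]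
  refine finprod_congr fun d => ?_
  by_cases hne : Nonempty {x // q x = d}
  · refine compsProd_of_connected 𝕜 fun x y => ?_
    have hs := isSummand_fiber (fun x y => (h x y).1) d
    have h1 := (Setoid.comap_sup_of_saturated _ G.vert G.edge hs.vert hs.edge).1
    change (G.vert.comap Subtype.val ⊔ G.edge.comap Subtype.val).r x y
    rw [← h1]
    exact (h _ _).2 (x.2.trans y.2.symm)
  · have : ∀ x, (G.comap (Subtype.val : {x // q x = d} → α)).IsLeg x := fun x => absurd ⟨x⟩ hne
    rw [compsProd_of_legs 𝕜 this, toAlg_of_legs 𝕜 this]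

theorem coprod_of_legs [Finite α] (h : ∀ x, Γ.IsLeg x) : Γ.coprod 𝕜 = 1 ⊗ₜ[𝕜] 1 := by
  let huniq : Unique {S : Set α // Γ.IsSub S} :=
    { default := ⟨∅, isSub_empty⟩
      uniq := fun S => Subtype.ext (Set.eq_empty_of_forall_notMem fun x hx => h x (S.2.1 x hx).1) }
  have hd : (huniq.default : {S : Set α // Γ.IsSub S}).1 = ∅ := rfl
  rw [coprod_eq, finsum_unique, hd, compsProd_of_legs 𝕜, toAlg_of_legs 𝕜]
  · intro x
    have hI : (∅ : Set α) = Γ.internals := (Set.eq_empty_of_forall_notMem fun x hx => h x hx).symm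
    revert x
    rw [hI]
    exact contract_internals_isLeg
  · refine isLeg_of_edge_bot ?_
    rintro x y (e | ⟨hx, _⟩)
    · exact e
    · exact absurd hx (Set.notMem_empty _)

theorem graphComul_toAlg' [Finite α] (h : Γ.IsFeynman ∨ ∀ x, Γ.IsLeg x) :
    graphComul 𝕜 (Γ.toAlg 𝕜) = Γ.coprod 𝕜 := by
  rcases h with h | h
  · exact graphComul_toAlg 𝕜 h
  · rw [toAlg_of_legs 𝕜 h, coprod_of_legs 𝕜 h, map_one]; rfl

theorem IsFeynman.contract_or [Finite α] (h : Γ.IsFeynman) (hS : Γ.IsSub S) :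
    (Γ.contract S).IsFeynman ∨ ∀ x, (Γ.contract S).IsLeg x := by
  by_cases hne : S = Γ.internals
  · right; subst hne; exact contract_internals_isLeg
  · exact Or.inl (h.contract hS hne)

/-- The coproduct of a cograph is a sum over the subgraphs that contain the contracted one. -/
theorem IsFeynman.graphComul_contract [Finite α] (h : Γ.IsFeynman) (hS : Γ.IsSub S) :
    graphComul 𝕜 ((Γ.contract S).toAlg 𝕜) = ∑ᶠ T : {T // Γ.IsSub T ∧ S ⊆ T},
      ((Γ.contract S).cut (Subtype.val ⁻¹' T.1)).compsProd 𝕜 ⊗ₜ[𝕜] (Γ.contract T.1).toAlg 𝕜 := by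
  rw [graphComul_toAlg' 𝕜 (h.contract_or hS), coprod_eq]
  refine (finsum_eq_of_bijective _ (h.bijective_preimage hS) fun T => ?_).symm
  rw [toAlg_iso 𝕜 (contract_contract_iso T.2.2 hS.edgeClosed T.2.1.edgeClosed
    (T.2.1.propClosed hS.edgeClosed)).some]

/-- The coproduct of a subgraph is a sum over the smaller subgraphs. -/
theorem IsFeynman.graphComul_compsProd [Finite α] (h : Γ.IsFeynman) (hT : Γ.IsSub T) :
    graphComul 𝕜 ((Γ.cut T).compsProd 𝕜) = ∑ᶠ S : {S // Γ.IsSub S ∧ S ⊆ T},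
      (Γ.cut S.1).compsProd 𝕜 ⊗ₜ[𝕜] ((Γ.contract S.1).cut (Subtype.val ⁻¹' T)).compsProd 𝕜 := by
  let ι := Quotient (Γ.conn T)
  have : Fintype ι := Fintype.ofFinite _
  let q : α → ι := Quotient.mk _
  have hq : ∀ x y, ((Γ.cut T).vert ⊔ (Γ.cut T).edge).r x y → q x = q y := fun x y hxy =>
    Quotient.sound hxy
  have hs := isSummand_fiber hq
  have (d : ι) : Fintype {S // (Γ.component T d).IsSub S} := Fintype.ofFinite _
  have : Fintype {S // Γ.IsSub S ∧ S ⊆ T} := Fintype.ofFinite _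
  rw [← finprod_component, finprod_eq_prod_of_fintype, map_prod]
  simp only [graphComul_toAlg' 𝕜 (h.component hT _), coprod_eq, finsum_eq_sum_of_fintype]
  rw [Finset.prod_univ_sum, Fintype.piFinset_univ]
  -- a subgraph of `T` is a family of subgraphs of the components of `T`
  let F : {S // Γ.IsSub S ∧ S ⊆ T} → ((d : ι) → {S // (Γ.component T d).IsSub S}) := fun S d =>
    ⟨Subtype.val ⁻¹' S.1, (isSub_iff_forall_fiber hq S.1).1 ((cut_isSub hT _).2 S.2) d⟩
  have hF : Function.Bijective F := by
    constructor
    · intro S S' hSS'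
      refine Subtype.ext (Set.ext fun x => ?_)
      have := congrArg Subtype.val (congrFun hSS' (q x))
      exact Set.ext_iff.1 this ⟨x, rfl⟩
    · intro f
      let S : Set α := {x | (⟨x, rfl⟩ : {y // q y = q x}) ∈ (f (q x)).1}
      have hS : ∀ d, (Subtype.val ⁻¹' S : Set {y // q y = d}) = (f d).1 := by
        intro d
        ext ⟨x, rfl⟩
        exact Iff.rfl
      have hsub : (Γ.cut T).IsSub S := (isSub_iff_forall_fiber hq S).2 fun d => by
        rw [hS]; exact (f d).2
      exact ⟨⟨S, (cut_isSub hT _).1 hsub⟩, funext fun d => Subtype.ext (hS d)⟩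
  refine (Fintype.sum_bijective F hF _ _ ?_).symm
  rintro ⟨S, hS, hST⟩
  rw [prod_tmul_prod]
  have hP := hT.propClosed hS.edgeClosed
  congr 1
  · rw [compsProd_eq_finprod 𝕜 (G := Γ.cut S) (q := q)
        (fun x y hxy => Quotient.sound (Γ.conn_mono hST hxy)),
      finprod_eq_prod_of_fintype]
    refine Finset.prod_congr rfl fun d _ => ?_
    change _ = ((((Γ.cut T).comap Subtype.val)).cut (Subtype.val ⁻¹' S)).compsProd 𝕜
    rw [cut_comap _ (hs d).inj, cut_cut hST]
  · obtain ⟨e, he⟩ := cut_contract_iso hST hT.edgeClosed hP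
    have hconn : ∀ x y, (((Γ.contract S).cut (Subtype.val ⁻¹' T)).vert ⊔
        ((Γ.contract S).cut (Subtype.val ⁻¹' T)).edge).r x y ↔ q x.1 = q y.1 := by
      intro x y
      change ((Γ.contract S).conn (Subtype.val ⁻¹' T)).r x y ↔ _
      rw [contract_conn_rel hST hS.edgeClosed hT.edgeClosed hP]
      exact Quotient.eq.symm
    rw [compsProd_eq_finprod_toAlg 𝕜 hconn, finprod_eq_prod_of_fintype]
    refine Finset.prod_congr rfl fun d _ => ?_
    change _ = ((((Γ.cut T).comap (Subtype.val : {x // q x = d} → α))).contract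
      (Subtype.val ⁻¹' S)).toAlg 𝕜
    rw [(hs d).contract_comap S, e.eq_comap, comap_comap]
    refine (toAlg_iso 𝕜 (comap_iso_of_range _ ?_ Subtype.val_injective ?_).some).symm
    · exact e.1.injective.comp ((hs d).contractMap_injective S)
    · rw [Set.range_comp]
      ext z
      constructor
      · rintro ⟨w, hw, rfl⟩
        obtain ⟨⟨y, hy⟩, hyw⟩ := ((hs d).mem_range_contractMap S w).1 hw
        refine ⟨⟨e.1 w, ?_⟩, rfl⟩
        rw [he, ← hyw]; exact hy
      · rintro ⟨⟨w, hw⟩, rfl⟩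
        refine ⟨e.1.symm w, ((hs d).mem_range_contractMap S _).2 ⟨⟨w.1, hw⟩, ?_⟩, by simp⟩
        rw [← he]; simp

/-- Coassociativity on a graph: both sides are the sum over pairs `S ⊆ T` of subgraphs. -/
theorem IsFeynman.coassoc [Finite α] (h : Γ.IsFeynman) :
    TensorProduct.assoc 𝕜 _ _ _ (TensorProduct.map (graphComul 𝕜).toLinearMap LinearMap.id
      (Γ.coprod 𝕜)) = TensorProduct.map LinearMap.id (graphComul 𝕜).toLinearMap (Γ.coprod 𝕜) := by
  have : Fintype (Set α) := Fintype.ofFinite _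
  rw [coprod_eq, finsum_subtype_eq_sum (fun S : Set α => Γ.IsSub S) fun S =>
    (Γ.cut S).compsProd 𝕜 ⊗ₜ[𝕜] (Γ.contract S).toAlg 𝕜, map_sum, map_sum, map_sum]
  -- the coproduct of the components of `T` cuts out the subgraphs `S ⊆ T`
  have h1 : ∀ T ∈ Finset.univ.filter (fun S : Set α => Γ.IsSub S),
      TensorProduct.assoc 𝕜 _ _ _ (TensorProduct.map (graphComul 𝕜).toLinearMap LinearMap.id
        ((Γ.cut T).compsProd 𝕜 ⊗ₜ[𝕜] (Γ.contract T).toAlg 𝕜)) =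
      ∑ S ∈ Finset.univ.filter (fun S : Set α => Γ.IsSub S ∧ S ⊆ T), (Γ.cut S).compsProd 𝕜 ⊗ₜ[𝕜]
        (((Γ.contract S).cut (Subtype.val ⁻¹' T)).compsProd 𝕜 ⊗ₜ[𝕜] (Γ.contract T).toAlg 𝕜) := by
    intro T hT
    rw [TensorProduct.map_tmul]
    change TensorProduct.assoc 𝕜 _ _ _ (graphComul 𝕜 _ ⊗ₜ[𝕜] _) = _
    rw [h.graphComul_compsProd 𝕜 (Finset.mem_filter.1 hT).2,
      finsum_subtype_eq_sum (fun S : Set α => Γ.IsSub S ∧ S ⊆ T) fun S => (Γ.cut S).compsProd 𝕜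
        ⊗ₜ[𝕜] ((Γ.contract S).cut (Subtype.val ⁻¹' T)).compsProd 𝕜,
      TensorProduct.sum_tmul, map_sum]
    exact Finset.sum_congr rfl fun _ _ => rfl
  -- the coproduct of the contraction of `S` cuts out the images of the subgraphs `T ⊇ S`
  have h2 : ∀ S ∈ Finset.univ.filter (fun S : Set α => Γ.IsSub S),
      TensorProduct.map LinearMap.id (graphComul 𝕜).toLinearMap
        ((Γ.cut S).compsProd 𝕜 ⊗ₜ[𝕜] (Γ.contract S).toAlg 𝕜) =
      ∑ T ∈ Finset.univ.filter (fun T : Set α => Γ.IsSub T ∧ S ⊆ T), (Γ.cut S).compsProd 𝕜 ⊗ₜ[𝕜]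
        (((Γ.contract S).cut (Subtype.val ⁻¹' T)).compsProd 𝕜 ⊗ₜ[𝕜] (Γ.contract T).toAlg 𝕜) := by
    intro S hS
    rw [TensorProduct.map_tmul]
    change _ ⊗ₜ[𝕜] graphComul 𝕜 _ = _
    rw [h.graphComul_contract 𝕜 (Finset.mem_filter.1 hS).2,
      finsum_subtype_eq_sum (fun T : Set α => Γ.IsSub T ∧ S ⊆ T) fun T =>
        ((Γ.contract S).cut (Subtype.val ⁻¹' T)).compsProd 𝕜 ⊗ₜ[𝕜] (Γ.contract T).toAlg 𝕜,
      TensorProduct.tmul_sum]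
    exact Finset.sum_congr rfl fun _ _ => rfl
  rw [Finset.sum_congr rfl h1, Finset.sum_congr rfl h2]
  refine Finset.sum_comm' fun T S => ?_
  simp only [Finset.mem_filter, Finset.mem_univ, true_and]
  tauto

end Alg

end FGraph


/-! ### Loop numbers -/

theorem Nat.card_eq_sum_fiber {α ι : Type*} [Finite α] [Fintype ι] (q : α → ι) :
    Nat.card α = ∑ i, Nat.card {x // q x = i} := by
  rw [Nat.card_congr (Equiv.sigmaFiberEquiv q).symm, Nat.card_sigma]

theorem Nat.card_add_card_not {α : Type*} [Finite α] (p q : α → Prop) :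
    Nat.card {x // p x} = Nat.card {x // p x ∧ q x} + Nat.card {x // p x ∧ ¬ q x} := by
  have := Fintype.ofFinite α
  simp only [Nat.card_eq_fintype_card, Fintype.card_subtype]
  rw [← Finset.card_filter_add_card_filter_not (s := Finset.univ.filter p) q, Finset.filter_filter,
    Finset.filter_filter]

/-- Joining two different classes lowers their number by one. -/
theorem Setoid.card_quotient_sup_pair {α : Type*} [Finite α] (r s : Setoid α) {x y : α}
    (h : ¬ r x y) (hs : ∀ a b, s a b ↔ a = b ∨ (a = x ∧ b = y) ∨ (a = y ∧ b = x)) :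
    Nat.card (Quotient (r ⊔ s)) + 1 = Nat.card (Quotient r) := by
  have key : ∀ a b, (r ⊔ s) a b → r a b ∨ (r a x ∧ r y b) ∨ (r a y ∧ r x b) := by
    intro a b hab
    refine Setoid.sup_induction (P := fun b => r a b ∨ (r a x ∧ r y b) ∨ (r a y ∧ r x b))
      (Or.inl (r.refl' a)) ?_ ?_ hab
    · rintro b c (h1 | ⟨h1, h2⟩ | ⟨h1, h2⟩) hbc
      · exact Or.inl (r.trans' h1 hbc)
      · exact Or.inr (Or.inl ⟨h1, r.trans' h2 hbc⟩)
      · exact Or.inr (Or.inr ⟨h1, r.trans' h2 hbc⟩)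
    · rintro b c hb hbc
      rcases (hs b c).1 hbc with rfl | ⟨rfl, rfl⟩ | ⟨rfl, rfl⟩
      · exact hb
      · rcases hb with h1 | ⟨h1, h2⟩ | ⟨h1, h2⟩
        · exact Or.inr (Or.inl ⟨h1, r.refl' _⟩)
        · exact absurd (r.symm' h2) h
        · exact Or.inl h1
      · rcases hb with h1 | ⟨h1, h2⟩ | ⟨h1, h2⟩
        · exact Or.inr (Or.inr ⟨h1, r.refl' _⟩)
        · exact Or.inl h1
        · exact absurd h2 h
  -- the new classes correspond to the old classes other than that of `y`
  have h1 : Nat.card {c : Quotient r // c ≠ Quotient.mk r y} + 1 = Nat.card (Quotient r) := by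
    have := Fintype.ofFinite (Quotient r)
    rw [Nat.card_eq_fintype_card, Nat.card_eq_fintype_card, Fintype.card_subtype_compl,
      Fintype.card_subtype_eq]
    have : 0 < Fintype.card (Quotient r) := Fintype.card_pos_iff.2 ⟨Quotient.mk r y⟩
    omega
  rw [← h1]
  congr 1
  symm
  refine Nat.card_congr (Equiv.ofBijective (fun c : {c : Quotient r // c ≠ Quotient.mk r y} =>
    Quotient.map' (s₁ := r) (s₂ := r ⊔ s) id (fun a b hab => Setoid.sup_left hab) c.1) ⟨?_, ?_⟩)
  · rintro ⟨⟨a⟩, ha⟩ ⟨⟨b⟩, hb⟩ hab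
    have ha' : ¬ r a y := fun h => ha (Quotient.sound h)
    have hb' : ¬ r b y := fun h => hb (Quotient.sound h)
    rcases key a b (Quotient.exact hab) with h1 | ⟨h1, h2⟩ | ⟨h1, h2⟩
    · exact Subtype.ext (Quotient.sound h1)
    · exact absurd (r.symm' h2) hb'
    · exact absurd h1 ha'
  · rintro ⟨b⟩
    by_cases hb : r b y
    · refine ⟨⟨Quotient.mk r x, fun e => h (Quotient.exact e)⟩, Quotient.sound ?_⟩
      exact (r ⊔ s).trans' (Setoid.sup_right ((hs x y).2 (Or.inr (Or.inl ⟨rfl, rfl⟩))))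
        (Setoid.sup_left (r.symm' hb))
    · exact ⟨⟨Quotient.mk r b, fun e => hb (Quotient.exact e)⟩, rfl⟩

namespace FGraph

variable {α β : Type} {Γ : FGraph α} {S T : Set α}

instance [Finite α] : Finite (FGraph α) :=
  Finite.of_injective (β := (α → α → Prop) × (α → α → Prop)) (fun Γ => (Γ.vert.r, Γ.edge.r))
    fun Γ Γ' h => by
      have h1 := congrArg Prod.fst h
      have h2 := congrArg Prod.snd h
      exact ext' (Setoid.ext fun x y => iff_of_eq (congrFun (congrFun h1 x) y))
        (Setoid.ext fun x y => iff_of_eq (congrFun (congrFun h2 x) y))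

/-- The internal half-edges come in pairs. -/
theorem even_card_internal [Finite α]
    (h : ∀ x y z, Γ.edge.r x y → Γ.edge.r x z → x = y ∨ x = z ∨ y = z) :
    Even (Nat.card {x // Γ.IsInternal x}) := by
  have := Fintype.ofFinite α
  have hp : ∀ x : {x // Γ.IsInternal x}, ∃ y : {x // Γ.IsInternal x},
      y ≠ x ∧ Γ.edge.r x.1 y.1 := fun x => by
    obtain ⟨y, hy, hxy⟩ := x.2
    exact ⟨⟨y, x.1, hy.symm, Γ.edge.symm' hxy⟩, fun e => hy (congrArg Subtype.val e), hxy⟩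
  choose p hp1 hp2 using hp
  have hpp : ∀ x, p (p x) = x := fun x => by
    rcases h (p x).1 (p (p x)).1 x.1 (hp2 _) (Γ.edge.symm' (hp2 x)) with e | e | e
    · exact absurd (Subtype.ext e.symm) (hp1 (p x))
    · exact absurd (Subtype.ext e) (hp1 x)
    · exact Subtype.ext e
  rw [Nat.card_eq_fintype_card, even_iff_two_dvd]
  -- an involution of a set of odd cardinality has a fixed point
  by_contra hd
  obtain ⟨a, ha⟩ := Equiv.Perm.exists_fixed_point_of_prime (p := 2) (n := 1) hd
    (σ := ⟨p, p, hpp, hpp⟩) (Equiv.ext fun x => by simpa [pow_succ] using hpp x)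
  exact hp1 a ha

/-- Every vertex has at least two internal half-edges: the edge of a single one would be a bridge. -/
theorem IsFeynman.two_le_card_internal [Finite α] (h : Γ.IsFeynman) (v : Quotient Γ.vert) :
    2 ≤ Nat.card {x // Γ.IsInternal x ∧ Quotient.mk Γ.vert x = v} := by
  by_contra hlt
  have hsub : ∀ x y, Γ.IsInternal x → Quotient.mk Γ.vert x = v → Γ.IsInternal y →
      Quotient.mk Γ.vert y = v → x = y := by
    intro x y h1 h2 h3 h4
    have : Subsingleton {x // Γ.IsInternal x ∧ Quotient.mk Γ.vert x = v} :=
      (Finite.card_le_one_iff_subsingleton).1 (by omega)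
    exact congrArg Subtype.val (Subsingleton.elim
      (⟨x, h1, h2⟩ : {x // Γ.IsInternal x ∧ Quotient.mk Γ.vert x = v}) ⟨y, h3, h4⟩)
  obtain ⟨a, ha⟩ := Quotient.exists_rep v
  obtain ⟨x₀, hx₀⟩ := h.has_internal
  have hvert : ∀ y z, Quotient.mk Γ.vert y = v → Γ.vert.r y z → Quotient.mk Γ.vert z = v :=
    fun y z h1 h2 => (Quotient.sound (Γ.vert.symm' h2)).trans h1
  -- with one internal half-edge the vertex is separated by cutting its edge, with none it is a
  -- component of its own
  by_cases hex : ∃ x, Γ.IsInternal x ∧ Quotient.mk Γ.vert x = v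
  · obtain ⟨x, hx, hxv⟩ := hex
    obtain ⟨y, hy, hxy⟩ := id hx
    have hyi : Γ.IsInternal y := ⟨x, hy.symm, Γ.edge.symm' hxy⟩
    have := Γ.conn_mem (A := {z | Quotient.mk Γ.vert z = v}) hvert (fun z w hz hzS hwS hzw => ?_)
      (h.irreducible x y hy.symm hxy) hxv
    · exact hy (hsub y x hyi this hx hxv)
    · by_cases hzw' : w = z
      · exact hzw' ▸ hz
      · exact absurd (Or.inl (hsub z x ⟨w, hzw', hzw⟩ hz hx hxv)) hzS
  · have := Γ.conn_mem (A := {z | Quotient.mk Γ.vert z = v}) hvert (fun z w hz _ _ hzw => ?_)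
      (h.connected a x₀) ha
    · exact hex ⟨x₀, hx₀, this⟩
    · by_cases hzw' : w = z
      · exact hzw' ▸ hz
      · exact absurd ⟨z, ⟨w, hzw', hzw⟩, hz⟩ hex

theorem card_internal_eq_sum [Finite α] [Fintype (Quotient Γ.vert)] :
    Nat.card {x // Γ.IsInternal x} =
      ∑ v, Nat.card {x // Γ.IsInternal x ∧ Quotient.mk Γ.vert x = v} := by
  rw [Nat.card_eq_sum_fiber fun x : {x // Γ.IsInternal x} => Quotient.mk Γ.vert x.1]
  refine Finset.sum_congr rfl fun v _ => Nat.card_congr ?_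
  exact Equiv.subtypeSubtypeEquivSubtypeInter Γ.IsInternal (fun x => Quotient.mk Γ.vert x = v)

theorem IsFeynman.two_mul_numVertices_le [Finite α] (h : Γ.IsFeynman) :
    2 * Γ.numVertices ≤ Nat.card {x // Γ.IsInternal x} := by
  have := Fintype.ofFinite (Quotient Γ.vert)
  rw [card_internal_eq_sum, numVertices, Nat.card_eq_fintype_card, ← Finset.card_univ, mul_comm,
    ← smul_eq_mul]
  exact Finset.card_nsmul_le_sum _ _ _ fun v _ => h.two_le_card_internal v

theorem IsFeynman.two_mul_numEdges [Finite α] (h : Γ.IsFeynman) :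
    2 * Γ.numEdges = Nat.card {x // Γ.IsInternal x} :=
  Nat.mul_div_cancel' (even_iff_two_dvd.1 (even_card_internal h.edge_le_two))

theorem IsFeynman.two_mul_loops [Finite α] (h : Γ.IsFeynman) :
    2 * Γ.loops + 2 * Γ.numVertices = Nat.card {x // Γ.IsInternal x} + 2 := by
  have h1 := h.two_mul_numEdges
  have h2 := h.two_mul_numVertices_le
  unfold loops
  omega

theorem IsFeynman.one_le_loops [Finite α] (h : Γ.IsFeynman) : 1 ≤ Γ.loops := by
  have h1 := h.two_mul_loops
  have h2 := h.two_mul_numVertices_le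
  omega

theorem card_internal_of_legs (h : ∀ x, Γ.IsLeg x) : Nat.card {x // Γ.IsInternal x} = 0 := by
  have : IsEmpty {x // Γ.IsInternal x} := ⟨fun x => h x.1 x.2⟩
  exact Nat.card_of_isEmpty

/-- The exponent of the monomial represented by a connected graph. -/
noncomputable def exponent [Finite α] (Γ : FGraph α) : FeynmanGraph →₀ ℕ :=
  if h : Γ.IsFeynman then Finsupp.single (Γ.cls h) 1 else 0

theorem toAlg_eq_monomial (𝕜 : Type*) [Field 𝕜] [Finite α] (h : Γ.IsFeynman ∨ ∀ x, Γ.IsLeg x) :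
    Γ.toAlg 𝕜 = MvPolynomial.monomial Γ.exponent 1 := by
  unfold exponent
  split_ifs with h'
  · rw [toAlg_of_isFeynman 𝕜 h']; rfl
  · rw [toAlg_of_legs 𝕜 (h.resolve_left h')]; rfl

/-- The exponent of the monomial represented by a subgraph. -/
noncomputable def subExponent [Finite α] (Γ : FGraph α) (S : Set α) : FeynmanGraph →₀ ℕ :=
  ∑ᶠ c : Quotient (Γ.conn S), (Γ.component S c).exponent

theorem IsFeynman.compsProd_eq_monomial (𝕜 : Type*) [Field 𝕜] [Finite α] (h : Γ.IsFeynman)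
    (hS : Γ.IsSub S) : (Γ.cut S).compsProd 𝕜 = MvPolynomial.monomial (Γ.subExponent S) 1 := by
  have := Fintype.ofFinite (Quotient (Γ.conn S))
  rw [← finprod_component, finprod_eq_prod_of_fintype, subExponent, finsum_eq_sum_of_fintype]
  rw [MvPolynomial.monomial_sum_one]
  exact Finset.prod_congr rfl fun c _ => toAlg_eq_monomial 𝕜 (h.component hS c)

/-- The total loop number of a monomial. -/
noncomputable def _root_.FeynmanGraph.degree (m : FeynmanGraph →₀ ℕ) : ℕ :=
  m.sum fun γ k => k * γ.loops

theorem _root_.FeynmanGraph.degree_add (m m' : FeynmanGraph →₀ ℕ) :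
    FeynmanGraph.degree (m + m') = FeynmanGraph.degree m + FeynmanGraph.degree m' :=
  Finsupp.sum_add_index' (by simp) (fun _ _ _ => add_mul _ _ _)

theorem _root_.FeynmanGraph.degree_single (γ : FeynmanGraph) (k : ℕ) :
    FeynmanGraph.degree (Finsupp.single γ k) = k * γ.loops :=
  Finsupp.sum_single_index (by simp)

theorem _root_.FeynmanGraph.degree_sum {ι : Type*} (s : Finset ι) (f : ι → FeynmanGraph →₀ ℕ) :
    FeynmanGraph.degree (∑ i ∈ s, f i) = ∑ i ∈ s, FeynmanGraph.degree (f i) :=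
  map_sum (⟨⟨FeynmanGraph.degree, rfl⟩, FeynmanGraph.degree_add⟩ : (FeynmanGraph →₀ ℕ) →+ ℕ) f s

theorem component_isInternal (hS : Γ.EdgeClosed S) (c : Quotient (Γ.conn S)) (x) :
    (Γ.component S c).IsInternal x ↔ x.1 ∈ S ∧ Γ.IsInternal x.1 := by
  constructor
  · rintro ⟨y, hy, h | ⟨h1, h2, h3⟩⟩
    · exact absurd (Subtype.ext h.symm) hy
    · exact ⟨h1, y.1, fun e => hy (Subtype.ext e), h3⟩
  · rintro ⟨h1, y, hy, hxy⟩
    have hyS := hS _ h1 _ hxy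
    exact ⟨⟨y, (Quotient.sound ((Γ.conn S).symm' (Γ.conn_edge h1 hyS hxy))).trans x.2⟩,
      fun e => hy (congrArg Subtype.val e), Or.inr ⟨h1, hyS, hxy⟩⟩

theorem sum_card_internal_component [Finite α] (hS : Γ.IsSub S) [Fintype (Quotient (Γ.conn S))] :
    ∑ c, Nat.card {x // (Γ.component S c).IsInternal x} = Nat.card S := by
  rw [Nat.card_eq_sum_fiber fun x : S => Quotient.mk (Γ.conn S) x.1]
  refine Finset.sum_congr rfl fun c _ => ?_
  refine (Nat.card_congr (Equiv.subtypeEquivRight fun x => component_isInternal hS.edgeClosed c x)).trans ?_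
  refine Nat.card_congr ⟨fun x => ⟨⟨x.1.1, x.2.1⟩, x.1.2⟩,
    fun x => ⟨⟨x.1.1, x.2⟩, x.1.2, (hS.1 _ x.1.2).1⟩, fun _ => rfl, fun _ => rfl⟩

theorem sum_numVertices_component [Finite α] (Γ : FGraph α) (S : Set α)
    [Fintype (Quotient (Γ.conn S))] :
    ∑ c, (Γ.component S c).numVertices = Γ.numVertices := by
  rw [numVertices, Nat.card_eq_sum_fiber (Quotient.map' (s₁ := Γ.vert) (s₂ := Γ.conn S) id
    fun a b hab => Γ.conn_vert hab)]
  refine Finset.sum_congr rfl fun c _ => ?_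
  refine Nat.card_congr (Equiv.ofBijective
    (fun v => ⟨Quotient.map' (s₁ := (Γ.component S c).vert) (s₂ := Γ.vert) Subtype.val
      (fun a b hab => hab) v, ?_⟩) ⟨?_, ?_⟩)
  · induction v using Quotient.inductionOn with
    | h x => exact x.2
  · rintro ⟨a⟩ ⟨b⟩ hab
    have hab' := congrArg Subtype.val hab
    exact Quotient.sound (s := (Γ.component S c).vert) (Quotient.exact (s := Γ.vert) hab')
  · rintro ⟨⟨a⟩, ha⟩
    exact ⟨Quotient.mk (Γ.component S c).vert ⟨a, ha⟩, rfl⟩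

/-- Twice the loop number of a subgraph, by Euler's formula for its components. -/
theorem IsFeynman.degree_subExponent [Finite α] (h : Γ.IsFeynman) (hS : Γ.IsSub S) :
    2 * FeynmanGraph.degree (Γ.subExponent S) + 2 * Γ.numVertices =
      Nat.card S + 2 * Nat.card (Quotient (Γ.conn S)) := by
  have := Fintype.ofFinite (Quotient (Γ.conn S))
  rw [subExponent, finsum_eq_sum_of_fintype, FeynmanGraph.degree_sum,
    ← sum_numVertices_component Γ S, ← sum_card_internal_component hS, Finset.mul_sum,
    Finset.mul_sum, Nat.card_eq_fintype_card, ← Finset.card_univ, Finset.card_eq_sum_ones,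
    Finset.mul_sum, ← Finset.sum_add_distrib, ← Finset.sum_add_distrib]
  refine Finset.sum_congr rfl fun c _ => ?_
  by_cases hc : (Γ.component S c).IsFeynman
  · rw [exponent, dif_pos hc, FeynmanGraph.degree_single, one_mul, loops_cls, hc.two_mul_loops,
      mul_one]
  · have hl := (h.component hS c).resolve_left hc
    have hV : (Γ.component S c).numVertices = 1 := by
      obtain ⟨x, rfl⟩ := Quotient.exists_rep c
      refine Nat.card_eq_one_iff_unique.2 ⟨⟨?_⟩, ⟨Quotient.mk _ ⟨x, rfl⟩⟩⟩
      rintro ⟨a⟩ ⟨b⟩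
      refine Quotient.sound (s := (Γ.component S _).vert) ?_
      have hab : (Γ.conn S).r a.1 b.1 := Quotient.exact (a.2.trans b.2.symm)
      refine ((Γ.conn_mem (A := {z | Γ.vert.r a.1 z}) (fun y z h1 h2 => Γ.vert.trans' h1 h2)
        (fun y z h1 hy hz hyz => ?_) hab (Γ.vert.refl' _)) : Γ.vert.r a.1 b.1)
      by_cases hzy : z = y
      · exact hzy ▸ h1
      · refine absurd ?_ (hl ⟨y, (Quotient.sound ((Γ.conn S).symm' (Γ.conn_vert h1))).trans a.2⟩)
        exact (component_isInternal hS.edgeClosed _ _).2 ⟨hy, z, hzy, hyz⟩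
    rw [exponent, dif_neg hc, card_internal_of_legs hl, hV]
    rfl

/-- The components with exactly two legs. -/
abbrev Propagators (Γ : FGraph α) (S : Set α) : Type :=
  {c : Quotient (Γ.conn S) // Nat.card {y // Quotient.mk (Γ.conn S) y = c ∧ y ∉ S} = 2}

theorem inPropagator_iff_card {x : α} : Γ.InPropagator S x ↔
    Nat.card {y // Quotient.mk (Γ.conn S) y = Quotient.mk (Γ.conn S) x ∧ y ∉ S} = 2 := by
  unfold InPropagator
  rw [Nat.card_congr (Equiv.subtypeEquivRight fun y => and_congr_left' ?_)]
  exact ⟨fun h => Quotient.sound ((Γ.conn S).symm' h), fun h => (Γ.conn S).symm' (Quotient.exact h)⟩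

theorem IsFeynman.card_quotient_contract [Finite α] (h : Γ.IsFeynman) (hS : Γ.IsSub S) :
    (Γ.contract S).numVertices + Nat.card (Γ.Propagators S) = Nat.card (Quotient (Γ.conn S)) := by
  have e1 := Nat.card_add_card_not (fun _ : Quotient (Γ.conn S) => True)
    (fun c => Nat.card {y // Quotient.mk (Γ.conn S) y = c ∧ y ∉ S} = 2)
  simp only [true_and] at e1
  rw [← Nat.card_congr (Equiv.subtypeUnivEquiv (p := fun _ : Quotient (Γ.conn S) => True)
    fun _ => trivial), e1, add_comm]
  congr 1
  refine Nat.card_congr (Equiv.ofBijective (fun v => ⟨Quotient.map' (s₁ := (Γ.contract S).vert)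
    (s₂ := Γ.conn S) Subtype.val (fun a b hab => hab) v, ?_⟩) ⟨?_, ?_⟩)
  · induction v using Quotient.inductionOn with
    | h x => exact fun hx => x.2.2 (inPropagator_iff_card.2 hx)
  · rintro ⟨a⟩ ⟨b⟩ hab
    have hab' := congrArg Subtype.val hab
    exact Quotient.sound (s := (Γ.contract S).vert) (Quotient.exact (s := Γ.conn S) hab')
  · rintro ⟨⟨a⟩, ha⟩
    have h2 := h.two_le_card_legs hS a
    have : Nonempty {y // (Γ.conn S).r a y ∧ y ∉ S} := (Nat.card_pos_iff.1 (by omega)).1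
    obtain ⟨y, hy, hyS⟩ := this
    have hq : Quotient.mk (Γ.conn S) y = Quotient.mk (Γ.conn S) a :=
      Quotient.sound ((Γ.conn S).symm' hy)
    exact ⟨Quotient.mk (Γ.contract S).vert ⟨y, hyS, fun hp => ha (by
      have := inPropagator_iff_card.1 hp
      rw [hq] at this; exact this)⟩, Subtype.ext hq⟩

theorem card_inPropagator [Finite α] (Γ : FGraph α) (S : Set α) :
    Nat.card {x // x ∉ S ∧ Γ.InPropagator S x} = 2 * Nat.card (Γ.Propagators S) := by
  have := Fintype.ofFinite (Γ.Propagators S)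
  rw [Nat.card_eq_sum_fiber (fun x : {x // x ∉ S ∧ Γ.InPropagator S x} =>
    (⟨Quotient.mk _ x.1, inPropagator_iff_card.1 x.2.2⟩ : Γ.Propagators S)),
    Nat.card_eq_fintype_card, ← Finset.card_univ, mul_comm, Finset.card_eq_sum_ones,
    Finset.sum_mul]
  refine Finset.sum_congr rfl fun c _ => ?_
  rw [one_mul]
  refine Eq.trans (Nat.card_congr ⟨fun x => ⟨x.1.1, congrArg Subtype.val x.2, x.1.2.1⟩,
    fun x => ⟨⟨x.1, x.2.2, inPropagator_iff_card.2 (by rw [x.2.1]; exact c.2)⟩, Subtype.ext x.2.1⟩,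
    fun _ => rfl, fun _ => rfl⟩) c.2

/-- The loop number is additive under contraction. -/
theorem IsFeynman.loops_contract [Finite α] (h : Γ.IsFeynman) (hS : Γ.IsSub S)
    (hne : S ≠ Γ.internals) :
    FeynmanGraph.degree (Γ.subExponent S) + (Γ.contract S).loops = Γ.loops := by
  have h1 := h.degree_subExponent hS
  have h2 := (h.contract hS hne).two_mul_loops
  have h3 := h.two_mul_loops
  have h4 := h.card_quotient_contract hS
  have h5 := card_inPropagator Γ S
  have h6 : Nat.card {x // Γ.IsInternal x} = Nat.card S + Nat.card {x // x ∉ S ∧ Γ.InPropagator S x}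
      + Nat.card {x // (Γ.contract S).IsInternal x} := by
    rw [Nat.card_add_card_not Γ.IsInternal (· ∈ S), add_assoc]
    congr 1
    · exact Nat.card_congr (Equiv.subtypeEquivRight fun x => and_iff_right_of_imp fun hx => (hS.1 x hx).1)
    · rw [Nat.card_add_card_not _ (Γ.InPropagator S)]
      congr 1
      · refine Nat.card_congr (Equiv.subtypeEquivRight fun x => ⟨fun hx => ⟨hx.1.2, hx.2⟩,
          fun hx => ⟨⟨?_, hx.1⟩, hx.2⟩⟩)
        by_contra hl
        exact hne (h.eq_internals_of_leg hS hl hx.2)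
      · exact Nat.card_congr ⟨fun x => ⟨⟨x.1, x.2.1.2, x.2.2⟩, (h.contract_isInternal hS _).2 x.2.1.1⟩,
          fun x => ⟨x.1.1, ⟨(h.contract_isInternal hS _).1 x.2, x.1.2.1⟩, x.1.2.2⟩,
          fun _ => rfl, fun _ => rfl⟩
  omega

end FGraph


/-! ### One-loop graphs and maximal subgraphs -/

namespace FGraph

variable {α β : Type} {Γ : FGraph α} {S T : Set α}

theorem card_subtype_sub_pair [Finite α] {U : Set α} {x y : α} (hx : x ∈ U) (hy : y ∈ U)
    (hne : x ≠ y) : Nat.card (U \ {x, y} : Set α) + 2 = Nat.card U := by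
  have h1 : ({x, y} : Set α) ⊆ U := by rintro z (rfl | rfl) <;> assumption
  have h2 := Set.ncard_sdiff_add_ncard_of_subset h1
  rw [Set.ncard_pair hne] at h2
  exact h2

/-- Without bridgeless parts, the edges of a graph form a forest: deleting its bridges one by one
raises the number of components by one each time. -/
theorem card_of_forest [Finite α]
    (h2 : ∀ x y z, Γ.edge.r x y → Γ.edge.r x z → x = y ∨ x = z ∨ y = z) (n : ℕ) :
    ∀ U : Set α, Nat.card U = n → U ⊆ Γ.internals → Γ.EdgeClosed U →
      (∀ T, Γ.IsSub T → T ⊆ U → T = ∅) →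
      Nat.card U + 2 * Nat.card (Quotient (Γ.conn U)) = 2 * Γ.numVertices := by
  induction n using Nat.strong_induction_on with
  | _ n ih =>
  intro U hn hUi hUe hU
  by_cases hemp : U = ∅
  · subst hemp
    have : Γ.conn ∅ = Γ.vert := by
      refine le_antisymm (sup_le le_rfl ?_) le_sup_left
      rintro x y (rfl | ⟨hx, -⟩)
      · exact Setoid.refl' _ _
      · exact absurd hx (Set.notMem_empty _)
    rw [this, Nat.card_of_isEmpty, zero_add]
    rfl
  have hns : ¬ Γ.IsSub U := fun h => hemp (hU U h subset_rfl)
  -- `U` is not a subgraph, so it has a bridge `{x, y}`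
  have : ∃ x ∈ U, ∃ y ∈ U, x ≠ y ∧ Γ.edge.r x y ∧ ¬ (Γ.conn (U \ {x, y})).r x y := by
    by_contra hc
    push Not at hc
    exact hns ⟨fun x hx => ⟨hUi hx, hUe x hx⟩, hc⟩
  obtain ⟨x, hx, y, hy, hne, hxy, hb⟩ := this
  have hcard := card_subtype_sub_pair hx hy hne
  have hedge : ∀ a b, a ∈ ({x, y} : Set α) → Γ.edge.r a b → b ∈ ({x, y} : Set α) := by
    rintro a b (rfl | rfl) hab
    · rcases h2 _ _ _ hxy hab with e | e | e
      · exact absurd e hne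
      · exact Or.inl e.symm
      · exact Or.inr e.symm
    · rcases h2 _ _ _ (Γ.edge.symm' hxy) hab with e | e | e
      · exact absurd e.symm hne
      · exact Or.inr e.symm
      · exact Or.inl e.symm
  have hsup : Γ.conn U = Γ.conn (U \ {x, y}) ⊔ Γ.edgeOn {x, y} := by
    refine le_antisymm (sup_le (le_sup_left.trans le_sup_left) ?_)
      (sup_le (Γ.conn_mono Set.sdiff_subset) (le_trans (Γ.edgeOn_mono ?_) le_sup_right))
    · rintro a b (rfl | ⟨ha, hb, hab⟩)
      · exact Setoid.refl' _ _
      · by_cases hap : a ∈ ({x, y} : Set α)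
        · exact Setoid.sup_right (Or.inr ⟨hap, hedge a b hap hab, hab⟩)
        · exact Setoid.sup_left (Γ.conn_edge ⟨ha, hap⟩
            ⟨hb, fun h => hap (hedge b a h (Γ.edge.symm' hab))⟩ hab)
    · rintro z (rfl | rfl) <;> assumption
  -- adding the bridge joins two components
  have hq := Setoid.card_quotient_sup_pair (Γ.conn (U \ {x, y})) (Γ.edgeOn {x, y}) hb (by
    intro a b
    constructor
    · rintro (h | ⟨ha, hb, -⟩)
      · exact Or.inl h
      · rcases ha with rfl | rfl <;> rcases hb with rfl | rfl <;> simp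
    · rintro (h | ⟨rfl, rfl⟩ | ⟨rfl, rfl⟩)
      · exact Or.inl h
      · exact Or.inr ⟨by simp, by simp, hxy⟩
      · exact Or.inr ⟨by simp, by simp, Γ.edge.symm' hxy⟩)
  rw [← hsup] at hq
  have := ih (Nat.card (U \ {x, y} : Set α)) (by omega) _ rfl (Set.sdiff_subset.trans hUi)
    (fun a ha b hab => ⟨hUe a ha.1 b hab, fun h => ha.2 (hedge b a h (Γ.edge.symm' hab))⟩)
    (fun T hT hTU => hU T hT (hTU.trans Set.sdiff_subset))
  omega

/-- A graph without proper subgraphs has one loop: without one internal edge it is a tree. -/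
theorem IsFeynman.loops_eq_one [Finite α] (h : Γ.IsFeynman)
    (hT : ∀ T, Γ.IsSub T → T = ∅ ∨ T = Γ.internals) : Γ.loops = 1 := by
  obtain ⟨x, y, hne, hxy⟩ := h.has_internal
  have hx : x ∈ Γ.internals := ⟨y, hne, hxy⟩
  have hy : y ∈ Γ.internals := ⟨x, hne.symm, Γ.edge.symm' hxy⟩
  have hirr : (Γ.conn (Γ.internals \ {x, y})).r x y :=
    h.isSub_internals.2 x hx y hy hne.symm hxy
  -- without the edge `{x, y}` there are no subgraphs left, but the graph is still connected
  have h1 := card_of_forest h.edge_le_two _ (Γ.internals \ {x, y}) rfl Set.sdiff_subset ?_ ?_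
  · have hconn : Γ.conn (Γ.internals \ {x, y}) = ⊤ := by
      rw [eq_top_iff]
      rintro a b -
      refine Γ.conn_mem (A := {z | (Γ.conn (Γ.internals \ {x, y})).r a z})
        (fun z w hz hzw => Setoid.trans' _ hz (Γ.conn_vert hzw))
        (fun z w hz _ _ hzw =>
          show (Γ.conn (Γ.internals \ {x, y})).r a w from Setoid.trans' _ hz ?_) (h.connected a b)
        (show (Γ.conn (Γ.internals \ {x, y})).r a a from Setoid.refl' _ _)
      by_cases hzw' : w = z
      · exact hzw' ▸ Setoid.refl' _ _
      have hzi : z ∈ Γ.internals := ⟨w, hzw', hzw⟩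
      have hwi : w ∈ Γ.internals := internals_edgeClosed z hzi w hzw
      by_cases hzp : z ∈ ({x, y} : Set α)
      · rcases hzp with rfl | rfl
        · rcases h.edge_le_two _ _ _ hxy hzw with e | e | e
          · exact absurd e.symm hne
          · exact absurd e.symm hzw'
          · exact e ▸ hirr
        · rcases h.edge_le_two _ _ _ (Γ.edge.symm' hxy) hzw with e | e | e
          · exact absurd e hne
          · exact absurd e.symm hzw'
          · exact e ▸ Setoid.symm' _ hirr
      · by_cases hwp : w ∈ ({x, y} : Set α)
        · rcases hwp with rfl | rfl
          · rcases h.edge_le_two _ _ _ hxy (Γ.edge.symm' hzw) with e | e | e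
            · exact absurd e.symm hne
            · exact absurd e hzw'
            · exact e ▸ Setoid.symm' _ hirr
          · rcases h.edge_le_two _ _ _ (Γ.edge.symm' hxy) (Γ.edge.symm' hzw) with e | e | e
            · exact absurd e hne
            · exact absurd e hzw'
            · exact e ▸ hirr
        · exact Γ.conn_edge ⟨hzi, hzp⟩ ⟨hwi, hwp⟩ hzw
    have h3 : Nat.card (Quotient (Γ.conn (Γ.internals \ {x, y}))) = 1 := by
      rw [hconn]
      exact Nat.card_eq_one_iff_unique.2 ⟨⟨by rintro ⟨a⟩ ⟨b⟩; exact Quotient.sound (s := ⊤) trivial⟩,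
        ⟨Quotient.mk _ x⟩⟩
    have h4 := card_subtype_sub_pair hx hy hne.symm
    have h5 := h.two_mul_loops
    have h6 : Nat.card Γ.internals = Nat.card {x // Γ.IsInternal x} := rfl
    omega
  · rintro a ⟨ha, hap⟩ b hab
    refine ⟨internals_edgeClosed a ha b hab, fun hb => hap ?_⟩
    rcases hb with rfl | rfl
    · rcases h.edge_le_two _ _ _ hxy (Γ.edge.symm' hab) with e | e | e
      · exact absurd e.symm hne
      · exact Or.inl e.symm
      · exact Or.inr e.symm
    · rcases h.edge_le_two _ _ _ (Γ.edge.symm' hxy) (Γ.edge.symm' hab) with e | e | e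
      · exact absurd e hne
      · exact Or.inr e.symm
      · exact Or.inl e.symm
  · intro T hTs hTU
    refine (hT T hTs).resolve_right fun e => ?_
    exact (hTU (e ▸ hx)).2 (Or.inl rfl)

/-- At every vertex of a one-loop graph exactly two half-edges are internal, and a subgraph contains
both as soon as it contains one. -/
theorem IsFeynman.isSub_of_loops_eq_one [Finite α] (h : Γ.IsFeynman) (hl : Γ.loops = 1)
    (hS : Γ.IsSub S) : S = ∅ ∨ S = Γ.internals := by
  have := Fintype.ofFinite (Quotient Γ.vert)
  have h1 := h.two_mul_loops
  have hv : ∀ v, Nat.card {x // Γ.IsInternal x ∧ Quotient.mk Γ.vert x = v} = 2 := by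
    have h2 : ∑ v : Quotient Γ.vert, Nat.card {x // Γ.IsInternal x ∧ Quotient.mk Γ.vert x = v} =
        ∑ v : Quotient Γ.vert, 2 := by
      rw [← card_internal_eq_sum, Finset.sum_const, Finset.card_univ, ← Nat.card_eq_fintype_card,
        smul_eq_mul]
      unfold numVertices at h1
      omega
    intro v
    exact ((Finset.sum_eq_sum_iff_of_le fun v _ => h.two_le_card_internal v).1 h2.symm v
      (Finset.mem_univ v)).symm
  rcases S.eq_empty_or_nonempty with he | ⟨x, hx⟩
  · exact Or.inl he
  refine Or.inr (Set.Subset.antisymm hS.subset fun y hy => ?_)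
  -- all internal half-edges at a vertex that meets `S` lie in `S`
  have key : ∀ a b, (Γ.conn S).r x a → Γ.vert.r a b → Γ.IsInternal b → b ∈ S := by
    intro a b hxa hab hb
    set c := Quotient.mk (Γ.conn S) x with hc
    have hF : (Γ.component S c).IsFeynman := by
      refine (h.component hS c).resolve_right fun hl' => hl' ⟨x, rfl⟩ ?_
      exact (component_isInternal hS.edgeClosed _ _).2 ⟨hx, (hS.1 x hx).1⟩
    have hbc : Quotient.mk (Γ.conn S) b = c :=
      Quotient.sound (Setoid.symm' _ (Setoid.trans' _ hxa (Γ.conn_vert hab)))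
    have h3 := hF.two_le_card_internal (Quotient.mk _ ⟨b, hbc⟩)
    have h4 := hv (Quotient.mk _ b)
    by_contra hbS
    have h5 : Nat.card {x // (Γ.component S c).IsInternal x ∧
        Quotient.mk (Γ.component S c).vert x = Quotient.mk _ ⟨b, hbc⟩} <
        Nat.card {x // Γ.IsInternal x ∧ Quotient.mk Γ.vert x = Quotient.mk _ b} := by
      have hi : ∀ z : {x // (Γ.component S c).IsInternal x ∧
          Quotient.mk (Γ.component S c).vert x = Quotient.mk _ ⟨b, hbc⟩},
          z.1.1 ∈ S ∧ Γ.IsInternal z.1.1 := fun z =>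
        (component_isInternal hS.edgeClosed _ _).1 z.2.1
      have := Fintype.ofFinite α
      rw [Nat.card_eq_fintype_card, Nat.card_eq_fintype_card]
      refine Fintype.card_lt_of_injective_of_notMem (b := ⟨b, hb, rfl⟩)
        (fun z => ⟨z.1.1, (hi z).2, Quotient.sound (s := Γ.vert)
          (Quotient.exact (s := (Γ.component S c).vert) z.2.2)⟩) ?_ ?_
      · intro z w hzw
        have hzw' := congrArg Subtype.val hzw
        exact Subtype.ext (Subtype.ext hzw')
      · rintro ⟨z, hz⟩
        have hz' := congrArg Subtype.val hz
        have := (hi z).1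
        simp only at hz'
        rw [hz'] at this
        exact hbS this
    omega
  have hcl : (Γ.conn S).r x y := by
    refine Γ.conn_mem (A := {z | (Γ.conn S).r x z})
        (fun z w hz hzw => Setoid.trans' _ hz (Γ.conn_vert hzw))
        (fun z w hz _ _ hzw => show (Γ.conn S).r x w from Setoid.trans' _ hz ?_) (h.connected x y)
        (show (Γ.conn S).r x x from Setoid.refl' _ _)
    by_cases hzw' : w = z
    · exact hzw' ▸ Setoid.refl' _ _
    · have hzS := key z z hz (Γ.vert.refl' _) ⟨w, hzw', hzw⟩
      exact Γ.conn_edge hzS (hS.edgeClosed z hzS w hzw) hzw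
  exact key y y hcl (Γ.vert.refl' _) hy

theorem IsFeynman.internals_ne_empty (h : Γ.IsFeynman) : Γ.internals ≠ ∅ := by
  obtain ⟨x, hx⟩ := h.has_internal
  exact Set.Nonempty.ne_empty ⟨x, hx⟩

/-- The cograph of a subgraph has one loop if and only if the subgraph is maximal. -/
theorem IsFeynman.loops_contract_eq_one_iff [Finite α] (h : Γ.IsFeynman) (hS : Γ.IsSub S)
    (hne : S ≠ Γ.internals) :
    (Γ.contract S).loops = 1 ↔ ∀ T, Γ.IsSub T → S ⊆ T → T = S ∨ T = Γ.internals := by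
  have hF := h.contract hS hne
  have hb := h.bijective_preimage hS
  have hpS : (Subtype.val ⁻¹' S : Set {x // x ∉ S ∧ ¬ Γ.InPropagator S x}) = ∅ := by
    ext x
    exact iff_of_false x.2.1 (Set.notMem_empty _)
  have hpI : (Subtype.val ⁻¹' Γ.internals : Set {x // x ∉ S ∧ ¬ Γ.InPropagator S x}) =
      (Γ.contract S).internals := by
    ext x
    exact (h.contract_isInternal hS x).symm
  constructor
  · intro hl T hT hST
    rcases hF.isSub_of_loops_eq_one hl (h.isSub_contract hS hT hST) with e | e
    · have := @hb.1 ⟨T, hT, hST⟩ ⟨S, hS, subset_rfl⟩ (Subtype.ext (e.trans hpS.symm))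
      exact Or.inl (congrArg Subtype.val this)
    · have := @hb.1 ⟨T, hT, hST⟩ ⟨_, h.isSub_internals, hS.subset⟩ (Subtype.ext (e.trans hpI.symm))
      exact Or.inr (congrArg Subtype.val this)
  · intro hm
    refine hF.loops_eq_one fun T' hT' => ?_
    obtain ⟨⟨T, hT, hST⟩, hTT⟩ := hb.2 ⟨T', hT'⟩
    have hTT' : (Subtype.val ⁻¹' T : Set {x // x ∉ S ∧ ¬ Γ.InPropagator S x}) = T' :=
      congrArg Subtype.val hTT
    rcases hm T hT hST with rfl | rfl
    · exact Or.inl (hTT'.symm.trans hpS)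
    · exact Or.inr (hTT'.symm.trans hpI)

/-- The maximal forests are the subgraphs whose cograph has one loop. -/
theorem IsFeynman.maxf_eq [Finite α] (h : Γ.IsFeynman) : Γ.maxf =
    Nat.card {S // Γ.IsSub S ∧ S ≠ Γ.internals ∧ (Γ.contract S).loops = 1} := by
  refine Nat.card_congr (Equiv.subtypeEquivRight fun S => and_congr_right fun hS =>
    and_congr_right fun hne => (h.loops_contract_eq_one_iff hS hne).symm)

theorem IsFeynman.maxf_pos [Finite α] (h : Γ.IsFeynman) : 0 < Γ.maxf := by
  obtain ⟨S, ⟨hS, hne⟩, hmax⟩ := Set.Finite.exists_maximal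
    (Set.toFinite {S : Set α | Γ.IsSub S ∧ S ≠ Γ.internals})
    ⟨∅, isSub_empty, h.internals_ne_empty.symm⟩
  have : Nonempty {S : Set α // Γ.IsSub S ∧ S ≠ {x | Γ.IsInternal x} ∧
      ∀ T, Γ.IsSub T → S ⊆ T → T = S ∨ T = {x | Γ.IsInternal x}} := by
    refine ⟨⟨S, hS, hne, fun T hT hST => ?_⟩⟩
    by_cases hTi : T = Γ.internals
    · exact Or.inr hTi
    · exact Or.inl (Set.Subset.antisymm (hmax ⟨hT, hTi⟩ hST) hST)
  exact Nat.card_pos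

/-! ### Trivial terms of the coproduct -/

theorem cut_empty_isLeg (x) : (Γ.cut ∅).IsLeg x :=
  isLeg_of_edge_bot (fun x y (h : (Γ.edgeOn ∅).r x y) =>
    h.resolve_right fun h => absurd h.1 (Set.notMem_empty _)) x

theorem cut_internals (Γ : FGraph α) : Γ.cut Γ.internals = Γ := by
  refine ext' rfl (le_antisymm (Γ.edgeOn_le _) fun x y hxy => ?_)
  by_cases hne : y = x
  · exact Or.inl hne.symm
  · exact Or.inr ⟨⟨y, hne, hxy⟩, ⟨x, Ne.symm hne, Γ.edge.symm' hxy⟩, hxy⟩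

theorem compsProd_cut_empty (𝕜 : Type*) [Field 𝕜] [Finite α] (Γ : FGraph α) :
    (Γ.cut ∅).compsProd 𝕜 = 1 := compsProd_of_legs 𝕜 cut_empty_isLeg

theorem conn_empty (Γ : FGraph α) : Γ.conn ∅ = Γ.vert := by
  refine le_antisymm (sup_le le_rfl ?_) le_sup_left
  rintro x y (rfl | ⟨hx, -⟩)
  · exact Setoid.refl' _ _
  · exact absurd hx (Set.notMem_empty _)

theorem IsFeynman.notInPropagator_empty (h : Γ.IsFeynman) (x : α) : ¬ Γ.InPropagator ∅ x := by
  intro hp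
  have h3 := h.three_le_valence (Quotient.mk _ x)
  rw [valence_mk] at h3
  unfold InPropagator at hp
  rw [conn_empty, ← Nat.card_congr (Equiv.subtypeEquivRight fun y =>
    (show Γ.vert.r y x ↔ _ from ⟨fun h => ⟨Γ.vert.symm' h, Set.notMem_empty _⟩,
      fun h => Γ.vert.symm' h.1⟩))] at hp
  omega

theorem IsFeynman.contract_empty_iso (h : Γ.IsFeynman) : Nonempty (Iso (Γ.contract ∅) Γ) := by
  refine ⟨Iso.ofEq (Equiv.subtypeUnivEquiv fun x =>
    ⟨Set.notMem_empty x, h.notInPropagator_empty x⟩) (ext' ?_ ?_)⟩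
  · change (Γ.conn ∅).comap _ = Γ.vert.comap _
    rw [conn_empty]; rfl
  · have : Γ.propagatorRel ∅ = ⊥ := by
      rw [eq_bot_iff]
      rintro x y (rfl | ⟨_, _, _, hp, _⟩)
      · exact Setoid.refl' _ _
      · exact absurd hp (h.notInPropagator_empty x)
    change (Γ.edge ⊔ Γ.propagatorRel ∅).comap _ = Γ.edge.comap _
    rw [this, sup_bot_eq]; rfl

theorem IsFeynman.compsProd_cut_internals (𝕜 : Type*) [Field 𝕜] [Finite α] (h : Γ.IsFeynman) :
    (Γ.cut Γ.internals).compsProd 𝕜 = Γ.toAlg 𝕜 := by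
  rw [cut_internals]
  obtain ⟨x, -⟩ := h.has_internal
  have : Nonempty α := ⟨x⟩
  refine compsProd_of_connected 𝕜 fun x y => ?_
  have := h.connected x y
  rwa [conn, edgeOn_univ] at this

end FGraph


/-! ### Finiteness and primitive graphs -/

namespace FGraph

variable {α β : Type} {Γ : FGraph α} {S T : Set α}
variable (𝕜 : Type*) [Field 𝕜]

/-- The coproduct without its last term. -/
theorem IsFeynman.coprod_eq_add [Finite α] (h : Γ.IsFeynman) :
    Γ.coprod 𝕜 = Γ.toAlg 𝕜 ⊗ₜ[𝕜] 1 + ∑ᶠ S : {S : Set α // Γ.IsSub S ∧ S ≠ Γ.internals},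
      (Γ.cut S.1).compsProd 𝕜 ⊗ₜ[𝕜] (Γ.contract S.1).toAlg 𝕜 := by
  have := Fintype.ofFinite α
  rw [coprod_eq, finsum_subtype_eq_sum Γ.IsSub fun S : Set α =>
    (Γ.cut S).compsProd 𝕜 ⊗ₜ[𝕜] (Γ.contract S).toAlg 𝕜,
    finsum_subtype_eq_sum (fun S => Γ.IsSub S ∧ S ≠ Γ.internals) fun S : Set α =>
    (Γ.cut S).compsProd 𝕜 ⊗ₜ[𝕜] (Γ.contract S).toAlg 𝕜,
    ← Finset.add_sum_erase _ _ (Finset.mem_filter.2 ⟨Finset.mem_univ _, h.isSub_internals⟩)]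
  rw [h.compsProd_cut_internals 𝕜, toAlg_of_legs 𝕜 contract_internals_isLeg]
  congr 2
  ext S
  simp only [Finset.mem_erase, Finset.mem_filter, Finset.mem_univ, true_and]
  tauto

theorem IsFeynman.isPrimitive [Finite α] (h : Γ.IsFeynman) (hl : Γ.loops = 1) :
    (Γ.cls h).IsPrimitive 𝕜 := by
  unfold FeynmanGraph.IsPrimitive
  rw [← toAlg_of_isFeynman 𝕜 h, graphComul_toAlg 𝕜 h, h.coprod_eq_add 𝕜]
  congr 1
  have : Fintype {S : Set α // Γ.IsSub S ∧ S ≠ Γ.internals} := Fintype.ofFinite _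
  let u : Unique {S : Set α // Γ.IsSub S ∧ S ≠ Γ.internals} :=
    ⟨⟨⟨∅, isSub_empty, h.internals_ne_empty.symm⟩⟩, fun S => Subtype.ext
      ((h.isSub_of_loops_eq_one hl S.2.1).resolve_right S.2.2)⟩
  rw [finsum_unique]
  change (Γ.cut ∅).compsProd 𝕜 ⊗ₜ[𝕜] (Γ.contract ∅).toAlg 𝕜 = _
  rw [compsProd_cut_empty, toAlg_iso 𝕜 h.contract_empty_iso.some]

theorem _root_.FeynmanGraph.isPrimitive_of_loops {γ : FeynmanGraph} (h : γ.loops = 1) :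
    γ.IsPrimitive 𝕜 := by
  have := γ.rep_isFeynman.isPrimitive 𝕜 h
  rwa [cls_rep] at this

/-- There are finitely many graphs with given numbers of legs and loops. -/
instance _root_.FeynmanGraph.finite_numLegs_loops (n L : ℕ) :
    Finite {γ : FeynmanGraph // γ.numLegs = n ∧ γ.loops = L} := by
  -- `2 (E + 1 - V) = 2 L` and `3 V ≤ 2 E + n` bound the number `2 E + n` of half-edges
  have hb : ∀ γ : FeynmanGraph, γ.numLegs = n ∧ γ.loops = L → γ.size < 3 * n + 6 * L + 1 := by
    rintro γ ⟨hn, hL⟩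
    have h := γ.rep_isFeynman
    have h1 := h.two_mul_loops
    have h2 : 3 * γ.rep.numVertices ≤ γ.size := by
      have := Fintype.ofFinite (Quotient γ.rep.vert)
      have e := Nat.card_eq_sum_fiber fun x : Fin γ.size => Quotient.mk γ.rep.vert x
      rw [Nat.card_eq_fintype_card, Fintype.card_fin] at e
      refine le_of_le_of_eq ?_ e.symm
      rw [numVertices, Nat.card_eq_fintype_card, ← Finset.card_univ, mul_comm, ← smul_eq_mul]
      exact Finset.card_nsmul_le_sum _ _ _ fun v _ => h.three_le_valence v
    have h3 : γ.size = Nat.card {x // γ.rep.IsInternal x} + γ.rep.numLegs := by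
      have e := Nat.card_add_card_not (fun _ : Fin γ.size => True) γ.rep.IsInternal
      rw [Nat.card_congr (Equiv.subtypeUnivEquiv fun _ => trivial), Nat.card_eq_fintype_card,
        Fintype.card_fin] at e
      simp only [true_and] at e
      exact e
    have h4 : γ.rep.numLegs = n := hn
    have h5 : γ.rep.loops = L := hL
    omega
  refine Finite.of_injective (β := Σ k : Fin (3 * n + 6 * L + 1), FGraph (Fin k))
    (fun γ => ⟨⟨γ.1.size, hb γ.1 γ.2⟩, γ.1.rep⟩) fun γ γ' hγ => Subtype.ext ?_
  have key : ∀ (p q : Σ h : ℕ, FGraph (Fin h)) (hp : p.2.IsFeynman) (hq : q.2.IsFeynman), p = q →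
      p.2.cls hp = q.2.cls hq := by rintro p q hp hq rfl; rfl
  have := key ⟨γ.1.size, γ.1.rep⟩ ⟨γ'.1.size, γ'.1.rep⟩ γ.1.rep_isFeynman γ'.1.rep_isFeynman
    (congrArg (fun s : Σ k : Fin (3 * n + 6 * L + 1), FGraph (Fin k) =>
      (⟨s.1.1, s.2⟩ : Σ h : ℕ, FGraph (Fin h))) hγ)
  exact (cls_rep γ.1).symm.trans (this.trans (cls_rep γ'.1))

end FGraph

section Counit
variable (𝕜 : Type*) [Field 𝕜]

theorem graphCounit_monomial (m : FeynmanGraph →₀ ℕ) :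
    graphCounit 𝕜 (MvPolynomial.monomial m 1) = if m = 0 then 1 else 0 := by
  unfold graphCounit
  rw [MvPolynomial.aeval_monomial, map_one, one_mul]
  split_ifs with h
  · rw [h, Finsupp.prod_zero_index]
  · obtain ⟨γ, hγ⟩ := Finsupp.support_nonempty_iff.2 h
    exact Finset.prod_eq_zero hγ (zero_pow (Finsupp.mem_support_iff.1 hγ))

end Counit


/-! ### Insertion of a graph: the inserted graph and the cograph -/

namespace FGraph

variable {α β : Type} {Γ : FGraph α} {S : Set α} {Y : FGraph β} {x : α}

namespace Gluing

variable (φ : Gluing Γ S Y)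

theorem vert_iff (h2 : Y.numLegs ≠ 2) {x z : α} (hx : x ∈ Set.range φ.1) :
    Γ.vert.r x z ↔ z ∈ Set.range φ.1 := by
  have h := φ.2.2
  rw [if_neg h2] at h
  obtain ⟨x₀, h, -⟩ := h
  rw [h] at hx ⊢
  exact ⟨fun hz => Γ.vert.trans' hx hz, fun hz => Γ.vert.trans' (Γ.vert.symm' hx) hz⟩

theorem edge_iff (h2 : Y.numLegs = 2) {x z : α} (hx : x ∈ Set.range φ.1) :
    Γ.edge.r x z ↔ z ∈ Set.range φ.1 := by
  have h := φ.2.2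
  rw [if_pos h2] at h
  obtain ⟨x₀, -, -, h⟩ := h
  rw [h] at hx ⊢
  exact ⟨fun hz => Γ.edge.trans' hx hz, fun hz => Γ.edge.trans' (Γ.edge.symm' hx) hz⟩

theorem isInternal (h2 : Y.numLegs = 2) {x : α} (hx : x ∈ Set.range φ.1) : Γ.IsInternal x := by
  have h := φ.2.2
  rw [if_pos h2] at h
  obtain ⟨x₀, -, hi, h⟩ := h
  rw [h] at hx
  exact IsFeynman.internals_edgeClosed x₀ hi x hx

theorem notMem (hS : Γ.EdgeClosed S) {x : α} (hx : x ∈ Set.range φ.1) : x ∉ S := by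
  have h := φ.2.2
  split_ifs at h with h2
  · obtain ⟨x₀, h0, -, h⟩ := h
    rw [h] at hx
    exact fun hxS => h0 (hS x hxS x₀ (Γ.edge.symm' hx))
  · obtain ⟨x₀, -, h⟩ := h
    exact Set.disjoint_left.1 h hx

/-- The half-edges whose edges are kept by the insertion. -/
def keep : Set α := if Y.numLegs = 2 then (Set.range φ.1)ᶜ else Set.univ

/-- A leg of the inserted graph is identified with the half-edge it is glued to. -/
noncomputable def fold : α ⊕ β → α ⊕ β
  | Sum.inl x => Sum.inl x
  | Sum.inr y => if h : Y.IsLeg y then Sum.inl (φ.1 ⟨y, h⟩) else Sum.inr y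

theorem fold_leg {y : β} (h : Y.IsLeg y) : φ.fold (Sum.inr y) = Sum.inl (φ.1 ⟨y, h⟩) := dif_pos h

theorem fold_internal {y : β} (h : Y.IsInternal y) : φ.fold (Sum.inr y) = Sum.inr y :=
  dif_neg fun hl => hl h

/-- The embedding of the inserted graph. -/
def inner (y : β) : GlueCarrier Γ S Y φ := ⟨Sum.inr y, fun _ h => nomatch h⟩

/-- The half-edges that represent those of the original graph; if a vertex is replaced, its
half-edges are represented by the legs of the inserted graph. -/
noncomputable def outer (x : α) : GlueCarrier Γ S Y φ :=
  if h : Y.numLegs = 2 then ⟨Sum.inl x, fun _ _ => Or.inl h⟩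
  else if h : ∃ l, φ.1 l = x then φ.inner h.choose.1
  else ⟨Sum.inl x, fun _ e => Or.inr (Sum.inl.inj e ▸ h)⟩

theorem inner_injective : Function.Injective φ.inner := fun a b h => by
  have h' := congrArg Subtype.val h
  exact Sum.inr.inj h'

theorem outer_of_two (h : Y.numLegs = 2) (x : α) : (φ.outer x).1 = Sum.inl x :=
  congrArg Subtype.val (dif_pos h : φ.outer x = ⟨Sum.inl x, fun _ _ => Or.inl h⟩)

theorem outer_of_notMem {x : α} (h : x ∉ Set.range φ.1) : (φ.outer x).1 = Sum.inl x := by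
  by_cases h2 : Y.numLegs = 2
  · exact φ.outer_of_two h2 x
  · exact congrArg Subtype.val (((dif_neg h2).trans (dif_neg h)) :
      φ.outer x = ⟨Sum.inl x, fun _ e => Or.inr (Sum.inl.inj e ▸ h)⟩)

theorem outer_glued (h2 : Y.numLegs ≠ 2) (l : {l // Y.IsLeg l}) :
    φ.outer (φ.1 l) = φ.inner l.1 := by
  have h : ∃ l', φ.1 l' = φ.1 l := ⟨l, rfl⟩
  exact ((dif_neg h2).trans (dif_pos h)).trans
    (congrArg φ.inner (congrArg Subtype.val (φ.2.1 h.choose_spec)))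

theorem fold_outer (x : α) : φ.fold (φ.outer x).1 = Sum.inl x := by
  by_cases h2 : Y.numLegs = 2
  · rw [φ.outer_of_two h2]; rfl
  · by_cases hx : x ∈ Set.range φ.1
    · obtain ⟨l, rfl⟩ := hx
      rw [φ.outer_glued h2]
      exact φ.fold_leg l.2
    · rw [φ.outer_of_notMem hx]; rfl

theorem outer_injective : Function.Injective φ.outer := fun a b h => by
  have := φ.fold_outer a
  rw [h, φ.fold_outer] at this
  exact (Sum.inl.inj this).symm

theorem outer_or_inner (z : GlueCarrier Γ S Y φ) : (∃ x, z = φ.outer x) ∨ ∃ y, z = φ.inner y := by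
  obtain ⟨x | y, hz⟩ := z
  · left
    refine ⟨x, Subtype.ext ?_⟩
    rcases hz x rfl with h2 | hx
    · rw [φ.outer_of_two h2]
    · rw [φ.outer_of_notMem hx]
  · exact Or.inr ⟨y, rfl⟩

theorem liftRel_equivalence {r : Setoid α} {s : Setoid β} :
    Equivalence (Sum.LiftRel r.r s.r) where
  refl := by
    rintro (x | x)
    · exact Sum.LiftRel.inl (r.refl' x)
    · exact Sum.LiftRel.inr (s.refl' x)
  symm := by
    rintro _ _ (h | h)
    · exact Sum.LiftRel.inl (r.symm' h)
    · exact Sum.LiftRel.inr (s.symm' h)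
  trans := by
    rintro _ _ _ (h | h) h'
    · cases h' with | inl h' => exact Sum.LiftRel.inl (r.trans' h h')
    · cases h' with | inr h' => exact Sum.LiftRel.inr (s.trans' h h')

theorem glue_vert (a b : GlueCarrier Γ S Y φ) :
    (glue Γ S Y φ).vert.r a b ↔ Sum.LiftRel Γ.vert.r Y.vert.r a.1 b.1 :=
  liftRel_equivalence.eqvGen_iff

/-- Two half-edges form an edge after the insertion if and only if they do so after the
identification of the legs of the inserted graph with the half-edges they are glued to. -/
theorem glue_edge (a b : GlueCarrier Γ S Y φ) : (glue Γ S Y φ).edge.r a b ↔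
    Sum.LiftRel (Γ.edgeOn φ.keep).r Y.edge.r (φ.fold a.1) (φ.fold b.1) := by
  obtain ⟨a, ha⟩ := a
  obtain ⟨b, hb⟩ := b
  change Relation.EqvGen (fun a b => Sum.LiftRel (Γ.edgeOn φ.keep).r Y.edge.r a b ∨
      ∃ l, a = Sum.inl (φ.1 l) ∧ b = Sum.inr l.1) a b ↔
    Sum.LiftRel (Γ.edgeOn φ.keep).r Y.edge.r (φ.fold a) (φ.fold b)
  clear ha hb
  have hE := liftRel_equivalence (r := Γ.edgeOn φ.keep) (s := Y.edge)
  constructor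
  · intro h
    induction h with
    | rel a b h =>
      rcases h with h | ⟨l, rfl, rfl⟩
      · rcases h with h | h
        · exact Sum.LiftRel.inl h
        · rename_i y y'
          by_cases hyy : y' = y
          · subst hyy; exact hE.refl _
          · rw [φ.fold_internal ⟨y', hyy, h⟩, φ.fold_internal ⟨y, Ne.symm hyy, Y.edge.symm' h⟩]
            exact Sum.LiftRel.inr h
      · rw [φ.fold_leg l.2]; exact hE.refl _
    | refl a => exact hE.refl _
    | symm a b _ ih => exact hE.symm ih
    | trans a b c _ _ ih ih' => exact hE.trans ih ih'
  · have key : ∀ c, Relation.EqvGen (fun a b => Sum.LiftRel (Γ.edgeOn φ.keep).r Y.edge.r a b ∨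
      ∃ l, a = Sum.inl (φ.1 l) ∧ b = Sum.inr l.1) (φ.fold c) c := by
      rintro (x | y)
      · exact Relation.EqvGen.refl _
      · by_cases hl : Y.IsLeg y
        · rw [φ.fold_leg hl]
          exact Relation.EqvGen.rel _ _ (Or.inr ⟨⟨y, hl⟩, rfl, rfl⟩)
        · rw [φ.fold_internal (not_not.1 hl)]; exact Relation.EqvGen.refl _
    intro h
    exact Relation.EqvGen.trans _ _ _ (Relation.EqvGen.symm _ _ (key a))
      (Relation.EqvGen.trans _ _ _ (Relation.EqvGen.rel _ _ (Or.inl h)) (key b))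

/-- The internal half-edges of the inserted graph. -/
def core : Set (GlueCarrier Γ S Y φ) := {z | ∃ y, Y.IsInternal y ∧ z = φ.inner y}

theorem inner_mem_core (y : β) : φ.inner y ∈ φ.core ↔ Y.IsInternal y :=
  ⟨fun ⟨_, h, e⟩ => φ.inner_injective e ▸ h, fun h => ⟨y, h, rfl⟩⟩

theorem outer_notMem_core (x : α) : φ.outer x ∉ φ.core := by
  rintro ⟨y, hy, e⟩
  have h1 := φ.fold_outer x
  rw [e] at h1
  exact nomatch (φ.fold_internal hy).symm.trans h1

theorem outer_eq_inner {x : α} {y : β} (h : φ.outer x = φ.inner y) :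
    Y.numLegs ≠ 2 ∧ ∃ hl : Y.IsLeg y, φ.1 ⟨y, hl⟩ = x := by
  refine ⟨fun h2 => ?_, ?_⟩
  · have := φ.outer_of_two h2 x
    rw [h] at this
    exact nomatch this
  · have hl : Y.IsLeg y := fun hi => φ.outer_notMem_core x (h ▸ (φ.inner_mem_core y).2 hi)
    have h1 := φ.fold_outer x
    rw [h] at h1
    exact ⟨hl, Sum.inl.inj ((φ.fold_leg hl).symm.trans h1)⟩

theorem outer_mem_glueSet (hS : Γ.EdgeClosed S) (x : α) :
    φ.outer x ∈ glueSet Γ S Y φ ↔ x ∈ S := by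
  constructor
  · rintro (⟨x', hx', e⟩ | ⟨y, hy, e⟩)
    · have := φ.fold_outer x
      rw [e] at this
      exact Sum.inl.inj this ▸ hx'
    · exact absurd ⟨y, hy, Subtype.ext e⟩ (φ.outer_notMem_core x)
  · intro hx
    exact Or.inl ⟨x, hx, φ.outer_of_notMem fun h => φ.notMem hS h hx⟩

theorem inner_mem_glueSet (y : β) : φ.inner y ∈ glueSet Γ S Y φ ↔ Y.IsInternal y := by
  constructor
  · rintro (⟨x', hx', e⟩ | ⟨y', hy, e⟩)
    · exact nomatch e
    · exact Sum.inr.inj e ▸ hy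
  · exact fun h => Or.inr ⟨y, h, rfl⟩

theorem core_subset : φ.core ⊆ glueSet Γ S Y φ := by
  rintro _ ⟨y, hy, rfl⟩; exact (φ.inner_mem_glueSet y).2 hy

theorem glue_edge_inner (y y' : β) (h : Y.IsInternal y) :
    (glue Γ S Y φ).edge.r (φ.inner y) (φ.inner y') ↔ Y.edge.r y y' := by
  rw [glue_edge]
  change Sum.LiftRel _ _ (φ.fold (Sum.inr y)) (φ.fold (Sum.inr y')) ↔ _
  rw [φ.fold_internal h]
  by_cases hl : Y.IsLeg y'
  · rw [φ.fold_leg hl]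
    refine iff_of_false (fun h => nomatch h) fun hyy => hl ?_
    exact IsFeynman.internals_edgeClosed y h y' hyy
  · rw [φ.fold_internal (not_not.1 hl), Sum.liftRel_inr_inr]

theorem glue_edge_outer (x x' : α) :
    (glue Γ S Y φ).edge.r (φ.outer x) (φ.outer x') ↔ (Γ.edgeOn φ.keep).r x x' := by
  rw [glue_edge, fold_outer, fold_outer, Sum.liftRel_inl_inl]

theorem core_edgeClosed : (glue Γ S Y φ).EdgeClosed φ.core := by
  rintro _ ⟨y, hy, rfl⟩ z hz
  rcases φ.outer_or_inner z with ⟨x, rfl⟩ | ⟨y', rfl⟩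
  · rw [glue_edge, fold_outer] at hz
    have h := φ.fold_internal hy
    change Sum.LiftRel _ _ (φ.fold (Sum.inr y)) _ at hz
    rw [h] at hz
    exact nomatch hz
  · rw [φ.glue_edge_inner y y' hy] at hz
    exact ⟨y', IsFeynman.internals_edgeClosed y hy y' hz, rfl⟩

/-- Paths in the inserted graph. -/
theorem conn_inner {T : Set β} {U : Set (GlueCarrier Γ S Y φ)}
    (hTU : ∀ t ∈ T, Y.IsInternal t → φ.inner t ∈ U) {y y' : β} (h : (Y.conn T).r y y') :
    ((glue Γ S Y φ).conn U).r (φ.inner y) (φ.inner y') := by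
  refine Setoid.sup_induction (P := fun y' => ((glue Γ S Y φ).conn U).r (φ.inner y) (φ.inner y'))
    (Setoid.refl' _ _) ?_ ?_ h
  · exact fun a b ha hab => Setoid.trans' _ ha (conn_vert _ ((φ.glue_vert _ _).2
      (Sum.LiftRel.inr hab)))
  · rintro a b ha (rfl | ⟨h1, h2, hab⟩)
    · exact ha
    · by_cases hne : b = a
      · exact hne ▸ ha
      · have hi : Y.IsInternal a := ⟨b, hne, hab⟩
        exact Setoid.trans' _ ha (conn_edge _ (hTU a h1 hi)
          (hTU b h2 (IsFeynman.internals_edgeClosed a hi b hab)) ((φ.glue_edge_inner a b hi).2 hab))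

theorem conn_core_inner (hY : Y.IsFeynman) {U : Set (GlueCarrier Γ S Y φ)} (hU : φ.core ⊆ U)
    (y y' : β) : ((glue Γ S Y φ).conn U).r (φ.inner y) (φ.inner y') :=
  φ.conn_inner (fun t _ ht => hU ⟨t, ht, rfl⟩) (hY.connected y y')

theorem outer_vert {x x' : α} (hY : Y.IsFeynman) {U : Set (GlueCarrier Γ S Y φ)} (hU : φ.core ⊆ U)
    (h : Γ.vert.r x x') : ((glue Γ S Y φ).conn U).r (φ.outer x) (φ.outer x') := by
  by_cases hx : Y.numLegs ≠ 2 ∧ x ∈ Set.range φ.1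
  · obtain ⟨l', rfl⟩ := (φ.vert_iff hx.1 hx.2).1 h
    obtain ⟨h2, ⟨l, rfl⟩⟩ := hx
    rw [φ.outer_glued h2, φ.outer_glued h2]
    exact φ.conn_core_inner hY hU _ _
  · refine conn_vert _ ((φ.glue_vert _ _).2 ?_)
    have e1 : (φ.outer x).1 = Sum.inl x := by
      by_cases h2 : Y.numLegs = 2
      · exact φ.outer_of_two h2 x
      · exact φ.outer_of_notMem fun hx' => hx ⟨h2, hx'⟩
    have e2 : (φ.outer x').1 = Sum.inl x' := by
      by_cases h2 : Y.numLegs = 2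
      · exact φ.outer_of_two h2 x'
      · exact φ.outer_of_notMem fun hx' => hx ⟨h2, (φ.vert_iff h2 hx').1 (Γ.vert.symm' h)⟩
    rw [e1, e2]
    exact Sum.LiftRel.inl h

/-- The half-edges at the inserted graph together form one class; the others keep their vertex. -/
theorem conn_core (hY : Y.IsFeynman) (a b : GlueCarrier Γ S Y φ) :
    ((glue Γ S Y φ).conn φ.core).r a b ↔ Sum.LiftRel Γ.vert.r (fun _ _ => True) a.1 b.1 := by
  constructor
  · refine Setoid.sup_induction (P := fun b : GlueCarrier Γ S Y φ =>
      Sum.LiftRel Γ.vert.r (fun _ _ => True) a.1 b.1) ?_ ?_ ?_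
    · obtain ⟨a | a, ha⟩ := a
      · exact Sum.LiftRel.inl (Γ.vert.refl' _)
      · exact Sum.LiftRel.inr trivial
    · rintro ⟨b, hb⟩ ⟨c, hc⟩ h1 h2
      have h3 := (φ.glue_vert _ _).1 h2
      obtain ⟨a, ha⟩ := a
      simp only at h1 h3 ⊢
      clear h2 ha hb hc
      cases h1 with
      | inl h1 => cases h3 with | inl h3 => exact Sum.LiftRel.inl (Γ.vert.trans' h1 h3)
      | inr h1 => cases h3 with | inr h3 => exact Sum.LiftRel.inr trivial
    · rintro b c h1 (rfl | ⟨⟨y, hy, rfl⟩, ⟨y', hy', rfl⟩, -⟩)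
      · exact h1
      · obtain ⟨a | a, ha⟩ := a
        · exact nomatch h1
        · exact Sum.LiftRel.inr trivial
  · obtain ⟨a | a, ha⟩ := a <;> obtain ⟨b | b, hb⟩ := b
    · intro h
      exact conn_vert _ ((φ.glue_vert _ _).2 (Sum.LiftRel.inl (Sum.liftRel_inl_inl.1 h)))
    · exact fun h => nomatch h
    · exact fun h => nomatch h
    · exact fun _ => φ.conn_core_inner hY subset_rfl a b

theorem outer_conn_core (hY : Y.IsFeynman) (x x' : α) :
    ((glue Γ S Y φ).conn φ.core).r (φ.outer x) (φ.outer x') ↔ Γ.vert.r x x' := by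
  refine ⟨fun h => ?_, φ.outer_vert hY subset_rfl⟩
  by_cases h2 : Y.numLegs = 2
  · rw [φ.conn_core hY, φ.outer_of_two h2, φ.outer_of_two h2] at h
    exact Sum.liftRel_inl_inl.1 h
  · rw [φ.conn_core hY] at h
    by_cases hx : x ∈ Set.range φ.1
    · rw [φ.vert_iff h2 hx]
      obtain ⟨l, rfl⟩ := hx
      by_contra hx'
      rw [φ.outer_glued h2, φ.outer_of_notMem hx'] at h
      exact nomatch h
    · rw [φ.outer_of_notMem hx] at h
      by_cases hx' : x' ∈ Set.range φ.1
      · obtain ⟨l, rfl⟩ := hx'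
        rw [φ.outer_glued h2] at h
        exact nomatch h
      · rw [φ.outer_of_notMem hx'] at h
        exact Sum.liftRel_inl_inl.1 h

theorem inner_inPropagator (hY : Y.IsFeynman) (y : β) :
    (glue Γ S Y φ).InPropagator φ.core (φ.inner y) ↔ Y.numLegs = 2 := by
  unfold InPropagator numLegs
  rw [← Nat.card_congr (Equiv.ofBijective (fun l : {l // Y.IsLeg l} =>
    (⟨φ.inner l.1, φ.conn_core_inner hY subset_rfl _ _, fun h => l.2 ((φ.inner_mem_core _).1 h)⟩ :
      {z // ((glue Γ S Y φ).conn φ.core).r (φ.inner y) z ∧ z ∉ φ.core})) ⟨?_, ?_⟩)]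
  · intro a b h
    have h' := congrArg Subtype.val h
    exact Subtype.ext (φ.inner_injective h')
  · rintro ⟨⟨x | l, hz⟩, h1, h2⟩
    · exact nomatch (φ.conn_core hY _ _).1 h1
    · exact ⟨⟨l, fun hi => h2 ⟨l, hi, rfl⟩⟩, rfl⟩

/-- No half-edge of the original graph disappears when the inserted graph is contracted. -/
theorem outer_notInPropagator (hΓ : Γ.IsFeynman) (hY : Y.IsFeynman) (x : α) :
    ¬ (glue Γ S Y φ).InPropagator φ.core (φ.outer x) := by
  by_cases hx : Y.numLegs ≠ 2 ∧ x ∈ Set.range φ.1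
  · obtain ⟨h2, ⟨l, rfl⟩⟩ := hx
    rwa [φ.outer_glued h2, φ.inner_inPropagator hY]
  · have hout : ∀ x', Γ.vert.r x x' → (φ.outer x').1 = Sum.inl x' := by
      intro x' h
      by_cases h2 : Y.numLegs = 2
      · exact φ.outer_of_two h2 x'
      · exact φ.outer_of_notMem fun hx' => hx ⟨h2, (φ.vert_iff h2 hx').1 (Γ.vert.symm' h)⟩
    -- otherwise `x` lies at a vertex of the original graph, which is a component with at least three legs
    have h3 := hΓ.three_le_valence (Quotient.mk _ x)
    rw [valence_mk] at h3
    unfold InPropagator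
    rw [← Nat.card_congr (Equiv.ofBijective (fun x' : {x' // Γ.vert.r x' x} =>
      (⟨φ.outer x'.1, (φ.outer_conn_core hY _ _).2 (Γ.vert.symm' x'.2), φ.outer_notMem_core _⟩ :
        {z // ((glue Γ S Y φ).conn φ.core).r (φ.outer x) z ∧ z ∉ φ.core})) ⟨?_, ?_⟩)]
    · omega
    · intro a b h
      have h' := congrArg Subtype.val h
      exact Subtype.ext (φ.outer_injective h')
    · rintro ⟨⟨x' | l, hz⟩, h1, h2⟩
      · have h4 := (φ.conn_core hY _ _).1 h1
        rw [hout x (Γ.vert.refl' _)] at h4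
        have h5 := Sum.liftRel_inl_inl.1 h4
        exact ⟨⟨x', Γ.vert.symm' h5⟩, Subtype.ext (Subtype.ext (hout x' h5))⟩
      · have h4 := (φ.conn_core hY _ _).1 h1
        rw [hout x (Γ.vert.refl' _)] at h4
        exact nomatch h4

/-- After contraction of the inserted graph the half-edges of the original graph remain. -/
noncomputable def outerEquiv (hΓ : Γ.IsFeynman) (hY : Y.IsFeynman) :
    α ≃ {z // z ∉ φ.core ∧ ¬ (glue Γ S Y φ).InPropagator φ.core z} :=
  Equiv.ofBijective (fun x => ⟨φ.outer x, φ.outer_notMem_core x, φ.outer_notInPropagator hΓ hY x⟩)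
    ⟨fun a b h => by
      have h' := congrArg Subtype.val h
      exact φ.outer_injective h', fun z => by
      obtain ⟨z, h1, h2⟩ := z
      rcases φ.outer_or_inner z with ⟨x, rfl⟩ | ⟨y, rfl⟩
      · exact ⟨x, rfl⟩
      · rw [φ.inner_inPropagator hY] at h2
        have hl : Y.IsLeg y := fun hi => h1 ⟨y, hi, rfl⟩
        exact ⟨φ.1 ⟨y, hl⟩, Subtype.ext (φ.outer_glued h2 ⟨y, hl⟩)⟩⟩

/-- The two legs of an inserted propagator graph. -/
theorem other_leg (h2 : Y.numLegs = 2) {x x' : α} (hx : x ∈ Set.range φ.1) (h : Γ.edge.r x x') :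
    ∃ l l', φ.1 l = x ∧ φ.1 l' = x' := by
  obtain ⟨l', hl'⟩ := (φ.edge_iff h2 hx).1 h
  obtain ⟨l, hl⟩ := hx
  exact ⟨l, l', hl, hl'⟩

theorem edge_glued (l : {l // Y.IsLeg l}) :
    (glue Γ S Y φ).edge.r (φ.outer (φ.1 l)) (φ.inner l.1) := by
  rw [glue_edge, fold_outer]
  change Sum.LiftRel _ _ _ (φ.fold (Sum.inr l.1))
  rw [φ.fold_leg l.2]

theorem edge_of_two (h2 : Y.numLegs = 2) (l l' : {l // Y.IsLeg l}) :
    Γ.edge.r (φ.1 l) (φ.1 l') := (φ.edge_iff h2 ⟨l, rfl⟩).2 ⟨l', rfl⟩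

theorem mem_keep (h : Y.numLegs = 2 → x ∉ Set.range φ.1) : x ∈ φ.keep := by
  unfold keep
  split_ifs with h2
  · exact h h2
  · trivial

/-- The contraction of the inserted graph restores the edges of the original graph. -/
theorem outer_chain (hΓ : Γ.IsFeynman) (hY : Y.IsFeynman) (x x' : α) :
    ((glue Γ S Y φ).edge ⊔ (glue Γ S Y φ).propagatorRel φ.core).r (φ.outer x) (φ.outer x') ↔
      Γ.edge.r x x' := by
  constructor
  · intro h
    obtain ⟨w, hw, hxw⟩ := Setoid.sup_induction (x := φ.outer x) (P := fun z : GlueCarrier Γ S Y φ =>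
      ∃ w, φ.fold z.1 = Sum.inl w ∧ Γ.edge.r x w) ⟨x, φ.fold_outer x, Γ.edge.refl' _⟩ (by
        rintro a b ⟨w, hw, hxw⟩ hab
        have hab := (φ.glue_edge a b).1 hab
        rw [hw] at hab
        generalize φ.fold b.1 = t at hab ⊢
        cases hab with
        | inl h => exact ⟨_, rfl, Γ.edge.trans' hxw (Γ.edgeOn_le _ h)⟩) (by
        rintro a b ⟨w, hw, hxw⟩ (rfl | ⟨ha, hb, hab, hpa, hpb⟩)
        · exact ⟨w, hw, hxw⟩
        · rcases φ.outer_or_inner a with ⟨x', rfl⟩ | ⟨l, rfl⟩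
          · exact absurd hpa (φ.outer_notInPropagator hΓ hY _)
          rcases φ.outer_or_inner b with ⟨x', rfl⟩ | ⟨l', rfl⟩
          · exact absurd hpb (φ.outer_notInPropagator hΓ hY _)
          have h2 := (φ.inner_inPropagator hY l).1 hpa
          have hl : Y.IsLeg l := fun hi => ha ((φ.inner_mem_core l).2 hi)
          have hl' : Y.IsLeg l' := fun hi => hb ((φ.inner_mem_core l').2 hi)
          refine ⟨_, φ.fold_leg hl', Γ.edge.trans' hxw ?_⟩
          rw [← Sum.inl.inj ((φ.fold_leg hl).symm.trans hw)]
          exact φ.edge_of_two h2 _ _) h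
    rw [φ.fold_outer] at hw
    exact Sum.inl.inj hw ▸ hxw
  · intro h
    by_cases hx : Y.numLegs = 2 ∧ x ∈ Set.range φ.1
    · obtain ⟨h2, hx⟩ := hx
      obtain ⟨l, l', rfl, rfl⟩ := φ.other_leg h2 hx h
      have hp := fun y => (φ.inner_inPropagator hY y).2 h2
      have hc : ∀ l : {l // Y.IsLeg l}, φ.inner l.1 ∉ φ.core := fun l h =>
        l.2 ((φ.inner_mem_core _).1 h)
      exact Setoid.trans' _ (Setoid.sup_left (φ.edge_glued l)) (Setoid.trans' _
        (Setoid.sup_right (Or.inr ⟨hc l, hc l', φ.conn_core_inner hY subset_rfl _ _, hp _, hp _⟩))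
        (Setoid.sup_left (Setoid.symm' _ (φ.edge_glued l'))))
    · refine Setoid.sup_left ((φ.glue_edge_outer x x').2 (Or.inr ⟨?_, ?_, h⟩))
      · exact φ.mem_keep fun h2 hx' => hx ⟨h2, hx'⟩
      · exact φ.mem_keep fun h2 hx' => hx ⟨h2, (φ.edge_iff h2 hx').1 (Γ.edge.symm' h)⟩

/-- Contracting the inserted graph gives the original graph back. -/
noncomputable def outerIso (hΓ : Γ.IsFeynman) (hY : Y.IsFeynman) :
    Iso Γ ((glue Γ S Y φ).contract φ.core) :=
  ⟨φ.outerEquiv hΓ hY, fun x x' => ⟨(φ.outer_conn_core hY x x').symm,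
    (φ.outer_chain hΓ hY x x').symm⟩⟩

end Gluing

end FGraph


/-! ### Insertion preserves one-particle irreducible graphs -/

namespace FGraph

variable {α β : Type} {Γ : FGraph α} {S : Set α} {Y : FGraph β} {x : α}

namespace Gluing

variable (φ : Gluing Γ S Y)

theorem glue_cases (z : GlueCarrier Γ S Y φ) : (∃ x, z = φ.outer x) ∨
    (∃ y, Y.IsInternal y ∧ z = φ.inner y) ∨
      (Y.numLegs = 2 ∧ ∃ l : {l // Y.IsLeg l}, z = φ.inner l.1) := by
  rcases φ.outer_or_inner z with h | ⟨y, rfl⟩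
  · exact Or.inl h
  by_cases hl : Y.IsLeg y
  · by_cases h2 : Y.numLegs = 2
    · exact Or.inr (Or.inr ⟨h2, ⟨y, hl⟩, rfl⟩)
    · exact Or.inl ⟨φ.1 ⟨y, hl⟩, (φ.outer_glued h2 ⟨y, hl⟩).symm⟩
  · exact Or.inr (Or.inl ⟨y, not_not.1 hl, rfl⟩)

theorem fold_inner_leg (l : {l // Y.IsLeg l}) : φ.fold (φ.inner l.1).1 = Sum.inl (φ.1 l) :=
  φ.fold_leg l.2

theorem fold_inner_internal {y : β} (h : Y.IsInternal y) : φ.fold (φ.inner y).1 = Sum.inr y :=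
  φ.fold_internal h

theorem notMem_range_of_keep (h2 : Y.numLegs = 2) (h : x ∈ φ.keep) : x ∉ Set.range φ.1 := by
  unfold keep at h
  rwa [if_pos h2] at h

theorem of_notMem_keep (h : x ∉ φ.keep) : Y.numLegs = 2 ∧ x ∈ Set.range φ.1 := by
  by_contra hc
  exact h (φ.mem_keep fun h2 hx => hc ⟨h2, hx⟩)

theorem eq_outer_of_fold {z : GlueCarrier Γ S Y φ} (hx : x ∈ φ.keep)
    (h : φ.fold z.1 = Sum.inl x) : z = φ.outer x := by
  rcases φ.glue_cases z with ⟨x', rfl⟩ | ⟨y, hy, rfl⟩ | ⟨h2, l, rfl⟩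
  · rw [fold_outer] at h
    rw [Sum.inl.inj h]
  · rw [φ.fold_inner_internal hy] at h
    exact nomatch h
  · rw [φ.fold_inner_leg] at h
    exact absurd ⟨l, Sum.inl.inj h⟩ (φ.notMem_range_of_keep h2 hx)

theorem edge_outer_left (z : GlueCarrier Γ S Y φ) (hx : x ∈ φ.keep)
    (h : (glue Γ S Y φ).edge.r (φ.outer x) z) : ∃ x' ∈ φ.keep, z = φ.outer x' ∧ Γ.edge.r x x' := by
  rw [glue_edge, fold_outer] at h
  generalize ht : φ.fold z.1 = t at h
  cases h with
  | @inl a c h =>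
    rcases h with rfl | ⟨-, h2, h3⟩
    · exact ⟨_, hx, φ.eq_outer_of_fold hx ht, Γ.edge.refl' _⟩
    · exact ⟨_, h2, φ.eq_outer_of_fold h2 ht, h3⟩

theorem edge_glued_left (h2 : Y.numLegs = 2) (l : {l // Y.IsLeg l}) (z : GlueCarrier Γ S Y φ)
    (h : (glue Γ S Y φ).edge.r (φ.outer (φ.1 l)) z) : z = φ.outer (φ.1 l) ∨ z = φ.inner l.1 := by
  rw [glue_edge, fold_outer] at h
  rcases φ.glue_cases z with ⟨x', rfl⟩ | ⟨y, hy, rfl⟩ | ⟨-, l', rfl⟩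
  · rw [fold_outer] at h
    rcases Sum.liftRel_inl_inl.1 h with h | ⟨h, -⟩
    · exact Or.inl (h ▸ rfl)
    · exact absurd ⟨l, rfl⟩ (φ.notMem_range_of_keep h2 h)
  · rw [φ.fold_inner_internal hy] at h
    exact nomatch h
  · rw [φ.fold_inner_leg] at h
    rcases Sum.liftRel_inl_inl.1 h with h | ⟨h, -⟩
    · exact Or.inr (φ.2.1 h ▸ rfl)
    · exact absurd ⟨l, rfl⟩ (φ.notMem_range_of_keep h2 h)

theorem edge_inner_left {y : β} (h : Y.IsInternal y) (z : GlueCarrier Γ S Y φ)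
    (hz : (glue Γ S Y φ).edge.r (φ.inner y) z) : ∃ y', z = φ.inner y' ∧ Y.edge.r y y' := by
  obtain ⟨y', -, rfl⟩ := φ.core_edgeClosed _ ((φ.inner_mem_core y).2 h) z hz
  exact ⟨y', rfl, (φ.glue_edge_inner y y' h).1 hz⟩

theorem glue_edge_le_two (hΓ : Γ.IsFeynman) (hY : Y.IsFeynman) (a b c : GlueCarrier Γ S Y φ)
    (hab : (glue Γ S Y φ).edge.r a b) (hac : (glue Γ S Y φ).edge.r a c) :
    a = b ∨ a = c ∨ b = c := by
  have key : ∀ l b c, Y.numLegs = 2 → (glue Γ S Y φ).edge.r (φ.outer (φ.1 l)) b →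
      (glue Γ S Y φ).edge.r (φ.outer (φ.1 l)) c → ∀ a, (a = φ.outer (φ.1 l) ∨ a = φ.inner l.1) →
      a = b ∨ a = c ∨ b = c := by
    intro l b c h2 hb hc a ha
    rcases ha with rfl | rfl <;> rcases φ.edge_glued_left h2 l b hb with rfl | rfl <;>
      rcases φ.edge_glued_left h2 l c hc with rfl | rfl <;> simp
  rcases φ.glue_cases a with ⟨x, rfl⟩ | ⟨y, hy, rfl⟩ | ⟨h2, l, rfl⟩
  · by_cases hx : x ∈ φ.keep
    · obtain ⟨b, -, rfl, hb⟩ := φ.edge_outer_left b hx hab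
      obtain ⟨c, -, rfl, hc⟩ := φ.edge_outer_left c hx hac
      rcases hΓ.edge_le_two _ _ _ hb hc with rfl | rfl | rfl <;> simp
    · obtain ⟨h2, l, rfl⟩ := φ.of_notMem_keep hx
      exact key l b c h2 hab hac _ (Or.inl rfl)
  · obtain ⟨b, rfl, hb⟩ := φ.edge_inner_left hy b hab
    obtain ⟨c, rfl, hc⟩ := φ.edge_inner_left hy c hac
    rcases hY.edge_le_two _ _ _ hb hc with rfl | rfl | rfl <;> simp
  · exact key l b c h2 (Setoid.trans' _ (φ.edge_glued l) hab)
      (Setoid.trans' _ (φ.edge_glued l) hac) _ (Or.inr rfl)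

theorem inner_ne_outer (h2 : Y.numLegs = 2) (x : α) (y : β) : φ.inner y ≠ φ.outer x :=
  fun h => (φ.outer_eq_inner h.symm).1 h2

/-- Paths in the original graph survive the insertion. -/
theorem conn_outer (hY : Y.IsFeynman) {T : Set α} {U : Set (GlueCarrier Γ S Y φ)}
    (hU : φ.core ⊆ U) (hT : ∀ t ∈ T, φ.outer t ∈ U)
    (hl : Y.numLegs = 2 → (∃ l, φ.1 l ∈ T) → ∀ l : {l // Y.IsLeg l}, φ.inner l.1 ∈ U)
    {x x' : α} (h : (Γ.conn T).r x x') :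
    ((glue Γ S Y φ).conn U).r (φ.outer x) (φ.outer x') := by
  refine Setoid.sup_induction
    (P := fun x' => ((glue Γ S Y φ).conn U).r (φ.outer x) (φ.outer x')) (Setoid.refl' _ _) ?_ ?_ h
  · exact fun a b ha hab => Setoid.trans' _ ha (φ.outer_vert hY hU hab)
  · rintro a b ha (rfl | ⟨h1, h2, hab⟩)
    · exact ha
    refine Setoid.trans' _ ha ?_
    by_cases hk : a ∈ φ.keep ∧ b ∈ φ.keep
    · exact conn_edge _ (hT a h1) (hT b h2) ((φ.glue_edge_outer a b).2 (Or.inr ⟨hk.1, hk.2, hab⟩))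
    · have : Y.numLegs = 2 ∧ a ∈ Set.range φ.1 := by
        by_cases hak : a ∈ φ.keep
        · obtain ⟨h2, hb⟩ := φ.of_notMem_keep fun hb => hk ⟨hak, hb⟩
          exact ⟨h2, (φ.edge_iff h2 hb).1 (Γ.edge.symm' hab)⟩
        · exact φ.of_notMem_keep hak
      obtain ⟨hY2, har⟩ := this
      obtain ⟨l, l', rfl, rfl⟩ := φ.other_leg hY2 har hab
      have hlU := hl hY2 ⟨l, h1⟩
      exact Setoid.trans' _ (conn_edge _ (hT _ h1) (hlU l) (φ.edge_glued l))
        (Setoid.trans' _ (φ.conn_core_inner hY hU _ _)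
          (conn_edge _ (hlU l') (hT _ h2) (Setoid.symm' _ (φ.edge_glued l'))))

theorem irreducible_outer (hΓ : Γ.IsFeynman) (hY : Y.IsFeynman) {x x' : α} (hne : x ≠ x')
    (h : (Γ.edgeOn φ.keep).r x x') :
    ((glue Γ S Y φ).conn {φ.outer x, φ.outer x'}ᶜ).r (φ.outer x) (φ.outer x') := by
  obtain ⟨-, -, hxx⟩ := h.resolve_left hne
  refine φ.conn_outer hY ?_ ?_ ?_ (hΓ.irreducible x x' hne hxx)
  · rintro z hz (rfl | rfl) <;> exact φ.outer_notMem_core _ hz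
  · rintro t ht (h | h)
    · exact ht (Or.inl (φ.outer_injective h))
    · exact ht (Or.inr (φ.outer_injective h))
  · rintro h2 - l (h | h) <;> exact φ.inner_ne_outer h2 _ _ h

theorem irreducible_inner (hY : Y.IsFeynman) {y y' : β} (hne : y ≠ y') (h : Y.edge.r y y') :
    ((glue Γ S Y φ).conn {φ.inner y, φ.inner y'}ᶜ).r (φ.inner y) (φ.inner y') := by
  refine φ.conn_inner ?_ (hY.irreducible y y' hne h)
  rintro t ht - (h | h)
  · exact ht (Or.inl (φ.inner_injective h))
  · exact ht (Or.inr (φ.inner_injective h))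

/-- An edge that joins the original graph to an inserted propagator graph is not a bridge: cutting it
amounts to cutting the edge into which the graph is inserted. -/
theorem irreducible_glued (hΓ : Γ.IsFeynman) (hY : Y.IsFeynman) (h2 : Y.numLegs = 2)
    (l : {l // Y.IsLeg l}) : ((glue Γ S Y φ).conn {φ.outer (φ.1 l), φ.inner l.1}ᶜ).r
      (φ.outer (φ.1 l)) (φ.inner l.1) := by
  obtain ⟨l', hl', hne⟩ := exists_ne_of_card_two h2 l.1
  have hne' : φ.1 l ≠ φ.1 ⟨l', hl'⟩ := fun h => hne (congrArg Subtype.val (φ.2.1 h)).symm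
  have hed := φ.edge_of_two h2 l ⟨l', hl'⟩
  have hcore : φ.core ⊆ {φ.outer (φ.1 l), φ.inner l.1}ᶜ := by
    rintro z hz (rfl | rfl)
    · exact φ.outer_notMem_core _ hz
    · exact l.2 ((φ.inner_mem_core _).1 hz)
  have h1 := φ.conn_outer hY (U := {φ.outer (φ.1 l), φ.inner l.1}ᶜ) hcore ?_ ?_
    (hΓ.irreducible _ _ hne' hed)
  · refine Setoid.trans' _ h1 (Setoid.trans' _ (conn_edge _ ?_ ?_ (φ.edge_glued ⟨l', hl'⟩))
      (φ.conn_core_inner hY hcore l' l.1))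
    · rintro (h | h)
      · exact hne' (φ.outer_injective h).symm
      · exact φ.inner_ne_outer h2 _ _ h.symm
    · rintro (h | h)
      · exact φ.inner_ne_outer h2 _ _ h
      · exact hne (φ.inner_injective h)
  · rintro t ht (h | h)
    · exact ht (Or.inl (φ.outer_injective h))
    · exact φ.inner_ne_outer h2 _ _ h.symm
  · rintro - ⟨l'', hl''⟩
    exfalso
    rcases hΓ.edge_le_two _ _ _ hed (φ.edge_of_two h2 l l'') with h | h | h
    · exact hne' h
    · exact hl'' (Or.inl h.symm)
    · exact hl'' (Or.inr h.symm)

theorem glue_irreducible (hΓ : Γ.IsFeynman) (hY : Y.IsFeynman) (a b : GlueCarrier Γ S Y φ)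
    (hne : a ≠ b) (hab : (glue Γ S Y φ).edge.r a b) : ((glue Γ S Y φ).conn {a, b}ᶜ).r a b := by
  have key : ∀ l b, Y.numLegs = 2 → φ.outer (φ.1 l) ≠ b →
      (glue Γ S Y φ).edge.r (φ.outer (φ.1 l)) b →
      ((glue Γ S Y φ).conn {φ.outer (φ.1 l), b}ᶜ).r (φ.outer (φ.1 l)) b := by
    intro l b h2 hne h
    rcases φ.edge_glued_left h2 l b h with rfl | rfl
    · exact absurd rfl hne
    · exact φ.irreducible_glued hΓ hY h2 l
  rcases φ.glue_cases a with ⟨x, rfl⟩ | ⟨y, hy, rfl⟩ | ⟨h2, l, rfl⟩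
  · by_cases hx : x ∈ φ.keep
    · obtain ⟨x', -, rfl, h⟩ := φ.edge_outer_left b hx hab
      exact φ.irreducible_outer hΓ hY (fun e => hne (e ▸ rfl)) ((φ.glue_edge_outer _ _).1 hab)
    · obtain ⟨h2, l, rfl⟩ := φ.of_notMem_keep hx
      exact key l b h2 hne hab
  · obtain ⟨y', rfl, h⟩ := φ.edge_inner_left hy b hab
    exact φ.irreducible_inner hY (fun e => hne (e ▸ rfl)) h
  · have h1 := Setoid.trans' _ (φ.edge_glued l) hab
    rcases φ.edge_glued_left h2 l b h1 with rfl | rfl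
    · rw [Set.pair_comm]
      exact Setoid.symm' _ (φ.irreducible_glued hΓ hY h2 l)
    · exact absurd rfl hne

theorem outer_isLeg (h : Γ.IsLeg x) : (glue Γ S Y φ).IsLeg (φ.outer x) := by
  rintro ⟨b, hb, hxb⟩
  have hx : x ∈ φ.keep := φ.mem_keep fun h2 hx => h (φ.isInternal h2 hx)
  obtain ⟨x', -, rfl, hxx⟩ := φ.edge_outer_left b hx hxb
  exact hb (isLeg_eq h hxx ▸ rfl)

/-- The result of an insertion is a one-particle irreducible graph. -/
theorem glue_isFeynman [Finite α] [Finite β] (hΓ : Γ.IsFeynman) (hY : Y.IsFeynman) :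
    (glue Γ S Y φ).IsFeynman where
  edge_le_two := φ.glue_edge_le_two hΓ hY
  three_le_valence v := by
    -- a vertex keeps all its half-edges, unless it is replaced
    obtain ⟨⟨x | y, hz⟩, rfl⟩ := Quotient.exists_rep v
    · refine le_of_le_of_eq ?_ (valence_mk _ _).symm
      have h := hΓ.three_le_valence (Quotient.mk _ x)
      rw [valence_mk] at h
      refine h.trans (Nat.card_le_card_of_injective (fun x' => ⟨⟨Sum.inl x'.1, fun w hw => ?_⟩,
        (φ.glue_vert _ _).2 (Sum.LiftRel.inl x'.2)⟩) ?_)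
      · rcases hz x rfl with h2 | hx
        · exact Or.inl h2
        · by_cases h2 : Y.numLegs = 2
          · exact Or.inl h2
          · refine Or.inr fun hw' => hx ?_
            rw [← Sum.inl.inj hw] at hw'
            exact (φ.vert_iff h2 hw').1 x'.2
      · intro a b h
        have h' := congrArg (fun z => z.1.1) h
        exact Subtype.ext (Sum.inl.inj h')
    · refine le_of_le_of_eq ?_ (valence_mk _ _).symm
      have h := hY.three_le_valence (Quotient.mk _ y)
      rw [valence_mk] at h
      refine h.trans (Nat.card_le_card_of_injective (fun y' => ⟨φ.inner y'.1,
        (φ.glue_vert _ _).2 (Sum.LiftRel.inr y'.2)⟩) ?_)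
      intro a b h
      have h' := congrArg Subtype.val h
      exact Subtype.ext (φ.inner_injective h')
  connected := by
    obtain ⟨l, hl⟩ := hY.exists_leg
    have h1 : ∀ y y', ((glue Γ S Y φ).conn Set.univ).r (φ.inner y) (φ.inner y') :=
      φ.conn_core_inner hY (Set.subset_univ _)
    have h2 : ∀ x x', ((glue Γ S Y φ).conn Set.univ).r (φ.outer x) (φ.outer x') := fun x x' =>
      φ.conn_outer hY (Set.subset_univ _) (fun _ _ => trivial) (fun _ _ _ => trivial)
        (hΓ.connected x x')
    have h3 : ((glue Γ S Y φ).conn Set.univ).r (φ.outer (φ.1 ⟨l, hl⟩)) (φ.inner l) := by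
      by_cases h2 : Y.numLegs = 2
      · exact conn_edge _ trivial trivial (φ.edge_glued ⟨l, hl⟩)
      · rw [φ.outer_glued h2]
    have h4 : ∀ z, ((glue Γ S Y φ).conn Set.univ).r z (φ.inner l) := by
      intro z
      rcases φ.outer_or_inner z with ⟨x, rfl⟩ | ⟨y, rfl⟩
      · exact Setoid.trans' _ (h2 _ _) h3
      · exact h1 _ _
    exact fun a b => Setoid.trans' _ (h4 a) (Setoid.symm' _ (h4 b))
  irreducible := φ.glue_irreducible hΓ hY
  has_internal := by
    obtain ⟨y, y', hne, hy⟩ := hY.has_internal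
    exact ⟨φ.inner y, φ.inner y', fun h => hne (φ.inner_injective h),
      (φ.glue_edge_inner y y' ⟨y', hne, hy⟩).2 hy⟩
  two_le_legs := by
    refine hΓ.two_le_legs.trans (Nat.card_le_card_of_injective
      (fun l : {l // Γ.IsLeg l} => (⟨φ.outer l.1, φ.outer_isLeg l.2⟩ :
        {l // (glue Γ S Y φ).IsLeg l})) fun a b h => ?_)
    have h' := congrArg Subtype.val h
    exact Subtype.ext (φ.outer_injective h')

theorem core_isSub (hY : Y.IsFeynman) : (glue Γ S Y φ).IsSub φ.core := by
  refine ⟨?_, ?_⟩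
  · rintro _ ⟨y, hy, rfl⟩
    refine ⟨?_, fun z hz => φ.core_edgeClosed _ ⟨y, hy, rfl⟩ z hz⟩
    obtain ⟨y', hne, hyy⟩ := id hy
    exact ⟨φ.inner y', fun h => hne (φ.inner_injective h), (φ.glue_edge_inner y y' hy).2 hyy⟩
  · rintro _ ⟨y, hy, rfl⟩ _ ⟨y', hy', rfl⟩ hne h
    have hyy := (φ.glue_edge_inner y y' hy).1 h
    refine φ.conn_inner ?_ (hY.irreducible y y' (fun e => hne (e ▸ rfl)) hyy)
    refine fun t ht hti => ⟨⟨t, hti, rfl⟩, ?_⟩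
    rintro (h | h)
    · exact ht (Or.inl (φ.inner_injective h))
    · exact ht (Or.inr (φ.inner_injective h))

theorem core_ne (hΓ : Γ.IsFeynman) (hY : Y.IsFeynman) :
    φ.core ≠ (glue Γ S Y φ).internals := by
  intro h
  obtain ⟨x, y, hne, hxy⟩ := hΓ.has_internal
  have e := φ.outerIso hΓ hY
  rw [h] at e
  exact contract_internals_isLeg (e.1 x) ⟨e.1 y, fun h => hne (e.1.injective h), ((e.2 x y).2).1 hxy⟩

theorem glueSet_edgeClosed (hS : Γ.EdgeClosed S) :
    (glue Γ S Y φ).EdgeClosed (glueSet Γ S Y φ) := by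
  intro z hz w hw
  rcases φ.outer_or_inner z with ⟨x, rfl⟩ | ⟨y, rfl⟩
  · have hx := (φ.outer_mem_glueSet hS x).1 hz
    obtain ⟨x', -, rfl, h⟩ := φ.edge_outer_left w (φ.mem_keep fun _ h => φ.notMem hS h hx) hw
    exact (φ.outer_mem_glueSet hS x').2 (hS x hx x' h)
  · have hy := (φ.inner_mem_glueSet y).1 hz
    exact φ.core_subset (φ.core_edgeClosed _ ((φ.inner_mem_core y).2 hy) w hw)

/-- The marked half-edges form a subgraph, because they do so after the contraction of the inserted
graph. -/
theorem glueSet_isSub [Finite α] [Finite β] (hΓ : Γ.IsFeynman) (hY : Y.IsFeynman)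
    (hS : Γ.IsSub S) : (glue Γ S Y φ).IsSub (glueSet Γ S Y φ) := by
  have hSe := hS.edgeClosed
  refine (φ.glue_isFeynman hΓ hY).isSub_of_contract (φ.core_isSub hY) (φ.core_ne hΓ hY)
    φ.core_subset ?_ (φ.glueSet_edgeClosed hSe) ?_ ?_
  · intro z hz
    rcases φ.outer_or_inner z with ⟨x, rfl⟩ | ⟨y, rfl⟩
    · have hx := (φ.outer_mem_glueSet hSe x).1 hz
      obtain ⟨x', hne, hxx⟩ := (hS.1 x hx).1
      refine ⟨φ.outer x', fun h => hne (φ.outer_injective h), (φ.glue_edge_outer x x').2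
        (Or.inr ⟨?_, ?_, hxx⟩)⟩
      · exact φ.mem_keep fun _ h => φ.notMem hSe h hx
      · exact φ.mem_keep fun _ h => φ.notMem hSe h (hSe x hx x' hxx)
    · exact ((φ.core_isSub hY).1 _ ((φ.inner_mem_core y).2 ((φ.inner_mem_glueSet y).1 hz))).1
  · rintro z hz w (rfl | ⟨hzc, -, -, hp, -⟩)
    · exact hz
    · rcases φ.outer_or_inner z with ⟨x, rfl⟩ | ⟨y, rfl⟩
      · exact absurd hp (φ.outer_notInPropagator hΓ hY x)
      · exact absurd ((φ.inner_mem_core y).2 ((φ.inner_mem_glueSet y).1 hz)) hzc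
  · have e := φ.outerIso hΓ hY
    have h1 := (φ.outerIso hΓ hY).eq_comap
    have h2 := (IsSummand.of_equiv (φ.outerIso hΓ hY).1 ((glue Γ S Y φ).contract φ.core)).isSub
      (Subtype.val ⁻¹' glueSet Γ S Y φ) (by rw [Equiv.range_eq_univ]; exact Set.subset_univ _)
    refine h2.1 ?_
    rw [← h1]
    convert hS using 1
    ext x
    exact φ.outer_mem_glueSet hSe x

/-- In the result of the insertion, the inserted graph is a component of the marked subgraph. -/
theorem conn_glueSet_inner (hY : Y.IsFeynman) (y : β) (z : GlueCarrier Γ S Y φ) :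
    ((glue Γ S Y φ).conn (glueSet Γ S Y φ)).r (φ.inner y) z ↔ ∃ y', z = φ.inner y' := by
  constructor
  · intro h
    refine conn_mem _ (A := {z | ∃ y', z = φ.inner y'}) ?_ ?_ h ⟨y, rfl⟩
    · rintro _ ⟨w, hw⟩ ⟨y, rfl⟩ h
      have := (φ.glue_vert _ _).1 h
      change Sum.LiftRel _ _ (Sum.inr y) w at this
      cases this
      exact ⟨_, rfl⟩
    · rintro _ w ⟨y, rfl⟩ hy - h
      obtain ⟨y', rfl, -⟩ := φ.edge_inner_left ((φ.inner_mem_glueSet y).1 hy) w h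
      exact ⟨y', rfl⟩
  · rintro ⟨y', rfl⟩
    exact φ.conn_core_inner hY φ.core_subset y y'

end Gluing

end FGraph


/-! ### Removing an inserted component -/

namespace FGraph

variable {α β δ : Type} {Γ : FGraph α} {S : Set α} {Y : FGraph β}

/-- The internal half-edges of a component of a subgraph. -/
def part (Γ : FGraph α) (S : Set α) (A : Quotient (Γ.conn S)) : Set α :=
  {z | z ∈ S ∧ Quotient.mk (Γ.conn S) z = A}

theorem part_edgeClosed (hS : Γ.EdgeClosed S) (A : Quotient (Γ.conn S)) :
    Γ.EdgeClosed (Γ.part S A) := by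
  rintro x ⟨hx, rfl⟩ y hxy
  exact ⟨hS x hx y hxy, Quotient.sound (Setoid.symm' _ (Γ.conn_edge hx (hS x hx y hxy) hxy))⟩

theorem part_conn (A : Quotient (Γ.conn S)) (a b : α) : (Γ.conn (Γ.part S A)).r a b ↔
    Γ.vert.r a b ∨ (Quotient.mk (Γ.conn S) a = A ∧ Quotient.mk (Γ.conn S) b = A) := by
  constructor
  · intro h
    refine Setoid.sup_induction (P := fun b => Γ.vert.r a b ∨ (Quotient.mk (Γ.conn S) a = A ∧
      Quotient.mk (Γ.conn S) b = A)) (Or.inl (Γ.vert.refl' _)) ?_ ?_ h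
    · rintro b c (h1 | ⟨h1, h2⟩) hbc
      · exact Or.inl (Γ.vert.trans' h1 hbc)
      · exact Or.inr ⟨h1, (Quotient.sound (Setoid.symm' _ (Γ.conn_vert hbc))).trans h2⟩
    · rintro b c hb (rfl | ⟨h1, h2, -⟩)
      · exact hb
      · rcases hb with hb | ⟨hb, -⟩
        · exact Or.inr ⟨(Quotient.sound (Γ.conn_vert hb)).trans h1.2, h2.2⟩
        · exact Or.inr ⟨hb, h2.2⟩
  · rintro (h | ⟨h1, h2⟩)
    · exact Γ.conn_vert h
    · have h3 : (Γ.conn S).r a b := Quotient.exact (h1.trans h2.symm)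
      refine (Setoid.sup_induction (P := fun b => (Γ.conn (Γ.part S A)).r a b ∧
        Quotient.mk (Γ.conn S) b = A) ⟨Setoid.refl' _ _, h1⟩ ?_ ?_ h3).1
      · rintro b c ⟨hb, hbA⟩ hbc
        exact ⟨Setoid.trans' _ hb (Γ.conn_vert hbc),
          (Quotient.sound (Setoid.symm' _ (Γ.conn_vert hbc))).trans hbA⟩
      · rintro b c ⟨hb, hbA⟩ (rfl | ⟨hbS, hcS, hbc⟩)
        · exact ⟨hb, hbA⟩
        · have hcA := (Quotient.sound (Setoid.symm' _ (Γ.conn_edge hbS hcS hbc))).trans hbA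
          exact ⟨Setoid.trans' _ hb (Γ.conn_edge ⟨hbS, hbA⟩ ⟨hcS, hcA⟩ hbc), hcA⟩

theorem part_isSub (hS : Γ.IsSub S) (A : Quotient (Γ.conn S)) : Γ.IsSub (Γ.part S A) := by
  refine ⟨fun x hx => ⟨(hS.1 x hx.1).1, part_edgeClosed hS.edgeClosed A x hx⟩, ?_⟩
  rintro x ⟨hx, hxA⟩ y ⟨hy, hyA⟩ hne hxy
  refine (Setoid.sup_induction (P := fun b => (Γ.conn (Γ.part S A \ {x, y})).r x b ∧
    Quotient.mk (Γ.conn S) b = A) ⟨Setoid.refl' _ _, hxA⟩ ?_ ?_ (hS.2 x hx y hy hne hxy)).1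
  · rintro b c ⟨hb, hbA⟩ hbc
    exact ⟨Setoid.trans' _ hb (Γ.conn_vert hbc),
      (Quotient.sound (Setoid.symm' _ (Γ.conn_vert hbc))).trans hbA⟩
  · rintro b c ⟨hb, hbA⟩ (rfl | ⟨hbS, hcS, hbc⟩)
    · exact ⟨hb, hbA⟩
    · have hcA := (Quotient.sound (Setoid.symm' _ (Γ.conn_edge hbS.1 hcS.1 hbc))).trans hbA
      exact ⟨Setoid.trans' _ hb (Γ.conn_edge ⟨⟨hbS.1, hbA⟩, hbS.2⟩ ⟨⟨hcS.1, hcA⟩, hcS.2⟩ hbc), hcA⟩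

theorem part_inPropagator (A : Quotient (Γ.conn S)) {a : α} (ha : Quotient.mk (Γ.conn S) a = A) :
    Γ.InPropagator (Γ.part S A) a ↔
      Nat.card {y // Quotient.mk (Γ.conn S) y = A ∧ y ∉ S} = 2 := by
  unfold InPropagator
  rw [Nat.card_congr (Equiv.subtypeEquivRight fun y => ?_)]
  rw [part_conn]
  constructor
  · rintro ⟨h | ⟨-, h⟩, h'⟩
    · have hy := (Quotient.sound (Setoid.symm' _ (Γ.conn_vert h))).trans ha
      exact ⟨hy, fun hS => h' ⟨hS, hy⟩⟩
    · exact ⟨h, fun hS => h' ⟨hS, h⟩⟩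
  · rintro ⟨h, h'⟩
    exact ⟨Or.inr ⟨ha, h⟩, fun hp => h' hp.1⟩

theorem IsFeynman.part_notInPropagator (h : Γ.IsFeynman) (A : Quotient (Γ.conn S)) {a : α}
    (ha : Quotient.mk (Γ.conn S) a ≠ A) : ¬ Γ.InPropagator (Γ.part S A) a := by
  have h3 := h.three_le_valence (Quotient.mk _ a)
  rw [valence_mk] at h3
  unfold InPropagator
  rw [← Nat.card_congr (Equiv.subtypeEquivRight (p := fun y => Γ.vert.r y a) fun y => ?_)]
  · omega
  rw [part_conn]
  constructor
  · intro h
    refine ⟨Or.inl (Γ.vert.symm' h), fun hp => ha ?_⟩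
    exact (Quotient.sound (Setoid.symm' _ (Γ.conn_vert h))).trans hp.2
  · rintro ⟨h | ⟨h, -⟩, -⟩
    · exact Γ.vert.symm' h
    · exact absurd h ha

/-- Isomorphisms that respect marked sets of half-edges. -/
abbrev MarkedIso (Γ : FGraph α) (S : Set α) (Γ' : FGraph δ) (S' : Set δ) : Type :=
  {e : Iso Γ Γ' // ∀ x, x ∈ S ↔ e.1 x ∈ S'}

instance [Finite α] [Finite δ] (Γ : FGraph α) (Γ' : FGraph δ) : Finite (Iso Γ Γ') :=
  Subtype.finite

instance [Finite α] [Finite β] (Γ : FGraph α) (S : Set α) (Y : FGraph β) :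
    Finite (Gluing Γ S Y) := Subtype.finite

theorem exists_contract_iso {Γ' : FGraph δ} {S' : Set δ} (f : α ≃ δ) (h : Γ = Γ'.comap f)
    (hS : S = f ⁻¹' S') :
    ∃ e : Iso (Γ.contract S) (Γ'.contract S'), ∀ x, (e.1 x).1 = f x.1 := by
  subst h hS
  have hs := IsSummand.of_equiv f Γ'
  refine ⟨Iso.ofEq (Equiv.ofBijective (hs.contractMap S') ⟨hs.contractMap_injective S', fun x =>
    (hs.mem_range_contractMap S' x).2 (f.surjective x.1)⟩) (hs.contract_comap S'), fun x => rfl⟩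

theorem Iso.conn_rel {Γ' : FGraph δ} (e : Iso Γ Γ') (S' : Set δ) (x y : α) :
    (Γ.conn (e.1 ⁻¹' S')).r x y ↔ (Γ'.conn S').r (e.1 x) (e.1 y) := by
  have key : ∀ f : α ≃ δ, Γ = Γ'.comap f →
      ((Γ.conn (f ⁻¹' S')).r x y ↔ (Γ'.conn S').r (f x) (f y)) := by
    rintro f rfl
    exact conn_comap_equiv _ _ _ _ _
  exact key e.1 e.eq_comap

variable {Γ' : FGraph δ} {S' : Set δ}

/-- The maps of half-edges given by an isomorphism of the result of an insertion with a graph. -/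
noncomputable def splitOfGlue (p : Σ φ : Gluing Γ S Y, MarkedIso (glue Γ S Y φ) (glueSet Γ S Y φ) Γ' S') :
    (β → δ) × (α → δ) := (fun y => p.2.1.1 (p.1.inner y), fun x => p.2.1.1 (p.1.outer x))

/-- The maps of half-edges given by an isomorphism with a component and one with the cograph. -/
def splitOfParts (p : Σ A : Quotient (Γ'.conn S'), Iso Y (Γ'.component S' A) ×
    MarkedIso Γ S (Γ'.contract (Γ'.part S' A)) (Subtype.val ⁻¹' S')) :
    (β → δ) × (α → δ) := (fun y => (p.2.1.1 y).1, fun x => (p.2.2.1.1 x).1)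

/-- The gluing is determined by the isomorphism: the half-edge to which a leg is glued forms an edge with
the leg, or it is the leg. -/
theorem splitOfGlue_injective (h : Γ'.IsFeynman) :
    Function.Injective (splitOfGlue (Γ := Γ) (S := S) (Y := Y) (Γ' := Γ') (S' := S')) := by
  rintro ⟨φ, ψ, hψ⟩ ⟨φ', ψ', hψ'⟩ heq
  have hin : ∀ y, ψ.1 (φ.inner y) = ψ'.1 (φ'.inner y) := fun y =>
    congrFun (congrArg Prod.fst heq) y
  have hout : ∀ x, ψ.1 (φ.outer x) = ψ'.1 (φ'.outer x) := fun x =>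
    congrFun (congrArg Prod.snd heq) x
  have hφ : φ = φ' := by
    refine Subtype.ext (funext fun l => ?_)
    by_cases h2 : Y.numLegs = 2
    · have e1 := ((ψ.2 _ _).2).1 (φ.edge_glued l)
      have e2 := ((ψ'.2 _ _).2).1 (φ'.edge_glued l)
      rw [hin] at e1
      rcases h.edge_le_two _ _ _ (Γ'.edge.symm' e1) (Γ'.edge.symm' e2) with e | e | e
      · rw [← hin] at e
        exact absurd (ψ.1.injective e) (φ.inner_ne_outer h2 _ _)
      · exact absurd (ψ'.1.injective e) (φ'.inner_ne_outer h2 _ _)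
      · rw [hout] at e
        exact φ'.outer_injective (ψ'.1.injective e)
    · have e1 := hout (φ.1 l)
      rw [φ.outer_glued h2, hin, ← φ'.outer_glued h2] at e1
      exact (φ'.outer_injective (ψ'.1.injective e1)).symm
  subst hφ
  have : ψ = ψ' := by
    refine Subtype.ext (Equiv.ext fun z => ?_)
    rcases φ.outer_or_inner z with ⟨x, rfl⟩ | ⟨y, rfl⟩
    · exact hout x
    · exact hin y
  subst this
  rfl

theorem splitOfParts_injective (hY : Y.IsFeynman) :
    Function.Injective (splitOfParts (Γ := Γ) (S := S) (Y := Y) (Γ' := Γ') (S' := S')) := by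
  obtain ⟨y₀, -⟩ := hY.has_internal
  rintro ⟨A, u, w, hw⟩ ⟨A', u', w', hw'⟩ heq
  have hu : ∀ y, (u.1 y).1 = (u'.1 y).1 := fun y => congrFun (congrArg Prod.fst heq) y
  have hww : ∀ x, (w.1 x).1 = (w'.1 x).1 := fun x => congrFun (congrArg Prod.snd heq) x
  have hA : A = A' := by rw [← (u.1 y₀).2, ← (u'.1 y₀).2, hu]
  subst hA
  have e1 : u = u' := Subtype.ext (Equiv.ext fun y => Subtype.ext (hu y))
  have e2 : w = w' := Subtype.ext (Equiv.ext fun x => Subtype.ext (hww x))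
  subst e1 e2
  rfl

/-- An isomorphism of the result of an insertion with `Γ'` restricts to one of the inserted graph with a
component and one of the original graph with the cograph. -/
theorem splitOfGlue_mem (hΓ : Γ.IsFeynman) (hS : Γ.EdgeClosed S) (hY : Y.IsFeynman)
    (p : Σ φ : Gluing Γ S Y, MarkedIso (glue Γ S Y φ) (glueSet Γ S Y φ) Γ' S') :
    splitOfGlue p ∈ Set.range (splitOfParts (Γ := Γ) (S := S) (Y := Y) (Γ' := Γ') (S' := S')) := by
  obtain ⟨φ, ψ, hψ⟩ := p
  obtain ⟨y₀, -⟩ := hY.has_internal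
  have hG := ψ.eq_comap
  have hset : glueSet Γ S Y φ = ψ.1 ⁻¹' S' := Set.ext hψ
  -- `A` is the component onto which the inserted graph is mapped
  have hcl : ∀ z, (Γ'.conn S').r (ψ.1 (φ.inner y₀)) (ψ.1 z) ↔ ∃ y', z = φ.inner y' := by
    intro z
    rw [← φ.conn_glueSet_inner hY y₀, hset]
    exact (ψ.conn_rel S' _ _).symm
  set A := Quotient.mk (Γ'.conn S') (ψ.1 (φ.inner y₀)) with hA
  have hmem : ∀ z, Quotient.mk (Γ'.conn S') (ψ.1 z) = A ↔ ∃ y', z = φ.inner y' := fun z =>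
    ⟨fun h => (hcl z).1 (Setoid.symm' _ (Quotient.exact h)),
      fun h => Quotient.sound (Setoid.symm' _ ((hcl z).2 h))⟩
  have hbij : Function.Bijective fun y => (⟨ψ.1 (φ.inner y), (hmem _).2 ⟨y, rfl⟩⟩ :
      {x // Quotient.mk (Γ'.conn S') x = A}) := by
    constructor
    · intro a b hab
      have hab' := congrArg Subtype.val hab
      exact φ.inner_injective (ψ.1.injective hab')
    · rintro ⟨z, hz⟩
      obtain ⟨z, rfl⟩ := ψ.1.surjective z
      obtain ⟨y, rfl⟩ := (hmem z).1 hz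
      exact ⟨y, rfl⟩
  have hcore : φ.core = ψ.1 ⁻¹' Γ'.part S' A := by
    ext z
    constructor
    · rintro ⟨y, hy, rfl⟩
      exact ⟨(hψ _).1 ((φ.inner_mem_glueSet y).2 hy), (hmem _).2 ⟨y, rfl⟩⟩
    · rintro ⟨h1, h2⟩
      obtain ⟨y, rfl⟩ := (hmem z).1 h2
      exact (φ.inner_mem_core y).2 ((φ.inner_mem_glueSet y).1 ((hψ _).2 h1))
  obtain ⟨e, he⟩ := exists_contract_iso ψ.1 hG hcore
  refine ⟨⟨A, ⟨Equiv.ofBijective _ hbij, fun y y' => ⟨?_, ?_⟩⟩, (φ.outerIso hΓ hY).trans e, ?_⟩, ?_⟩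
  · refine Iff.trans ?_ (ψ.2 (φ.inner y) (φ.inner y')).1
    rw [φ.glue_vert]
    exact Sum.liftRel_inr_inr.symm
  · change _ ↔ (Γ'.edgeOn S').r (ψ.1 (φ.inner y)) (ψ.1 (φ.inner y'))
    rw [edgeOn_rel, ← hψ, ← hψ, φ.inner_mem_glueSet, φ.inner_mem_glueSet, ← (ψ.2 _ _).2,
      ψ.1.injective.eq_iff, φ.inner_injective.eq_iff]
    constructor
    · intro h
      by_cases hne : y = y'
      · exact Or.inl hne
      · have hy : Y.IsInternal y := ⟨y', Ne.symm hne, h⟩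
        exact Or.inr ⟨hy, IsFeynman.internals_edgeClosed y hy y' h, (φ.glue_edge_inner y y' hy).2 h⟩
    · rintro (rfl | ⟨hy, -, h⟩)
      · exact Y.edge.refl' _
      · exact (φ.glue_edge_inner y y' hy).1 h
  · intro x
    change x ∈ S ↔ (e.1 ((φ.outerIso hΓ hY).1 x)).1 ∈ S'
    rw [he, ← φ.outer_mem_glueSet hS]
    exact hψ _
  · refine Prod.ext rfl (funext fun x => ?_)
    exact he _

/-- The legs of a component with two legs, not the whole graph, belong to edges that leave the
component. -/
theorem IsFeynman.exists_partner (h : Γ'.IsFeynman) (hS : Γ'.IsSub S') (A : Quotient (Γ'.conn S'))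
    (hne : Γ'.part S' A ≠ Γ'.internals)
    (h2 : Nat.card {y // Quotient.mk (Γ'.conn S') y = A ∧ y ∉ S'} = 2) {x : δ}
    (hx : Quotient.mk (Γ'.conn S') x = A) (hxS : x ∉ S') :
    ∃ y, y ≠ x ∧ Γ'.edge.r x y ∧ Quotient.mk (Γ'.conn S') y ≠ A := by
  have hsub := part_isSub hS A
  have hp : Γ'.InPropagator (Γ'.part S' A) x := (part_inPropagator A hx).2 h2
  have hxp : x ∉ Γ'.part S' A := fun h => hxS h.1
  have hi : Γ'.IsInternal x := by
    by_contra hl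
    exact hne (h.eq_internals_of_leg hsub hl hp)
  obtain ⟨y, hyx, hxy⟩ := hi
  refine ⟨y, hyx, hxy, fun hy => ?_⟩
  have hyS : y ∉ S' := fun h => hxS (hS.edgeClosed y h x (Γ'.edge.symm' hxy))
  have h3 : ∀ z, Quotient.mk (Γ'.conn S') z = A → z ∉ S' → z = x ∨ z = y := by
    intro z hz hzS
    rcases eq_or_eq_of_card_two h2 ⟨hx, hxS⟩ ⟨hy, hyS⟩ ⟨hz, hzS⟩ with e | e | e
    · exact absurd e.symm hyx
    · exact Or.inl e.symm
    · exact Or.inr e.symm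
  -- if the two legs `x`, `y` of the component formed an edge, their chain would be closed
  obtain ⟨u, hu⟩ := h.exists_chain_end hsub hne hxp
  have hclosed : u.1 = x ∨ u.1 = y := by
    refine Setoid.sup_induction (P := fun z => z = x ∨ z = y) (Or.inl rfl) ?_ ?_ hu
    · rintro a b (rfl | rfl) hab
      · rcases h.edge_le_two _ _ _ hxy hab with e | e | e
        · exact absurd e.symm hyx
        · exact Or.inl e.symm
        · exact Or.inr e.symm
      · rcases h.edge_le_two _ _ _ (Γ'.edge.symm' hxy) hab with e | e | e
        · exact absurd e hyx
        · exact Or.inr e.symm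
        · exact Or.inl e.symm
    · rintro a b ha (rfl | ⟨ha', hb', hab, -, -⟩)
      · exact ha
      · have haA : Quotient.mk (Γ'.conn S') a = A := by rcases ha with rfl | rfl <;> assumption
        have hbA : Quotient.mk (Γ'.conn S') b = A := by
          rcases (part_conn A a b).1 hab with h | h
          · exact (Quotient.sound (Setoid.symm' _ (Γ'.conn_vert h))).trans haA
          · exact h.2
        exact h3 b hbA fun hbS => hb' ⟨hbS, hbA⟩
  have huA : Quotient.mk (Γ'.conn S') u.1 = A := by rcases hclosed with e | e <;> rw [e] <;> assumption
  exact u.2.2 ((part_inPropagator A huA).2 h2)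

/-- Isomorphisms of `Y` with a component and of `Γ` with the cograph come from an isomorphism of the
result of an insertion with `Γ'`. -/
theorem splitOfParts_mem (hΓ : Γ.IsFeynman) (hY : Y.IsFeynman)
    (hΓ' : Γ'.IsFeynman) (hS' : Γ'.IsSub S')
    (p : Σ A : Quotient (Γ'.conn S'), Iso Y (Γ'.component S' A) ×
      MarkedIso Γ S (Γ'.contract (Γ'.part S' A)) (Subtype.val ⁻¹' S')) :
    splitOfParts p ∈ Set.range (splitOfGlue (Γ := Γ) (S := S) (Y := Y) (Γ' := Γ') (S' := S')) := by
  obtain ⟨A, u, w, hw⟩ := p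
  have hS'e := hS'.edgeClosed
  have hsub : Γ'.IsSub (Γ'.part S' A) := part_isSub hS' A
  have hce := hsub.edgeClosed
  have hne : (Γ'.part S' A) ≠ Γ'.internals := by
    intro h
    obtain ⟨x, y, hxy, hed⟩ := hΓ.has_internal
    have hl : ∀ z, (Γ'.contract (Γ'.part S' A)).IsLeg z := by rw [h]; exact contract_internals_isLeg
    exact hl (w.1 x) ⟨w.1 y, fun e => hxy (w.1.injective e), ((w.2 x y).2).1 hed⟩
  have huA : ∀ y, Quotient.mk (Γ'.conn S') (u.1 y).1 = A := fun y => (u.1 y).2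
  have hui : ∀ y, Y.IsInternal y ↔ (u.1 y).1 ∈ S' := by
    intro y
    have h1 : Y.IsInternal y ↔ (Γ'.component S' A).IsInternal (u.1 y) := by
      constructor
      · rintro ⟨y', h1, h2⟩
        exact ⟨u.1 y', fun e => h1 (u.1.injective e), ((u.2 y y').2).1 h2⟩
      · rintro ⟨z, h1, h2⟩
        obtain ⟨y', rfl⟩ := u.1.surjective z
        exact ⟨y', fun e => h1 (e ▸ rfl), ((u.2 y y').2).2 h2⟩
    rw [h1, component_isInternal hS'e]
    exact and_iff_left_of_imp fun h => (hS'.1 _ h).1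
  have hcard : Nat.card {y // Quotient.mk (Γ'.conn S') y = A ∧ y ∉ S'} = Y.numLegs := by
    symm
    refine Nat.card_congr (Equiv.ofBijective (fun l : {l // Y.IsLeg l} =>
      ⟨(u.1 l.1).1, huA _, fun h => l.2 ((hui _).2 h)⟩) ⟨fun a b hab => ?_, fun z => ?_⟩)
    · have hab' := congrArg Subtype.val hab
      exact Subtype.ext (u.1.injective (Subtype.ext hab'))
    · obtain ⟨y, hy⟩ := u.1.surjective ⟨z.1, z.2.1⟩
      have hy' := congrArg Subtype.val hy
      exact ⟨⟨y, fun hi => z.2.2 (by rw [← hy']; exact (hui y).1 hi)⟩, Subtype.ext hy'⟩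
  -- a half-edge of the cograph lies in the component only if this has become a vertex
  have hKA : ∀ x, Quotient.mk (Γ'.conn S') (w.1 x).1 = A → Y.numLegs ≠ 2 ∧ (w.1 x).1 ∉ S' := by
    intro x hx
    refine ⟨fun h2 => (w.1 x).2.2 ((part_inPropagator A hx).2 (hcard.trans h2)), fun h => ?_⟩
    exact (w.1 x).2.1 ⟨h, hx⟩
  have hwc : ∀ x, (w.1 x).1 ∉ (Γ'.part S' A) := fun x => (w.1 x).2.1
  have hwsurj : ∀ z, z ∉ (Γ'.part S' A) → (Quotient.mk (Γ'.conn S') z = A → Y.numLegs ≠ 2) →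
      ∃ x, (w.1 x).1 = z := by
    intro z hz h
    have hp : ¬ Γ'.InPropagator (Γ'.part S' A) z := by
      by_cases hzA : Quotient.mk (Γ'.conn S') z = A
      · rw [part_inPropagator A hzA, hcard]
        exact h hzA
      · exact hΓ'.part_notInPropagator A hzA
    obtain ⟨x, hx⟩ := w.1.surjective ⟨z, hz, hp⟩
    exact ⟨x, congrArg Subtype.val hx⟩
  have hwinj : ∀ x x', (w.1 x).1 = (w.1 x').1 → x = x' := fun x x' h =>
    w.1.injective (Subtype.ext h)
  have huinj : ∀ x x', (u.1 x).1 = (u.1 x').1 → x = x' := fun x x' h =>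
    u.1.injective (Subtype.ext h)
  have hwvert : ∀ x x', Γ.vert.r x x' ↔ (Γ'.conn (Γ'.part S' A)).r (w.1 x).1 (w.1 x').1 := fun x x' => (w.2 x x').1
  have hwedge : ∀ x x', Γ.edge.r x x' ↔ (Γ'.chain (Γ'.part S' A)).r (w.1 x).1 (w.1 x').1 := fun x x' =>
    (w.2 x x').2
  have huedge : ∀ y y', Y.edge.r y y' ↔ (Γ'.edgeOn S').r (u.1 y).1 (u.1 y').1 := fun y y' =>
    (u.2 y y').2
  -- it remains to find the gluing data and to compare the edges
  suffices H : ∃ φ : Gluing Γ S Y, (Y.numLegs ≠ 2 → ∀ l, (w.1 (φ.1 l)).1 = (u.1 l.1).1) ∧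
      (∀ x x', (Γ.edgeOn φ.keep).r x x' ↔ Γ'.edge.r (w.1 x).1 (w.1 x').1) ∧
      (Y.numLegs = 2 → ∀ l x, Γ'.edge.r (u.1 l.1).1 (w.1 x).1 ↔ φ.1 l = x) by
    obtain ⟨φ, hφ, hout2, hleg⟩ := H
    set ψ : GlueCarrier Γ S Y φ → δ := fun a =>
      Sum.elim (fun x => (w.1 x).1) (fun y => (u.1 y).1) a.1 with hψ
    have hin : ∀ y, ψ (φ.inner y) = (u.1 y).1 := fun y => rfl
    have hout : ∀ x, ψ (φ.outer x) = (w.1 x).1 := by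
      intro x
      by_cases h2 : Y.numLegs = 2
      · rw [hψ]; simp only [φ.outer_of_two h2, Sum.elim_inl]
      · by_cases hx : x ∈ Set.range φ.1
        · obtain ⟨l, rfl⟩ := hx
          rw [φ.outer_glued h2, hin, hφ h2]
        · rw [hψ]; simp only [φ.outer_of_notMem hx, Sum.elim_inl]
    have hinout : ∀ x y, ψ (φ.outer x) = ψ (φ.inner y) → φ.outer x = φ.inner y := by
      intro x y h
      rw [hin, hout] at h
      obtain ⟨h2, hxS⟩ := hKA x (h ▸ huA y)
      have hl : Y.IsLeg y := fun hi => hxS (h ▸ (hui y).1 hi)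
      rw [← hφ h2 ⟨y, hl⟩] at h
      rw [hwinj _ _ h, φ.outer_glued h2]
    have hbij : Function.Bijective ψ := by
      constructor
      · intro a b hab
        rcases φ.outer_or_inner a with ⟨x, rfl⟩ | ⟨y, rfl⟩ <;>
          rcases φ.outer_or_inner b with ⟨x', rfl⟩ | ⟨y', rfl⟩
        · rw [hout, hout] at hab; rw [hwinj _ _ hab]
        · exact hinout _ _ hab
        · exact (hinout _ _ hab.symm).symm
        · rw [huinj _ _ hab]
      · intro z
        by_cases hzA : Quotient.mk (Γ'.conn S') z = A
        · obtain ⟨y, hy⟩ := u.1.surjective ⟨z, hzA⟩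
          exact ⟨φ.inner y, congrArg Subtype.val hy⟩
        · obtain ⟨x, hx⟩ := hwsurj z (fun h => hzA h.2) fun h => absurd h hzA
          exact ⟨φ.outer x, (hout x).trans hx⟩
    -- a half-edge of the original graph that is kept does not belong to the component
    have hinl : ∀ (x : α) (hz : ∀ x', Sum.inl x = (Sum.inl x' : α ⊕ β) →
        Y.numLegs = 2 ∨ x' ∉ Set.range φ.1), Quotient.mk (Γ'.conn S') (w.1 x).1 ≠ A := by
      intro x hz hA
      obtain ⟨h2, hxS⟩ := hKA x hA
      obtain ⟨y, hy⟩ := u.1.surjective ⟨_, hA⟩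
      have hy' := congrArg Subtype.val hy
      have hl : Y.IsLeg y := fun hi => hxS (hy' ▸ (hui y).1 hi)
      exact (hz x rfl).resolve_left h2 ⟨⟨y, hl⟩, hwinj _ _ ((hφ h2 ⟨y, hl⟩).trans hy')⟩
    have hvert : ∀ a b, (glue Γ S Y φ).vert.r a b ↔ Γ'.vert.r (ψ a) (ψ b) := by
      intro a b
      rw [φ.glue_vert]
      obtain ⟨x | y, ha⟩ := a <;> obtain ⟨x' | y', hb⟩ := b
      · rw [Sum.liftRel_inl_inl, hwvert, part_conn]
        exact or_iff_left fun h => hinl x ha h.1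
      · refine iff_of_false (fun h => nomatch h) fun h => hinl x ha ?_
        exact (Quotient.sound (Γ'.conn_vert h)).trans (huA y')
      · refine iff_of_false (fun h => nomatch h) fun h => hinl x' hb ?_
        exact (Quotient.sound (Setoid.symm' _ (Γ'.conn_vert h))).trans (huA y)
      · rw [Sum.liftRel_inr_inr]
        exact (u.2 y y').1
    have hedge : ∀ a b, (glue Γ S Y φ).edge.r a b ↔ Γ'.edge.r (ψ a) (ψ b) := by
      have hint : ∀ y b, Y.IsInternal y →
          ((glue Γ S Y φ).edge.r (φ.inner y) b ↔ Γ'.edge.r (ψ (φ.inner y)) (ψ b)) := by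
        intro y b hy
        constructor
        · intro h
          obtain ⟨y', rfl, h'⟩ := φ.edge_inner_left hy b h
          exact Γ'.edgeOn_le _ ((huedge y y').1 h')
        · intro h
          have hyc : ψ (φ.inner y) ∈ Γ'.part S' A := ⟨(hui y).1 hy, huA y⟩
          rcases φ.outer_or_inner b with ⟨x, rfl⟩ | ⟨y', rfl⟩
          · have := hce _ hyc _ h
            rw [hout] at this
            exact absurd this (hwc x)
          · refine (φ.glue_edge_inner y y' hy).2 ((huedge y y').2 ?_)
            exact Or.inr ⟨hyc.1, hS'e _ hyc.1 _ h, h⟩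
      have hmix : ∀ x l, Y.numLegs = 2 → ((glue Γ S Y φ).edge.r (φ.outer x) (φ.inner l) ↔
          Γ'.edge.r (ψ (φ.outer x)) (ψ (φ.inner l)) ∨ ¬ Y.IsLeg l ∧
            (glue Γ S Y φ).edge.r (φ.outer x) (φ.inner l)) := by
        intro x l h2
        by_cases hl : Y.IsLeg l
        · rw [hout, hin, Γ'.edge_comm, hleg h2 ⟨l, hl⟩, φ.glue_edge, φ.fold_outer,
            φ.fold_inner_leg ⟨l, hl⟩, Sum.liftRel_inl_inl]
          constructor
          · rintro (h | ⟨-, h, -⟩)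
            · exact Or.inl h.symm
            · exact absurd ⟨_, rfl⟩ (φ.notMem_range_of_keep h2 h)
          · rintro (h | ⟨h, -⟩)
            · exact Or.inl h.symm
            · exact absurd hl h
        · rw [(glue Γ S Y φ).edge_comm, hint l _ (not_not.1 hl), Γ'.edge_comm]
          exact ⟨Or.inl, fun h => h.elim id fun h => h.2⟩
      intro a b
      rcases φ.glue_cases a with ⟨x, rfl⟩ | ⟨y, hy, rfl⟩ | ⟨h2, l, rfl⟩
      · rcases φ.glue_cases b with ⟨x', rfl⟩ | ⟨y', hy', rfl⟩ | ⟨h2, l', rfl⟩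
        · rw [φ.glue_edge_outer, hout, hout, hout2]
        · rw [(glue Γ S Y φ).edge_comm, hint y' _ hy', Γ'.edge_comm]
        · rw [hmix x l' h2]
          exact or_iff_left fun h => h.1 l'.2
      · exact hint y b hy
      · rcases φ.glue_cases b with ⟨x', rfl⟩ | ⟨y', hy', rfl⟩ | ⟨-, l', rfl⟩
        · rw [(glue Γ S Y φ).edge_comm, Γ'.edge_comm, hmix x' l h2]
          exact or_iff_left fun h => h.1 l.2
        · rw [(glue Γ S Y φ).edge_comm, hint y' _ hy', Γ'.edge_comm]
        · rw [φ.glue_edge, φ.fold_inner_leg, φ.fold_inner_leg, Sum.liftRel_inl_inl]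
          constructor
          · rintro (h | ⟨-, h, -⟩)
            · rw [φ.2.1 h]
            · exact absurd ⟨_, rfl⟩ (φ.notMem_range_of_keep h2 h)
          · intro h
            have h1 := (hleg h2 l _).2 rfl
            rcases hΓ'.edge_le_two _ _ _ h1 h with e | e | e
            · exact absurd h2 (hKA _ (e ▸ huA l.1)).1
            · exact Or.inl (congrArg φ.1 (Subtype.ext (huinj _ _ e)))
            · exact absurd h2 (hKA _ ((congrArg _ e).trans (huA l'.1))).1
    have hmark : ∀ a, a ∈ glueSet Γ S Y φ ↔ ψ a ∈ S' := by
      rintro ⟨x | y, hz⟩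
      · have : (⟨Sum.inl x, hz⟩ : GlueCarrier Γ S Y φ) ∈ glueSet Γ S Y φ ↔ x ∈ S := by
          constructor
          · rintro (⟨x', hx', e⟩ | ⟨y, -, e⟩)
            · exact Sum.inl.inj e ▸ hx'
            · exact nomatch e
          · exact fun hx => Or.inl ⟨x, hx, rfl⟩
        exact this.trans (hw x)
      · exact (φ.inner_mem_glueSet y).trans (hui y)
    exact ⟨⟨φ, ⟨Equiv.ofBijective ψ hbij, fun a b => ⟨hvert a b, hedge a b⟩⟩, hmark⟩,
      Prod.ext rfl (funext hout)⟩
  have hlS : ∀ l : {l // Y.IsLeg l}, (u.1 l.1).1 ∉ S' := fun l h => l.2 ((hui _).2 h)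
  have hleg : ∀ z, Quotient.mk (Γ'.conn S') z = A → z ∉ S' →
      ∃ l : {l // Y.IsLeg l}, (u.1 l.1).1 = z := by
    intro z hz hzS
    obtain ⟨y, hy⟩ := u.1.surjective ⟨z, hz⟩
    have hy' := congrArg Subtype.val hy
    exact ⟨⟨y, fun hi => hzS ((congrArg (· ∈ S') hy').mp ((hui y).1 hi))⟩, hy'⟩
  obtain ⟨l₀, hl₀⟩ := hY.exists_leg
  by_cases h2 : Y.numLegs = 2
  -- a propagator graph: a leg is glued to the half-edge with which it forms an edge of `Γ'`
  · have hpart : ∀ l : {l // Y.IsLeg l}, ∃ x, Γ'.edge.r (u.1 l.1).1 (w.1 x).1 := by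
      intro l
      obtain ⟨y, -, h1, h3⟩ := hΓ'.exists_partner hS' A hne (hcard.trans h2) (huA l.1) (hlS l)
      obtain ⟨x, rfl⟩ := hwsurj y (fun h => h3 h.2) fun h => absurd h h3
      exact ⟨x, h1⟩
    choose f hf using hpart
    have hne' : ∀ l x, (u.1 l).1 ≠ (w.1 x).1 := fun l x h => (hKA x (h ▸ huA l)).1 h2
    have hf2 : ∀ l x, Γ'.edge.r (u.1 l.1).1 (w.1 x).1 ↔ f l = x := by
      intro l x
      constructor
      · intro h
        rcases hΓ'.edge_le_two _ _ _ (hf l) h with e | e | e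
        · exact absurd e (hne' _ _)
        · exact absurd e (hne' _ _)
        · exact hwinj _ _ e
      · rintro rfl; exact hf l
    have hinj : Function.Injective f := by
      intro l l' h
      have h1 := hf l
      rw [h] at h1
      rcases hΓ'.edge_le_two _ _ _ (Γ'.edge.symm' h1) (Γ'.edge.symm' (hf l')) with e | e | e
      · exact absurd e.symm (hne' _ _)
      · exact absurd e.symm (hne' _ _)
      · exact Subtype.ext (huinj _ _ e)
    have hchain : ∀ l l', Γ.edge.r (f l) (f l') := by
      intro l l'
      rw [hwedge]
      have hp : ∀ l, Γ'.InPropagator (Γ'.part S' A) (u.1 l).1 := fun l =>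
        (part_inPropagator A (huA l)).2 (hcard.trans h2)
      exact Setoid.trans' _ (chain_edge (Γ'.edge.symm' (hf l))) (Setoid.trans' _
        (Setoid.sup_right (Or.inr ⟨fun h => hlS l h.1, fun h => hlS l' h.1,
          (part_conn A _ _).2 (Or.inr ⟨huA _, huA _⟩), hp _, hp _⟩)) (chain_edge (hf l')))
    obtain ⟨l₁, hl₁, hll⟩ := exists_ne_of_card_two h2 l₀
    have hff : f ⟨l₁, hl₁⟩ ≠ f ⟨l₀, hl₀⟩ := fun h => hll (congrArg Subtype.val (hinj h))
    have hrange : Set.range f = {z | Γ.edge.r (f ⟨l₀, hl₀⟩) z} := by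
      ext z
      constructor
      · rintro ⟨l, rfl⟩; exact hchain _ _
      · intro hz
        rcases hΓ.edge_le_two _ _ _ (hchain ⟨l₀, hl₀⟩ ⟨l₁, hl₁⟩) hz with e | e | e
        · exact absurd e.symm hff
        · exact ⟨_, e⟩
        · exact ⟨_, e⟩
    have hglue : Function.Injective f ∧
        if Y.numLegs = 2 then ∃ x, x ∉ S ∧ Γ.IsInternal x ∧ Set.range f = {z | Γ.edge.r x z}
        else ∃ x, Set.range f = {z | Γ.vert.r x z} ∧ Disjoint (Set.range f) S := by
      rw [if_pos h2]
      refine ⟨hinj, f ⟨l₀, hl₀⟩, fun hS => ?_, ⟨_, hff, hchain _ _⟩, hrange⟩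
      exact hlS ⟨l₀, hl₀⟩ (hS'e _ ((hw _).1 hS) _ (Γ'.edge.symm' (hf _)))
    have hkeep : ∀ x, x ∈ Gluing.keep (Γ := Γ) (S := S) (Y := Y) ⟨f, hglue⟩ ↔ x ∉ Set.range f := fun x =>
      ⟨Gluing.notMem_range_of_keep _ h2, fun h => Gluing.mem_keep _ fun _ => h⟩
    have hnr : ∀ x x', x ≠ x' → Γ'.edge.r (w.1 x).1 (w.1 x').1 → x ∉ Set.range f := by
      rintro x x' hxx h ⟨l, rfl⟩
      rcases hΓ'.edge_le_two _ _ _ (Γ'.edge.symm' (hf l)) h with e | e | e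
      · exact absurd e.symm (hne' _ _)
      · exact hxx (hwinj _ _ e)
      · exact absurd e (hne' _ _)
    refine ⟨⟨f, hglue⟩, fun h => absurd h2 h, fun x x' => ⟨?_, fun h => ?_⟩, fun _ => hf2⟩
    · rintro (rfl | ⟨hx, hx', h⟩)
      · exact Γ'.edge.refl' _
      · rw [hkeep] at hx hx'
        refine Setoid.sup_induction (P := fun z => Γ'.edge.r (w.1 x).1 z) (Γ'.edge.refl' _)
          (fun y z hy hyz => Γ'.edge.trans' hy hyz) ?_ ((hwedge x x').1 h)
        rintro y z hy (rfl | ⟨hyc, -, -, hp, -⟩)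
        · exact hy
        · exfalso
          by_cases hyA : Quotient.mk (Γ'.conn S') y = A
          · obtain ⟨l, rfl⟩ := hleg y hyA fun h => hyc ⟨h, hyA⟩
            exact hx ⟨l, (hf2 l x).1 (Γ'.edge.symm' hy)⟩
          · exact hΓ'.part_notInPropagator A hyA hp
    · by_cases hxx : x = x'
      · exact Or.inl hxx
      · exact Or.inr ⟨(hkeep x).2 (hnr x x' hxx h),
          (hkeep x').2 (hnr x' x (Ne.symm hxx) (Γ'.edge.symm' h)),
          (hwedge x x').2 (chain_edge h)⟩
  -- a vertex graph: a leg is glued to the half-edge of the cograph that it has become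
  · have hpart : ∀ l : {l // Y.IsLeg l}, ∃ x, (w.1 x).1 = (u.1 l.1).1 := fun l =>
      hwsurj _ (fun h => hlS l h.1) fun _ => h2
    choose f hf using hpart
    have hinj : Function.Injective f := by
      intro l l' h
      have h1 := hf l
      rw [h, hf l'] at h1
      exact Subtype.ext (huinj _ _ h1.symm)
    have hrange : Set.range f = {z | Γ.vert.r (f ⟨l₀, hl₀⟩) z} := by
      ext z
      rw [Set.mem_ofPred_eq, hwvert, part_conn, hf]
      constructor
      · rintro ⟨l, rfl⟩
        exact Or.inr ⟨huA _, by rw [hf]; exact huA _⟩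
      · intro h
        have hz : Quotient.mk (Γ'.conn S') (w.1 z).1 = A := by
          rcases h with h | h
          · exact (Quotient.sound (Setoid.symm' _ (Γ'.conn_vert h))).trans (huA _)
          · exact h.2
        obtain ⟨l, hl⟩ := hleg _ hz (hKA z hz).2
        exact ⟨l, hwinj _ _ ((hf l).trans hl)⟩
    have hglue : Function.Injective f ∧
        if Y.numLegs = 2 then ∃ x, x ∉ S ∧ Γ.IsInternal x ∧ Set.range f = {z | Γ.edge.r x z}
        else ∃ x, Set.range f = {z | Γ.vert.r x z} ∧ Disjoint (Set.range f) S := by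
      rw [if_neg h2]
      refine ⟨hinj, _, hrange, Set.disjoint_left.2 ?_⟩
      rintro _ ⟨l, rfl⟩ h
      have := (hw _).1 h
      exact hlS l ((congrArg (· ∈ S') (hf l)).mp this)
    refine ⟨⟨f, hglue⟩, fun _ => hf, fun x x' => ?_, fun h => absurd h h2⟩
    have hk : Gluing.keep (Γ := Γ) (S := S) (Y := Y) ⟨f, hglue⟩ = Set.univ := if_neg h2
    rw [hk, edgeOn_univ, hwedge]
    refine ⟨fun h => ?_, fun h => chain_edge h⟩
    refine Setoid.sup_induction (P := fun z => Γ'.edge.r (w.1 x).1 z) (Γ'.edge.refl' _)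
      (fun y z hy hyz => Γ'.edge.trans' hy hyz) ?_ h
    rintro y z hy (rfl | ⟨hyc, -, -, hp, -⟩)
    · exact hy
    · exfalso
      by_cases hyA : Quotient.mk (Γ'.conn S') y = A
      · exact h2 (hcard.symm.trans ((part_inPropagator A hyA).1 hp))
      · exact hΓ'.part_notInPropagator A hyA hp

/-- The gluings of a graph `Y` that lead to a given graph correspond to its components isomorphic
to `Y`, with the cograph as the graph into which `Y` is inserted. -/
theorem sum_card_glue_iso [Finite α] [Finite β] [Finite δ] (hΓ : Γ.IsFeynman) (hS : Γ.EdgeClosed S)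
    (hY : Y.IsFeynman) (hΓ' : Γ'.IsFeynman) (hS' : Γ'.IsSub S') :
    ∑ᶠ φ : Gluing Γ S Y, Nat.card (MarkedIso (glue Γ S Y φ) (glueSet Γ S Y φ) Γ' S') =
      ∑ᶠ A : Quotient (Γ'.conn S'), Nat.card (Iso Y (Γ'.component S' A)) *
        Nat.card (MarkedIso Γ S (Γ'.contract (Γ'.part S' A)) (Subtype.val ⁻¹' S')) := by
  have := Fintype.ofFinite (Gluing Γ S Y)
  have := Fintype.ofFinite (Quotient (Γ'.conn S'))
  simp_rw [← Nat.card_prod]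
  rw [finsum_eq_sum_of_fintype, finsum_eq_sum_of_fintype, ← Nat.card_sigma, ← Nat.card_sigma,
    Nat.card_congr (Equiv.ofInjective _ (splitOfGlue_injective hΓ')),
    Nat.card_congr (Equiv.ofInjective _ (splitOfParts_injective hY))]
  congr 2
  refine congrArg _ (Set.Subset.antisymm ?_ ?_)
  · rintro _ ⟨p, rfl⟩; exact splitOfGlue_mem hΓ hS hY p
  · rintro _ ⟨p, rfl⟩; exact splitOfParts_mem hΓ hY hΓ' hS' p

end FGraph


/-! ### Iterated insertion -/

namespace FGraph

variable {α β δ : Type} {Γ : FGraph α} {S : Set α} {Y : FGraph β}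

/-- Sums over iterated gluings of functions that depend on the inserted subgraph, too. -/
noncomputable def markedGlueSum {M : Type*} [AddCommMonoid M]
    (f : ∀ (α : Type) [Finite α], FGraph α → Set α → M) :
    List FeynmanGraph → ∀ (α : Type) [Finite α], FGraph α → Set α → M
  | [], α, _, Γ, S => f α Γ S
  | Y :: L, _, _, Γ, S => ∑ᶠ φ : Gluing Γ S Y.rep,
      markedGlueSum f L (GlueCarrier Γ S Y.rep φ) (glue Γ S Y.rep φ) (glueSet Γ S Y.rep φ)

section
variable {M : Type*} [AddCommMonoid M]

theorem glueSum_eq_markedGlueSum (f : ∀ (α : Type) [Finite α], FGraph α → M)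
    (L : List FeynmanGraph) : ∀ (α : Type) [Finite α] (Γ : FGraph α) (S : Set α),
      glueSum f L α Γ S = markedGlueSum (fun α _ Γ _ => f α Γ) L α Γ S := by
  induction L with
  | nil => intros; rfl
  | cons Y L ih => intro α _ Γ S; exact finsum_congr fun φ => ih _ _ _

theorem markedGlueSum_append (f : ∀ (α : Type) [Finite α], FGraph α → Set α → M)
    (L : List FeynmanGraph) (Y : FeynmanGraph) :
    ∀ (α : Type) [Finite α] (Γ : FGraph α) (S : Set α), markedGlueSum f (L ++ [Y]) α Γ S =
      markedGlueSum (fun _ _ Γ S => ∑ᶠ φ : Gluing Γ S Y.rep,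
        f (GlueCarrier Γ S Y.rep φ) (glue Γ S Y.rep φ) (glueSet Γ S Y.rep φ)) L α Γ S := by
  induction L with
  | nil => intros; rfl
  | cons Z L ih => intro α _ Γ S; exact finsum_congr fun φ => ih _ _ _

theorem markedGlueSum_congr {f g : ∀ (α : Type) [Finite α], FGraph α → Set α → M}
    (h : ∀ (α : Type) [Finite α] (Γ : FGraph α) (S : Set α), Γ.IsFeynman → Γ.IsSub S →
      f α Γ S = g α Γ S) (L : List FeynmanGraph) :
    ∀ (α : Type) [Finite α] (Γ : FGraph α) (S : Set α), Γ.IsFeynman → Γ.IsSub S →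
      markedGlueSum f L α Γ S = markedGlueSum g L α Γ S := by
  induction L with
  | nil => exact h
  | cons Y L ih =>
    intro α _ Γ S hΓ hS
    exact finsum_congr fun φ => ih _ _ _ (φ.glue_isFeynman hΓ Y.rep_isFeynman)
      (φ.glueSet_isSub hΓ Y.rep_isFeynman hS)

theorem markedGlueSum_map {N : Type*} [AddCommMonoid N] (h : M →+ N)
    (f : ∀ (α : Type) [Finite α], FGraph α → Set α → M) (L : List FeynmanGraph) :
    ∀ (α : Type) [Finite α] (Γ : FGraph α) (S : Set α),
      markedGlueSum (fun α _ Γ S => h (f α Γ S)) L α Γ S = h (markedGlueSum f L α Γ S) := by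
  induction L with
  | nil => intros; rfl
  | cons Y L ih =>
    intro α _ Γ S
    refine (finsum_congr fun φ => ih _ _ _).trans ?_
    exact (AddMonoidHom.map_finsum h (Set.toFinite _)).symm

theorem markedGlueSum_sum {ι : Type*} (s : Finset ι)
    (f : ι → ∀ (α : Type) [Finite α], FGraph α → Set α → M) (L : List FeynmanGraph) :
    ∀ (α : Type) [Finite α] (Γ : FGraph α) (S : Set α),
      markedGlueSum (fun α _ Γ S => ∑ i ∈ s, f i α Γ S) L α Γ S =
        ∑ i ∈ s, markedGlueSum (f i) L α Γ S := by
  induction L with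
  | nil => intros; rfl
  | cons Y L ih =>
    intro α _ Γ S
    refine (finsum_congr fun φ => ih _ _ _).trans ?_
    exact finsum_sum_comm s _ fun i _ => Set.toFinite _

end

/-- Components of a subgraph other than the contracted one are not changed by the contraction. -/
theorem IsFeynman.compsProd_contract_part (𝕜 : Type*) [Field 𝕜] [Finite α] (h : Γ.IsFeynman)
    (hS : Γ.IsSub S) (A : Quotient (Γ.conn S)) :
    (Γ.cut S).compsProd 𝕜 = (Γ.component S A).toAlg 𝕜 *
      ((Γ.contract (Γ.part S A)).cut (Subtype.val ⁻¹' S)).compsProd 𝕜 := by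
  have hSe := hS.edgeClosed
  have hsub := part_isSub hS A
  have hle : Γ.part S A ⊆ S := fun _ h => h.1
  have hP := hS.propClosed hsub.edgeClosed
  have hF := Fintype.ofFinite (Quotient (Γ.conn S))
  set K := {x // x ∉ Γ.part S A ∧ ¬ Γ.InPropagator (Γ.part S A) x}
  have hq : ∀ x y : K, (((Γ.contract (Γ.part S A)).cut (Subtype.val ⁻¹' S)).vert ⊔
      ((Γ.contract (Γ.part S A)).cut (Subtype.val ⁻¹' S)).edge).r x y ↔
      Quotient.mk (Γ.conn S) x.1 = Quotient.mk (Γ.conn S) y.1 := fun x y =>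
    (contract_conn_rel hle hsub.edgeClosed hSe hP x y).trans
      ⟨fun h => Quotient.sound h, fun h => Quotient.exact h⟩
  -- A chain that starts in another component meets no vertex of the contracted part, so it is an
  -- edge of `Γ`.
  have hchain : ∀ x y : α, Quotient.mk (Γ.conn S) x ≠ A → x ∈ S → (Γ.chain (Γ.part S A)).r x y →
      Γ.edge.r x y := by
    intro x y hxA hxS hxy
    refine (Setoid.sup_induction (P := fun z => Γ.edge.r x z ∧ z ∈ S ∧
      Quotient.mk (Γ.conn S) z ≠ A) ⟨Γ.edge.refl' _, hxS, hxA⟩ ?_ ?_ hxy).1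
    · rintro z w ⟨h1, h2, h3⟩ hzw
      refine ⟨Γ.edge.trans' h1 hzw, hSe z h2 w hzw, fun e => h3 (Eq.trans (Quotient.sound ?_) e)⟩
      exact Γ.conn_edge h2 (hSe z h2 w hzw) hzw
    · rintro z w ⟨h1, h2, h3⟩ (rfl | ⟨-, -, -, hp, -⟩)
      · exact ⟨h1, h2, h3⟩
      · exact absurd hp (h.part_notInPropagator A h3)
  rw [← finprod_component, compsProd_eq_finprod_toAlg 𝕜 hq, finprod_eq_prod_of_fintype,
    finprod_eq_prod_of_fintype, ← Finset.mul_prod_erase _ _ (Finset.mem_univ A)]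
  rw [← Finset.mul_prod_erase (s := Finset.univ) (a := A)
    (fun d => toAlg 𝕜 (FGraph.comap (Subtype.val : {x : K // Quotient.mk (Γ.conn S) x.1 = d} → K)
      ((Γ.contract (Γ.part S A)).cut (Subtype.val ⁻¹' S)))) (Finset.mem_univ A)]
  congr 1
  -- In the contraction, the fibre over `A` consists of legs only and contributes the factor 1.
  rw [toAlg_of_legs 𝕜 (Γ := FGraph.comap (Subtype.val : {x : K // Quotient.mk (Γ.conn S) x.1 = A} → K)
      ((Γ.contract (Γ.part S A)).cut (Subtype.val ⁻¹' S))), one_mul]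
  · refine Finset.prod_congr rfl fun d hd => ?_
    have hdA : d ≠ A := (Finset.mem_erase.1 hd).1
    have hK : ∀ x : {x // Quotient.mk (Γ.conn S) x = d},
        x.1 ∉ Γ.part S A ∧ ¬ Γ.InPropagator (Γ.part S A) x.1 := fun x =>
      ⟨fun h => hdA (x.2.symm.trans h.2), h.part_notInPropagator A (x.2.trans_ne hdA)⟩
    refine toAlg_iso 𝕜 ⟨⟨fun x => ⟨⟨x.1, hK x⟩, x.2⟩, fun x => ⟨x.1.1, x.2⟩, fun _ => rfl,
      fun _ => rfl⟩, fun x y => ⟨?_, ?_⟩⟩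
    · change Γ.vert.r x.1 y.1 ↔ (Γ.conn (Γ.part S A)).r x.1 y.1
      rw [part_conn]
      exact (or_iff_left fun h => hdA (x.2.symm.trans h.1)).symm
    · change (Γ.edgeOn S).r x.1 y.1 ↔
        ((Γ.contract (Γ.part S A)).edgeOn (Subtype.val ⁻¹' S)).r ⟨x.1, hK x⟩ ⟨y.1, hK y⟩
      rw [edgeOn_rel, edgeOn_rel]
      refine or_congr (by simp only [Subtype.ext_iff])
        (and_congr_right fun hx => and_congr_right fun _ => ⟨fun h => chain_edge h,
          fun h => hchain _ _ (x.2.trans_ne hdA) hx h⟩)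
  · refine isLeg_of_edge_bot ?_
    rintro ⟨x, hx⟩ ⟨y, hy⟩ (h | ⟨hxS, -, -⟩)
    · exact Subtype.ext h
    · exact absurd ⟨hxS, hx⟩ x.2.1

theorem IsFeynman.subExponent_contract_part [Finite α] (h : Γ.IsFeynman) (hS : Γ.IsSub S)
    (A : Quotient (Γ.conn S)) (hne : Γ.part S A ≠ Γ.internals) :
    Γ.subExponent S = (Γ.component S A).exponent +
      (Γ.contract (Γ.part S A)).subExponent (Subtype.val ⁻¹' S) := by
  have h1 := h.compsProd_contract_part ℚ hS A
  rw [h.compsProd_eq_monomial ℚ hS, toAlg_eq_monomial ℚ (h.component hS A),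
    (h.contract (part_isSub hS A) hne).compsProd_eq_monomial ℚ
      (h.isSub_contract (part_isSub hS A) hS fun _ h => h.1), MvPolynomial.monomial_mul,
    one_mul] at h1
  exact (MvPolynomial.monomial_left_injective one_ne_zero) h1

theorem exponent_apply [Finite α] (Y : FeynmanGraph) :
    Γ.exponent Y = if Nonempty (Iso Y.rep Γ) then 1 else 0 := by
  unfold exponent
  split_ifs with h h' h'
  · rw [Finsupp.single_apply, if_pos ((cls_eq_iff_rep h Y).2 h')]
  · rw [Finsupp.single_apply, if_neg fun e => h' ((cls_eq_iff_rep h Y).1 e)]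
  · exact absurd (h'.some.symm.isFeynman Y.rep_isFeynman) h
  · rfl

theorem exponent_of_iso [Finite α] {Y : FeynmanGraph} (e : Iso Y.rep Γ) :
    Γ.exponent = Finsupp.single Y 1 := by
  have h := e.symm.isFeynman Y.rep_isFeynman
  rw [exponent, dif_pos h, (cls_eq_iff_rep h Y).2 ⟨e⟩]

theorem card_iso_right [Finite α] [Finite β] [Finite δ] {Γ' : FGraph β} {Γ'' : FGraph δ}
    (e : Iso Γ' Γ'') : Nat.card (Iso Γ Γ') = Nat.card (Iso Γ Γ'') :=
  Nat.card_congr ⟨fun f => f.trans e, fun f => f.trans e.symm,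
    fun _ => Subtype.ext (Equiv.ext fun _ => e.1.symm_apply_apply _),
    fun _ => Subtype.ext (Equiv.ext fun _ => e.1.apply_symm_apply _)⟩

theorem IsFeynman.subExponent_eq_zero [Finite α] (h : Γ.IsFeynman) (hS : Γ.IsSub S) :
    Γ.subExponent S = 0 ↔ S = ∅ := by
  constructor
  · intro h0
    by_contra hne
    obtain ⟨x, hx⟩ := Set.nonempty_iff_ne_empty.2 hne
    have hF := Fintype.ofFinite (Quotient (Γ.conn S))
    rw [subExponent, finsum_eq_sum_of_fintype] at h0
    have h1 := (Finset.sum_eq_zero_iff.1 h0) (Quotient.mk _ x) (Finset.mem_univ _)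
    have hc : (Γ.component S (Quotient.mk _ x)).IsFeynman := by
      refine (h.component hS _).resolve_right fun hl => hl ⟨x, rfl⟩ ?_
      exact (component_isInternal hS.edgeClosed _ _).2 ⟨hx, (hS.1 x hx).1⟩
    rw [exponent, dif_pos hc] at h1
    exact one_ne_zero (Finsupp.single_eq_zero.1 h1)
  · rintro rfl
    have h1 := h.compsProd_eq_monomial ℚ hS
    rw [compsProd_cut_empty] at h1
    exact (MvPolynomial.monomial_left_injective one_ne_zero) h1.symm

/-- The number of automorphisms of a disjoint union of graphs. -/
noncomputable def _root_.FeynmanGraph.symmetry (m : FeynmanGraph →₀ ℕ) : ℕ :=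
  m.prod fun Y k => k.factorial * Y.numAut ^ k

theorem _root_.FeynmanGraph.symmetry_add_single (m : FeynmanGraph →₀ ℕ) (Y : FeynmanGraph) :
    FeynmanGraph.symmetry (m + Finsupp.single Y 1) =
      Y.numAut * (m Y + 1) * FeynmanGraph.symmetry m := by
  unfold FeynmanGraph.symmetry
  have hs : ∀ m' : FeynmanGraph →₀ ℕ, m'.support ⊆ insert Y m.support →
      m'.prod (fun Y k => k.factorial * Y.numAut ^ k) = (m' Y).factorial * Y.numAut ^ m' Y *
        ∏ Z ∈ m.support.erase Y, (m' Z).factorial * Z.numAut ^ m' Z := by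
    intro m' hm'
    rw [Finsupp.prod_of_support_subset _ hm' _ (by simp), ← Finset.mul_prod_erase _ _
      (Finset.mem_insert_self Y _), Finset.erase_insert_eq_erase]
  rw [hs m (Finset.subset_insert _ _), hs (m + Finsupp.single Y 1) (by
    refine Finsupp.support_add.trans (Finset.union_subset (Finset.subset_insert _ _) ?_)
    exact Finsupp.support_single_subset.trans (by simp))]
  have : ∏ Z ∈ m.support.erase Y, ((m + Finsupp.single Y 1 : FeynmanGraph →₀ ℕ) Z).factorial *
      Z.numAut ^ (m + Finsupp.single Y 1 : FeynmanGraph →₀ ℕ) Z =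
      ∏ Z ∈ m.support.erase Y, (m Z).factorial * Z.numAut ^ m Z := by
    refine Finset.prod_congr rfl fun Z hZ => ?_
    have hZY := (Finset.mem_erase.1 hZ).1
    rw [Finsupp.add_apply, Finsupp.single_apply, if_neg hZY.symm, add_zero]
  rw [this, Finsupp.add_apply, Finsupp.single_eq_same, Nat.factorial_succ, pow_succ]
  ring

variable {Γ' : FGraph δ} {S' : Set δ}

theorem not_iso_contract_internals (hΓ : Γ.IsFeynman) : IsEmpty (Iso Γ (Γ'.contract Γ'.internals)) := by
  refine ⟨fun w => ?_⟩
  obtain ⟨x, y, hxy, hed⟩ := hΓ.has_internal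
  exact contract_internals_isLeg (w.1 x) ⟨w.1 y, fun e => hxy (w.1.injective e), ((w.2 x y).2).1 hed⟩

/-- The number of ways to obtain a graph with a marked subgraph by insertion of the components of
the subgraph into the cograph. -/
theorem markedGlueSum_card [Finite α] (hΓ : Γ.IsFeynman) (L : List FeynmanGraph) :
    ∀ (δ : Type) [Finite δ] (Γ' : FGraph δ) (S' : Set δ), Γ'.IsFeynman → Γ'.IsSub S' →
    markedGlueSum (fun _ _ Γ S => Nat.card (MarkedIso Γ S Γ' S')) L α Γ ∅ =
      if Γ'.subExponent S' = Multiset.toFinsupp (L : Multiset FeynmanGraph) then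
        FeynmanGraph.symmetry (Multiset.toFinsupp (L : Multiset FeynmanGraph)) *
          Nat.card (Iso Γ (Γ'.contract S')) else 0 := by
  -- The graph inserted last is the one that `sum_card_glue_iso` removes from the marked graph.
  induction L using List.reverseRecOn with
  | nil =>
    intro δ _ Γ' S' h' hS'
    change Nat.card (MarkedIso Γ ∅ Γ' S') = _
    rw [Multiset.coe_nil, map_zero]
    by_cases h0 : S' = ∅
    · rw [if_pos ((h'.subExponent_eq_zero hS').2 h0)]
      subst h0
      rw [card_iso_right h'.contract_empty_iso.some, FeynmanGraph.symmetry, Finsupp.prod_zero_index,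
        one_mul]
      exact Nat.card_congr (Equiv.subtypeUnivEquiv fun e x => Iff.rfl)
    · rw [if_neg fun h => h0 ((h'.subExponent_eq_zero hS').1 h)]
      have : IsEmpty (MarkedIso Γ ∅ Γ' S') := by
        refine ⟨fun e => h0 (Set.eq_empty_iff_forall_notMem.2 fun x hx => ?_)⟩
        obtain ⟨y, rfl⟩ := e.1.1.surjective x
        exact (e.2 y).2 hx
      exact Nat.card_of_isEmpty
  | append_singleton L Y ih =>
    intro δ _ Γ' S' h' hS'
    have hF := Fintype.ofFinite (Quotient (Γ'.conn S'))
    set m := Multiset.toFinsupp (L : Multiset FeynmanGraph) with hm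
    have hm' : Multiset.toFinsupp ((L ++ [Y] : List FeynmanGraph) : Multiset FeynmanGraph) =
        m + Finsupp.single Y 1 := by
      rw [← Multiset.coe_add, map_add, Multiset.coe_singleton, Multiset.toFinsupp_singleton]
    rw [markedGlueSum_append, hm', markedGlueSum_congr (g := fun _ _ Γ S =>
      ∑ A : Quotient (Γ'.conn S'), Nat.card (Iso Y.rep (Γ'.component S' A)) *
        Nat.card (MarkedIso Γ S (Γ'.contract (Γ'.part S' A)) (Subtype.val ⁻¹' S')))
      (fun α _ Γ S hΓ hS => (sum_card_glue_iso hΓ hS.edgeClosed Y.rep_isFeynman h' hS').trans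
        (finsum_eq_sum_of_fintype _)) L α Γ ∅ hΓ isSub_empty, markedGlueSum_sum]
    have hterm : ∀ A : Quotient (Γ'.conn S'), markedGlueSum (fun _ _ Γ S =>
        Nat.card (Iso Y.rep (Γ'.component S' A)) *
        Nat.card (MarkedIso Γ S (Γ'.contract (Γ'.part S' A)) (Subtype.val ⁻¹' S'))) L α Γ ∅ =
        (Γ'.component S' A).exponent Y *
          if Γ'.subExponent S' = m + Finsupp.single Y 1 then
            Y.numAut * (FeynmanGraph.symmetry m * Nat.card (Iso Γ (Γ'.contract S'))) else 0 := by
      intro A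
      refine (markedGlueSum_map (AddMonoidHom.mulLeft
        (Nat.card (Iso Y.rep (Γ'.component S' A)))) _ L α Γ ∅).trans ?_
      rw [AddMonoidHom.coe_mulLeft, exponent_apply]
      split_ifs with hY he he
      · obtain ⟨e⟩ := hY
        rw [← card_iso_right e, one_mul]
        change Y.numAut * _ = _
        congr 1
        by_cases hne : Γ'.part S' A = Γ'.internals
        -- A single component that is the whole graph has a cograph without edges, which is not
        -- isomorphic to `Γ`: both sides vanish.
        · have hSI : S' = Γ'.internals :=
            Set.Subset.antisymm hS'.subset (hne ▸ fun _ h => h.1)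
          have hE : IsEmpty (Iso Γ (Γ'.contract S')) := by
            rw [hSI]; exact not_iso_contract_internals hΓ
          rw [Nat.card_of_isEmpty, mul_zero]
          refine (markedGlueSum_congr (g := fun _ _ _ _ => (AddMonoidHom.mulLeft 0 : ℕ →+ ℕ) 0)
            (fun α _ Γ S hΓ hS => ?_) L α Γ ∅ hΓ isSub_empty).trans
              ((markedGlueSum_map _ _ L α Γ ∅).trans (zero_mul _))
          have : IsEmpty (MarkedIso Γ S (Γ'.contract (Γ'.part S' A)) (Subtype.val ⁻¹' S')) := by
            rw [hne]; exact ⟨fun e => (not_iso_contract_internals hΓ).false e.1⟩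
          rw [Nat.card_of_isEmpty, map_zero]
        · have hsub := part_isSub hS' A
          have hle : Γ'.part S' A ⊆ S' := fun _ h => h.1
          have h1 := h'.subExponent_contract_part hS' A hne
          rw [exponent_of_iso e, he, add_comm m] at h1
          rw [ih _ _ _ (h'.contract hsub hne) (h'.isSub_contract hsub hS' hle),
            if_pos (add_left_cancel h1).symm]
          congr 1
          exact card_iso_right (contract_contract_iso hle hsub.edgeClosed hS'.edgeClosed
            (hS'.propClosed hsub.edgeClosed)).some
      · obtain ⟨e⟩ := hY
        rw [mul_zero]
        refine mul_eq_zero_of_right _ ?_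
        by_cases hne : Γ'.part S' A = Γ'.internals
        · refine (markedGlueSum_congr (g := fun _ _ _ _ => (AddMonoidHom.mulLeft 0 : ℕ →+ ℕ) 0)
            (fun α _ Γ S hΓ hS => ?_) L α Γ ∅ hΓ isSub_empty).trans
              ((markedGlueSum_map _ _ L α Γ ∅).trans (zero_mul _))
          have : IsEmpty (MarkedIso Γ S (Γ'.contract (Γ'.part S' A)) (Subtype.val ⁻¹' S')) := by
            rw [hne]; exact ⟨fun e => (not_iso_contract_internals hΓ).false e.1⟩
          rw [Nat.card_of_isEmpty, map_zero]
        · have hsub := part_isSub hS' A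
          have hle : Γ'.part S' A ⊆ S' := fun _ h => h.1
          have h1 := h'.subExponent_contract_part hS' A hne
          rw [exponent_of_iso e] at h1
          rw [ih _ _ _ (h'.contract hsub hne) (h'.isSub_contract hsub hS' hle), if_neg]
          intro h2
          rw [h2, add_comm] at h1
          exact he h1
      · have : IsEmpty (Iso Y.rep (Γ'.component S' A)) := not_nonempty_iff.1 hY
        rw [Nat.card_of_isEmpty, zero_mul, zero_mul]
      · have : IsEmpty (Iso Y.rep (Γ'.component S' A)) := not_nonempty_iff.1 hY
        rw [Nat.card_of_isEmpty, zero_mul, zero_mul]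
    rw [Finset.sum_congr rfl fun A _ => hterm A, ← Finset.sum_mul]
    -- Every component of `S'` that is isomorphic to `Y` can be the last one inserted; their number is
    -- the factor by which the factorial in the symmetry factor grows.
    have hsum : ∑ A : Quotient (Γ'.conn S'), (Γ'.component S' A).exponent Y =
        Γ'.subExponent S' Y := by
      rw [subExponent, finsum_eq_sum_of_fintype, Finsupp.finsetSum_apply]
    rw [hsum]
    split_ifs with he
    · rw [he, FeynmanGraph.symmetry_add_single, Finsupp.add_apply, Finsupp.single_eq_same]
      ring
    · rw [mul_zero]

end FGraph


/-! ### Insertion places -/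

theorem Nat.card_equiv_of_card_eq {α β : Type*} [Finite α] [Finite β]
    (h : Nat.card α = Nat.card β) : Nat.card (α ≃ β) = (Nat.card α).factorial := by
  have := Fintype.ofFinite α
  have := Fintype.ofFinite β
  obtain ⟨e⟩ := Finite.card_eq.1 h
  rw [Nat.card_eq_fintype_card, Fintype.card_equiv e, Nat.card_eq_fintype_card]

namespace FGraph

variable {α β : Type} {Γ : FGraph α} {S : Set α} {Y : FGraph β}

/-- The vertex does not belong to the subgraph with internal half-edges `S`. -/
def IsFree (Γ : FGraph α) (S : Set α) (v : Quotient Γ.vert) : Prop :=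
  ∀ x ∈ S, Quotient.mk Γ.vert x ≠ v

/-- The number of half-edges of internal edges outside of the subgraph. -/
noncomputable def numFree (Γ : FGraph α) (S : Set α) : ℕ :=
  Nat.card {x // Γ.IsInternal x ∧ x ∉ S}

namespace Gluing

variable (φ : Gluing Γ S Y)

theorem isInternal_outer_iff {x : α} :
    (glue Γ S Y φ).IsInternal (φ.outer x) ↔ Γ.IsInternal x := by
  refine ⟨fun h => ?_, fun hx => ?_⟩
  · by_contra hx
    exact φ.outer_isLeg hx h
  · obtain ⟨y, hy, hxy⟩ := hx
    by_cases h2 : Y.numLegs = 2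
    · by_cases hr : x ∈ Set.range φ.1
      · obtain ⟨l, rfl⟩ := hr
        exact ⟨φ.inner l.1, φ.inner_ne_outer h2 _ _, φ.edge_glued l⟩
      · refine ⟨φ.outer y, fun e => hy (φ.outer_injective e), (φ.glue_edge_outer x y).2
          (Or.inr ⟨φ.mem_keep fun _ => hr, φ.mem_keep fun _ hr' => hr ?_, hxy⟩)⟩
        exact (φ.edge_iff h2 hr').1 (Γ.edge.symm' hxy)
    · exact ⟨φ.outer y, fun e => hy (φ.outer_injective e), (φ.glue_edge_outer x y).2
        (Or.inr ⟨φ.mem_keep fun h => absurd h h2, φ.mem_keep fun h => absurd h h2, hxy⟩)⟩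

theorem numFree_of_ne (h2 : Y.numLegs ≠ 2) (hS : Γ.EdgeClosed S) :
    (glue Γ S Y φ).numFree (glueSet Γ S Y φ) = Γ.numFree S := by
  refine (Nat.card_congr (Equiv.ofBijective (fun x : {x // Γ.IsInternal x ∧ x ∉ S} =>
    (⟨φ.outer x.1, φ.isInternal_outer_iff.2 x.2.1,
      fun h => x.2.2 ((φ.outer_mem_glueSet hS _).1 h)⟩ :
      {z // (glue Γ S Y φ).IsInternal z ∧ z ∉ glueSet Γ S Y φ})) ⟨?_, ?_⟩)).symm
  · intro x x' h
    exact Subtype.ext (φ.outer_injective (congrArg Subtype.val h))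
  · rintro ⟨z, hz, hzS⟩
    rcases φ.glue_cases z with ⟨x, rfl⟩ | ⟨y, hy, rfl⟩ | ⟨h, -⟩
    · exact ⟨⟨x, φ.isInternal_outer_iff.1 hz,
        fun h => hzS ((φ.outer_mem_glueSet hS _).2 h)⟩, rfl⟩
    · exact absurd ((φ.inner_mem_glueSet y).2 hy) hzS
    · exact absurd h h2

theorem numFree_of_two [Finite α] [Finite β] (h2 : Y.numLegs = 2) (hS : Γ.EdgeClosed S) :
    (glue Γ S Y φ).numFree (glueSet Γ S Y φ) = Γ.numFree S + 2 := by
  have hi : ∀ x, (glue Γ S Y φ).IsInternal (φ.outer x) ↔ Γ.IsInternal x := fun x =>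
    φ.isInternal_outer_iff
  rw [← h2, numFree, numFree, numLegs, ← Nat.card_sum]
  refine (Nat.card_congr (Equiv.ofBijective (fun x : {x // Γ.IsInternal x ∧ x ∉ S} ⊕ {l // Y.IsLeg l} =>
    Sum.elim (fun x => (⟨φ.outer x.1, (hi _).2 x.2.1,
      fun h => x.2.2 ((φ.outer_mem_glueSet hS _).1 h)⟩ :
      {z // (glue Γ S Y φ).IsInternal z ∧ z ∉ glueSet Γ S Y φ}))
      (fun l => ⟨φ.inner l.1, ⟨φ.outer (φ.1 l), (φ.inner_ne_outer h2 _ _).symm,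
        (glue Γ S Y φ).edge.symm' (φ.edge_glued l)⟩,
        fun h => l.2 ((φ.inner_mem_glueSet _).1 h)⟩) x) ⟨?_, ?_⟩)).symm
  · rintro (x | l) (x' | l') h <;> have h' := congrArg Subtype.val h
    · exact congrArg _ (Subtype.ext (φ.outer_injective h'))
    · exact absurd h'.symm (φ.inner_ne_outer h2 _ _)
    · exact absurd h' (φ.inner_ne_outer h2 _ _)
    · exact congrArg _ (Subtype.ext (φ.inner_injective h'))
  · rintro ⟨z, hz, hzS⟩
    rcases φ.glue_cases z with ⟨x, rfl⟩ | ⟨y, hy, rfl⟩ | ⟨-, l, rfl⟩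
    · exact ⟨Sum.inl ⟨x, (hi x).1 hz, fun h => hzS ((φ.outer_mem_glueSet hS _).2 h)⟩, rfl⟩
    · exact absurd ((φ.inner_mem_glueSet y).2 hy) hzS
    · exact ⟨Sum.inr l, rfl⟩

/-- The free vertices after an insertion are the free vertices that have not been replaced. -/
theorem finprod_free [Finite α] [Finite β] {M : Type*} [CommMonoid M] (hY : Y.IsFeynman)
    (hS : Γ.EdgeClosed S) (g : ℕ → M) :
    ∏ᶠ v : {v // (glue Γ S Y φ).IsFree (glueSet Γ S Y φ) v}, g ((glue Γ S Y φ).valence v.1) =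
      ∏ᶠ v : {v // Γ.IsFree S v ∧ (Y.numLegs ≠ 2 → ∀ l, Quotient.mk Γ.vert (φ.1 l) ≠ v)},
        g (Γ.valence v.1) := by
  have hout : ∀ x, (Y.numLegs ≠ 2 → ∀ l, Quotient.mk Γ.vert (φ.1 l) ≠ Quotient.mk Γ.vert x) →
      (φ.outer x).1 = Sum.inl x := by
    intro x hx
    by_cases h2 : Y.numLegs = 2
    · exact φ.outer_of_two h2 x
    · refine φ.outer_of_notMem ?_
      rintro ⟨l, rfl⟩
      exact hx h2 l rfl
  have hinl : ∀ x (z : GlueCarrier Γ S Y φ), z.1 = Sum.inl x → z = φ.outer x ∧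
      (Y.numLegs ≠ 2 → ∀ l, Quotient.mk Γ.vert (φ.1 l) ≠ Quotient.mk Γ.vert x) := by
    intro x z hz
    have hx := z.2 x hz
    refine ⟨Subtype.ext (hz.trans ?_), fun h2 l h => hx.resolve_left h2 ?_⟩
    · rcases hx with h2 | hx
      · exact (φ.outer_of_two h2 x).symm
      · exact (φ.outer_of_notMem hx).symm
    · exact (φ.vert_iff h2 ⟨l, rfl⟩).1 (Quotient.exact h)
  -- Vertices of the inserted graph carry internal half-edges of it, so they are not free.
  have hnotfree : ∀ y, ¬ (glue Γ S Y φ).IsFree (glueSet Γ S Y φ) (Quotient.mk _ (φ.inner y)) := by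
    intro y hf
    have h2 := hY.two_le_card_internal (Quotient.mk _ y)
    obtain ⟨⟨y', hy', hv⟩⟩ : Nonempty {x // Y.IsInternal x ∧ Quotient.mk Y.vert x = Quotient.mk _ y} :=
      (Nat.card_pos_iff.1 (by omega)).1
    refine hf (φ.inner y') ((φ.inner_mem_glueSet y').2 hy') (Quotient.sound ?_)
    exact (φ.glue_vert _ _).2 (Sum.LiftRel.inr (Quotient.exact hv))
  have hvo : ∀ x, (Y.numLegs ≠ 2 → ∀ l, Quotient.mk Γ.vert (φ.1 l) ≠ Quotient.mk Γ.vert x) →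
      ∀ z, (glue Γ S Y φ).vert.r (φ.outer x) z ↔ ∃ x', z.1 = Sum.inl x' ∧ Γ.vert.r x x' := by
    intro x hx z
    rw [φ.glue_vert, hout x hx]
    constructor
    · intro h
      generalize z.1 = w at h
      cases h with
      | inl h => exact ⟨_, rfl, h⟩
    · rintro ⟨x', e, h⟩
      rw [e]
      exact Sum.LiftRel.inl h
  symm
  have hmk : ∀ v : Quotient Γ.vert, Quotient.mk Γ.vert v.out = v := Quotient.out_eq
  refine finprod_eq_of_bijective (fun v => ⟨Quotient.mk _ (φ.outer v.1.out), ?_⟩) ⟨?_, ?_⟩ ?_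
  · intro z hz hzv
    obtain ⟨x', hx', hv⟩ := (hvo v.1.out (by rw [hmk]; exact v.2.2) z).1
      (Setoid.symm' _ (Quotient.exact hzv))
    rw [(hinl _ _ hx').1, φ.outer_mem_glueSet hS] at hz
    exact v.2.1 x' hz ((Quotient.sound hv).symm.trans (hmk _))
  · rintro ⟨v, hv⟩ ⟨v', hv'⟩ h
    have h' := Quotient.exact (congrArg Subtype.val h)
    obtain ⟨x', hx', hvv⟩ := (hvo v.out (by rw [hmk]; exact hv.2) _).1 h'
    have hx'' := hout v'.out (by rw [hmk]; exact hv'.2)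
    have hx3 := Sum.inl.inj (hx''.symm.trans hx')
    refine Subtype.ext ?_
    change v = v'
    rw [← hmk v, ← hmk v', hx3]
    exact Quotient.sound hvv
  · rintro ⟨w, hw⟩
    induction w using Quotient.inductionOn with | _ z
    rcases hz : z.1 with x | y
    · obtain ⟨rfl, h⟩ := hinl x z hz
      refine ⟨⟨Quotient.mk _ x, fun x' hx' hv => ?_, h⟩, Subtype.ext (Quotient.sound ?_)⟩
      · refine hw (φ.outer x') ((φ.outer_mem_glueSet hS _).2 hx') (Quotient.sound ?_)
        refine Setoid.symm' _ ((hvo x h _).2 ⟨x', hout x' ?_, Setoid.symm' _ (Quotient.exact hv)⟩)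
        rw [hv]; exact h
      · refine Setoid.symm' _ ((hvo x h _).2 ⟨_, hout _ ?_, Setoid.symm' _ (Quotient.exact (hmk _))⟩)
        rw [hmk]; exact h
    · have : z = φ.inner y := Subtype.ext hz
      exact absurd (this ▸ hw) (hnotfree y)
  · rintro ⟨v, hv⟩
    have hv2 : (Y.numLegs ≠ 2 → ∀ l, Quotient.mk Γ.vert (φ.1 l) ≠ Quotient.mk Γ.vert v.out) := by
      rw [hmk]; exact hv.2
    congr 1
    refine Nat.card_congr (Equiv.ofBijective (fun x => ⟨φ.outer x.1, ?_⟩) ⟨?_, ?_⟩)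
    · refine Quotient.sound (Setoid.symm' _ ((hvo _ hv2 _).2 ⟨x.1, hout _ ?_, ?_⟩))
      · rw [x.2]; exact hv.2
      · exact Quotient.exact ((hmk v).trans x.2.symm)
    · intro x x' h
      exact Subtype.ext (φ.outer_injective (congrArg Subtype.val h))
    · rintro ⟨z, hz⟩
      obtain ⟨x', hx', hvv⟩ := (hvo _ hv2 _).1 (Setoid.symm' _ (Quotient.exact hz))
      obtain ⟨rfl, -⟩ := hinl _ _ hx'
      exact ⟨⟨x', (Quotient.sound hvv).symm.trans (hmk v)⟩, rfl⟩

end Gluing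

/-- A two-legged graph can be put into every free internal edge in two ways. -/
theorem card_gluing_of_two (hΓ : Γ.IsFeynman) (hS : Γ.EdgeClosed S) (hY : Y.IsFeynman)
    (h2 : Y.numLegs = 2) : Nat.card (Gluing Γ S Y) = Γ.numFree S := by
  obtain ⟨l₀, hl₀⟩ := hY.exists_leg
  obtain ⟨l₁, hl₁, hne⟩ := exists_ne_of_card_two h2 l₀
  have hne' : (⟨l₁, hl₁⟩ : {l // Y.IsLeg l}) ≠ ⟨l₀, hl₀⟩ := fun h => hne (congrArg Subtype.val h)
  have hl : ∀ l : {l // Y.IsLeg l}, l = ⟨l₀, hl₀⟩ ∨ l = ⟨l₁, hl₁⟩ := by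
    intro l
    rcases eq_or_eq_of_card_two h2 l.2 hl₀ hl₁ with e | e | e
    · exact Or.inl (Subtype.ext e)
    · exact Or.inr (Subtype.ext e)
    · exact absurd e.symm hne
  -- A gluing is determined by the image of the first leg: the second leg goes to the other
  -- half-edge of the same edge.
  refine Nat.card_congr (Equiv.ofBijective (fun φ : Gluing Γ S Y =>
    (⟨φ.1 ⟨l₀, hl₀⟩, φ.isInternal h2 ⟨_, rfl⟩, φ.notMem hS ⟨_, rfl⟩⟩ :
      {x // Γ.IsInternal x ∧ x ∉ S})) ⟨?_, ?_⟩)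
  · intro φ ψ h
    have h0 : φ.1 ⟨l₀, hl₀⟩ = ψ.1 ⟨l₀, hl₀⟩ := congrArg Subtype.val h
    have h1 : φ.1 ⟨l₁, hl₁⟩ = ψ.1 ⟨l₁, hl₁⟩ := by
      have e1 := φ.edge_of_two h2 ⟨l₀, hl₀⟩ ⟨l₁, hl₁⟩
      have e2 := ψ.edge_of_two h2 ⟨l₀, hl₀⟩ ⟨l₁, hl₁⟩
      rw [← h0] at e2
      rcases hΓ.edge_le_two _ _ _ e1 e2 with e | e | e
      · exact absurd (φ.2.1 e).symm hne'
      · exact absurd (ψ.2.1 (h0.symm.trans e)).symm hne'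
      · exact e
    refine Subtype.ext (funext fun l => ?_)
    rcases hl l with rfl | rfl
    · exact h0
    · exact h1
  · rintro ⟨x, hx, hxS⟩
    obtain ⟨y, hy, hxy⟩ := id hx
    refine ⟨⟨fun l => if l = ⟨l₀, hl₀⟩ then x else y, fun l l' h => ?_, ?_⟩,
      Subtype.ext (if_pos rfl)⟩
    · rcases hl l with rfl | rfl <;> rcases hl l' with rfl | rfl
      · rfl
      · simp only [if_neg hne', if_true] at h
        exact absurd h.symm hy
      · simp only [if_neg hne', if_true] at h
        exact absurd h hy
      · rfl
    · rw [if_pos h2]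
      refine ⟨x, hxS, hx, Set.Subset.antisymm ?_ fun z hz => ?_⟩
      · rintro _ ⟨l, rfl⟩
        rcases hl l with rfl | rfl
        · simp only [if_true]
          exact Γ.edge.refl' _
        · simp only [if_neg hne']
          exact hxy
      · rcases hΓ.edge_le_two _ _ _ hxy hz with e | e | e
        · exact absurd e.symm hy
        · exact ⟨⟨l₀, hl₀⟩, (if_pos rfl).trans e⟩
        · exact ⟨⟨l₁, hl₁⟩, (if_neg hne').trans e⟩

/-- The gluings of a graph with at least three legs are its bijections with the free vertices
of the same valence. -/
theorem finsum_gluing_of_ne [Finite α] [Finite β] {M : Type*} [AddCommMonoid M]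
    (h2 : Y.numLegs ≠ 2) (G : Quotient Γ.vert → M) (l₀ : {l // Y.IsLeg l}) :
    ∑ᶠ φ : Gluing Γ S Y, G (Quotient.mk Γ.vert (φ.1 l₀)) =
      Y.numLegs.factorial • ∑ᶠ v : {v // Γ.IsFree S v ∧ Γ.valence v = Y.numLegs}, G v.1 := by
  -- A gluing is a free vertex of the right valence together with a bijection from the legs to its
  -- half-edges.
  set P := Σ v : {v // Γ.IsFree S v ∧ Γ.valence v = Y.numLegs},
    {l // Y.IsLeg l} ≃ {x // Quotient.mk Γ.vert x = v.1}
  have hF1 := Fintype.ofFinite {v // Γ.IsFree S v ∧ Γ.valence v = Y.numLegs}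
  have hF2 := Fintype.ofFinite P
  have hF3 := Fintype.ofFinite {l // Y.IsLeg l}
  have hF4 : ∀ v : Quotient Γ.vert, Fintype {x // Quotient.mk Γ.vert x = v} := fun v =>
    Fintype.ofFinite _
  have hrange : ∀ p : P, Set.range (fun l => (p.2 l).1) = {x | Quotient.mk Γ.vert x = p.1.1} := by
    intro p
    refine Set.Subset.antisymm ?_ fun x hx => ?_
    · rintro _ ⟨l, rfl⟩; exact (p.2 l).2
    · exact ⟨p.2.symm ⟨x, hx⟩, by simp⟩
  have hbij : ∑ᶠ φ : Gluing Γ S Y, G (Quotient.mk Γ.vert (φ.1 l₀)) = ∑ᶠ p : P, G p.1.1 := by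
    symm
    refine finsum_eq_of_bijective (fun p => ⟨fun l => (p.2 l).1,
      fun l l' h => p.2.injective (Subtype.ext h), ?_⟩) ⟨?_, ?_⟩ ?_
    · rw [if_neg h2, hrange]
      obtain ⟨x, hx⟩ := Quotient.exists_rep p.1.1
      refine ⟨x, ?_, ?_⟩
      · ext z
        change Quotient.mk Γ.vert z = p.1.1 ↔ _
        rw [← hx]
        exact ⟨fun h => Setoid.symm' _ (Quotient.exact h),
          fun h => Quotient.sound (Setoid.symm' _ h)⟩
      · exact Set.disjoint_left.2 fun z hz hzS => p.1.2.1 z hzS hz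
    · rintro ⟨⟨v, hv⟩, e⟩ ⟨⟨v', hv'⟩, e'⟩ h
      have h' : ∀ l, (e l).1 = (e' l).1 := fun l => congrFun (congrArg Subtype.val h) l
      have hvv : v = v' := (e l₀).2.symm.trans ((congrArg _ (h' l₀)).trans (e' l₀).2)
      subst hvv
      congr 1
      exact Equiv.ext fun l => Subtype.ext (h' l)
    · intro φ
      have hv : ∀ x, Quotient.mk Γ.vert x = Quotient.mk Γ.vert (φ.1 l₀) ↔ x ∈ Set.range φ.1 :=
        fun x => ⟨fun h => (φ.vert_iff h2 ⟨l₀, rfl⟩).1 (Quotient.exact h.symm),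
          fun h => Quotient.sound (Setoid.symm' _ ((φ.vert_iff h2 ⟨l₀, rfl⟩).2 h))⟩
      let e : {l // Y.IsLeg l} ≃ {x // Quotient.mk Γ.vert x = Quotient.mk Γ.vert (φ.1 l₀)} :=
        Equiv.ofBijective (fun l => ⟨φ.1 l, (hv _).2 ⟨l, rfl⟩⟩)
          ⟨fun l l' h => φ.2.1 (congrArg Subtype.val h), fun x => by
            obtain ⟨l, hl⟩ := (hv _).1 x.2
            exact ⟨l, Subtype.ext hl⟩⟩
      refine ⟨⟨⟨Quotient.mk Γ.vert (φ.1 l₀), fun x hx h => ?_, ?_⟩, e⟩, rfl⟩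
      · have h3 := φ.2.2
        rw [if_neg h2] at h3
        obtain ⟨-, -, hd⟩ := h3
        exact Set.disjoint_left.1 hd ((hv _).1 h) hx
      · exact (Nat.card_congr e).symm
    · intro p
      exact congrArg G (p.2 l₀).2.symm
  rw [hbij, finsum_eq_sum_of_fintype, finsum_eq_sum_of_fintype, Finset.smul_sum]
  have hF5 : ∀ v : {v // Γ.IsFree S v ∧ Γ.valence v = Y.numLegs},
      Fintype ({l // Y.IsLeg l} ≃ {x // Quotient.mk Γ.vert x = v.1}) := fun v => Fintype.ofFinite _
  rw [show (Finset.univ : Finset P) = Finset.univ.sigma fun _ => Finset.univ from by ext; simp,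
    Finset.sum_sigma]
  refine Finset.sum_congr rfl fun v _ => ?_
  refine (Finset.sum_const (G v.1)).trans ?_
  rw [Finset.card_univ, ← Nat.card_eq_fintype_card]
  congr 1
  exact Nat.card_equiv_of_card_eq v.2.2.symm

end FGraph


/-! ### The generating function of insertions -/

theorem finprod_subtype_eq_prod {ι M : Type*} [Fintype ι] [CommMonoid M] (p : ι → Prop)
    [DecidablePred p] (f : ι → M) :
    ∏ᶠ i : {i // p i}, f i.1 = ∏ i ∈ Finset.univ.filter p, f i := by
  rw [finprod_subtype_eq_finprod_cond p, finprod_cond_eq_prod_of_cond_iff]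
  intro x _
  simp

theorem Derivation.leibniz_finsetProd {R A ι : Type*} [DecidableEq ι] [CommRing R] [CommRing A] [Algebra R A]
    (D : Derivation R A A) (s : Finset ι) (f : ι → A) :
    D (∏ i ∈ s, f i) = ∑ i ∈ s, (∏ j ∈ s.erase i, f j) * D (f i) := by
  induction s using Finset.induction_on with
  | empty => simp
  | insert a s ha ih =>
    rw [Finset.prod_insert ha, D.leibniz, ih, Finset.sum_insert ha, Finset.erase_insert ha,
      add_comm, smul_eq_mul, smul_eq_mul, Finset.mul_sum]
    congr 1
    refine Finset.sum_congr rfl fun i hi => ?_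
    rw [Finset.erase_insert_of_ne (ne_of_mem_of_not_mem hi ha).symm,
      Finset.prod_insert (fun h => ha (Finset.mem_of_mem_erase h)), mul_assoc]

noncomputable section

variable (𝕜 : Type*) [Field 𝕜]

theorem FeynmanGraph.one_le_loops (γ : FeynmanGraph) : 1 ≤ γ.loops := γ.rep_isFeynman.one_le_loops

theorem coeff_green (n k : ℕ) : PowerSeries.coeff k (green 𝕜 n) = (if k = 0 then 1 else 0) +
    greenSign 𝕜 n • ∑ᶠ γ : {γ : FeynmanGraph // γ.numLegs = n ∧ γ.loops = k},
      γ.1.weight 𝕜 • (MvPolynomial.X γ.1 : GraphAlg 𝕜) := by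
  rw [green, map_add, PowerSeries.coeff_one, PowerSeries.coeff_mk]

theorem constantCoeff_green (n : ℕ) : PowerSeries.constantCoeff (green 𝕜 n) = 1 := by
  rw [← PowerSeries.coeff_zero_eq_constantCoeff_apply, coeff_green, if_pos rfl]
  have : IsEmpty {γ : FeynmanGraph // γ.numLegs = n ∧ γ.loops = 0} :=
    ⟨fun γ => absurd γ.1.one_le_loops (by rw [γ.2.2]; norm_num)⟩
  rw [finsum_of_isEmpty, smul_zero, add_zero]

theorem green_mul_greenInv (n : ℕ) : green 𝕜 n * greenInv 𝕜 n = 1 :=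
  PowerSeries.mul_invOfUnit _ _ (constantCoeff_green 𝕜 n)

/-- The coefficientwise partial derivative of power series over the algebra of graphs. -/
def seriesDeriv (Y : FeynmanGraph) :
    Derivation 𝕜 (PowerSeries (GraphAlg 𝕜)) (PowerSeries (GraphAlg 𝕜)) :=
  Derivation.mk'
    { toFun := fun f => PowerSeries.mk fun k => MvPolynomial.pderiv Y (PowerSeries.coeff k f)
      map_add' := fun f g => by ext k : 1; simp
      map_smul' := fun c f => by ext k : 1; simp }
    (fun f g => by
      ext k : 1
      simp only [LinearMap.coe_mk, AddHom.coe_mk, PowerSeries.coeff_mk, PowerSeries.coeff_mul,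
        map_sum, map_add, smul_eq_mul, Derivation.leibniz, Finset.sum_add_distrib]
      congr 1
      exact (Finset.Nat.sum_antidiagonal_swap (f := fun x : ℕ × ℕ =>
        PowerSeries.coeff x.1 g * MvPolynomial.pderiv Y (PowerSeries.coeff x.2 f))))

theorem coeff_seriesDeriv (Y : FeynmanGraph) (f : PowerSeries (GraphAlg 𝕜)) (k : ℕ) :
    PowerSeries.coeff k (seriesDeriv 𝕜 Y f) = MvPolynomial.pderiv Y (PowerSeries.coeff k f) :=
  PowerSeries.coeff_mk k fun k => MvPolynomial.pderiv Y (PowerSeries.coeff k f)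

theorem seriesDeriv_green (Y : FeynmanGraph) (n : ℕ) : seriesDeriv 𝕜 Y (green 𝕜 n) =
    if Y.numLegs = n then (greenSign 𝕜 n * Y.weight 𝕜) • PowerSeries.X ^ Y.loops else 0 := by
  ext k : 1
  have hF := Fintype.ofFinite {γ : FeynmanGraph // γ.numLegs = n ∧ γ.loops = k}
  rw [coeff_seriesDeriv, coeff_green, map_add, finsum_eq_sum_of_fintype, Derivation.map_smul,
    map_sum]
  have h1 : MvPolynomial.pderiv Y ((if k = 0 then 1 else 0 : GraphAlg 𝕜)) = 0 := by
    split_ifs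
    · exact (MvPolynomial.pderiv Y).map_one_eq_zero
    · exact map_zero _
  rw [h1, zero_add]
  simp_rw [Derivation.map_smul, MvPolynomial.pderiv_X]
  split_ifs with h
  · rw [PowerSeries.coeff_smul, PowerSeries.coeff_X_pow, mul_smul]
    congr 1
    split_ifs with hk
    · rw [Finset.sum_eq_single_of_mem (⟨Y, h, hk.symm⟩ :
        {γ : FeynmanGraph // γ.numLegs = n ∧ γ.loops = k}) (Finset.mem_univ _)]
      · rw [Pi.single_eq_same]
      · intro γ _ hne
        rw [Pi.single_eq_of_ne (fun e => hne (Subtype.ext e)), smul_zero]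
    · rw [smul_zero]
      refine Finset.sum_eq_zero fun γ _ => ?_
      rw [Pi.single_eq_of_ne (fun e => hk (γ.2.2.symm.trans (congrArg _ e))), smul_zero]
  · rw [map_zero]
    refine smul_eq_zero_of_right _ (Finset.sum_eq_zero fun γ _ => ?_)
    rw [Pi.single_eq_of_ne (fun e => h ((congrArg _ e.symm).trans γ.2.1)), smul_zero]

theorem seriesDeriv_greenInv (Y : FeynmanGraph) (n : ℕ) : seriesDeriv 𝕜 Y (greenInv 𝕜 n) =
    - greenInv 𝕜 n ^ 2 * seriesDeriv 𝕜 Y (green 𝕜 n) := by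
  rw [(seriesDeriv 𝕜 Y).leibniz_of_mul_eq_one (b := green 𝕜 n)
    (by rw [mul_comm]; exact green_mul_greenInv 𝕜 n), smul_eq_mul]

namespace FGraph

variable {α β : Type} {Γ : FGraph α} {S : Set α}

theorem IsFeynman.even_numFree [Finite α] (hΓ : Γ.IsFeynman) (hS : Γ.EdgeClosed S) :
    Even (Γ.numFree S) := by
  have h := even_card_internal (Γ := Γ.cut Sᶜ) ?_
  · convert h using 1
    refine Nat.card_congr (Equiv.subtypeEquivRight fun x => ⟨?_, ?_⟩)
    · rintro ⟨⟨y, hy, hxy⟩, hx⟩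
      exact ⟨y, hy, Or.inr ⟨hx, fun h => hx (hS y h x (Γ.edge.symm' hxy)), hxy⟩⟩
    · rintro ⟨y, hy, (h | ⟨hx, -, h⟩)⟩
      · exact absurd h.symm hy
      · exact ⟨⟨y, hy, h⟩, hx⟩
  · rintro x y z (h | ⟨-, -, h⟩) (h' | ⟨-, -, h'⟩)
    · exact Or.inl h
    · exact Or.inl h
    · exact Or.inr (Or.inl h')
    · exact hΓ.edge_le_two x y z h h'

/-- A factor `X^m` for every free vertex of valence `m` and a factor `1 / X^2` for every free
internal edge. -/
def freeSeries (Γ : FGraph α) (S : Set α) : PowerSeries (GraphAlg 𝕜) :=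
  (∏ᶠ v : {v // Γ.IsFree S v}, green 𝕜 (Γ.valence v.1)) * greenInv 𝕜 2 ^ (Γ.numFree S / 2)

/-- Differentiation by a graph amounts to its insertion in all possible ways. -/
theorem IsFeynman.seriesDeriv_freeSeries [CharZero 𝕜] [Finite α] (hΓ : Γ.IsFeynman)
    (hS : Γ.EdgeClosed S) (Y : FeynmanGraph) :
    (Y.numAut : 𝕜) • seriesDeriv 𝕜 Y (Γ.freeSeries 𝕜 S) = PowerSeries.X ^ Y.loops *
      ∑ᶠ φ : Gluing Γ S Y.rep, (glue Γ S Y.rep φ).freeSeries 𝕜 (glueSet Γ S Y.rep φ) := by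
  have hY := Y.rep_isFeynman
  have hF := Fintype.ofFinite (Quotient Γ.vert)
  have hA : (Y.numAut : 𝕜) ≠ 0 := by
    have : Nonempty (Iso Y.rep Y.rep) := ⟨Iso.refl _⟩
    exact Nat.cast_ne_zero.2 Nat.card_pos.ne'
  set F := Finset.univ.filter (Γ.IsFree S) with hFdef
  set e := Γ.numFree S / 2 with he
  set g : Quotient Γ.vert → PowerSeries (GraphAlg 𝕜) := fun v => green 𝕜 (Γ.valence v) with hg
  have hprod : Γ.freeSeries 𝕜 S = (∏ v ∈ F, g v) * greenInv 𝕜 2 ^ e := by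
    rw [freeSeries, finprod_subtype_eq_prod (Γ.IsFree S) fun v => green 𝕜 (Γ.valence v)]
  rw [hprod, Derivation.leibniz, smul_eq_mul, smul_eq_mul, Derivation.leibniz_pow,
    seriesDeriv_greenInv, Derivation.leibniz_finsetProd]
  by_cases h2 : Y.numLegs = 2
  -- A graph with two legs occurs in no vertex factor, since all valences are at least 3; the
  -- derivative acts on the propagators `1 / X^2`, and each of them gives a factor `2 / X^2`.
  · have h0 : ∑ v ∈ F, (∏ w ∈ F.erase v, g w) * seriesDeriv 𝕜 Y (g v) = 0 := by
      refine Finset.sum_eq_zero fun v _ => ?_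
      rw [hg]
      simp only
      rw [seriesDeriv_green, if_neg, mul_zero]
      have := hΓ.three_le_valence v
      omega
    have hterm : ∀ φ : Gluing Γ S Y.rep, (glue Γ S Y.rep φ).freeSeries 𝕜 (glueSet Γ S Y.rep φ) =
        (∏ v ∈ F, g v) * greenInv 𝕜 2 ^ (e + 1) := by
      intro φ
      rw [freeSeries, φ.finprod_free hY hS (fun m => green 𝕜 m), φ.numFree_of_two h2 hS,
        Nat.add_div_right _ (by norm_num),
        finprod_subtype_eq_prod (fun v => Γ.IsFree S v ∧ (Y.rep.numLegs ≠ 2 → _)) fun v => green 𝕜 (Γ.valence v)]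
      congr 1
      refine Finset.prod_congr (Finset.filter_congr fun v _ => ?_) fun _ _ => rfl
      exact and_iff_left fun h => absurd h2 h
    have := Fintype.ofFinite (Gluing Γ S Y.rep)
    rw [h0, mul_zero, add_zero, finsum_congr hterm, finsum_eq_sum_of_fintype, Finset.sum_const,
      Finset.card_univ, ← Nat.card_eq_fintype_card, card_gluing_of_two hΓ hS hY h2,
      seriesDeriv_green, if_pos h2, greenSign, if_pos rfl, FeynmanGraph.weight, h2]
    have hnf : Γ.numFree S = 2 * e := by
      have := hΓ.even_numFree hS
      rw [he, Nat.mul_div_cancel' (even_iff_two_dvd.1 this)]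
    rw [hnf]
    -- The sign in `X^2` cancels that of the derivative of the inverse; the 2 counts the two ways
    -- of putting a graph into an edge.
    have hcast : (Y.numAut : 𝕜) * (-1 * ((Nat.factorial 2 : ℕ) / (Y.numAut : 𝕜))) = -2 := by
      field_simp
      norm_num [Nat.factorial]
    have hc : ∀ A B C : PowerSeries (GraphAlg 𝕜), (Y.numAut : 𝕜) • (A * (e • (B * (C *
        ((-1 * ((Nat.factorial 2 : ℕ) / (Y.numAut : 𝕜))) • PowerSeries.X ^ Y.loops))))) =
        PowerSeries.X ^ Y.loops * ((2 * e) • (A * (B * -C))) := by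
      intro A B C
      have h3 : ∀ c d : 𝕜, d • (A * (e • (B * (C * (c • PowerSeries.X ^ Y.loops))))) =
          (d * c) • (A * (e • (B * (C * PowerSeries.X ^ Y.loops)))) := by
        intro c d
        rw [mul_smul]
        simp only [mul_smul_comm]
        rw [smul_comm e c]
      rw [h3, hcast, neg_smul, two_smul, nsmul_eq_mul, nsmul_eq_mul]
      push_cast
      ring
    rw [smul_eq_mul, hc]
    congr 1
    rcases Nat.eq_zero_or_pos e with h | h
    · rw [h, mul_zero, zero_smul, zero_smul]
    · congr 2
      rw [neg_neg, ← pow_add]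
      congr 1
      omega
  -- A graph with at least three legs does not occur in `X^2`; the derivative replaces the factor
  -- of one vertex of the right valence by its weight.
  · have h0 : seriesDeriv 𝕜 Y (green 𝕜 2) = 0 := by rw [seriesDeriv_green, if_neg h2]
    obtain ⟨l₀, hl₀⟩ := hY.exists_leg
    set G : Quotient Γ.vert → PowerSeries (GraphAlg 𝕜) := fun w =>
      (∏ v ∈ F.erase w, g v) * greenInv 𝕜 2 ^ e with hG
    have hterm : ∀ φ : Gluing Γ S Y.rep, (glue Γ S Y.rep φ).freeSeries 𝕜 (glueSet Γ S Y.rep φ) =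
        G (Quotient.mk Γ.vert (φ.1 ⟨l₀, hl₀⟩)) := by
      intro φ
      rw [freeSeries, φ.finprod_free hY hS (fun m => green 𝕜 m), φ.numFree_of_ne h2 hS,
        finprod_subtype_eq_prod (fun v => Γ.IsFree S v ∧ (Y.rep.numLegs ≠ 2 → _)) fun v => green 𝕜 (Γ.valence v)]
      refine congrArg (· * greenInv 𝕜 2 ^ e) (Finset.prod_congr ?_ fun _ _ => rfl)
      ext v
      rw [Finset.mem_filter, Finset.mem_erase, hFdef, Finset.mem_filter]
      constructor
      · rintro ⟨-, h1, h3⟩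
        exact ⟨fun h => h3 h2 ⟨l₀, hl₀⟩ h.symm, Finset.mem_univ _, h1⟩
      · rintro ⟨h1, -, h3⟩
        refine ⟨Finset.mem_univ _, h3, fun _ l h => h1 (h.symm.trans (Quotient.sound ?_))⟩
        exact (φ.vert_iff h2 ⟨l, rfl⟩).2 ⟨_, rfl⟩
    rw [finsum_congr hterm, finsum_gluing_of_ne h2, finsum_subtype_eq_sum
      (fun v => Γ.IsFree S v ∧ Γ.valence v = Y.rep.numLegs) G, h0]
    simp only [mul_zero, smul_zero, zero_add]
    rw [← Finset.filter_filter, ← hFdef,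
      Finset.sum_filter (s := F) (fun v => Γ.valence v = Y.rep.numLegs), Finset.mul_sum, Finset.smul_sum,
      Finset.smul_sum, Finset.mul_sum]
    refine Finset.sum_congr rfl fun v _ => ?_
    rw [hg]
    simp only
    rw [seriesDeriv_green]
    by_cases hv : Γ.valence v = Y.rep.numLegs
    · have hv' : Y.numLegs = Γ.valence v := hv.symm
      rw [if_pos hv', if_pos hv, ← hv', greenSign, if_neg h2, FeynmanGraph.weight, one_mul,
        mul_smul_comm, mul_smul_comm, smul_smul, mul_div_cancel₀ _ hA, Nat.cast_smul_eq_nsmul,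
        mul_smul_comm]
      refine congrArg (Y.numLegs.factorial • ·) ?_
      rw [hG]
      simp only
      rw [mul_comm (PowerSeries.X ^ Y.loops), mul_comm (greenInv 𝕜 2 ^ e), mul_assoc, mul_assoc,
        mul_comm (PowerSeries.X ^ Y.loops)]
    · rw [if_neg (show ¬ Y.numLegs = Γ.valence v from fun h => hv h.symm), if_neg hv]
      simp

end FGraph

end


noncomputable section

variable (𝕜 : Type*) [Field 𝕜]

theorem map_constantCoeff_green (n : ℕ) :
    PowerSeries.map (MvPolynomial.constantCoeff) (green 𝕜 n) = 1 := by
  ext k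
  have hF := Fintype.ofFinite {γ : FeynmanGraph // γ.numLegs = n ∧ γ.loops = k}
  rw [PowerSeries.coeff_map, coeff_green, map_add, finsum_eq_sum_of_fintype,
    MvPolynomial.constantCoeff_smul, map_sum, PowerSeries.coeff_one, Finset.sum_eq_zero, smul_zero,
    add_zero]
  · split_ifs <;> simp
  · intro γ _
    rw [MvPolynomial.constantCoeff_smul, MvPolynomial.constantCoeff_X, smul_zero]

theorem map_constantCoeff_greenInv (n : ℕ) :
    PowerSeries.map (MvPolynomial.constantCoeff) (greenInv 𝕜 n) = 1 := by
  have h := congrArg (PowerSeries.map MvPolynomial.constantCoeff) (green_mul_greenInv 𝕜 n)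
  rwa [map_mul, map_constantCoeff_green, one_mul, map_one] at h

namespace FGraph

variable {α β : Type} {Γ : FGraph α} {S : Set α}

theorem map_constantCoeff_freeSeries [Finite α] (Γ : FGraph α) (S : Set α) :
    PowerSeries.map (MvPolynomial.constantCoeff) (Γ.freeSeries 𝕜 S) = 1 := by
  have hF := Fintype.ofFinite {v // Γ.IsFree S v}
  rw [freeSeries, map_mul, map_pow, map_constantCoeff_greenInv, one_pow, mul_one,
    finprod_eq_prod_of_fintype, map_prod]
  exact Finset.prod_eq_one fun v _ => map_constantCoeff_green 𝕜 _

/-- The coefficients of the series of insertion places count the insertions. -/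
theorem coeff_freeSeries [CharZero 𝕜] (L : List FeynmanGraph) :
    ∀ (α : Type) [Finite α] (Γ : FGraph α) (S : Set α) (k : ℕ), Γ.IsFeynman → Γ.IsSub S →
      (FeynmanGraph.symmetry (Multiset.toFinsupp (L : Multiset FeynmanGraph)) : 𝕜) *
        MvPolynomial.coeff (Multiset.toFinsupp (L : Multiset FeynmanGraph))
          (PowerSeries.coeff k (Γ.freeSeries 𝕜 S)) =
      if k = FeynmanGraph.degree (Multiset.toFinsupp (L : Multiset FeynmanGraph)) then
        markedGlueSum (fun _ _ _ _ => (1 : 𝕜)) L α Γ S else 0 := by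
  induction L with
  | nil =>
    intro α _ Γ S k hΓ hS
    have h := congrArg (PowerSeries.coeff k) (map_constantCoeff_freeSeries 𝕜 Γ S)
    rw [PowerSeries.coeff_map, PowerSeries.coeff_one, MvPolynomial.constantCoeff_eq] at h
    rw [Multiset.coe_nil, map_zero, h, FeynmanGraph.symmetry, Finsupp.prod_zero_index, Nat.cast_one,
      one_mul, FeynmanGraph.degree, Finsupp.sum_zero_index]
    rfl
  -- Differentiate by the first graph of the list; the symmetry factor absorbs its automorphisms
  -- and its exponent.
  | cons Y L ih =>
    intro α _ Γ S k hΓ hS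
    have := Fintype.ofFinite (Gluing Γ S Y.rep)
    set m := Multiset.toFinsupp (L : Multiset FeynmanGraph) with hm
    have hm' : Multiset.toFinsupp ((Y :: L : List FeynmanGraph) : Multiset FeynmanGraph) =
        m + Finsupp.single Y 1 := by
      rw [← Multiset.cons_coe, ← Multiset.singleton_add, map_add, Multiset.toFinsupp_singleton,
        add_comm]
    have h1 : (Y.numAut : 𝕜) * (MvPolynomial.coeff (m + Finsupp.single Y 1)
        (PowerSeries.coeff k (Γ.freeSeries 𝕜 S)) * ((m Y : 𝕜) + 1)) =
        MvPolynomial.coeff m (PowerSeries.coeff k (PowerSeries.X ^ Y.loops *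
          ∑ φ : Gluing Γ S Y.rep, (glue Γ S Y.rep φ).freeSeries 𝕜 (glueSet Γ S Y.rep φ))) := by
      rw [← finsum_eq_sum_of_fintype, ← hΓ.seriesDeriv_freeSeries 𝕜 hS.edgeClosed,
        PowerSeries.coeff_smul, MvPolynomial.coeff_smul, coeff_seriesDeriv,
        MvPolynomial.coeff_pderiv, smul_eq_mul]
    have h2 : ((Y.numAut * (m Y + 1) * FeynmanGraph.symmetry m : ℕ) : 𝕜) *
        MvPolynomial.coeff (m + Finsupp.single Y 1) (PowerSeries.coeff k (Γ.freeSeries 𝕜 S)) =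
        FeynmanGraph.symmetry m * ((Y.numAut : 𝕜) * (MvPolynomial.coeff (m + Finsupp.single Y 1)
        (PowerSeries.coeff k (Γ.freeSeries 𝕜 S)) * ((m Y : 𝕜) + 1))) := by
      push_cast; ring
    rw [hm', FeynmanGraph.symmetry_add_single, h2, h1, PowerSeries.coeff_X_pow_mul',
      FeynmanGraph.degree_add, FeynmanGraph.degree_single, one_mul]
    split_ifs with hk hkm hkm
    · rw [map_sum, MvPolynomial.coeff_sum, Finset.mul_sum, markedGlueSum, finsum_eq_sum_of_fintype]
      refine Finset.sum_congr rfl fun φ _ => ?_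
      rw [ih _ _ _ _ (φ.glue_isFeynman hΓ Y.rep_isFeynman)
        (φ.glueSet_isSub hΓ Y.rep_isFeynman hS), if_pos (by omega)]
    · rw [map_sum, MvPolynomial.coeff_sum, Finset.mul_sum]
      refine Finset.sum_eq_zero fun φ _ => ?_
      rw [ih _ _ _ _ (φ.glue_isFeynman hΓ Y.rep_isFeynman)
        (φ.glueSet_isSub hΓ Y.rep_isFeynman hS), if_neg (by omega)]
    · omega
    · rw [MvPolynomial.coeff_zero, mul_zero]

theorem freeSeries_empty (γ : FeynmanGraph) : γ.rep.freeSeries 𝕜 ∅ = insertionArg 𝕜 γ := by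
  rw [freeSeries, insertionArg, numFree, numEdges]
  congr 1
  · exact finprod_eq_of_bijective Subtype.val
      ⟨Subtype.val_injective, fun v => ⟨⟨v, fun x hx => absurd hx (Set.notMem_empty x)⟩, rfl⟩⟩
      fun _ => rfl
  · congr 2
    exact Nat.card_congr (Equiv.subtypeEquivRight fun x => and_iff_left (Set.notMem_empty x))

end FGraph

/-- The list of the factors of a monomial. -/
def FeynmanGraph.factors (m : FeynmanGraph →₀ ℕ) : List FeynmanGraph := (Finsupp.toMultiset m).toList

theorem FeynmanGraph.toFinsupp_factors (m : FeynmanGraph →₀ ℕ) :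
    Multiset.toFinsupp (FeynmanGraph.factors m : Multiset FeynmanGraph) = m := by
  rw [FeynmanGraph.factors, Multiset.coe_toList, Finsupp.toMultiset_toFinsupp]

theorem coeff_insertionArg [CharZero 𝕜] (γ : FeynmanGraph) (m : FeynmanGraph →₀ ℕ) (k : ℕ) :
    (FeynmanGraph.symmetry m : 𝕜) * MvPolynomial.coeff m (PowerSeries.coeff k (insertionArg 𝕜 γ)) =
      if k = FeynmanGraph.degree m then FGraph.markedGlueSum (fun _ _ _ _ => (1 : 𝕜))
        (FeynmanGraph.factors m) _ γ.rep ∅ else 0 := by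
  have h := FGraph.coeff_freeSeries 𝕜 (FeynmanGraph.factors m) _ γ.rep ∅ k γ.rep_isFeynman
    FGraph.isSub_empty
  rwa [FeynmanGraph.toFinsupp_factors, FGraph.freeSeries_empty] at h

end


/-! ### The graphs obtained by insertion -/

namespace FGraph

variable {α δ : Type} {Γ : FGraph α} {S : Set α}

theorem Iso.isSub {Γ' : FGraph δ} (e : Iso Γ Γ') (S' : Set δ) (hS : Γ.IsSub (e.1 ⁻¹' S')) :
    Γ'.IsSub S' := by
  have key : ∀ f : α ≃ δ, Γ = Γ'.comap f → Γ.IsSub (f ⁻¹' S') → Γ'.IsSub S' := by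
    rintro f rfl
    exact ((IsSummand.of_equiv f Γ').isSub S' fun x _ => f.surjective x).1
  exact key e.1 e.eq_comap hS

theorem sum_card_markedIso [Finite α] [Fintype δ] (hS : Γ.IsSub S) (Γ' : FGraph δ) :
    ∑ S' ∈ Finset.univ.filter Γ'.IsSub, Nat.card (MarkedIso Γ S Γ' S') = Nat.card (Iso Γ Γ') := by
  rw [← finsum_subtype_eq_sum Γ'.IsSub fun S' => Nat.card (MarkedIso Γ S Γ' S'),
    finsum_eq_sum_of_fintype, ← Nat.card_sigma]
  refine Nat.card_congr (Equiv.ofBijective (fun p => p.2.1) ⟨?_, ?_⟩)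
  · rintro ⟨⟨S', hS'⟩, e, he⟩ ⟨⟨S'', hS''⟩, e', he'⟩ h
    have h1 : e = e' := h
    subst h1
    have h2 : S' = S'' := by
      ext x
      obtain ⟨y, rfl⟩ := e.1.surjective x
      exact (he y).symm.trans (he' y)
    subst h2
    rfl
  · intro e
    refine ⟨⟨⟨e.1.symm ⁻¹' S, ?_⟩, e, fun x => ?_⟩, rfl⟩
    · refine e.isSub _ ?_
      rwa [← Set.preimage_comp, Equiv.symm_comp_self]
    · rw [Set.mem_preimage, Equiv.symm_apply_apply]

end FGraph

namespace FeynmanGraph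

/-- The finite set of graphs with `n` legs and `L` loops. -/
noncomputable def withLegsLoops (n L : ℕ) : Finset FeynmanGraph :=
  Set.Finite.toFinset (s := {γ : FeynmanGraph | γ.numLegs = n ∧ γ.loops = L})
    (FeynmanGraph.finite_numLegs_loops n L)

theorem mem_withLegsLoops {n L : ℕ} {γ : FeynmanGraph} :
    γ ∈ withLegsLoops n L ↔ γ.numLegs = n ∧ γ.loops = L :=
  Set.Finite.mem_toFinset _

theorem finsum_eq_sum_withLegsLoops {M : Type*} [AddCommMonoid M] (n L : ℕ) (f : FeynmanGraph → M) :
    ∑ᶠ γ : {γ : FeynmanGraph // γ.numLegs = n ∧ γ.loops = L}, f γ.1 =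
      ∑ γ ∈ withLegsLoops n L, f γ := by
  rw [finsum_subtype_eq_finsum_cond fun γ : FeynmanGraph => γ.numLegs = n ∧ γ.loops = L,
    finsum_cond_eq_sum_of_cond_iff]
  exact fun _ => mem_withLegsLoops.symm

/-- The subgraphs of (a representative of) a graph. -/
noncomputable def subs (Γ : FeynmanGraph) : Finset (Set (Fin Γ.size)) :=
  Finset.univ.filter Γ.rep.IsSub

theorem mem_subs {Γ : FeynmanGraph} {S : Set (Fin Γ.size)} : S ∈ Γ.subs ↔ Γ.rep.IsSub S := by
  rw [subs, Finset.mem_filter]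
  exact and_iff_right (Finset.mem_univ _)

/-- The number of identifications of `γ` with the cograph `Γ / S`. -/
noncomputable def cographIso (γ Γ : FeynmanGraph) (S : Set (Fin Γ.size)) : ℕ :=
  Nat.card (FGraph.Iso γ.rep (Γ.rep.contract S))

theorem numAut_pos (γ : FeynmanGraph) : 0 < γ.numAut :=
  have : Nonempty (FGraph.Iso γ.rep γ.rep) := ⟨FGraph.Iso.refl _⟩
  Nat.card_pos

theorem symmetry_pos (m : FeynmanGraph →₀ ℕ) : 0 < symmetry m :=
  Finset.prod_pos fun _ _ => Nat.mul_pos (Nat.factorial_pos _) (Nat.pow_pos (numAut_pos _))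

theorem card_iso_rep {α : Type} [Finite α] {Γ : FGraph α} (Γ' : FeynmanGraph) :
    Nat.card (FGraph.Iso Γ Γ'.rep) = Γ'.numAut * Γ.exponent Γ' := by
  rw [FGraph.exponent_apply]
  split_ifs with h
  · rw [mul_one]
    obtain ⟨e⟩ := h
    exact Nat.card_congr ⟨fun f => e.trans f, fun f => e.symm.trans f,
      fun _ => Subtype.ext (Equiv.ext fun _ => by simp [FGraph.Iso.trans, FGraph.Iso.symm]),
      fun _ => Subtype.ext (Equiv.ext fun _ => by simp [FGraph.Iso.trans, FGraph.Iso.symm])⟩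
  · have : IsEmpty (FGraph.Iso Γ Γ'.rep) := ⟨fun e => h ⟨e.symm⟩⟩
    rw [mul_zero]
    exact Nat.card_of_isEmpty

/-- The formal sum of the graphs that result from the gluings of the factors of a monomial into
`γ`. -/
noncomputable def insertions (γ : FeynmanGraph) (m : FeynmanGraph →₀ ℕ) : FeynmanGraph →₀ ℕ :=
  FGraph.markedGlueSum (fun _ _ Γ _ => Γ.exponent) (factors m) _ γ.rep ∅

/-- A graph arises by insertion as often as the inserted graphs form one of its subgraphs. -/
theorem numAut_mul_insertions (γ : FeynmanGraph) (m : FeynmanGraph →₀ ℕ) (Γ : FeynmanGraph) :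
    Γ.numAut * γ.insertions m Γ = symmetry m *
      ∑ S ∈ Γ.subs, if Γ.rep.subExponent S = m then γ.cographIso Γ S else 0 := by
  have h1 := FGraph.markedGlueSum_map ((AddMonoidHom.mulLeft Γ.numAut).comp
    (Finsupp.applyAddHom Γ : (FeynmanGraph →₀ ℕ) →+ ℕ))
    (fun _ _ Γ _ => Γ.exponent) (factors m) _ γ.rep ∅
  refine Eq.trans h1.symm ?_
  refine (FGraph.markedGlueSum_congr (g := fun _ _ Γ₁ S₁ => ∑ S ∈ Γ.subs,
    Nat.card (FGraph.MarkedIso Γ₁ S₁ Γ.rep S)) (fun α _ Γ₁ S₁ _ hS₁ => ?_) _ _ _ _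
      γ.rep_isFeynman FGraph.isSub_empty).trans ?_
  · exact (card_iso_rep Γ).symm.trans (FGraph.sum_card_markedIso hS₁ Γ.rep).symm
  · rw [FGraph.markedGlueSum_sum, Finset.mul_sum]
    refine Finset.sum_congr rfl fun S hS => ?_
    rw [FGraph.markedGlueSum_card γ.rep_isFeynman _ _ _ _ Γ.rep_isFeynman (mem_subs.1 hS),
      toFinsupp_factors, mul_ite, mul_zero]
    rfl

theorem cographIso_ne_zero {γ Γ : FeynmanGraph} {S : Set (Fin Γ.size)} (hS : S ∈ Γ.subs)
    (h : γ.cographIso Γ S ≠ 0) : Γ.numLegs = γ.numLegs ∧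
      degree (Γ.rep.subExponent S) + γ.loops = Γ.loops := by
  have hn : Nonempty (FGraph.Iso γ.rep (Γ.rep.contract S)) := by
    by_contra hn
    rw [not_nonempty_iff] at hn
    exact h Nat.card_of_isEmpty
  obtain ⟨e⟩ := hn
  have hne : S ≠ Γ.rep.internals := by
    rintro rfl
    exact (FGraph.not_iso_contract_internals γ.rep_isFeynman).false e
  have hc := Γ.rep_isFeynman.contract (mem_subs.1 hS) hne
  have hcls := (FGraph.cls_eq_iff_rep hc γ).2 ⟨e⟩
  have h1 := FGraph.numLegs_cls _ hc
  have h2 := FGraph.loops_cls _ hc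
  rw [hcls] at h1 h2
  constructor
  · exact (Γ.rep_isFeynman.numLegs_contract (mem_subs.1 hS) hne).symm.trans h1.symm
  · rw [h2]
    exact Γ.rep_isFeynman.loops_contract (mem_subs.1 hS) hne

variable (𝕜 : Type*) [Field 𝕜]

theorem sum_cographIso [CharZero 𝕜] {M : Type*} [AddCommGroup M] [Module 𝕜 M] {Γ : FeynmanGraph}
    {S : Set (Fin Γ.size)} (hS : S ∈ Γ.subs) (hne : S ≠ Γ.rep.internals) {s : Finset FeynmanGraph}
    (F : FeynmanGraph → M)
    (hs : (Γ.rep.contract S).cls (Γ.rep_isFeynman.contract (mem_subs.1 hS) hne) ∈ s) :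
    ∑ γ ∈ s, ((γ.cographIso Γ S : 𝕜) / γ.numAut) • F γ =
      F ((Γ.rep.contract S).cls (Γ.rep_isFeynman.contract (mem_subs.1 hS) hne)) := by
  have hc := Γ.rep_isFeynman.contract (mem_subs.1 hS) hne
  have hI : ∀ γ, (γ.cographIso Γ S : 𝕜) / γ.numAut = if (Γ.rep.contract S).cls hc = γ then 1 else 0 := by
    intro γ
    have h1 : γ.cographIso Γ S = γ.numAut * (Γ.rep.contract S).exponent γ :=
      (Nat.card_congr ⟨fun f => f.symm, fun f => f.symm, fun _ => rfl, fun _ => rfl⟩).trans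
        (card_iso_rep γ)
    rw [h1, FGraph.exponent, dif_pos hc, Finsupp.single_apply]
    have h2 : (γ.numAut : 𝕜) ≠ 0 := Nat.cast_ne_zero.2 γ.numAut_pos.ne'
    split_ifs
    · rw [mul_one, div_self h2]
    · rw [mul_zero, Nat.cast_zero, zero_div]
  simp_rw [hI, ite_smul, one_smul, zero_smul]
  rw [Finset.sum_ite_eq, if_pos hs]

/-- The number of all insertions of the factors of a monomial. -/
noncomputable def numInsertions (γ : FeynmanGraph) (m : FeynmanGraph →₀ ℕ) : ℕ :=
  (γ.insertions m).sum fun _ k => k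

theorem markedGlueSum_exponent {M : Type*} [AddCommMonoid M] (v : FeynmanGraph → M)
    (f : ∀ (α : Type) [Finite α], FGraph α → M)
    (hf : ∀ (α : Type) [Finite α] (Γ : FGraph α) (h : Γ.IsFeynman), f α Γ = v (Γ.cls h))
    (γ : FeynmanGraph) (m : FeynmanGraph →₀ ℕ) :
    FGraph.markedGlueSum (fun α _ Γ _ => f α Γ) (factors m) _ γ.rep ∅ =
      (γ.insertions m).sum fun Γ k => k • v Γ := by
  refine Eq.trans ?_ (FGraph.markedGlueSum_map
    (Finsupp.liftAddHom fun Γ => multiplesHom M (v Γ)) (fun _ _ Γ _ => Γ.exponent) (factors m) _ γ.rep ∅)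
  refine FGraph.markedGlueSum_congr (fun α _ Γ S h _ => ?_) _ _ _ _ γ.rep_isFeynman FGraph.isSub_empty
  rw [hf α Γ h, FGraph.exponent, dif_pos h, Finsupp.liftAddHom_apply_single, multiplesHom_apply,
    one_smul]

theorem markedGlueSum_one (γ : FeynmanGraph) (m : FeynmanGraph →₀ ℕ) :
    FGraph.markedGlueSum (fun _ _ _ _ => (1 : 𝕜)) (factors m) _ γ.rep ∅ = γ.numInsertions m := by
  rw [markedGlueSum_exponent (fun _ => (1 : 𝕜)) (fun _ _ _ => 1) (fun _ _ _ _ => rfl),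
    numInsertions, Finsupp.sum, Finsupp.sum, Nat.cast_sum]
  simp

/-- The value of `B_+^γ` on a monomial. -/
theorem insertion_monomial (γ : FeynmanGraph) (m : FeynmanGraph →₀ ℕ) (c : 𝕜) :
    insertion 𝕜 γ (MvPolynomial.monomial m c) = (c * (γ.numInsertions m : 𝕜)⁻¹) •
      (γ.insertions m).sum fun Γ k => k • (Γ.rep.maxf : 𝕜)⁻¹ • (MvPolynomial.X Γ : GraphAlg 𝕜) := by
  have h1 : MvPolynomial.monomial m c = c • MvPolynomial.basisMonomials FeynmanGraph 𝕜 m := by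
    rw [MvPolynomial.coe_basisMonomials, MvPolynomial.smul_monomial, smul_eq_mul, mul_one]
  rw [h1, map_smul, insertion, Module.Basis.constr_basis, smul_smul, mul_smul, mul_smul]
  refine congrArg (c • ·) ?_
  rw [FGraph.glueSum_eq_markedGlueSum, FGraph.glueSum_eq_markedGlueSum]
  have h2 := markedGlueSum_one 𝕜 γ m
  have h3 := markedGlueSum_exponent
    (fun Γ : FeynmanGraph => (Γ.rep.maxf : 𝕜)⁻¹ • (MvPolynomial.X Γ : GraphAlg 𝕜))
    (fun _ _ Γ => ((Γ.maxf : 𝕜)⁻¹) • Γ.toAlg 𝕜) (fun α _ Γ h => by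
      obtain ⟨e⟩ := Γ.cls_iso h
      have hm : Γ.maxf = (Γ.cls h).rep.maxf := by
        conv_lhs => rw [e.eq_comap, FGraph.maxf_comap]
      rw [hm, FGraph.toAlg_of_isFeynman 𝕜 h]) γ m
  rw [factors] at h2 h3
  rw [h2, h3]

theorem insertions_eq [CharZero 𝕜] (γ : FeynmanGraph) (m : FeynmanGraph →₀ ℕ) (Γ : FeynmanGraph) :
    (γ.insertions m Γ : 𝕜) = symmetry m * ((Γ.numAut : 𝕜)⁻¹ *
      ∑ S ∈ Γ.subs, if Γ.rep.subExponent S = m then (γ.cographIso Γ S : 𝕜) else 0) := by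
  have h := congrArg (Nat.cast : ℕ → 𝕜) (numAut_mul_insertions γ m Γ)
  have h2 : (Γ.numAut : 𝕜) ≠ 0 := Nat.cast_ne_zero.2 Γ.numAut_pos.ne'
  push_cast at h
  field_simp
  rw [mul_comm, h]

theorem insertions_support {γ Γ : FeynmanGraph} {m : FeynmanGraph →₀ ℕ} (h : γ.insertions m Γ ≠ 0) :
    Γ ∈ withLegsLoops γ.numLegs (degree m + γ.loops) := by
  have h1 : Γ.numAut * γ.insertions m Γ ≠ 0 := Nat.mul_ne_zero Γ.numAut_pos.ne' h
  rw [numAut_mul_insertions] at h1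
  obtain ⟨S, hS, h2⟩ := Finset.exists_ne_zero_of_sum_ne_zero (right_ne_zero_of_mul h1)
  rw [ite_ne_right_iff] at h2
  obtain ⟨rfl, h2⟩ := h2
  have h3 := cographIso_ne_zero hS h2
  exact mem_withLegsLoops.2 ⟨h3.1, h3.2.symm⟩

/-- The coefficients of the series inserted into `γ`: every graph with a subgraph whose cograph is
`γ` contributes. -/
theorem coeff_insertionArg_eq [CharZero 𝕜] (γ : FeynmanGraph) (m : FeynmanGraph →₀ ℕ) (k : ℕ) :
    MvPolynomial.coeff m (PowerSeries.coeff k (insertionArg 𝕜 γ)) =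
      ∑ Γ ∈ withLegsLoops γ.numLegs (k + γ.loops), (Γ.numAut : 𝕜)⁻¹ *
        ∑ S ∈ Γ.subs, if Γ.rep.subExponent S = m then (γ.cographIso Γ S : 𝕜) else 0 := by
  have hs : (symmetry m : 𝕜) ≠ 0 := Nat.cast_ne_zero.2 (symmetry_pos m).ne'
  refine mul_left_cancel₀ hs ?_
  rw [coeff_insertionArg, Finset.mul_sum]
  split_ifs with hk
  · subst hk
    rw [markedGlueSum_one, numInsertions, Finsupp.sum_of_support_subset (s := withLegsLoops γ.numLegs (degree m + γ.loops)) _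
      (fun Γ h => insertions_support (Finsupp.mem_support_iff.1 h)) _ (fun _ _ => rfl), Nat.cast_sum]
    exact Finset.sum_congr rfl fun Γ _ => insertions_eq 𝕜 γ m Γ
  · symm
    refine Finset.sum_eq_zero fun Γ hΓ => ?_
    rw [Finset.sum_eq_zero, mul_zero, mul_zero]
    intro S hS
    split_ifs with h
    · by_contra h0
      have h1 := cographIso_ne_zero hS (fun e => h0 (by rw [e, Nat.cast_zero]))
      have h2 := (mem_withLegsLoops.1 hΓ).2
      rw [h] at h1
      omega
    · rfl

/-- The series inserted into `γ` as a sum over all pairs of a graph and a subgraph with cograph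
`γ`. -/
theorem coeff_insertionArg_eq_sum [CharZero 𝕜] (γ : FeynmanGraph) (k : ℕ) :
    PowerSeries.coeff k (insertionArg 𝕜 γ) = ∑ Γ ∈ withLegsLoops γ.numLegs (k + γ.loops),
      (Γ.numAut : 𝕜)⁻¹ • ∑ S ∈ Γ.subs, (γ.cographIso Γ S : 𝕜) • (Γ.rep.cut S).compsProd 𝕜 := by
  ext m
  rw [coeff_insertionArg_eq, MvPolynomial.coeff_sum]
  refine Finset.sum_congr rfl fun Γ _ => ?_
  rw [MvPolynomial.coeff_smul, MvPolynomial.coeff_sum, smul_eq_mul]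
  refine congrArg _ (Finset.sum_congr rfl fun S hS => ?_)
  rw [Γ.rep_isFeynman.compsProd_eq_monomial 𝕜 (mem_subs.1 hS), MvPolynomial.coeff_smul,
    MvPolynomial.coeff_monomial, smul_eq_mul, mul_ite, mul_one, mul_zero]

/-- The image of the inserted series under `B_+^γ`. -/
theorem insertion_coeff [CharZero 𝕜] (γ : FeynmanGraph) (k : ℕ) :
    insertion 𝕜 γ (PowerSeries.coeff k (insertionArg 𝕜 γ)) =
      ∑ Γ ∈ withLegsLoops γ.numLegs (k + γ.loops), ((Γ.numAut : 𝕜)⁻¹ *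
        (∑ S ∈ Γ.subs, (γ.cographIso Γ S : 𝕜)) * (Γ.rep.maxf : 𝕜)⁻¹) • MvPolynomial.X Γ := by
  set p := PowerSeries.coeff k (insertionArg 𝕜 γ) with hp
  set G := withLegsLoops γ.numLegs (k + γ.loops) with hG
  set c : (FeynmanGraph →₀ ℕ) → FeynmanGraph → 𝕜 := fun m Γ =>
    ∑ S ∈ Γ.subs, if Γ.rep.subExponent S = m then (γ.cographIso Γ S : 𝕜) else 0 with hc
  set s : Finset (FeynmanGraph →₀ ℕ) := p.support ∪ G.biUnion fun Γ => Γ.subs.image Γ.rep.subExponent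
  have h1 : p = ∑ m ∈ s, MvPolynomial.monomial m (MvPolynomial.coeff m p) := by
    conv_lhs => rw [p.as_sum]
    refine Finset.sum_subset Finset.subset_union_left fun m _ hm => ?_
    rw [MvPolynomial.notMem_support_iff.1 hm, map_zero]
  have h2 : ∀ m, insertion 𝕜 γ (MvPolynomial.monomial m (MvPolynomial.coeff m p)) =
      ∑ Γ ∈ G, ((Γ.numAut : 𝕜)⁻¹ * c m Γ * (Γ.rep.maxf : 𝕜)⁻¹) • MvPolynomial.X Γ := by
    intro m
    have hs : (symmetry m : 𝕜) ≠ 0 := Nat.cast_ne_zero.2 (symmetry_pos m).ne'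
    have h3 := coeff_insertionArg 𝕜 γ m k
    rw [insertion_monomial]
    by_cases hk : k = degree m
    · rw [if_pos hk, markedGlueSum_one] at h3
      have hsum : ((γ.insertions m).sum fun Γ k =>
          k • (Γ.rep.maxf : 𝕜)⁻¹ • (MvPolynomial.X Γ : GraphAlg 𝕜)) =
          ∑ Γ ∈ G, γ.insertions m Γ • (Γ.rep.maxf : 𝕜)⁻¹ • (MvPolynomial.X Γ : GraphAlg 𝕜) :=
        Finsupp.sum_of_support_subset _ (fun Γ h => by
          rw [hG, hk]; exact insertions_support (Finsupp.mem_support_iff.1 h)) _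
          (fun _ _ => zero_smul _ _)
      rw [hsum, Finset.smul_sum]
      refine Finset.sum_congr rfl fun Γ _ => ?_
      rw [← Nat.cast_smul_eq_nsmul 𝕜, smul_smul, smul_smul]
      congr 1
      by_cases hN : γ.numInsertions m = 0
      -- The monomial cannot be inserted into `γ`: no graph has a subgraph of this type with cograph
      -- `γ`.
      · have h0 : γ.insertions m Γ = 0 := by
          by_contra h0
          exact h0 (Finset.sum_eq_zero_iff.1 hN Γ (Finsupp.mem_support_iff.2 h0))
        have h4 := insertions_eq 𝕜 γ m Γ
        rw [h0, Nat.cast_zero] at h4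
        have h5 : (Γ.numAut : 𝕜)⁻¹ * c m Γ = 0 := (mul_eq_zero.1 h4.symm).resolve_left hs
        rw [h0, h5]
        simp
      -- The number of gluings by which `B_+^γ` divides is, up to the symmetry factor, the
      -- coefficient of the monomial.
      · have hN' : (γ.numInsertions m : 𝕜) ≠ 0 := Nat.cast_ne_zero.2 hN
        have h4 : MvPolynomial.coeff m p = γ.numInsertions m / symmetry m := by
          rw [eq_div_iff hs, mul_comm]; exact h3
        rw [h4, insertions_eq 𝕜 γ m Γ]
        change _ = (Γ.numAut : 𝕜)⁻¹ * c m Γ * (Γ.rep.maxf : 𝕜)⁻¹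
        change _ * ((symmetry m : 𝕜) * ((Γ.numAut : 𝕜)⁻¹ * c m Γ)) * _ = _
        field_simp
    · rw [if_neg hk] at h3
      have h4 : MvPolynomial.coeff m p = 0 := (mul_eq_zero.1 h3).resolve_left hs
      rw [h4, zero_mul, zero_smul]
      symm
      refine Finset.sum_eq_zero fun Γ hΓ => ?_
      have h5 : c m Γ = 0 := by
        refine Finset.sum_eq_zero fun S hS => ?_
        split_ifs with h
        · by_contra h0
          have h1 := cographIso_ne_zero hS (fun e => h0 (by rw [e, Nat.cast_zero]))
          have h2 := (mem_withLegsLoops.1 hΓ).2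
          rw [h] at h1
          omega
        · rfl
      rw [h5, mul_zero, zero_mul, zero_smul]
  rw [h1, map_sum, Finset.sum_congr rfl fun m _ => h2 m, Finset.sum_comm]
  refine Finset.sum_congr rfl fun Γ hΓ => ?_
  rw [← Finset.sum_smul, ← Finset.sum_mul, ← Finset.mul_sum, hc, Finset.sum_comm]
  congr 3
  refine Finset.sum_congr rfl fun S hS => ?_
  rw [Finset.sum_ite_eq, if_pos]
  exact Finset.mem_union_right _ (Finset.mem_biUnion.2 ⟨Γ, hΓ, Finset.mem_image_of_mem _ hS⟩)

end FeynmanGraph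


/-! ### The coproduct of the sums of graphs -/

namespace FeynmanGraph

variable (𝕜 : Type*) [Field 𝕜]

theorem cographIso_internals (γ Γ : FeynmanGraph) : γ.cographIso Γ Γ.rep.internals = 0 :=
  have := FGraph.not_iso_contract_internals (Γ' := Γ.rep) γ.rep_isFeynman
  Nat.card_of_isEmpty

theorem loops_of_cographIso {γ Γ : FeynmanGraph} {S : Set (Fin Γ.size)} (hS : S ∈ Γ.subs)
    (hne : S ≠ Γ.rep.internals) (h : γ.cographIso Γ S ≠ 0) : (Γ.rep.contract S).loops = γ.loops := by
  have h1 := (cographIso_ne_zero hS h).2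
  have h2 := Γ.rep_isFeynman.loops_contract (mem_subs.1 hS) hne
  have h3 : Γ.rep.loops = Γ.loops := rfl
  omega

theorem sum_cographIso_of_loops_eq_one [CharZero 𝕜] (Γ : FeynmanGraph) {S : Set (Fin Γ.size)}
    (hS : S ∈ Γ.subs) : ∑ γ ∈ withLegsLoops Γ.numLegs 1, (γ.cographIso Γ S : 𝕜) / γ.numAut =
      if S ≠ Γ.rep.internals ∧ (Γ.rep.contract S).loops = 1 then 1 else 0 := by
  split_ifs with h
  · have h1 := sum_cographIso 𝕜 hS h.1 (s := withLegsLoops Γ.numLegs 1) (fun _ => (1 : 𝕜))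
      (mem_withLegsLoops.2 ⟨(FGraph.numLegs_cls _ _).trans
        (Γ.rep_isFeynman.numLegs_contract (mem_subs.1 hS) h.1), (FGraph.loops_cls _ _).trans h.2⟩)
    simpa using h1
  · refine Finset.sum_eq_zero fun γ hγ => ?_
    rw [div_eq_zero_iff]
    left
    by_contra h0
    have h0' : γ.cographIso Γ S ≠ 0 := fun e => h0 (by rw [e, Nat.cast_zero])
    have hne : S ≠ Γ.rep.internals := by
      rintro rfl
      exact h0' (cographIso_internals γ Γ)
    exact h ⟨hne, (loops_of_cographIso hS hne h0').trans (mem_withLegsLoops.1 hγ).2⟩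

/-- The number of maximal subgraphs counts the ways to write a graph as an insertion into a
one-loop graph. -/
theorem sum_sum_cographIso [CharZero 𝕜] (Γ : FeynmanGraph) :
    ∑ γ ∈ withLegsLoops Γ.numLegs 1, (∑ S ∈ Γ.subs, (γ.cographIso Γ S : 𝕜)) / γ.numAut =
      Γ.rep.maxf := by
  simp_rw [Finset.sum_div]
  rw [Finset.sum_comm, Finset.sum_congr rfl fun S hS => sum_cographIso_of_loops_eq_one 𝕜 Γ hS,
    Finset.sum_boole, Γ.rep_isFeynman.maxf_eq, subs, Finset.filter_filter, Nat.card_eq_fintype_card,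
    Fintype.card_subtype]

end FeynmanGraph

section

open FeynmanGraph

variable (𝕜 : Type*) [Field 𝕜]

theorem coeff_green_eq (n k : ℕ) : PowerSeries.coeff k (green 𝕜 n) = (if k = 0 then 1 else 0) +
    greenSign 𝕜 n • ∑ γ ∈ withLegsLoops n k, γ.weight 𝕜 • (MvPolynomial.X γ : GraphAlg 𝕜) := by
  rw [coeff_green, finsum_eq_sum_withLegsLoops n k fun γ => γ.weight 𝕜 • (MvPolynomial.X γ : GraphAlg 𝕜)]

/-- The combinatorial Dyson-Schwinger equation in the algebra of graphs. -/
theorem coeff_green_succ [CharZero 𝕜] (n k : ℕ) :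
    PowerSeries.coeff (k + 1) (green 𝕜 n) = greenSign 𝕜 n • oneLoopInsertion 𝕜 n k := by
  rw [coeff_green_eq, if_neg (Nat.succ_ne_zero k), zero_add]
  congr 1
  rw [oneLoopInsertion, finsum_subtype_eq_finsum_cond
    (fun γ : FeynmanGraph => γ.numLegs = n ∧ γ.loops = 1 ∧ γ.IsPrimitive 𝕜)
    (f := fun γ => γ.weight 𝕜 • insertion 𝕜 γ (PowerSeries.coeff k (insertionArg 𝕜 γ))),
    finsum_cond_eq_sum_of_cond_iff (t := withLegsLoops n 1) _ (fun {γ} _ => by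
      rw [mem_withLegsLoops]
      exact ⟨fun h => ⟨h.1, h.2.1⟩, fun h => ⟨h.1, h.2, isPrimitive_of_loops 𝕜 h.2⟩⟩)]
  have h1 : ∀ γ ∈ withLegsLoops n 1,
      γ.weight 𝕜 • insertion 𝕜 γ (PowerSeries.coeff k (insertionArg 𝕜 γ)) =
      ∑ Γ ∈ withLegsLoops n (k + 1), ((n.factorial : 𝕜) * (Γ.numAut : 𝕜)⁻¹ * (Γ.rep.maxf : 𝕜)⁻¹ *
        ((∑ S ∈ Γ.subs, (γ.cographIso Γ S : 𝕜)) / γ.numAut)) • (MvPolynomial.X Γ : GraphAlg 𝕜) := by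
    intro γ hγ
    obtain ⟨hn, hl⟩ := mem_withLegsLoops.1 hγ
    rw [insertion_coeff, hn, hl, Finset.smul_sum]
    refine Finset.sum_congr rfl fun Γ _ => ?_
    rw [smul_smul, weight, hn]
    congr 1
    ring
  rw [Finset.sum_congr rfl h1, Finset.sum_comm]
  refine Finset.sum_congr rfl fun Γ hΓ => ?_
  obtain ⟨rfl, -⟩ := mem_withLegsLoops.1 hΓ
  have hm : (Γ.rep.maxf : 𝕜) ≠ 0 := Nat.cast_ne_zero.2 Γ.rep_isFeynman.maxf_pos.ne'
  rw [← Finset.sum_smul, ← Finset.mul_sum, sum_sum_cographIso, mul_assoc, inv_mul_cancel₀ hm, mul_one,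
    weight, div_eq_mul_inv]

/-- The coproduct of a sum of graphs: the graphs `Γ / S` are collected. -/
theorem graphComul_coeff_green [CharZero 𝕜] (n L : ℕ) (hL : L ≠ 0) :
    graphComul 𝕜 (PowerSeries.coeff L (green 𝕜 n)) =
      PowerSeries.coeff L (green 𝕜 n) ⊗ₜ[𝕜] (1 : GraphAlg 𝕜) +
      ∑ l ∈ Finset.Icc 1 L, ∑ γ ∈ withLegsLoops n l, (greenSign 𝕜 n * γ.weight 𝕜) •
        (PowerSeries.coeff (L - l) (insertionArg 𝕜 γ) ⊗ₜ[𝕜] (MvPolynomial.X γ : GraphAlg 𝕜)) := by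
  -- both sides are sums over pairs of a graph and a subgraph
  set F : (Γ : FeynmanGraph) → Set (Fin Γ.size) → FeynmanGraph → GraphAlg 𝕜 ⊗[𝕜] GraphAlg 𝕜 :=
    fun Γ S γ => (Γ.rep.cut S).compsProd 𝕜 ⊗ₜ[𝕜] (MvPolynomial.X γ : GraphAlg 𝕜) with hF
  have h1 : ∀ l ∈ Finset.Icc 1 L, ∀ γ ∈ withLegsLoops n l, (greenSign 𝕜 n * γ.weight 𝕜) •
      (PowerSeries.coeff (L - l) (insertionArg 𝕜 γ) ⊗ₜ[𝕜] (MvPolynomial.X γ : GraphAlg 𝕜)) =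
      ∑ Γ ∈ withLegsLoops n L, (greenSign 𝕜 n * Γ.weight 𝕜) • ∑ S ∈ Γ.subs,
        ((γ.cographIso Γ S : 𝕜) / γ.numAut) • F Γ S γ := by
    intro l hl γ hγ
    obtain ⟨hn, hγl⟩ := mem_withLegsLoops.1 hγ
    rw [coeff_insertionArg_eq_sum, hn, hγl, Nat.sub_add_cancel (Finset.mem_Icc.1 hl).2,
      TensorProduct.sum_tmul, Finset.smul_sum]
    refine Finset.sum_congr rfl fun Γ hΓ => ?_
    rw [← TensorProduct.smul_tmul', TensorProduct.sum_tmul, Finset.smul_sum, Finset.smul_sum,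
      Finset.smul_sum]
    refine Finset.sum_congr rfl fun S _ => ?_
    rw [← TensorProduct.smul_tmul', smul_smul, smul_smul, smul_smul, weight, weight, hn,
      (mem_withLegsLoops.1 hΓ).1]
    congr 1
    ring
  rw [Finset.sum_congr rfl fun l hl => Finset.sum_congr rfl (h1 l hl)]
  have h2 : ∑ l ∈ Finset.Icc 1 L, ∑ γ ∈ withLegsLoops n l, ∑ Γ ∈ withLegsLoops n L,
      (greenSign 𝕜 n * Γ.weight 𝕜) • ∑ S ∈ Γ.subs, ((γ.cographIso Γ S : 𝕜) / γ.numAut) • F Γ S γ =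
      ∑ Γ ∈ withLegsLoops n L, (greenSign 𝕜 n * Γ.weight 𝕜) • ∑ S ∈ Γ.subs,
        ∑ l ∈ Finset.Icc 1 L, ∑ γ ∈ withLegsLoops n l,
          ((γ.cographIso Γ S : 𝕜) / γ.numAut) • F Γ S γ := by
    simp_rw [Finset.smul_sum]
    rw [Finset.sum_congr rfl fun l _ => Finset.sum_comm, Finset.sum_comm]
    refine Finset.sum_congr rfl fun Γ _ => ?_
    rw [Finset.sum_congr rfl fun l _ => Finset.sum_comm, Finset.sum_comm]
  rw [h2, coeff_green_eq, if_neg hL, zero_add, map_smul, map_sum, ← TensorProduct.smul_tmul',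
    TensorProduct.sum_tmul, Finset.smul_sum, Finset.smul_sum, ← Finset.sum_add_distrib]
  refine Finset.sum_congr rfl fun Γ hΓ => ?_
  obtain ⟨hn, hΓL⟩ := mem_withLegsLoops.1 hΓ
  have h := Γ.rep_isFeynman
  have hco : graphComul 𝕜 (MvPolynomial.X Γ) = Γ.rep.coprod 𝕜 := MvPolynomial.aeval_X _ _
  rw [map_smul, hco, h.coprod_eq_add 𝕜, FGraph.toAlg_rep, ← TensorProduct.smul_tmul', smul_add,
    smul_add, smul_smul, smul_smul]
  congr 2
  rw [finsum_subtype_eq_sum (fun S => Γ.rep.IsSub S ∧ S ≠ Γ.rep.internals) fun S =>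
    (Γ.rep.cut S).compsProd 𝕜 ⊗ₜ[𝕜] (Γ.rep.contract S).toAlg 𝕜]
  have hint : ∑ l ∈ Finset.Icc 1 L, ∑ γ ∈ withLegsLoops n l,
      ((γ.cographIso Γ Γ.rep.internals : 𝕜) / γ.numAut) • F Γ Γ.rep.internals γ = 0 := by
    refine Finset.sum_eq_zero fun l _ => Finset.sum_eq_zero fun γ _ => ?_
    rw [cographIso_internals, Nat.cast_zero, zero_div, zero_smul]
  rw [← Finset.add_sum_erase Γ.subs _ (mem_subs.2 h.isSub_internals), hint, zero_add]
  have herase : Finset.univ.filter (fun S => Γ.rep.IsSub S ∧ S ≠ Γ.rep.internals) =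
      Γ.subs.erase Γ.rep.internals := by
    ext S
    rw [Finset.mem_filter, Finset.mem_erase, mem_subs]
    exact ⟨fun h => ⟨h.2.2, h.2.1⟩, fun h => ⟨Finset.mem_univ _, h.2, h.1⟩⟩
  rw [herase]
  refine Finset.sum_congr rfl fun S hS => ?_
  obtain ⟨hne, hS⟩ := Finset.mem_erase.1 hS
  have hc := h.contract (mem_subs.1 hS) hne
  have hlc := h.loops_contract (mem_subs.1 hS) hne
  have hlp : Γ.rep.loops = L := hΓL
  have hmem : (Γ.rep.contract S).loops ∈ Finset.Icc 1 L :=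
    Finset.mem_Icc.2 ⟨hc.one_le_loops, by omega⟩
  rw [Finset.sum_eq_single_of_mem _ hmem, sum_cographIso 𝕜 hS hne (F Γ S), hF,
    FGraph.toAlg_of_isFeynman 𝕜 hc]
  · exact mem_withLegsLoops.2 ⟨(FGraph.numLegs_cls _ _).trans
      ((h.numLegs_contract (mem_subs.1 hS) hne).trans hn), FGraph.loops_cls _ _⟩
  · intro l _ hl
    refine Finset.sum_eq_zero fun γ hγ => ?_
    have h0 : γ.cographIso Γ S = 0 := by
      by_contra h0
      exact hl ((mem_withLegsLoops.1 hγ).2.symm.trans (loops_of_cographIso hS hne h0).symm)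
    rw [h0, Nat.cast_zero, zero_div, zero_smul]

end


/-! ### The relations -/

noncomputable section

variable (𝕜 : Type*) [Field 𝕜]

section Ker

variable {R : Type*} [CommRing R] [Algebra 𝕜 R] (f : GraphAlg 𝕜 →ₐ[𝕜] R)

theorem map_green_mul_map_greenInv (n : ℕ) : PowerSeries.map (f : GraphAlg 𝕜 →+* R) (green 𝕜 n) *
    PowerSeries.map (f : GraphAlg 𝕜 →+* R) (greenInv 𝕜 n) = 1 := by
  rw [← map_mul, green_mul_greenInv, map_one]

/-- The relations hold in an algebra if the images of the sums of graphs form a geometric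
progression. -/
theorem relIdeal_le_ker (h : ∀ n, 3 ≤ n → PowerSeries.map (f : GraphAlg 𝕜 →+* R) (green 𝕜 (n + 1)) *
    PowerSeries.map (f : GraphAlg 𝕜 →+* R) (green 𝕜 (n - 1)) =
      PowerSeries.map (f : GraphAlg 𝕜 →+* R) (green 𝕜 n) ^ 2) :
    relIdeal 𝕜 ≤ RingHom.ker (f : GraphAlg 𝕜 →+* R) := by
  refine Ideal.span_le.2 ?_
  rintro _ ⟨n, k, hn, rfl⟩
  refine RingHom.mem_ker.2 ?_
  rw [← PowerSeries.coeff_map, map_sub, map_mul, map_mul]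
  have h1 := map_green_mul_map_greenInv 𝕜 f n
  have h2 := map_green_mul_map_greenInv 𝕜 f (n - 1)
  have h3 := h n hn
  refine (congrArg _ ?_).trans (map_zero (PowerSeries.coeff k))
  generalize PowerSeries.map (f : GraphAlg 𝕜 →+* R) (green 𝕜 (n + 1)) = u at *
  generalize PowerSeries.map (f : GraphAlg 𝕜 →+* R) (green 𝕜 n) = v at *
  generalize PowerSeries.map (f : GraphAlg 𝕜 →+* R) (green 𝕜 (n - 1)) = w at *
  generalize PowerSeries.map (f : GraphAlg 𝕜 →+* R) (greenInv 𝕜 n) = v' at *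
  generalize PowerSeries.map (f : GraphAlg 𝕜 →+* R) (greenInv 𝕜 (n - 1)) = w' at *
  linear_combination (v' * w') * h3 - u * v' * h2 + v * w' * h1

end Ker

/-- The series `X^n` modulo the relations. -/
def greenQ (n : ℕ) : PowerSeries (QuotAlg 𝕜) :=
  PowerSeries.map (proj 𝕜 : GraphAlg 𝕜 →+* QuotAlg 𝕜) (green 𝕜 n)

/-- The series `1 / X^2` modulo the relations. -/
def propQ : PowerSeries (QuotAlg 𝕜) :=
  PowerSeries.map (proj 𝕜 : GraphAlg 𝕜 →+* QuotAlg 𝕜) (greenInv 𝕜 2)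

/-- The series `Q^2` modulo the relations. -/
def chargeQ : PowerSeries (QuotAlg 𝕜) :=
  PowerSeries.map (proj 𝕜 : GraphAlg 𝕜 →+* QuotAlg 𝕜) (chargeSq 𝕜)

theorem greenQ_mul_propQ : greenQ 𝕜 2 * propQ 𝕜 = 1 := map_green_mul_map_greenInv 𝕜 (proj 𝕜) 2

theorem chargeQ_eq : chargeQ 𝕜 = greenQ 𝕜 3 ^ 2 * propQ 𝕜 ^ 3 := by
  rw [chargeQ, chargeSq, map_mul, map_pow, map_pow]; rfl

theorem greenQ_rel (n : ℕ) (hn : 3 ≤ n) :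
    greenQ 𝕜 (n + 1) * greenQ 𝕜 (n - 1) = greenQ 𝕜 n ^ 2 := by
  have h : PowerSeries.map (proj 𝕜 : GraphAlg 𝕜 →+* QuotAlg 𝕜)
      (green 𝕜 (n + 1) * greenInv 𝕜 n - green 𝕜 n * greenInv 𝕜 (n - 1)) = 0 := by
    ext k
    rw [PowerSeries.coeff_map, map_zero]
    exact Ideal.Quotient.eq_zero_iff_mem.2 (Ideal.subset_span ⟨n, k, hn, rfl⟩)
  have h1 := map_green_mul_map_greenInv 𝕜 (proj 𝕜) n
  have h2 := map_green_mul_map_greenInv 𝕜 (proj 𝕜) (n - 1)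
  rw [map_sub, map_mul, map_mul] at h
  unfold greenQ
  generalize PowerSeries.map (proj 𝕜 : GraphAlg 𝕜 →+* QuotAlg 𝕜) (green 𝕜 (n + 1)) = u at *
  generalize PowerSeries.map (proj 𝕜 : GraphAlg 𝕜 →+* QuotAlg 𝕜) (green 𝕜 n) = v at *
  generalize PowerSeries.map (proj 𝕜 : GraphAlg 𝕜 →+* QuotAlg 𝕜) (green 𝕜 (n - 1)) = w at *
  generalize PowerSeries.map (proj 𝕜 : GraphAlg 𝕜 →+* QuotAlg 𝕜) (greenInv 𝕜 n) = v' at *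
  generalize PowerSeries.map (proj 𝕜 : GraphAlg 𝕜 →+* QuotAlg 𝕜) (greenInv 𝕜 (n - 1)) = w' at *
  linear_combination (v * w) * h - u * w * h1 + v ^ 2 * h2

/-- Modulo the relations the sums of graphs are a geometric progression. -/
theorem greenQ_eq (m : ℕ) : greenQ 𝕜 (m + 2) = greenQ 𝕜 2 * (greenQ 𝕜 3 * propQ 𝕜) ^ m := by
  have ha := greenQ_mul_propQ 𝕜
  have h3 : greenQ 𝕜 3 = greenQ 𝕜 2 * (greenQ 𝕜 3 * propQ 𝕜) := by
    linear_combination - greenQ 𝕜 3 * ha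
  have key : greenQ 𝕜 (m + 2) = greenQ 𝕜 2 * (greenQ 𝕜 3 * propQ 𝕜) ^ m ∧
      greenQ 𝕜 (m + 3) = greenQ 𝕜 2 * (greenQ 𝕜 3 * propQ 𝕜) ^ (m + 1) := by
    induction m with
    | zero => exact ⟨by rw [pow_zero, mul_one], by rw [zero_add, zero_add, pow_one]; exact h3⟩
    | succ m ih =>
      refine ⟨ih.2, ?_⟩
      have hrel := greenQ_rel 𝕜 (m + 3) (by omega)
      rw [show m + 3 - 1 = m + 2 from rfl, ih.1, ih.2] at hrel
      rw [show m + 1 + 3 = m + 3 + 1 from rfl]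
      -- the middle term of the relation is cancelled by the inverse of `X^{m+2}`
      have hinv := map_green_mul_map_greenInv 𝕜 (proj 𝕜) (m + 2)
      have hinv' : greenQ 𝕜 2 * (greenQ 𝕜 3 * propQ 𝕜) ^ m *
          PowerSeries.map (proj 𝕜 : GraphAlg 𝕜 →+* QuotAlg 𝕜) (greenInv 𝕜 (m + 2)) = 1 := by
        rw [← ih.1]; exact hinv
      generalize PowerSeries.map (proj 𝕜 : GraphAlg 𝕜 →+* QuotAlg 𝕜) (greenInv 𝕜 (m + 2)) = z at hinv'
      generalize greenQ 𝕜 3 * propQ 𝕜 = b at *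
      linear_combination z * hrel - (greenQ 𝕜 (m + 3 + 1) - greenQ 𝕜 2 * b ^ (m + 2)) * hinv'
  exact key.1

namespace FGraph

variable {α : Type} {Γ : FGraph α}

theorem numVertices_add_loops [Finite α] (h : Γ.IsFeynman) :
    Γ.numVertices + Γ.loops = Γ.numEdges + 1 := by
  have h1 := h.two_mul_loops
  have h2 := h.two_mul_numEdges
  omega

theorem sum_valence [Finite α] [Fintype (Quotient Γ.vert)] :
    ∑ v, Γ.valence v = Nat.card {x // Γ.IsInternal x} + Γ.numLegs := by
  have e := Nat.card_add_card_not (fun _ : α => True) Γ.IsInternal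
  rw [Nat.card_congr (Equiv.subtypeUnivEquiv fun _ => trivial)] at e
  simp only [true_and] at e
  exact (Nat.card_eq_sum_fiber fun x : α => Quotient.mk Γ.vert x).symm.trans e

end FGraph

theorem pow_mul_pow_of_mul_eq_one {R : Type*} [CommRing R] {a p c : R} (h : a * p = 1)
    (V l n : ℕ) : a ^ V * (c * p) ^ (n + 2 * (l + 1)) * p ^ (V + l) =
      a * (c * p) ^ n * (c ^ 2 * p ^ 3) ^ (l + 1) := by
  have hV : a ^ V * p ^ V = 1 := by rw [← mul_pow, h, one_pow]
  have h1 : (c ^ 2 * p ^ 3) ^ (l + 1) = (c * p) ^ (2 * (l + 1)) * p ^ (l + 1) := by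
    rw [pow_mul (c * p), ← mul_pow]
    congr 1
    ring
  rw [h1, pow_add (c * p), pow_add p V, pow_succ p l]
  linear_combination ((c * p) ^ n * (c * p) ^ (2 * (l + 1)) * p ^ l) * hV -
    ((c * p) ^ n * (c * p) ^ (2 * (l + 1)) * p ^ l) * h

/-- The numbers of vertices and edges and the sum of the valences are determined by the numbers of
legs and loops, apart from one parameter. -/
theorem FGraph.IsFeynman.exists_counts {α : Type} [Finite α] {Γ : FGraph α} (h : Γ.IsFeynman)
    [Fintype (Quotient Γ.vert)] : ∃ n l, Γ.numLegs = n + 2 ∧ Γ.loops = l + 1 ∧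
      ∑ v, (Γ.valence v - 2) = n + 2 * (l + 1) ∧ Γ.numEdges = Γ.numVertices + l := by
  have hE := h.two_mul_numEdges
  have hV := FGraph.numVertices_add_loops h
  have hval := FGraph.sum_valence (Γ := Γ)
  have hsub : ∑ v, (Γ.valence v - 2) + 2 * Γ.numVertices = ∑ v, Γ.valence v := by
    have : 2 * Γ.numVertices = ∑ _v : Quotient Γ.vert, 2 := by
      rw [Finset.sum_const, Finset.card_univ, FGraph.numVertices, Nat.card_eq_fintype_card,
        smul_eq_mul, mul_comm]
    rw [this, ← Finset.sum_add_distrib]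
    exact Finset.sum_congr rfl fun v _ => Nat.sub_add_cancel (by
      have := h.three_le_valence v; omega)
  obtain ⟨n, hn⟩ := Nat.exists_eq_add_of_le' h.two_le_legs
  obtain ⟨l, hl⟩ := Nat.exists_eq_add_of_le' h.one_le_loops
  exact ⟨n, l, hn, hl, by omega, by omega⟩

/-- What is inserted into `γ` depends only on the numbers of legs and loops. -/
theorem map_insertionArg (γ : FeynmanGraph) :
    PowerSeries.map (proj 𝕜 : GraphAlg 𝕜 →+* QuotAlg 𝕜) (insertionArg 𝕜 γ) =
      greenQ 𝕜 γ.numLegs * chargeQ 𝕜 ^ γ.loops := by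
  have hF := Fintype.ofFinite (Quotient γ.rep.vert)
  obtain ⟨n, l, hn, hl, hsum, hE⟩ := γ.rep_isFeynman.exists_counts
  have h1 : ∀ v, PowerSeries.map (proj 𝕜 : GraphAlg 𝕜 →+* QuotAlg 𝕜) (green 𝕜 (γ.rep.valence v)) =
      greenQ 𝕜 2 * (greenQ 𝕜 3 * propQ 𝕜) ^ (γ.rep.valence v - 2) := by
    intro v
    rw [← greenQ_eq, Nat.sub_add_cancel (by have := γ.rep_isFeynman.three_le_valence v; omega)]
    rfl
  have h2 : PowerSeries.map (proj 𝕜 : GraphAlg 𝕜 →+* QuotAlg 𝕜) (insertionArg 𝕜 γ) =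
      greenQ 𝕜 2 ^ γ.rep.numVertices * (greenQ 𝕜 3 * propQ 𝕜) ^ (n + 2 * (l + 1)) *
        propQ 𝕜 ^ (γ.rep.numVertices + l) := by
    rw [insertionArg, map_mul, map_pow, finprod_eq_prod_of_fintype, map_prod,
      Finset.prod_congr rfl fun v _ => h1 v, Finset.prod_mul_distrib, Finset.prod_const,
      Finset.prod_pow_eq_pow_sum, Finset.card_univ, ← Nat.card_eq_fintype_card, hsum, hE]
    rfl
  rw [h2, pow_mul_pow_of_mul_eq_one (greenQ_mul_propQ 𝕜), ← greenQ_eq, ← chargeQ_eq]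
  exact congrArg₂ (fun a b => greenQ 𝕜 a * chargeQ 𝕜 ^ b) hn.symm hl.symm

theorem coeff_greenQ_mul_chargeQ (n k : ℕ) :
    (dseArg 𝕜 n k : QuotAlg 𝕜) = PowerSeries.coeff k (greenQ 𝕜 n * chargeQ 𝕜) := by
  rw [greenQ, chargeQ, ← map_mul, PowerSeries.coeff_map]
  rfl

theorem proj_coeff_insertionArg_of_loops {γ : FeynmanGraph} (h : γ.loops = 1) (k : ℕ) :
    proj 𝕜 (PowerSeries.coeff k (insertionArg 𝕜 γ)) = dseArg 𝕜 γ.numLegs k := by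
  rw [coeff_greenQ_mul_chargeQ, ← pow_one (chargeQ 𝕜), ← h, ← map_insertionArg,
    PowerSeries.coeff_map]
  rfl

end


/-! ### Antipodes of locally nilpotent bialgebras -/

noncomputable section

section Antipode

variable {𝕜 A : Type*} [Field 𝕜] [CommRing A] [Algebra 𝕜 A]

/-- The convolution powers of `ηε - id`. -/
def convPow (Δ : A →ₐ[𝕜] A ⊗[𝕜] A) (ε : A →ₐ[𝕜] 𝕜) : ℕ → A →ₗ[𝕜] A
  | 0 => Algebra.linearMap 𝕜 A ∘ₗ ε.toLinearMap
  | n + 1 => LinearMap.mul' 𝕜 A ∘ₗ TensorProduct.map (convPow Δ ε n)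
      (Algebra.linearMap 𝕜 A ∘ₗ ε.toLinearMap - LinearMap.id) ∘ₗ Δ.toLinearMap

/-- Every element is annihilated by almost all convolution powers of `ηε - id`. -/
def IsConilpotent (Δ : A →ₐ[𝕜] A ⊗[𝕜] A) (ε : A →ₐ[𝕜] 𝕜) : Prop :=
  ∀ x, ∃ N, ∀ n, N ≤ n → convPow Δ ε n x = 0

variable {Δ : A →ₐ[𝕜] A ⊗[𝕜] A} {ε : A →ₐ[𝕜] 𝕜}

theorem finsum_convPow {x : A} {N : ℕ} (h : ∀ n, N ≤ n → convPow Δ ε n x = 0) :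
    ∑ᶠ n, convPow Δ ε n x = ∑ n ∈ Finset.range N, convPow Δ ε n x :=
  finsum_eq_sum_of_support_subset _ fun n hn => by
    by_contra h'
    exact hn (h n (by simpa using h'))

theorem IsConilpotent.support_finite (h : IsConilpotent Δ ε) (x : A) :
    (Function.support fun n => convPow Δ ε n x).Finite := by
  obtain ⟨N, hN⟩ := h x
  refine (Set.finite_lt_nat N).subset fun n hn => ?_
  by_contra h'
  exact hn (hN n (not_lt.1 h'))

/-- The convolution inverse of the identity, as a geometric series. -/
def IsConilpotent.antipode (h : IsConilpotent Δ ε) : A →ₗ[𝕜] A where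
  toFun x := ∑ᶠ n, convPow Δ ε n x
  map_add' x y := by
    simp_rw [map_add]
    exact finsum_add_distrib (h.support_finite x) (h.support_finite y)
  map_smul' c x := by
    simp_rw [map_smul]
    exact (smul_finsum' c (h.support_finite x)).symm

theorem IsConilpotent.antipode_eq (h : IsConilpotent Δ ε) {x : A} {N : ℕ}
    (hN : ∀ n, N ≤ n → convPow Δ ε n x = 0) :
    h.antipode x = (∑ n ∈ Finset.range N, convPow Δ ε n) x := by
  rw [LinearMap.sum_apply]
  exact finsum_convPow hN

theorem IsConilpotent.map_antipode_left (h : IsConilpotent Δ ε) (t : A ⊗[𝕜] A) :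
    ∃ N₀, ∀ N, N₀ ≤ N → TensorProduct.map h.antipode LinearMap.id t =
      TensorProduct.map (∑ n ∈ Finset.range N, convPow Δ ε n) LinearMap.id t := by
  induction t using TensorProduct.induction_on with
  | zero => exact ⟨0, fun _ _ => by rw [map_zero, map_zero]⟩
  | tmul x y =>
    obtain ⟨N, hN⟩ := h x
    refine ⟨N, fun M hM => ?_⟩
    rw [TensorProduct.map_tmul, TensorProduct.map_tmul, h.antipode_eq fun n hn => hN n (hM.trans hn)]
  | add x y hx hy =>
    obtain ⟨N, hN⟩ := hx
    obtain ⟨M, hM⟩ := hy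
    refine ⟨max N M, fun K hK => ?_⟩
    rw [map_add, map_add, hN K ((le_max_left _ _).trans hK), hM K ((le_max_right _ _).trans hK)]

theorem IsConilpotent.map_antipode_right (h : IsConilpotent Δ ε) (t : A ⊗[𝕜] A) :
    ∃ N₀, ∀ N, N₀ ≤ N → TensorProduct.map LinearMap.id h.antipode t =
      TensorProduct.map LinearMap.id (∑ n ∈ Finset.range N, convPow Δ ε n) t := by
  induction t using TensorProduct.induction_on with
  | zero => exact ⟨0, fun _ _ => by rw [map_zero, map_zero]⟩
  | tmul x y =>
    obtain ⟨N, hN⟩ := h y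
    refine ⟨N, fun M hM => ?_⟩
    rw [TensorProduct.map_tmul, TensorProduct.map_tmul, h.antipode_eq fun n hn => hN n (hM.trans hn)]
  | add x y hx hy =>
    obtain ⟨N, hN⟩ := hx
    obtain ⟨M, hM⟩ := hy
    refine ⟨max N M, fun K hK => ?_⟩
    rw [map_add, map_add, hN K ((le_max_left _ _).trans hK), hM K ((le_max_right _ _).trans hK)]

/-- A conilpotent bialgebra is a Hopf algebra: the identity is inverted by a geometric series. -/
theorem IsConilpotent.isHopfAlgebra (h : IsConilpotent Δ ε)
    (coassoc : ∀ a, TensorProduct.assoc 𝕜 A A A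
      (TensorProduct.map Δ.toLinearMap LinearMap.id (Δ a)) =
      TensorProduct.map LinearMap.id Δ.toLinearMap (Δ a))
    (counit_left : ∀ a,
      TensorProduct.lid 𝕜 A (TensorProduct.map ε.toLinearMap LinearMap.id (Δ a)) = a)
    (counit_right : ∀ a,
      TensorProduct.rid 𝕜 A (TensorProduct.map LinearMap.id ε.toLinearMap (Δ a)) = a) :
    IsHopfAlgebra Δ ε h.antipode := by
  let _ : Coalgebra 𝕜 A :=
    { comul := Δ.toLinearMap
      counit := ε.toLinearMap
      coassoc := LinearMap.ext coassoc
      rTensor_counit_comp_comul := by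
        ext a
        refine (TensorProduct.lid 𝕜 A).injective ?_
        rw [TensorProduct.mk_apply, TensorProduct.lid_tmul, one_smul]
        exact counit_left a
      lTensor_counit_comp_comul := by
        ext a
        refine (TensorProduct.rid 𝕜 A).injective ?_
        rw [LinearMap.flip_apply, TensorProduct.mk_apply, TensorProduct.rid_tmul, one_smul]
        exact counit_right a }
  -- In the convolution algebra the identity is `1 - u`, with the inverse `∑ u ^ n`.
  set u : WithConv (A →ₗ[𝕜] A) := 1 - WithConv.toConv LinearMap.id with hu
  have hpow : ∀ n, WithConv.toConv (convPow Δ ε n) = u ^ n := by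
    intro n
    induction n with
    | zero => rfl
    | succ n ih => rw [pow_succ, ← ih]; rfl
  have hid : WithConv.toConv LinearMap.id = 1 - u := by rw [hu, sub_sub_cancel]
  have hsum : ∀ N, WithConv.toConv (∑ n ∈ Finset.range N, convPow Δ ε n) =
      ∑ n ∈ Finset.range N, u ^ n := by
    intro N
    induction N with
    | zero => rfl
    | succ N ih => rw [Finset.sum_range_succ, Finset.sum_range_succ, ← ih, ← hpow]; rfl
  refine ⟨coassoc, counit_left, counit_right, fun a => ?_, fun a => ?_⟩
  · obtain ⟨N, hN⟩ := h a
    obtain ⟨M, hM⟩ := h.map_antipode_left (Δ a)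
    rw [hM _ (le_max_right N M)]
    have key : (WithConv.toConv (∑ n ∈ Finset.range (max N M), convPow Δ ε n)) *
        WithConv.toConv LinearMap.id = 1 - WithConv.toConv (convPow Δ ε (max N M)) := by
      rw [hsum, hid, geom_sum_mul_neg, hpow]
    have h1 := congrArg (fun f : WithConv (A →ₗ[𝕜] A) => f.ofConv a) key
    refine h1.trans ?_
    change algebraMap 𝕜 A (ε a) - convPow Δ ε (max N M) a = _
    rw [hN _ (le_max_left _ _), sub_zero]
  · obtain ⟨N, hN⟩ := h a
    obtain ⟨M, hM⟩ := h.map_antipode_right (Δ a)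
    rw [hM _ (le_max_right N M)]
    have key : WithConv.toConv LinearMap.id *
        (WithConv.toConv (∑ n ∈ Finset.range (max N M), convPow Δ ε n)) =
          1 - WithConv.toConv (convPow Δ ε (max N M)) := by
      rw [hsum, hid, mul_neg_geom_sum, hpow]
    have h1 := congrArg (fun f : WithConv (A →ₗ[𝕜] A) => f.ofConv a) key
    refine h1.trans ?_
    change algebraMap 𝕜 A (ε a) - convPow Δ ε (max N M) a = _
    rw [hN _ (le_max_left _ _), sub_zero]

section Quotient

variable {B : Type*} [CommRing B] [Algebra 𝕜 B] {Δ' : B →ₐ[𝕜] B ⊗[𝕜] B} {ε' : B →ₐ[𝕜] 𝕜}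
  {p : A →ₐ[𝕜] B}

theorem map_comul (hΔ : ∀ x, Δ' (p x) = Algebra.TensorProduct.map p p (Δ x)) {C D : Type*}
    [AddCommGroup C] [Module 𝕜 C] [AddCommGroup D] [Module 𝕜 D] (f : B →ₗ[𝕜] C) (g : B →ₗ[𝕜] D)
    (x : A) : TensorProduct.map f g (Δ' (p x)) =
      TensorProduct.map (f ∘ₗ p.toLinearMap) (g ∘ₗ p.toLinearMap) (Δ x) := by
  rw [hΔ, TensorProduct.map_comp]
  rfl

theorem convPow_map (hΔ : ∀ x, Δ' (p x) = Algebra.TensorProduct.map p p (Δ x))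
    (hε : ∀ x, ε' (p x) = ε x) (n : ℕ) (x : A) :
    convPow Δ' ε' n (p x) = p (convPow Δ ε n x) := by
  induction n generalizing x with
  | zero =>
    change algebraMap 𝕜 B (ε' (p x)) = p (algebraMap 𝕜 A (ε x))
    rw [hε, AlgHom.commutes]
  | succ n ih =>
    change LinearMap.mul' 𝕜 B (TensorProduct.map _ _ (Δ' (p x))) =
      p (LinearMap.mul' 𝕜 A (TensorProduct.map _ _ (Δ x)))
    rw [map_comul hΔ]
    generalize Δ x = t
    induction t using TensorProduct.induction_on with
    | zero => simp only [map_zero]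
    | add s t hs ht => simp only [map_add, hs, ht]
    | tmul y z =>
      rw [TensorProduct.map_tmul, TensorProduct.map_tmul, LinearMap.mul'_apply,
        LinearMap.mul'_apply, map_mul]
      change convPow Δ' ε' n (p y) * (algebraMap 𝕜 B (ε' (p z)) - p z) =
        p (convPow Δ ε n y) * p (algebraMap 𝕜 A (ε z) - z)
      rw [ih, hε, map_sub, AlgHom.commutes]

theorem IsConilpotent.of_surjective (h : IsConilpotent Δ ε) (hp : Function.Surjective p)
    (hΔ : ∀ x, Δ' (p x) = Algebra.TensorProduct.map p p (Δ x))
    (hε : ∀ x, ε' (p x) = ε x) : IsConilpotent Δ' ε' := by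
  intro y
  obtain ⟨x, rfl⟩ := hp y
  obtain ⟨N, hN⟩ := h x
  exact ⟨N, fun n hn => by rw [convPow_map hΔ hε, hN n hn, map_zero]⟩

theorem IsConilpotent.antipode_map (h : IsConilpotent Δ ε) (h' : IsConilpotent Δ' ε')
    (hΔ : ∀ x, Δ' (p x) = Algebra.TensorProduct.map p p (Δ x))
    (hε : ∀ x, ε' (p x) = ε x) (x : A) : h'.antipode (p x) = p (h.antipode x) := by
  obtain ⟨N, hN⟩ := h x
  rw [h.antipode_eq hN, h'.antipode_eq (N := N)
    (fun n hn => by rw [convPow_map hΔ hε, hN n hn, map_zero]),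
    LinearMap.sum_apply, LinearMap.sum_apply, map_sum]
  exact Finset.sum_congr rfl fun n _ => convPow_map hΔ hε n x

theorem coassoc_of_surjective (hp : Function.Surjective p)
    (hΔ : ∀ x, Δ' (p x) = Algebra.TensorProduct.map p p (Δ x))
    (coassoc : ∀ a, TensorProduct.assoc 𝕜 A A A
      (TensorProduct.map Δ.toLinearMap LinearMap.id (Δ a)) =
      TensorProduct.map LinearMap.id Δ.toLinearMap (Δ a)) (b : B) :
    TensorProduct.assoc 𝕜 B B B (TensorProduct.map Δ'.toLinearMap LinearMap.id (Δ' b)) =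
      TensorProduct.map LinearMap.id Δ'.toLinearMap (Δ' b) := by
  obtain ⟨a, rfl⟩ := hp b
  have h1 : ∀ t : A ⊗[𝕜] A, TensorProduct.map (Δ'.toLinearMap ∘ₗ p.toLinearMap)
      (LinearMap.id ∘ₗ p.toLinearMap) t = TensorProduct.map
        (TensorProduct.map p.toLinearMap p.toLinearMap) p.toLinearMap
        (TensorProduct.map Δ.toLinearMap LinearMap.id t) := by
    intro t
    rw [← LinearMap.comp_apply, ← TensorProduct.map_comp]
    congr 2
    exact LinearMap.ext hΔ
  have h2 : ∀ t : A ⊗[𝕜] A, TensorProduct.map (LinearMap.id ∘ₗ p.toLinearMap)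
      (Δ'.toLinearMap ∘ₗ p.toLinearMap) t = TensorProduct.map p.toLinearMap
        (TensorProduct.map p.toLinearMap p.toLinearMap)
        (TensorProduct.map LinearMap.id Δ.toLinearMap t) := by
    intro t
    rw [← LinearMap.comp_apply, ← TensorProduct.map_comp]
    congr 2
    exact LinearMap.ext hΔ
  rw [map_comul hΔ, map_comul hΔ, h1, h2, ← coassoc]
  generalize TensorProduct.map Δ.toLinearMap LinearMap.id (Δ a) = t
  induction t using TensorProduct.induction_on with
  | zero => simp only [map_zero]
  | add s t hs ht => simp only [map_add, hs, ht]
  | tmul y z =>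
    induction y using TensorProduct.induction_on with
    | zero => simp only [map_zero, TensorProduct.zero_tmul]
    | add s t hs ht => simp only [map_add, TensorProduct.add_tmul, hs, ht]
    | tmul x y => rfl

theorem counit_left_of_surjective (hp : Function.Surjective p)
    (hΔ : ∀ x, Δ' (p x) = Algebra.TensorProduct.map p p (Δ x)) (hε : ∀ x, ε' (p x) = ε x)
    (counit_left : ∀ a,
      TensorProduct.lid 𝕜 A (TensorProduct.map ε.toLinearMap LinearMap.id (Δ a)) = a) (b : B) :
    TensorProduct.lid 𝕜 B (TensorProduct.map ε'.toLinearMap LinearMap.id (Δ' b)) = b := by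
  obtain ⟨a, rfl⟩ := hp b
  conv_rhs => rw [← counit_left a]
  rw [map_comul hΔ]
  generalize Δ a = t
  induction t using TensorProduct.induction_on with
  | zero => simp only [map_zero]
  | add s t hs ht => simp only [map_add, hs, ht]
  | tmul y z =>
    change ε' (p y) • p z = p (ε y • z)
    rw [hε, map_smul]

theorem counit_right_of_surjective (hp : Function.Surjective p)
    (hΔ : ∀ x, Δ' (p x) = Algebra.TensorProduct.map p p (Δ x)) (hε : ∀ x, ε' (p x) = ε x)
    (counit_right : ∀ a,
      TensorProduct.rid 𝕜 A (TensorProduct.map LinearMap.id ε.toLinearMap (Δ a)) = a) (b : B) :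
    TensorProduct.rid 𝕜 B (TensorProduct.map LinearMap.id ε'.toLinearMap (Δ' b)) = b := by
  obtain ⟨a, rfl⟩ := hp b
  conv_rhs => rw [← counit_right a]
  rw [map_comul hΔ]
  generalize Δ a = t
  induction t using TensorProduct.induction_on with
  | zero => simp only [map_zero]
  | add s t hs ht => simp only [map_add, hs, ht]
  | tmul y z =>
    change ε' (p z) • p y = p (ε z • y)
    rw [hε, map_smul]

end Quotient

/-- The antipode preserves every subalgebra that is closed under the coproduct. -/
theorem IsConilpotent.isSubHopf (h : IsConilpotent Δ ε) {C : Subalgebra 𝕜 A}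
    (hC : ∀ a ∈ C, Δ a ∈
      LinearMap.range (TensorProduct.map C.val.toLinearMap C.val.toLinearMap)) :
    IsSubHopf Δ h.antipode C := by
  refine ⟨hC, fun a ha => ?_⟩
  have key : ∀ n, ∀ a ∈ C, convPow Δ ε n a ∈ C := by
    intro n
    induction n with
    | zero => exact fun a _ => C.algebraMap_mem _
    | succ n ih =>
      intro a ha
      obtain ⟨t, ht⟩ := hC a ha
      change LinearMap.mul' 𝕜 A (TensorProduct.map _ _ (Δ a)) ∈ C
      rw [← ht]
      clear ht
      induction t using TensorProduct.induction_on with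
      | zero => simp only [map_zero]; exact C.zero_mem
      | add s t hs ht => simp only [map_add]; exact C.add_mem hs ht
      | tmul y z =>
        exact C.mul_mem (ih _ y.2) (C.sub_mem (C.algebraMap_mem _) z.2)
  obtain ⟨N, hN⟩ := h a
  rw [h.antipode_eq hN, LinearMap.sum_apply]
  exact C.sum_mem fun n _ => key n a ha

end Antipode

end


/-! ### The Hopf algebra of graphs -/

noncomputable section

variable (𝕜 : Type*) [Field 𝕜]

theorem graphComul_coassoc (a : GraphAlg 𝕜) : TensorProduct.assoc 𝕜 _ _ _
      (TensorProduct.map (graphComul 𝕜).toLinearMap LinearMap.id (graphComul 𝕜 a)) =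
    TensorProduct.map LinearMap.id (graphComul 𝕜).toLinearMap (graphComul 𝕜 a) := by
  have h : ((Algebra.TensorProduct.assoc 𝕜 𝕜 𝕜 (GraphAlg 𝕜) (GraphAlg 𝕜) (GraphAlg 𝕜)).toAlgHom.comp
      ((Algebra.TensorProduct.map (graphComul 𝕜) (AlgHom.id 𝕜 _)).comp (graphComul 𝕜))) =
      (Algebra.TensorProduct.map (AlgHom.id 𝕜 _) (graphComul 𝕜)).comp (graphComul 𝕜) := by
    refine MvPolynomial.algHom_ext fun γ => ?_
    have h1 : graphComul 𝕜 (MvPolynomial.X γ) = γ.rep.coprod 𝕜 := MvPolynomial.aeval_X _ _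
    have h2 := γ.rep_isFeynman.coassoc 𝕜
    rw [← h1] at h2
    exact h2
  exact DFunLike.congr_fun h a

theorem graphCounit_X (γ : FeynmanGraph) : graphCounit 𝕜 (MvPolynomial.X γ) = 0 :=
  MvPolynomial.aeval_X _ _

/-- The coproduct of a graph: the term of the whole graph, and the proper subgraphs with their
cographs. -/
theorem graphComul_X (γ : FeynmanGraph) : graphComul 𝕜 (MvPolynomial.X γ) =
    (MvPolynomial.X γ : GraphAlg 𝕜) ⊗ₜ[𝕜] (1 : GraphAlg 𝕜) +
      ∑ S ∈ γ.subs.erase γ.rep.internals,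
        (MvPolynomial.monomial (γ.rep.subExponent S) 1 : GraphAlg 𝕜) ⊗ₜ[𝕜]
          (γ.rep.contract S).toAlg 𝕜 := by
  have hco : graphComul 𝕜 (MvPolynomial.X γ) = γ.rep.coprod 𝕜 := MvPolynomial.aeval_X _ _
  rw [hco, γ.rep_isFeynman.coprod_eq_add 𝕜, FGraph.toAlg_rep,
    finsum_subtype_eq_sum (fun S => γ.rep.IsSub S ∧ S ≠ γ.rep.internals) fun S =>
    (γ.rep.cut S).compsProd 𝕜 ⊗ₜ[𝕜] (γ.rep.contract S).toAlg 𝕜]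
  congr 1
  have herase : Finset.univ.filter (fun S => γ.rep.IsSub S ∧ S ≠ γ.rep.internals) =
      γ.subs.erase γ.rep.internals := by
    ext S
    rw [Finset.mem_filter, Finset.mem_erase, FeynmanGraph.mem_subs]
    exact ⟨fun h => ⟨h.2.2, h.2.1⟩, fun h => ⟨Finset.mem_univ _, h.2, h.1⟩⟩
  rw [herase]
  refine Finset.sum_congr rfl fun S hS => ?_
  rw [γ.rep_isFeynman.compsProd_eq_monomial 𝕜 (FeynmanGraph.mem_subs.1 (Finset.mem_of_mem_erase hS))]

theorem graphComul_counit_left (a : GraphAlg 𝕜) : TensorProduct.lid 𝕜 _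
    (TensorProduct.map (graphCounit 𝕜).toLinearMap LinearMap.id (graphComul 𝕜 a)) = a := by
  have h : ((Algebra.TensorProduct.lid 𝕜 (GraphAlg 𝕜)).toAlgHom.comp
      ((Algebra.TensorProduct.map (graphCounit 𝕜) (AlgHom.id 𝕜 _)).comp (graphComul 𝕜))) =
      AlgHom.id 𝕜 _ := by
    refine MvPolynomial.algHom_ext fun γ => ?_
    have hγ := γ.rep_isFeynman
    change TensorProduct.lid 𝕜 _ (TensorProduct.map (graphCounit 𝕜).toLinearMap LinearMap.id
      (graphComul 𝕜 (MvPolynomial.X γ))) = MvPolynomial.X γ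
    rw [graphComul_X, map_add, map_add, map_sum, map_sum, TensorProduct.map_tmul,
      TensorProduct.lid_tmul]
    have h0 : ∅ ∈ γ.subs.erase γ.rep.internals := Finset.mem_erase.2
      ⟨hγ.internals_ne_empty.symm, FeynmanGraph.mem_subs.2 FGraph.isSub_empty⟩
    rw [Finset.sum_eq_single_of_mem _ h0]
    · rw [TensorProduct.map_tmul, TensorProduct.lid_tmul]
      change graphCounit 𝕜 _ • _ + graphCounit 𝕜 _ • (FGraph.toAlg 𝕜 _) = _
      rw [graphCounit_X, graphCounit_monomial, if_pos ((hγ.subExponent_eq_zero FGraph.isSub_empty).2 rfl),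
        zero_smul, zero_add, one_smul, FGraph.toAlg_iso 𝕜 hγ.contract_empty_iso.some, FGraph.toAlg_rep]
    · intro S hS hne
      rw [TensorProduct.map_tmul, TensorProduct.lid_tmul]
      change graphCounit 𝕜 _ • _ = _
      rw [graphCounit_monomial, if_neg, zero_smul]
      exact fun h => hne ((hγ.subExponent_eq_zero
        (FeynmanGraph.mem_subs.1 (Finset.mem_of_mem_erase hS))).1 h)
  exact DFunLike.congr_fun h a

theorem graphComul_counit_right (a : GraphAlg 𝕜) : TensorProduct.rid 𝕜 _
    (TensorProduct.map LinearMap.id (graphCounit 𝕜).toLinearMap (graphComul 𝕜 a)) = a := by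
  have h : ((Algebra.TensorProduct.rid 𝕜 𝕜 (GraphAlg 𝕜)).toAlgHom.comp
      ((Algebra.TensorProduct.map (AlgHom.id 𝕜 _) (graphCounit 𝕜)).comp (graphComul 𝕜))) =
      AlgHom.id 𝕜 _ := by
    refine MvPolynomial.algHom_ext fun γ => ?_
    have hγ := γ.rep_isFeynman
    change TensorProduct.rid 𝕜 _ (TensorProduct.map LinearMap.id (graphCounit 𝕜).toLinearMap
      (graphComul 𝕜 (MvPolynomial.X γ))) = MvPolynomial.X γ
    rw [graphComul_X, map_add, map_add, map_sum, map_sum, TensorProduct.map_tmul,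
      TensorProduct.rid_tmul, Finset.sum_eq_zero, add_zero]
    · change graphCounit 𝕜 1 • _ = _
      rw [map_one, one_smul]
      rfl
    · intro S hS
      obtain ⟨hne, hS⟩ := Finset.mem_erase.1 hS
      rw [TensorProduct.map_tmul, TensorProduct.rid_tmul]
      change graphCounit 𝕜 _ • _ = _
      rw [FGraph.toAlg_of_isFeynman 𝕜 (hγ.contract (FeynmanGraph.mem_subs.1 hS) hne), graphCounit_X,
        zero_smul]
  exact DFunLike.congr_fun h a

/-- The tensors of total loop number `d`. -/
def loopGrading (d : ℕ) : Submodule 𝕜 (GraphAlg 𝕜 ⊗[𝕜] GraphAlg 𝕜) :=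
  Submodule.span 𝕜 {t | ∃ a b, FeynmanGraph.degree a + FeynmanGraph.degree b = d ∧
    t = (MvPolynomial.monomial a 1 : GraphAlg 𝕜) ⊗ₜ[𝕜] (MvPolynomial.monomial b 1 : GraphAlg 𝕜)}

theorem tmul_mem_loopGrading {a b : FeynmanGraph →₀ ℕ} {d : ℕ}
    (h : FeynmanGraph.degree a + FeynmanGraph.degree b = d) :
    (MvPolynomial.monomial a 1 : GraphAlg 𝕜) ⊗ₜ[𝕜] (MvPolynomial.monomial b 1 : GraphAlg 𝕜) ∈
      loopGrading 𝕜 d := Submodule.subset_span ⟨a, b, h, rfl⟩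

theorem mul_mem_loopGrading {d e : ℕ} {x y : GraphAlg 𝕜 ⊗[𝕜] GraphAlg 𝕜}
    (hx : x ∈ loopGrading 𝕜 d) (hy : y ∈ loopGrading 𝕜 e) : x * y ∈ loopGrading 𝕜 (d + e) := by
  have h := Submodule.mul_mem_mul hx hy
  rw [loopGrading, loopGrading, Submodule.span_mul_span] at h
  refine Submodule.span_mono ?_ h
  rintro _ ⟨_, ⟨a, b, h1, rfl⟩, _, ⟨a', b', h2, rfl⟩, rfl⟩
  refine ⟨a + a', b + b', ?_, ?_⟩
  · rw [FeynmanGraph.degree_add, FeynmanGraph.degree_add]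
    omega
  · change _ * _ = _
    rw [Algebra.TensorProduct.tmul_mul_tmul, MvPolynomial.monomial_mul, MvPolynomial.monomial_mul,
      one_mul]

theorem degree_zero : FeynmanGraph.degree 0 = 0 := Finsupp.sum_zero_index

theorem degree_pos {m : FeynmanGraph →₀ ℕ} (h : m ≠ 0) : 0 < FeynmanGraph.degree m := by
  obtain ⟨γ, hγ⟩ := Finsupp.support_nonempty_iff.2 h
  exact Finset.sum_pos' (fun _ _ => Nat.zero_le _)
    ⟨γ, hγ, Nat.mul_pos (Nat.pos_of_ne_zero (Finsupp.mem_support_iff.1 hγ)) γ.one_le_loops⟩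

/-- The coproduct preserves the loop number. -/
theorem graphComul_mem_loopGrading (m : FeynmanGraph →₀ ℕ) :
    graphComul 𝕜 (MvPolynomial.monomial m 1) ∈ loopGrading 𝕜 (FeynmanGraph.degree m) := by
  have h0 : graphComul 𝕜 (MvPolynomial.monomial 0 1) ∈ loopGrading 𝕜 0 := by
    have h1 : (MvPolynomial.monomial 0 1 : GraphAlg 𝕜) = 1 := rfl
    rw [h1, map_one, Algebra.TensorProduct.one_def, ← h1]
    exact tmul_mem_loopGrading 𝕜 (by rw [degree_zero])
  have hadd : ∀ m m' : FeynmanGraph →₀ ℕ,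
      graphComul 𝕜 (MvPolynomial.monomial m 1) ∈ loopGrading 𝕜 (FeynmanGraph.degree m) →
      graphComul 𝕜 (MvPolynomial.monomial m' 1) ∈ loopGrading 𝕜 (FeynmanGraph.degree m') →
      graphComul 𝕜 (MvPolynomial.monomial (m + m') 1) ∈
        loopGrading 𝕜 (FeynmanGraph.degree (m + m')) := by
    intro m m' h h'
    have h1 : (MvPolynomial.monomial (m + m') 1 : GraphAlg 𝕜) =
        MvPolynomial.monomial m 1 * MvPolynomial.monomial m' 1 := by
      rw [MvPolynomial.monomial_mul, one_mul]
    rw [h1, map_mul, FeynmanGraph.degree_add]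
    exact mul_mem_loopGrading 𝕜 h h'
  have hX : ∀ γ : FeynmanGraph, graphComul 𝕜 (MvPolynomial.monomial (Finsupp.single γ 1) 1) ∈
      loopGrading 𝕜 (FeynmanGraph.degree (Finsupp.single γ 1)) := by
    intro γ
    change graphComul 𝕜 (MvPolynomial.X γ) ∈ _
    rw [graphComul_X]
    refine Submodule.add_mem _ ?_ (Submodule.sum_mem _ fun S hS => ?_)
    · exact tmul_mem_loopGrading 𝕜 (a := Finsupp.single γ 1) (b := 0)
        (by rw [degree_zero, add_zero])
    · obtain ⟨hne, hS⟩ := Finset.mem_erase.1 hS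
      have hc := γ.rep_isFeynman.contract (FeynmanGraph.mem_subs.1 hS) hne
      rw [FGraph.toAlg_of_isFeynman 𝕜 hc]
      refine tmul_mem_loopGrading 𝕜 (b := Finsupp.single _ 1) ?_
      rw [FeynmanGraph.degree_single, FeynmanGraph.degree_single, one_mul, one_mul,
        FGraph.loops_cls]
      exact γ.rep_isFeynman.loops_contract (FeynmanGraph.mem_subs.1 hS) hne
  induction m using Finsupp.induction_linear with
  | zero => rw [degree_zero]; exact h0
  | add m m' h h' => exact hadd m m' h h'
  | single γ k =>
    induction k with
    | zero => rw [Finsupp.single_zero, degree_zero]; exact h0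
    | succ k ih => rw [Finsupp.single_add]; exact hadd _ _ ih (hX γ)

/-- The coproduct respects the loop grading and all graphs have loops, so the `n`-th convolution
power vanishes in degrees below `n`. -/
theorem isConilpotent_graphComul : IsConilpotent (graphComul 𝕜) (graphCounit 𝕜) := by
  have key : ∀ n m, FeynmanGraph.degree m < n →
      convPow (graphComul 𝕜) (graphCounit 𝕜) n (MvPolynomial.monomial m 1) = 0 := by
    intro n
    induction n with
    | zero => exact fun m h => absurd h (Nat.not_lt_zero _)
    | succ n ih =>
      intro m hm
      have h := graphComul_mem_loopGrading 𝕜 m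
      change LinearMap.mul' 𝕜 _ (TensorProduct.map _ _ (graphComul 𝕜 _)) = 0
      rw [← LinearMap.comp_apply, ← LinearMap.mem_ker]
      refine Submodule.span_le.2 ?_ h
      rintro _ ⟨a, b, hab, rfl⟩
      refine LinearMap.mem_ker.2 ?_
      rw [LinearMap.comp_apply, TensorProduct.map_tmul, LinearMap.mul'_apply]
      by_cases hb : b = 0
      · subst hb
        have h1 : algebraMap 𝕜 (GraphAlg 𝕜) (graphCounit 𝕜 1) - 1 = 0 := by
          rw [map_one, map_one, sub_self]
        exact mul_eq_zero_of_right _ h1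
      · rw [ih a (by have := degree_pos hb; omega), zero_mul]
  intro x
  refine ⟨x.support.sup FeynmanGraph.degree + 1, fun n hn => ?_⟩
  rw [x.as_sum, map_sum]
  refine Finset.sum_eq_zero fun m hm => ?_
  have h1 : MvPolynomial.monomial m (MvPolynomial.coeff m x) =
      MvPolynomial.coeff m x • (MvPolynomial.monomial m 1 : GraphAlg 𝕜) := by
    rw [MvPolynomial.smul_monomial, smul_eq_mul, mul_one]
  rw [h1, map_smul, key n m, smul_zero]
  have := Finset.le_sup (f := FeynmanGraph.degree) hm
  omega

end


/-! ### The coproduct modulo the relations -/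

noncomputable section

variable (𝕜 : Type*) [Field 𝕜]

section Twist

variable {Q R : Type*} [CommRing Q] [CommRing R] (i j : Q →+* R) (c : PowerSeries Q)

theorem hasSubst_X_mul_map : PowerSeries.HasSubst (PowerSeries.X * PowerSeries.map i c) :=
  PowerSeries.HasSubst.of_constantCoeff_zero'
    (by rw [map_mul, PowerSeries.constantCoeff_X, zero_mul])

/-- The map of power series given by `j` on coefficients, followed by the substitution
`α ↦ α i(c)`. -/
def twistMap : PowerSeries Q →+* PowerSeries R :=
  ((PowerSeries.substAlgHom (R := R) (hasSubst_X_mul_map i c)).toRingHom).comp (PowerSeries.map j)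

theorem coeff_twistMap (f : PowerSeries Q) {m k : ℕ} (hmk : m ≤ k) :
    PowerSeries.coeff m (twistMap i j c f) = ∑ l ∈ Finset.range (k + 1),
      j (PowerSeries.coeff l f) * PowerSeries.coeff m ((PowerSeries.X * PowerSeries.map i c) ^ l) := by
  have h1 : twistMap i j c f = PowerSeries.subst (PowerSeries.X * PowerSeries.map i c)
      (PowerSeries.map j f) := congrFun (PowerSeries.coe_substAlgHom (hasSubst_X_mul_map i c)) _
  rw [h1, PowerSeries.coeff_subst' (hasSubst_X_mul_map i c),
    finsum_eq_sum_of_support_subset (s := Finset.range (k + 1))]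
  · refine Finset.sum_congr rfl fun l _ => ?_
    rw [PowerSeries.coeff_map, smul_eq_mul]
  · intro l hl
    by_contra h
    refine hl ?_
    have hlt : ¬ l ≤ m := by
      have : ¬ l < k + 1 := by simpa using h
      omega
    change _ • PowerSeries.coeff m ((PowerSeries.X * PowerSeries.map i c) ^ l) = 0
    rw [mul_pow, PowerSeries.coeff_X_pow_mul', if_neg hlt, smul_zero]

theorem coeff_map_mul_twistMap (g f : PowerSeries Q) (k : ℕ) :
    PowerSeries.coeff k (PowerSeries.map i g * twistMap i j c f) = ∑ l ∈ Finset.range (k + 1),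
      i (PowerSeries.coeff (k - l) (g * c ^ l)) * j (PowerSeries.coeff l f) := by
  rw [PowerSeries.coeff_mul]
  have h1 : ∀ p ∈ Finset.HasAntidiagonal.antidiagonal k, PowerSeries.coeff p.1 (PowerSeries.map i g) *
      PowerSeries.coeff p.2 (twistMap i j c f) = ∑ l ∈ Finset.range (k + 1),
        j (PowerSeries.coeff l f) * (PowerSeries.coeff p.1 (PowerSeries.map i g) *
          PowerSeries.coeff p.2 ((PowerSeries.X * PowerSeries.map i c) ^ l)) := by
    intro p hp
    have hle : p.2 ≤ k := by
      have := Finset.HasAntidiagonal.mem_antidiagonal.1 hp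
      omega
    rw [coeff_twistMap i j c f hle, Finset.mul_sum]
    exact Finset.sum_congr rfl fun l _ => mul_left_comm _ _ _
  rw [Finset.sum_congr rfl h1, Finset.sum_comm]
  refine Finset.sum_congr rfl fun l hl => ?_
  have hl' : l ≤ k := Finset.mem_range_succ_iff.1 hl
  rw [← Finset.mul_sum, ← PowerSeries.coeff_mul, mul_pow, mul_left_comm,
    PowerSeries.coeff_X_pow_mul', if_pos hl', ← map_pow, ← map_mul, PowerSeries.coeff_map, mul_comm]

end Twist

section Coaction

variable {𝕜} {A Q : Type*} [CommRing A] [Algebra 𝕜 A] [CommRing Q] [Algebra 𝕜 Q]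
  (δ : A →ₐ[𝕜] Q ⊗[𝕜] Q) (p : A →ₐ[𝕜] Q) (c : PowerSeries Q)

/-- The image of the series `f` under `δ` is `∑ l, f c^l ⊗ [α^l] f`. -/
def IsTwisted (f : PowerSeries A) : Prop :=
  ∀ k, δ (PowerSeries.coeff k f) = ∑ l ∈ Finset.range (k + 1), PowerSeries.coeff (k - l)
    (PowerSeries.map (p : A →+* Q) f * c ^ l) ⊗ₜ[𝕜] p (PowerSeries.coeff l f)

/-- The series `∑ l, f c^l ⊗ [α^l] f` is the product of `f ⊗ 1` and of `1 ⊗ f` at the argument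
`α (c ⊗ 1)`. In particular it is multiplicative in `f`. -/
def twistedHom : PowerSeries Q →* PowerSeries (Q ⊗[𝕜] Q) :=
  ((PowerSeries.map (Algebra.TensorProduct.includeLeftRingHom : Q →+* Q ⊗[𝕜] Q)) :
    PowerSeries Q →* PowerSeries (Q ⊗[𝕜] Q)) *
  (twistMap (Algebra.TensorProduct.includeLeftRingHom : Q →+* Q ⊗[𝕜] Q)
    ((Algebra.TensorProduct.includeRight : Q →ₐ[𝕜] Q ⊗[𝕜] Q) : Q →+* Q ⊗[𝕜] Q) c :
    PowerSeries Q →* PowerSeries (Q ⊗[𝕜] Q))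

variable {δ p c}

theorem isTwisted_iff {f : PowerSeries A} : IsTwisted δ p c f ↔
    PowerSeries.map (δ : A →+* Q ⊗[𝕜] Q) f =
      twistedHom c (PowerSeries.map (p : A →+* Q) f) := by
  rw [PowerSeries.ext_iff]
  refine forall_congr' fun k => ?_
  rw [twistedHom, MonoidHom.mul_apply]
  rw [MonoidHom.coe_coe, MonoidHom.coe_coe, coeff_map_mul_twistMap, PowerSeries.coeff_map]
  have h : ∀ a b : Q, (Algebra.TensorProduct.includeLeftRingHom : Q →+* Q ⊗[𝕜] Q) a *
      ((Algebra.TensorProduct.includeRight : Q →ₐ[𝕜] Q ⊗[𝕜] Q) : Q →+* Q ⊗[𝕜] Q) b =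
      a ⊗ₜ[𝕜] b := by
    intro a b
    change (a ⊗ₜ[𝕜] (1 : Q)) * ((1 : Q) ⊗ₜ[𝕜] b) = _
    rw [Algebra.TensorProduct.tmul_mul_tmul, one_mul, mul_one]
  simp only [h, PowerSeries.coeff_map]
  rfl

theorem IsTwisted.mul {f g : PowerSeries A} (hf : IsTwisted δ p c f) (hg : IsTwisted δ p c g) :
    IsTwisted δ p c (f * g) := by
  rw [isTwisted_iff] at *
  rw [map_mul, hf, hg, map_mul, map_mul]

theorem IsTwisted.pow {f : PowerSeries A} (hf : IsTwisted δ p c f) (n : ℕ) :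
    IsTwisted δ p c (f ^ n) := by
  rw [isTwisted_iff] at *
  rw [map_pow, hf, map_pow, map_pow]

theorem IsTwisted.of_mul_eq_one {f g : PowerSeries A} (hf : IsTwisted δ p c f) (h : f * g = 1) :
    IsTwisted δ p c g := by
  rw [isTwisted_iff] at *
  have h1 := congrArg (PowerSeries.map (δ : A →+* Q ⊗[𝕜] Q)) h
  have h2 := congrArg (fun x => twistedHom (𝕜 := 𝕜) c (PowerSeries.map (p : A →+* Q) x)) h
  simp only [map_mul, map_one] at h1 h2
  rw [hf] at h1
  exact left_inv_eq_right_inv (by rw [mul_comm]; exact h1) h2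

theorem IsTwisted.map_mul_map {f g h : PowerSeries A} (hf : IsTwisted δ p c f)
    (hg : IsTwisted δ p c g) (hh : IsTwisted δ p c h)
    (H : PowerSeries.map (p : A →+* Q) f * PowerSeries.map (p : A →+* Q) g =
      PowerSeries.map (p : A →+* Q) h ^ 2) :
    PowerSeries.map (δ : A →+* Q ⊗[𝕜] Q) f * PowerSeries.map (δ : A →+* Q ⊗[𝕜] Q) g =
      PowerSeries.map (δ : A →+* Q ⊗[𝕜] Q) h ^ 2 := by
  rw [isTwisted_iff] at *
  rw [hf, hg, hh, ← map_mul, H, map_pow]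

/-- The relations are preserved by an algebra map that acts on the sums of graphs by the twisted
coproduct. -/
theorem eq_zero_of_isTwisted {δ : GraphAlg 𝕜 →ₐ[𝕜] Q ⊗[𝕜] Q} {p : GraphAlg 𝕜 →ₐ[𝕜] Q}
    (h : ∀ n, IsTwisted δ p c (green 𝕜 n)) (H : ∀ n, 3 ≤ n →
      PowerSeries.map (p : GraphAlg 𝕜 →+* Q) (green 𝕜 (n + 1)) *
        PowerSeries.map (p : GraphAlg 𝕜 →+* Q) (green 𝕜 (n - 1)) =
          PowerSeries.map (p : GraphAlg 𝕜 →+* Q) (green 𝕜 n) ^ 2)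
    {x : GraphAlg 𝕜} (hx : x ∈ relIdeal 𝕜) : δ x = 0 :=
  relIdeal_le_ker 𝕜 δ (fun n hn => (h (n + 1)).map_mul_map (h (n - 1)) (h n) (H n hn)) hx

end Coaction

/-- The coproduct followed by the projection. -/
def projComul : GraphAlg 𝕜 →ₐ[𝕜] QuotAlg 𝕜 ⊗[𝕜] QuotAlg 𝕜 :=
  (Algebra.TensorProduct.map (proj 𝕜) (proj 𝕜)).comp (graphComul 𝕜)

theorem coeff_greenQ (n k : ℕ) :
    PowerSeries.coeff k (greenQ 𝕜 n) = proj 𝕜 (PowerSeries.coeff k (green 𝕜 n)) :=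
  PowerSeries.coeff_map _ _ _

theorem coeff_zero_greenQ (n : ℕ) : PowerSeries.coeff 0 (greenQ 𝕜 n) = 1 := by
  rw [coeff_greenQ, PowerSeries.coeff_zero_eq_constantCoeff_apply, constantCoeff_green, map_one]

/-- Modulo the relations, the coproduct of `X^n` is `∑ l, X^n Q^{2l} ⊗ [α^l] X^n`. -/
theorem isTwisted_green [CharZero 𝕜] (n : ℕ) :
    IsTwisted (projComul 𝕜) (proj 𝕜) (chargeQ 𝕜) (green 𝕜 n) := by
  intro k
  change Algebra.TensorProduct.map (proj 𝕜) (proj 𝕜) (graphComul 𝕜 _) =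
    ∑ l ∈ Finset.range (k + 1), PowerSeries.coeff (k - l) (greenQ 𝕜 n * chargeQ 𝕜 ^ l) ⊗ₜ[𝕜]
      proj 𝕜 (PowerSeries.coeff l (green 𝕜 n))
  rw [Finset.range_eq_Ico, Finset.sum_eq_sum_Ico_succ_bot (Nat.succ_pos k), pow_zero, mul_one,
    ← coeff_greenQ, coeff_zero_greenQ, Nat.sub_zero]
  by_cases hk : k = 0
  · subst hk
    rw [zero_add, Finset.Ico_self, Finset.sum_empty, add_zero, coeff_zero_greenQ,
      PowerSeries.coeff_zero_eq_constantCoeff_apply, constantCoeff_green, map_one, map_one]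
    rfl
  · rw [graphComul_coeff_green 𝕜 n k hk, map_add, Algebra.TensorProduct.map_tmul, map_one,
      ← coeff_greenQ, map_sum]
    refine congrArg (_ + ·) (Finset.sum_congr rfl fun l hl => ?_)
    have hl1 : 1 ≤ l := (Finset.mem_Icc.1 hl).1
    rw [map_sum, coeff_green_eq, if_neg (by omega), zero_add, map_smul, map_sum,
      Finset.smul_sum, TensorProduct.tmul_sum]
    refine Finset.sum_congr rfl fun γ hγ => ?_
    obtain ⟨hn, hγl⟩ := FeynmanGraph.mem_withLegsLoops.1 hγ
    rw [map_smul, Algebra.TensorProduct.map_tmul, map_smul, smul_smul, TensorProduct.tmul_smul,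
      ← hn, ← hγl, ← map_insertionArg, PowerSeries.coeff_map]
    rfl

theorem projComul_eq_zero [CharZero 𝕜] {x : GraphAlg 𝕜} (hx : x ∈ relIdeal 𝕜) :
    projComul 𝕜 x = 0 :=
  eq_zero_of_isTwisted (isTwisted_green 𝕜) (greenQ_rel 𝕜) hx

theorem coe_graphCounit : (graphCounit 𝕜 : GraphAlg 𝕜 →+* 𝕜) = MvPolynomial.constantCoeff := by
  refine MvPolynomial.ringHom_ext (fun c => ?_) fun γ => ?_
  · rw [MvPolynomial.constantCoeff_C]
    exact (graphCounit 𝕜).commutes c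
  · rw [MvPolynomial.constantCoeff_X]
    exact graphCounit_X 𝕜 γ

theorem relIdeal_le_ker_graphCounit :
    relIdeal 𝕜 ≤ RingHom.ker (graphCounit 𝕜 : GraphAlg 𝕜 →+* 𝕜) := by
  refine relIdeal_le_ker 𝕜 (graphCounit 𝕜) fun n hn => ?_
  rw [coe_graphCounit, map_constantCoeff_green, map_constantCoeff_green, map_constantCoeff_green,
    one_mul, one_pow]

/-- The coproduct of the quotient. -/
def quotComul [CharZero 𝕜] : QuotAlg 𝕜 →ₐ[𝕜] QuotAlg 𝕜 ⊗[𝕜] QuotAlg 𝕜 :=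
  Ideal.Quotient.liftₐ (relIdeal 𝕜) (projComul 𝕜) fun _ => projComul_eq_zero 𝕜

/-- The counit of the quotient. -/
def quotCounit : QuotAlg 𝕜 →ₐ[𝕜] 𝕜 :=
  Ideal.Quotient.liftₐ (relIdeal 𝕜) (graphCounit 𝕜) fun _ h => relIdeal_le_ker_graphCounit 𝕜 h

theorem quotComul_proj [CharZero 𝕜] (x : GraphAlg 𝕜) : quotComul 𝕜 (proj 𝕜 x) =
    Algebra.TensorProduct.map (proj 𝕜) (proj 𝕜) (graphComul 𝕜 x) := rfl

theorem quotCounit_proj (x : GraphAlg 𝕜) : quotCounit 𝕜 (proj 𝕜 x) = graphCounit 𝕜 x := rfl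

theorem proj_surjective : Function.Surjective (proj 𝕜) := Ideal.Quotient.mkₐ_surjective 𝕜 _

section Series

variable [CharZero 𝕜]

theorem isTwisted_greenQ (n : ℕ) :
    IsTwisted (quotComul 𝕜) (AlgHom.id 𝕜 _) (chargeQ 𝕜) (greenQ 𝕜 n) := by
  intro k
  rw [coeff_greenQ]
  refine (isTwisted_green 𝕜 n k).trans (Finset.sum_congr rfl fun l _ => ?_)
  rw [coeff_greenQ]
  rfl

theorem isTwisted_greenQ_mul_chargeQ (n : ℕ) :
    IsTwisted (quotComul 𝕜) (AlgHom.id 𝕜 _) (chargeQ 𝕜) (greenQ 𝕜 n * chargeQ 𝕜) := by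
  refine (isTwisted_greenQ 𝕜 n).mul ?_
  have h := ((isTwisted_greenQ 𝕜 3).pow 2).mul
    (((isTwisted_greenQ 𝕜 2).of_mul_eq_one (greenQ_mul_propQ 𝕜)).pow 3)
  rwa [← chargeQ_eq] at h

theorem quotComul_coeff_greenQ (n k : ℕ) : quotComul 𝕜 (PowerSeries.coeff k (greenQ 𝕜 n)) =
    ∑ l ∈ Finset.range (k + 1), PowerSeries.coeff (k - l) (greenQ 𝕜 n * chargeQ 𝕜 ^ l) ⊗ₜ[𝕜]
      PowerSeries.coeff l (greenQ 𝕜 n) := isTwisted_greenQ 𝕜 n k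

theorem quotComul_dseArg (n k : ℕ) : quotComul 𝕜 (dseArg 𝕜 n k : QuotAlg 𝕜) =
    ∑ l ∈ Finset.range (k + 1), PowerSeries.coeff (k - l) (greenQ 𝕜 n * chargeQ 𝕜 ^ (l + 1)) ⊗ₜ[𝕜]
      (dseArg 𝕜 n l : QuotAlg 𝕜) := by
  rw [coeff_greenQ_mul_chargeQ]
  refine (isTwisted_greenQ_mul_chargeQ 𝕜 n k).trans (Finset.sum_congr rfl fun l _ => ?_)
  rw [coeff_greenQ_mul_chargeQ, pow_succ', ← mul_assoc]
  rfl

end Series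

/-- The power series with coefficients in a subalgebra. -/
def coeffSubalg {A : Type*} [CommRing A] [Algebra 𝕜 A] (C : Subalgebra 𝕜 A) :
    Subring (PowerSeries A) := (PowerSeries.map (C.val : C →+* A)).range

theorem mem_coeffSubalg {A : Type*} [CommRing A] [Algebra 𝕜 A] {C : Subalgebra 𝕜 A}
    {f : PowerSeries A} : f ∈ coeffSubalg 𝕜 C ↔ ∀ k, PowerSeries.coeff k f ∈ C := by
  constructor
  · rintro ⟨g, rfl⟩ k
    rw [PowerSeries.coeff_map]
    exact (PowerSeries.coeff k g).2
  · intro h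
    refine ⟨PowerSeries.mk fun k => ⟨PowerSeries.coeff k f, h k⟩, ?_⟩
    ext k
    rw [PowerSeries.coeff_map, PowerSeries.coeff_mk]
    rfl

theorem greenQ_mem {n : ℕ} (hn : 2 ≤ n) : greenQ 𝕜 n ∈ coeffSubalg 𝕜 (greenSubalg 𝕜) :=
  (mem_coeffSubalg 𝕜).2 fun k => by
    rw [coeff_greenQ]
    exact Algebra.subset_adjoin ⟨n, k, hn, rfl⟩

theorem propQ_mem : propQ 𝕜 ∈ coeffSubalg 𝕜 (greenSubalg 𝕜) := by
  obtain ⟨g, hg⟩ := greenQ_mem 𝕜 le_rfl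
  have h1 : PowerSeries.constantCoeff g = 1 := by
    refine Subtype.ext ?_
    have := coeff_zero_greenQ 𝕜 2
    rw [← hg, PowerSeries.coeff_map, PowerSeries.coeff_zero_eq_constantCoeff_apply] at this
    exact this
  have h2 := congrArg (PowerSeries.map ((greenSubalg 𝕜).val : greenSubalg 𝕜 →+* QuotAlg 𝕜))
    (PowerSeries.mul_invOfUnit g 1 h1)
  rw [map_mul, map_one, hg] at h2
  refine ⟨PowerSeries.invOfUnit g 1, ?_⟩
  have h3 := greenQ_mul_propQ 𝕜
  linear_combination (propQ 𝕜) * h2 -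
    (PowerSeries.map ((greenSubalg 𝕜).val : greenSubalg 𝕜 →+* QuotAlg 𝕜)) (PowerSeries.invOfUnit g 1) * h3

theorem coeff_greenQ_mul_chargeQ_pow_mem {n : ℕ} (hn : 2 ≤ n) (l k : ℕ) :
    PowerSeries.coeff k (greenQ 𝕜 n * chargeQ 𝕜 ^ l) ∈ greenSubalg 𝕜 := by
  refine (mem_coeffSubalg 𝕜).1 ?_ k
  refine Subring.mul_mem _ (greenQ_mem 𝕜 hn) (Subring.pow_mem _ ?_ l)
  rw [chargeQ_eq]
  exact Subring.mul_mem _ (Subring.pow_mem _ (greenQ_mem 𝕜 (by norm_num)) _)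
    (Subring.pow_mem _ (propQ_mem 𝕜) _)

theorem quotComul_mem [CharZero 𝕜] {a : QuotAlg 𝕜} (ha : a ∈ greenSubalg 𝕜) : quotComul 𝕜 a ∈
    LinearMap.range (TensorProduct.map (greenSubalg 𝕜).val.toLinearMap
      (greenSubalg 𝕜).val.toLinearMap) := by
  have h : greenSubalg 𝕜 ≤ ((Algebra.TensorProduct.map (greenSubalg 𝕜).val
      (greenSubalg 𝕜).val).range).comap (quotComul 𝕜) := by
    refine Algebra.adjoin_le ?_
    rintro _ ⟨n, k, hn, rfl⟩
    change quotComul 𝕜 _ ∈ (Algebra.TensorProduct.map (greenSubalg 𝕜).val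
      (greenSubalg 𝕜).val).range
    rw [← coeff_greenQ, quotComul_coeff_greenQ]
    refine Subalgebra.sum_mem _ fun l _ => ?_
    have h1 := coeff_greenQ_mul_chargeQ_pow_mem 𝕜 hn l (k - l)
    have h2 := (mem_coeffSubalg 𝕜).1 (greenQ_mem 𝕜 hn) l
    exact ⟨⟨_, h1⟩ ⊗ₜ[𝕜] ⟨_, h2⟩, rfl⟩
  obtain ⟨t, ht⟩ := h ha
  exact ⟨t, ht⟩

end


/-! ### Linear independence of the coefficients of `X^n Q^2` -/

namespace FGraph

/-- The graph with one vertex, `n` legs and `k` self-loops. -/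
def rose (n k : ℕ) : FGraph (Fin n ⊕ Fin k × Bool) where
  vert := ⊤
  edge := Setoid.ker (Sum.map id Prod.fst)

theorem rose_isInternal {n k : ℕ} (x : Fin n ⊕ Fin k × Bool) :
    (rose n k).IsInternal x ↔ ∃ j, x = Sum.inr j := by
  constructor
  · rintro ⟨y, hne, h⟩
    change Sum.map id Prod.fst x = Sum.map id Prod.fst y at h
    rcases x with i | j
    · rcases y with i' | j'
      · exact absurd (congrArg Sum.inl (Sum.inl_injective h).symm) hne
      · exact nomatch h
    · exact ⟨j, rfl⟩
  · rintro ⟨⟨j, b⟩, rfl⟩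
    exact ⟨Sum.inr (j, !b), fun h => by simp at h, rfl⟩

theorem card_rose_internal (n k : ℕ) : Nat.card {x // (rose n k).IsInternal x} = 2 * k := by
  rw [Nat.card_congr (Equiv.subtypeEquivRight rose_isInternal),
    ← Nat.card_congr (Equiv.ofInjective _ (Sum.inr_injective (α := Fin n) (β := Fin k × Bool))) |>.trans
      (Nat.card_congr (Equiv.subtypeEquivRight fun x => ⟨fun ⟨j, h⟩ => ⟨j, h.symm⟩, fun ⟨j, h⟩ => ⟨j, h.symm⟩⟩))]
  simp [mul_comm]

theorem numLegs_rose (n k : ℕ) : (rose n k).numLegs = n := by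
  have h := Nat.card_add_card_not (fun _ => True) (rose n k).IsInternal
  simp only [true_and] at h
  have h1 : 2 * k + (rose n k).numLegs = n + k * 2 := by
    rw [← card_rose_internal]
    refine h.symm.trans ((Nat.card_congr (Equiv.subtypeUnivEquiv fun _ => trivial)).trans ?_)
    simp
  omega

theorem loops_rose {n k : ℕ} (hk : 1 ≤ k) : (rose n k).loops = k := by
  have h1 : (rose n k).numVertices = 1 := by
    refine Nat.card_eq_one_iff_unique.2 ⟨⟨fun a b => ?_⟩, ⟨Quotient.mk _ (Sum.inr (⟨0, hk⟩, true))⟩⟩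
    induction a using Quotient.inductionOn
    induction b using Quotient.inductionOn
    exact Quotient.sound trivial
  rw [loops, h1, numEdges, card_rose_internal]
  omega

theorem rose_isFeynman {n k : ℕ} (hn : 2 ≤ n) (hk : 1 ≤ k) : (rose n k).IsFeynman where
  edge_le_two x y z h1 h2 := by
    change Sum.map id Prod.fst x = Sum.map id Prod.fst y at h1
    change Sum.map id Prod.fst x = Sum.map id Prod.fst z at h2
    rcases x with x | ⟨x, _ | _⟩ <;> rcases y with y | ⟨y, _ | _⟩ <;>
      rcases z with z | ⟨z, _ | _⟩ <;> simp_all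
  three_le_valence v := by
    induction v using Quotient.inductionOn with
    | h x =>
      have h : (rose n k).valence (Quotient.mk _ x) = n + k * 2 := by
        rw [valence_mk]
        refine (Nat.card_congr (Equiv.subtypeUnivEquiv fun _ => trivial)).trans ?_
        simp
      omega
  connected x y := conn_vert _ trivial
  irreducible x y _ _ := conn_vert _ trivial
  has_internal := ⟨Sum.inr (⟨0, hk⟩, true), (rose_isInternal _).2 ⟨_, rfl⟩⟩
  two_le_legs := by rwa [numLegs_rose]

end FGraph

theorem FeynmanGraph.exists_numLegs_loops (n k : ℕ) :
    ∃ γ : FeynmanGraph, 2 ≤ n → 1 ≤ k → γ.numLegs = n ∧ γ.loops = k := by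
  by_cases h : 2 ≤ n ∧ 1 ≤ k
  · refine ⟨(FGraph.rose n k).cls (FGraph.rose_isFeynman h.1 h.2), fun _ _ => ?_⟩
    rw [FGraph.numLegs_cls, FGraph.loops_cls, FGraph.numLegs_rose, FGraph.loops_rose h.2]
    exact ⟨rfl, rfl⟩
  · exact ⟨(FGraph.rose 2 1).cls (FGraph.rose_isFeynman le_rfl le_rfl), fun h1 h2 => absurd ⟨h1, h2⟩ h⟩

noncomputable section

variable (𝕜 : Type*) [Field 𝕜]

theorem greenSign_mul_self (n : ℕ) : greenSign 𝕜 n * greenSign 𝕜 n = 1 := by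
  unfold greenSign
  split_ifs <;> ring

/-- The geometric series `1 / (1 - t α)`. -/
def geomSeries : PowerSeries (Polynomial 𝕜) := PowerSeries.rescale Polynomial.X (PowerSeries.mk 1)

theorem coeff_geomSeries_pow (n k : ℕ) : PowerSeries.coeff k (geomSeries 𝕜 ^ (n + 1)) =
    Polynomial.X ^ k * ((n + k).choose n : Polynomial 𝕜) := by
  rw [geomSeries, ← map_pow, PowerSeries.coeff_rescale, PowerSeries.mk_one_pow_eq_mk_choose_add,
    PowerSeries.coeff_mk]

variable [CharZero 𝕜]

theorem FeynmanGraph.weight_ne_zero (γ : FeynmanGraph) : γ.weight 𝕜 ≠ 0 :=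
  div_ne_zero (Nat.cast_ne_zero.2 (Nat.factorial_ne_zero _)) (Nat.cast_ne_zero.2 γ.numAut_pos.ne')

/-- The coefficients of positive order of the series `X^n` are algebraically independent: they can
be given any values. -/
theorem exists_character {A : Type*} [CommRing A] [Algebra 𝕜 A] (f : ℕ → ℕ → A) :
    ∃ χ : GraphAlg 𝕜 →ₐ[𝕜] A, ∀ n k, 2 ≤ n → 1 ≤ k →
      χ (PowerSeries.coeff k (green 𝕜 n)) = f n k := by
  choose R hR using FeynmanGraph.exists_numLegs_loops
  refine ⟨MvPolynomial.aeval fun γ => if γ = R γ.numLegs γ.loops then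
    (greenSign 𝕜 γ.numLegs * γ.weight 𝕜)⁻¹ • f γ.numLegs γ.loops else 0, fun n k hn hk => ?_⟩
  obtain ⟨h1, h2⟩ := hR n k hn hk
  have hs : greenSign 𝕜 n ≠ 0 := left_ne_zero_of_mul_eq_one (greenSign_mul_self 𝕜 n)
  rw [coeff_green_eq, if_neg (by omega), zero_add, map_smul, map_sum,
    Finset.sum_eq_single_of_mem (R n k) (FeynmanGraph.mem_withLegsLoops.2 ⟨h1, h2⟩)]
  · rw [map_smul, MvPolynomial.aeval_X, h1, h2, if_pos rfl, smul_smul, smul_smul,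
      mul_inv_cancel₀ (mul_ne_zero hs ((R n k).weight_ne_zero 𝕜)), one_smul]
  · intro γ hγ hne
    obtain ⟨h3, h4⟩ := FeynmanGraph.mem_withLegsLoops.1 hγ
    rw [map_smul, MvPolynomial.aeval_X, h3, h4, if_neg hne, smul_zero]

/-- There is a character of the quotient with `X^n ↦ (1 - t α)^{-(n-2)}`, so `X^n Q^2 ↦
(1 - t α)^{-n}`. -/
theorem exists_quot_character : ∃ χ : QuotAlg 𝕜 →ₐ[𝕜] Polynomial 𝕜, ∀ n k, 2 ≤ n →
    χ (dseArg 𝕜 n k) = PowerSeries.coeff k (geomSeries 𝕜 ^ n) := by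
  obtain ⟨χ, hχ⟩ := exists_character 𝕜 fun n k => PowerSeries.coeff k (geomSeries 𝕜 ^ (n - 2))
  have h0 : PowerSeries.constantCoeff (geomSeries 𝕜) = 1 := by
    rw [← pow_one (geomSeries 𝕜), ← PowerSeries.coeff_zero_eq_constantCoeff_apply,
      ← zero_add 1, coeff_geomSeries_pow]
    simp
  have h1 : ∀ n, 2 ≤ n → PowerSeries.map (χ : GraphAlg 𝕜 →+* Polynomial 𝕜) (green 𝕜 n) =
      geomSeries 𝕜 ^ (n - 2) := by
    intro n hn
    ext k : 1
    rw [PowerSeries.coeff_map]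
    rcases Nat.eq_zero_or_pos k with rfl | hk
    · rw [PowerSeries.coeff_zero_eq_constantCoeff_apply, constantCoeff_green, map_one,
        PowerSeries.coeff_zero_eq_constantCoeff_apply, map_pow, h0, one_pow]
    · exact hχ n k hn hk
  have hker : relIdeal 𝕜 ≤ RingHom.ker (χ : GraphAlg 𝕜 →+* Polynomial 𝕜) := by
    refine relIdeal_le_ker 𝕜 χ fun n hn => ?_
    rw [h1 _ (by omega), h1 _ (by omega), h1 _ (by omega), ← pow_add, ← pow_mul]
    congr 1
    omega
  refine ⟨Ideal.Quotient.liftₐ (relIdeal 𝕜) χ fun _ h => hker h, fun n k hn => ?_⟩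
  change (χ : GraphAlg 𝕜 →+* Polynomial 𝕜) (PowerSeries.coeff k (green 𝕜 n * chargeSq 𝕜)) = _
  have h2 : PowerSeries.map (χ : GraphAlg 𝕜 →+* Polynomial 𝕜) (greenInv 𝕜 2) = 1 := by
    have h := map_green_mul_map_greenInv 𝕜 χ 2
    rwa [h1 2 le_rfl, Nat.sub_self, pow_zero, one_mul] at h
  rw [← PowerSeries.coeff_map, chargeSq]
  refine congrArg (PowerSeries.coeff k) ?_
  rw [map_mul, map_mul, map_pow, map_pow, h2, one_pow, mul_one,
    h1 n hn, h1 3 (by norm_num), ← pow_mul, ← pow_add]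
  congr 1
  omega

/-- The coefficients of `X^n Q^2` are linearly independent modulo the relations, so a linear map on
the space spanned by them can be defined by its values on them. -/
theorem linearIndependent_dseArg {n : ℕ} (hn : 2 ≤ n) :
    LinearIndependent 𝕜 fun k => (dseArg 𝕜 n k : QuotAlg 𝕜) := by
  obtain ⟨χ, hχ⟩ := exists_quot_character 𝕜
  refine LinearIndependent.of_comp χ.toLinearMap ?_
  obtain ⟨m, rfl⟩ := Nat.exists_eq_add_of_le' (show 1 ≤ n by omega)
  have h := (Polynomial.basisMonomials 𝕜).linearIndependent.units_smul fun k =>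
    Units.mk0 (((m + k).choose m : ℕ) : 𝕜)
      (Nat.cast_ne_zero.2 (Nat.choose_pos (Nat.le_add_right m k)).ne')
  have e : (χ.toLinearMap ∘ fun k => (dseArg 𝕜 (m + 1) k : QuotAlg 𝕜)) = (fun k =>
      Units.mk0 (((m + k).choose m : ℕ) : 𝕜)
        (Nat.cast_ne_zero.2 (Nat.choose_pos (Nat.le_add_right m k)).ne')) •
          ⇑(Polynomial.basisMonomials 𝕜) := by
    funext k
    refine (hχ _ k hn).trans ?_
    rw [coeff_geomSeries_pow, Pi.smul_apply', Polynomial.coe_basisMonomials, Units.smul_mk0,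
      Polynomial.smul_monomial, smul_eq_mul, mul_one, ← Polynomial.C_mul_X_pow_eq_monomial, mul_comm]
    simp
  rw [e]
  exact h

end


/-! ### The maps `B_+^{1,n}` -/

noncomputable section

variable (𝕜 : Type*) [Field 𝕜] [CharZero 𝕜]

/-- The coefficients of `X^n Q^2` as a basis of the space that they span. -/
def dseBasis {n : ℕ} (hn : 2 ≤ n) : Module.Basis ℕ 𝕜 (dseSpace 𝕜 n) :=
  Module.Basis.span (linearIndependent_dseArg 𝕜 hn)

theorem dseBasis_apply {n : ℕ} (hn : 2 ≤ n) (k : ℕ) : dseBasis 𝕜 hn k = dseArg 𝕜 n k :=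
  Module.Basis.span_apply (linearIndependent_dseArg 𝕜 hn) k

/-- The map `B_+^{1,n}`, defined so that the Dyson-Schwinger equation holds. -/
def dseMap {n : ℕ} (hn : 2 ≤ n) : dseSpace 𝕜 n →ₗ[𝕜] greenSubalg 𝕜 :=
  (dseBasis 𝕜 hn).constr 𝕜 fun k =>
    greenSign 𝕜 n • ⟨_, (mem_coeffSubalg 𝕜).1 (greenQ_mem 𝕜 hn) (k + 1)⟩

theorem dseMap_dseArg {n : ℕ} (hn : 2 ≤ n) (k : ℕ) : (dseMap 𝕜 hn (dseArg 𝕜 n k) : QuotAlg 𝕜) =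
    greenSign 𝕜 n • PowerSeries.coeff (k + 1) (greenQ 𝕜 n) := by
  rw [← dseBasis_apply 𝕜 hn, dseMap, Module.Basis.constr_basis]
  rfl

theorem proj_coeff_green_succ {n : ℕ} (hn : 2 ≤ n) (k : ℕ) :
    proj 𝕜 (PowerSeries.coeff (k + 1) (green 𝕜 n)) =
      greenSign 𝕜 n • (dseMap 𝕜 hn (dseArg 𝕜 n k) : QuotAlg 𝕜) := by
  rw [dseMap_dseArg, smul_smul, greenSign_mul_self, one_smul, coeff_greenQ]

theorem dseMap_dseArg_eq_insertion {n : ℕ} (hn : 2 ≤ n) (k : ℕ) :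
    (dseMap 𝕜 hn (dseArg 𝕜 n k) : QuotAlg 𝕜) = proj 𝕜 (oneLoopInsertion 𝕜 n k) := by
  rw [dseMap_dseArg, coeff_greenQ, coeff_green_succ, map_smul, smul_smul, greenSign_mul_self,
    one_smul]

/-- The coaction on the space spanned by the coefficients of `X^n Q^2`. -/
def dseCoaction {n : ℕ} (hn : 2 ≤ n) :
    dseSpace 𝕜 n →ₗ[𝕜] greenSubalg 𝕜 ⊗[𝕜] dseSpace 𝕜 n :=
  (dseBasis 𝕜 hn).constr 𝕜 fun k => ∑ l ∈ Finset.range (k + 1),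
    (⟨_, coeff_greenQ_mul_chargeQ_pow_mem 𝕜 hn (l + 1) (k - l)⟩ : greenSubalg 𝕜) ⊗ₜ[𝕜] dseArg 𝕜 n l

theorem map_dseCoaction_dseArg {n : ℕ} (hn : 2 ≤ n) {M : Type*} [AddCommGroup M] [Module 𝕜 M]
    (f : dseSpace 𝕜 n →ₗ[𝕜] M) (k : ℕ) :
    TensorProduct.map (greenSubalg 𝕜).val.toLinearMap f (dseCoaction 𝕜 hn (dseArg 𝕜 n k)) =
      ∑ l ∈ Finset.range (k + 1), PowerSeries.coeff (k - l) (greenQ 𝕜 n * chargeQ 𝕜 ^ (l + 1)) ⊗ₜ[𝕜]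
        f (dseArg 𝕜 n l) := by
  rw [← dseBasis_apply 𝕜 hn k, dseCoaction, Module.Basis.constr_basis, map_sum]
  rfl

/-- The coproducts of `X^n` and of `X^n Q^2` are sums over the loop number of the cograph, with
the power of `Q^2` shifted by one. In the coproduct of `B_+^{1,n}` the term without loops in the
cograph is `B_+^{1,n} ⊗ 1`, and the others make up `(id ⊗ B_+^{1,n}) Δ`. -/
theorem isHochschildClosed_dseMap {n : ℕ} (hn : 2 ≤ n) :
    IsHochschildClosed (quotComul 𝕜) (greenSubalg 𝕜) (dseSpace 𝕜 n) (dseMap 𝕜 hn) := by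
  refine ⟨dseCoaction 𝕜 hn, fun v => ?_, fun v => ?_⟩
  · refine LinearMap.congr_fun (f := TensorProduct.map (greenSubalg 𝕜).val.toLinearMap
      (dseSpace 𝕜 n).subtype ∘ₗ dseCoaction 𝕜 hn)
      (g := (quotComul 𝕜).toLinearMap ∘ₗ (dseSpace 𝕜 n).subtype)
      ((dseBasis 𝕜 hn).ext fun k => ?_) v
    rw [dseBasis_apply]
    exact (map_dseCoaction_dseArg 𝕜 hn _ k).trans (quotComul_dseArg 𝕜 n k).symm
  · have key : TensorProduct.map (greenSubalg 𝕜).val.toLinearMap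
        ((greenSubalg 𝕜).val.toLinearMap ∘ₗ dseMap 𝕜 hn) ∘ₗ dseCoaction 𝕜 hn +
        (TensorProduct.mk 𝕜 (QuotAlg 𝕜) (QuotAlg 𝕜)).flip 1 ∘ₗ (greenSubalg 𝕜).val.toLinearMap ∘ₗ
          dseMap 𝕜 hn =
        (quotComul 𝕜).toLinearMap ∘ₗ (greenSubalg 𝕜).val.toLinearMap ∘ₗ dseMap 𝕜 hn := by
      refine (dseBasis 𝕜 hn).ext fun k => ?_
      rw [dseBasis_apply]
      change TensorProduct.map (greenSubalg 𝕜).val.toLinearMap _ (dseCoaction 𝕜 hn (dseArg 𝕜 n k)) +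
        (dseMap 𝕜 hn (dseArg 𝕜 n k) : QuotAlg 𝕜) ⊗ₜ[𝕜] 1 =
          quotComul 𝕜 (dseMap 𝕜 hn (dseArg 𝕜 n k) : QuotAlg 𝕜)
      rw [map_dseCoaction_dseArg, dseMap_dseArg, map_smul, quotComul_coeff_greenQ,
        Finset.sum_range_succ' _ (k + 1), smul_add, Finset.smul_sum]
      refine congrArg₂ (· + ·) (Finset.sum_congr rfl fun l _ => ?_) ?_
      · rw [Nat.add_sub_add_right, ← TensorProduct.tmul_smul]
        exact congrArg _ (dseMap_dseArg 𝕜 hn l)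
      · rw [coeff_zero_greenQ, pow_zero, mul_one, Nat.sub_zero, TensorProduct.smul_tmul']
    have h := LinearMap.congr_fun key v
    change TensorProduct.map (greenSubalg 𝕜).val.toLinearMap
      ((greenSubalg 𝕜).val.toLinearMap ∘ₗ dseMap 𝕜 hn) (dseCoaction 𝕜 hn v) +
        (dseMap 𝕜 hn v : QuotAlg 𝕜) ⊗ₜ[𝕜] 1 = quotComul 𝕜 (dseMap 𝕜 hn v) at h
    rw [← h]
    abel

end


theorem mainTheorem3 (𝕜 : Type*) [Field 𝕜] [CharZero 𝕜] :
    ∃ S : GraphAlg 𝕜 →ₗ[𝕜] GraphAlg 𝕜,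
      -- the graphs form a Hopf algebra
      IsHopfAlgebra (graphComul 𝕜) (graphCounit 𝕜) S ∧
      -- its structure descends to the quotient by the relations
      ∃ (Δ : QuotAlg 𝕜 →ₐ[𝕜] QuotAlg 𝕜 ⊗[𝕜] QuotAlg 𝕜) (ε : QuotAlg 𝕜 →ₐ[𝕜] 𝕜)
        (S' : QuotAlg 𝕜 →ₗ[𝕜] QuotAlg 𝕜),
        (∀ x, Δ (proj 𝕜 x) = Algebra.TensorProduct.map (proj 𝕜) (proj 𝕜) (graphComul 𝕜 x)) ∧
        (∀ x, ε (proj 𝕜 x) = graphCounit 𝕜 x) ∧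
        (∀ x, S' (proj 𝕜 x) = proj 𝕜 (S x)) ∧
        IsHopfAlgebra Δ ε S' ∧
        -- the coefficients of the series `X^n` generate a sub-Hopf algebra
        IsSubHopf Δ S' (greenSubalg 𝕜) ∧
        ∀ n : ℕ, 2 ≤ n →
          -- modulo the relations, what is inserted is `X^n Q^2` for all one-loop graphs
          (∀ γ : FeynmanGraph, γ.numLegs = n → γ.loops = 1 → ∀ k,
            proj 𝕜 (PowerSeries.coeff k (insertionArg 𝕜 γ)) = dseArg 𝕜 n k) ∧
          -- the map `B_+^{1,n}` is well defined
          ∃! B : dseSpace 𝕜 n →ₗ[𝕜] greenSubalg 𝕜,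
            (∀ k, (B (dseArg 𝕜 n k) : QuotAlg 𝕜) = proj 𝕜 (oneLoopInsertion 𝕜 n k)) ∧
            -- the Dyson-Schwinger equation `X^n = 1 ± α B_+^{1,n}(X^n Q^2)`
            (∀ k, proj 𝕜 (PowerSeries.coeff (k + 1) (green 𝕜 n)) =
              greenSign 𝕜 n • (B (dseArg 𝕜 n k) : QuotAlg 𝕜)) ∧
            IsHochschildClosed Δ (greenSubalg 𝕜) (dseSpace 𝕜 n) B := by
  have hΔ := quotComul_proj 𝕜
  have hε := quotCounit_proj 𝕜
  have hp := proj_surjective 𝕜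
  have hH := isConilpotent_graphComul 𝕜
  have hQ : IsConilpotent (quotComul 𝕜) (quotCounit 𝕜) := hH.of_surjective hp hΔ hε
  refine ⟨hH.antipode, hH.isHopfAlgebra (graphComul_coassoc 𝕜) (graphComul_counit_left 𝕜)
      (graphComul_counit_right 𝕜), quotComul 𝕜, quotCounit 𝕜, hQ.antipode, hΔ, hε,
    hH.antipode_map hQ hΔ hε, hQ.isHopfAlgebra
      (coassoc_of_surjective hp hΔ (graphComul_coassoc 𝕜))
      (counit_left_of_surjective hp hΔ hε (graphComul_counit_left 𝕜))
      (counit_right_of_surjective hp hΔ hε (graphComul_counit_right 𝕜)),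
    hQ.isSubHopf fun _ => quotComul_mem 𝕜, fun n hn => ⟨?_, dseMap 𝕜 hn,
      ⟨dseMap_dseArg_eq_insertion 𝕜 hn, proj_coeff_green_succ 𝕜 hn,
        isHochschildClosed_dseMap 𝕜 hn⟩, ?_⟩⟩
  · rintro γ rfl h k
    exact proj_coeff_insertionArg_of_loops 𝕜 h k
  · rintro B ⟨hB, -, -⟩
    refine (dseBasis 𝕜 hn).ext fun k => Subtype.ext ?_
    rw [dseBasis_apply, hB, dseMap_dseArg_eq_insertion]
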